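/- **Setting.** Let $V$ be a finite-dimensional complex vector space. For an operator $X$ on $V\otimes V$ let $X_i$ be its copy acting in the factors $i,i+1$ of $V^{\otimes n}$. An *R-matrix* is an invertible $X\in\mathrm{End}(V\otimes V)$ with $X_1X_2X_1=X_2X_1X_2$; it defines the representation $\rho_X:\mathbb C\mathcal B_n\to \mathrm{End}(V^{\otimes n})$, $\sigma_i\mapsto X_i$, of the braid group $\mathcal B_n$. $X$ is *skew invertible* if there is $\Psi_X\in\mathrm{End}(V\otimes V)$ with $\mathrm{Tr}_{(2)}X_{12}(\Psi_X)_{23}=\mathrm{Tr}_{(2)}(\Psi_X)_{12}X_{23}=P_{13}$ ($P$ the permutation); put $C_X=\mathrm{Tr}_{(1)}\Psi_X$, $D_X=\mathrm{Tr}_{(2)}\Psi_X$; $X$ is *strict skew invertible* if moreover $C_X$ or $D_X$ is invertible. $\{R,F\}$ is a *compatible pair* if $R_1F_2F_1=F_2F_1R_2$ and $R_2F_1F_2=F_1F_2R_1$. For $q\in\mathbb C\setminus\{0,\pm1\}$ put $i_q=(q^i-q^{-i})/(q-q^{-1})$. An R-matrix $R$ is *of BMW type* with parameters $q,\mu$,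 where $\mu\notin\{0,q,-q^{-1}\}$, if its minimal polynomial is $(x-q)(x+q^{-1})(x-\mu)$ and $K=\mu^{-1}(q-q^{-1})^{-1}(qI-R)(q^{-1}I+R)$ satisfies $K_2K_1=R_1R_2K_1=R_1^{-1}R_2^{-1}K_1$, $K_1K_2K_1=K_1$. In $\mathbb C\mathcal B_n$ put $\kappa_i=\mu^{-1}(q-q^{-1})^{-1}(q-\sigma_i)(q^{-1}+\sigma_i)$, $$\sigma_i^-(x)=1+\frac{x-1}{q-q^{-1}}\sigma_i+\frac{x-1}{q\mu^{-1}x+1}\kappa_i,$$ $a^{(1)}=1$ and $a^{(i+1)}=\frac{q^i}{(i+1)_q}a^{(i)}\sigma^-_i(q^{-2i})a^{(i)}$. Let $\alpha\mapsto\alpha^{\uparrow d}$ denote the shift $\sigma_i\mapsto\sigma_{i+d}$. For $k\ge2$, $R$ is *of type $O(k)$* if it is skew invertible and of BMW type with $\mu=q^{1-k}$, $i_q\ne0$ for $2\le i\le k$, $\mu\neq -q^{1-2i}$ for $1\le i\le k$, $\rho_R(a^{(i)})\neq0$ for $2\le i\le k$, $\rho_R\big(a^{(k)\uparrow1}\sigma_1^-(q^{-2k})a^{(k)\uparrow1}\big)=0$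 and $\mathrm{rk}\,\rho_R(a^{(k)})=1$. Let $\ell\ge2$, let $R$ be of type $O(2\ell-1)$ (so $\mu=q^{2-2\ell}$), let $F$ be a strict skew invertible R-matrix such that $\{R,F\}$ is a compatible pair, and assume $q^{2\ell+1}\ne-1$. For a matrix $M$ with entries in a $\mathbb C$-algebra let $M_{\overline1}=M_1$, $M_{\overline{i+1}}=F_iM_{\overline i}F_i^{-1}$ and let $\mathrm{Tr}_R(X)=\mathrm{Tr}(D_RX)$. For $\alpha\in\mathbb C\mathcal B_n$ put $$ch(\alpha)=\mathrm{Tr}_{R(1,\dots,n)}\big(M_{\overline1}\cdots M_{\overline n}\,\rho_R(\alpha)\big),\qquad M^\alpha=\mathrm{Tr}_{R(2,\dots,n)}\big(M_{\overline1}\cdots M_{\overline n}\,\rho_R(\alpha)\big),$$ and $g=\eta^{-1}ch(\kappa_1)$, $\eta=(q-\mu)(q^{-1}+\mu)/(\mu(q-q^{-1}))$. The *extended quantum matrix algebra* $\mathcal M^\bullet=\mathcal M^\bullet(R,F)$ is the unital algebra generated by the entries of the matrix $M$ and by $g^{-1}$, with relations $R_1M_{\overline1}M_{\overline2}=M_{\overline1}M_{\overline2}R_1$,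 $g^{-1}g=gg^{-1}=1$, $g^{-1}M=(G^{-1}MG)g^{-1}$, where $G_1=\mathrm{Tr}_{(2,3)}K_2F_1^{-1}F_2^{-1}$. Its *characteristic subalgebra* $\mathcal C^\bullet$ is generated by all $ch(\alpha)$, $\alpha\in\mathbb C\mathcal B_n$, $n\ge1$, and by $g^{-1}$. Put $a_0=1$, $a_i=ch(a^{(i)})$ and $g^{1/2}=g^{1-\ell}a_{2\ell-1}$. Let $\mathcal P^\bullet$ be the right $\mathcal C^\bullet$-module of matrices over $\mathcal M^\bullet$ generated by $I$ and all $M^\alpha$, $\alpha\in\mathbb C\mathcal B_n$, $n\ge1$. Its *$\star$-product* is the bilinear map with $$(M^\alpha c)\star(M^\beta d)=M^{\alpha\star\beta}cd,\quad (Ic)\star(M^\beta d)=M^\beta cd,\quad (M^\alpha c)\star(Id)=M^\alpha cd,\quad (Ic)\star(Id)=I\,cd$$ for $c,d\in\mathcal C^\bullet$, $\alpha\in\mathbb C\mathcal B_n$, $\beta\in\mathbb C\mathcal B_m$, where $\alpha\star\beta=\alpha\,\beta^{\uparrow n}\,(\sigma_n\cdots\sigma_2\sigma_1\sigma_2^{-1}\cdots\sigma_n^{-1})\in\mathbb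 C\mathcal B_{n+m}$. Let $M^{\overline0}=I$, $M^{\overline{n+1}}=M\star M^{\overline n}$, and let $$\mathrm{CH}=(M-g^{1/2}I)\star\sum_{i=0}^{2\ell-2}(-q)^i\,M^{\overline{2\ell-2-i}}\,\epsilon_i,\qquad \epsilon_i=\sum_{j=0}^i a_{i-j}(-g^{1/2})^j,\quad \epsilon_{\ell-1+i}=\epsilon_{\ell-1-i}\,g^i\quad(0\le i\le\ell-1)$$ be the left-hand side of the Cayley–Hamilton identity $\mathrm{CH}=0$ of $\mathcal M^\bullet$. Assume that $a_1,\dots,a_{2\ell-1}$ satisfy no algebraic relations other than the reciprocal relations $g^{2\ell-1-i}a_i=a_{2\ell-1}a_{2\ell-1-i}$, $i=0,\dots,2\ell-1$; that is, every polynomial relation between $a_1,\dots,a_{2\ell-1},g,g^{-1}$ in $\mathcal C^\bullet$ lies, as a polynomial in commuting variables, in the ideal generated by the reciprocal relations and $gg^{-1}=1$. Let $\mathcal E^\bullet_{2\ell-2}$ be the commutative $\mathbb C$-algebra generated by $\nu_0,\dots,\nu_{2\ell-2},\nu_0^{-1}$ with relations $\nu_0\nu_0^{-1}=1$ and $\nu_{\ell-1+j}\,\nu_{\ell-j}=\nu_0^2$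 for $j=1,\dots,\ell-1$, and let $e_i$ be the elementary symmetric functions. **Corollary 5.9.** Under these assumptions: 1. The $\star$-product on $\mathcal P^\bullet$ exists and is unique, and there is a unique homomorphism of algebras $\pi:\mathcal C^\bullet\to\mathcal E^\bullet_{2\ell-2}$ with $$g^{1/2}\mapsto\nu_0,\qquad a_i\mapsto e_i(\nu_0,\nu_1,\dots,\nu_{2\ell-2})\quad\forall\, i=1,\dots,2\ell-1 .$$ 2. Let $\mathcal C^\bullet$ act on $\mathcal E^\bullet_{2\ell-2}$ from the left through $\pi$. On the completion $\mathcal P_{O^\bullet(2\ell-1)}=\mathcal P^\bullet\otimes_{\mathcal C^\bullet}\mathcal E^\bullet_{2\ell-2}$ there is a unique bilinear product $\star$ with $(N\otimes e)\star(N'\otimes e')=(N\star N')\otimes ee'$ for $N,N'\in\mathcal P^\bullet$, $e,e'\in\mathcal E^\bullet_{2\ell-2}$; it is associative with unit $I\otimes1$. 3. Writing $M-eI$ for $M\otimes1-I\otimes e$, in $\mathcal P_{O^\bullet(2\ell-1)}$ the Cayley–Hamilton identity acquires the factorized form $$\mathrm{CH}\otimes1\;=\;(M-\nu_0I)\star\prod_{i=1}^{2\ell-2}\!{}^{\star}\,(M-q\nu_iI)\;=\;0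 ,$$ the factors being taken in the order $i=1,\dots,2\ell-2$. -/

import Mathlib

open scoped TensorProduct

namespace QMA

noncomputable section

/-! ## Operators on tensor powers

`V` has a basis indexed by the finite type `ι`; an endomorphism of `V^{⊗ n}` (with entries in `A`)
is a matrix with rows and columns indexed by `Fin n → ι`.  For a matrix `X` the lower indices are
the rows and the upper indices are the columns. -/

/-- Matrices of endomorphisms of `V^{⊗ n}` with entries in `A`. -/
abbrev Op (ι : Type) (n : ℕ) (A : Type) : Type := Matrix (Fin n → ι) (Fin n → ι) A

section Embed

variable {ι : Type}

open Classical in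
/-- The operator `X` on `V^{⊗ p}` placed in the tensor factors `f 0, f 1, …` of `V^{⊗ n}`,
the identity in all other factors. -/
def embed {p n : ℕ} {A : Type} [Zero A] (f : Fin p → Fin n) (X : Op ι p A) : Op ι n A :=
  fun s t => if ∀ c, c ∉ Set.range f → s c = t c then X (s ∘ f) (t ∘ f) else 0

lemma embed_one [DecidableEq ι] {p n : ℕ} (f : Fin p → Fin n) : embed f (1 : Op ι p ℂ) = 1 := by
  classical
  ext s t
  simp only [embed, Matrix.one_apply]
  by_cases hst : s = t
  · subst hst; simp
  · rw [if_neg hst]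
    split_ifs with h1 h2
    · exfalso
      apply hst
      funext c
      by_cases hc : c ∈ Set.range f
      · obtain ⟨k, rfl⟩ := hc
        exact congrFun h2 k
      · exact h1 c hc
    · rfl
    · rfl

lemma embed_mul [Fintype ι] {p n : ℕ} (f : Fin p → Fin n) (hf : Function.Injective f) (X Y : Op ι p ℂ) :
    embed f X * embed f Y = embed f (X * Y) := by
  classical
  ext s t
  rw [Matrix.mul_apply]
  simp only [embed]
  by_cases hst : ∀ c, c ∉ Set.range f → s c = t c
  · rw [if_pos hst, Matrix.mul_apply]
    symm
    apply Fintype.sum_of_injective (fun v : Fin p → ι => Function.extend f v s)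
    · intro v w hvw
      funext k
      have := congrFun hvw (f k)
      simpa [hf.extend_apply] using this
    · intro u hu
      rw [if_neg, zero_mul]
      intro h
      apply hu
      refine ⟨u ∘ f, ?_⟩
      funext c
      by_cases hc : c ∈ Set.range f
      · obtain ⟨k, rfl⟩ := hc
        simp [hf.extend_apply]
      · rw [← h c hc]
        exact Function.extend_apply' _ _ _ hc
    · intro v
      have hv : ∀ c, c ∉ Set.range f → Function.extend f v s c = s c :=
        fun c hc => Function.extend_apply' _ _ _ hc
      have hvf : (Function.extend f v s) ∘ f = v := by
        funext k
        simp [hf.extend_apply]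
      rw [if_pos (fun c hc => (hv c hc).symm), if_pos (fun c hc => (hv c hc).trans (hst c hc)), hvf]
  · rw [if_neg hst]
    apply Finset.sum_eq_zero
    intro u _
    by_cases h1 : ∀ c, c ∉ Set.range f → s c = u c
    · rw [if_neg (c := ∀ c, c ∉ Set.range f → u c = t c), mul_zero]
      intro h2
      exact hst fun c hc => (h1 c hc).trans (h2 c hc)
    · rw [if_neg h1, zero_mul]

lemma embed_embed {p m n : ℕ} (f : Fin m → Fin n) (hf : Function.Injective f)
    (g : Fin p → Fin m) (X : Op ι p ℂ) : embed f (embed g X) = embed (f ∘ g) X := by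
  classical
  ext s t
  simp only [embed]
  by_cases h : ∀ c, c ∉ Set.range (f ∘ g) → s c = t c
  · rw [if_pos h, if_pos, if_pos]
    · rfl
    · intro d hd
      apply h
      rintro ⟨k, hk⟩
      exact hd ⟨k, hf hk⟩
    · intro c hc
      apply h
      rintro ⟨k, hk⟩
      exact hc ⟨g k, hk⟩
  · rw [if_neg h]
    by_cases h1 : ∀ c, c ∉ Set.range f → s c = t c
    · rw [if_pos h1, if_neg]
      intro h2
      apply h
      intro c hc
      by_cases hcf : c ∈ Set.range f
      · obtain ⟨d, rfl⟩ := hcf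
        apply h2 d
        rintro ⟨k, rfl⟩
        exact hc ⟨k, rfl⟩
      · exact h1 c hcf
    · rw [if_neg h1]

lemma embed_mul_disjoint [Fintype ι] {p r n : ℕ} (f : Fin p → Fin n) (g : Fin r → Fin n)
    (hfg : ∀ a b, f a ≠ g b) (X : Op ι p ℂ) (Y : Op ι r ℂ) (s t : Fin n → ι)
    [Decidable (∀ c, c ∉ Set.range f → c ∉ Set.range g → s c = t c)] :
    (embed f X * embed g Y) s t =
      if ∀ c, c ∉ Set.range f → c ∉ Set.range g → s c = t c then
        X (s ∘ f) (t ∘ f) * Y (s ∘ g) (t ∘ g) else 0 := by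
  classical
  rw [Matrix.mul_apply]
  let u : Fin n → ι := fun c => if c ∈ Set.range f then t c else s c
  have huf : u ∘ f = t ∘ f := by funext k; simp [u]
  have hug : u ∘ g = s ∘ g := by
    funext k
    have : g k ∉ Set.range f := by rintro ⟨a, ha⟩; exact hfg a k ha
    simp only [u, Function.comp, if_neg this]
  rw [Finset.sum_eq_single u]
  · simp only [embed]
    rw [if_pos (c := ∀ c, c ∉ Set.range f → s c = u c)
      (fun c hc => by simp only [u, if_neg hc]), huf, hug]
    by_cases h : ∀ c, c ∉ Set.range f → c ∉ Set.range g → s c = t c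
    · rw [if_pos h, if_pos]
      intro c hc
      by_cases hcf : c ∈ Set.range f
      · simp only [u, if_pos hcf]
      · simp only [u, if_neg hcf]; exact h c hcf hc
    · rw [if_neg h, if_neg, mul_zero]
      intro h2
      apply h
      intro c hcf hcg
      have := h2 c hcg
      simpa only [u, if_neg hcf] using this
  · intro w _ hw
    simp only [embed]
    by_cases h1 : ∀ c, c ∉ Set.range f → s c = w c
    · rw [if_neg (c := ∀ c, c ∉ Set.range g → w c = t c), mul_zero]
      intro h2
      apply hw
      funext c
      by_cases hcf : c ∈ Set.range f
      · simp only [u, if_pos hcf]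
        apply h2
        obtain ⟨a, rfl⟩ := hcf
        rintro ⟨b, hb⟩
        exact hfg a b hb.symm
      · simp only [u, if_neg hcf]
        exact (h1 c hcf).symm
    · rw [if_neg h1, zero_mul]
  · intro h; exact absurd (Finset.mem_univ u) h

lemma embed_comm [Fintype ι] {p r n : ℕ} (f : Fin p → Fin n) (g : Fin r → Fin n)
    (hfg : ∀ a b, f a ≠ g b) (X : Op ι p ℂ) (Y : Op ι r ℂ) :
    embed f X * embed g Y = embed g Y * embed f X := by
  classical
  ext s t
  rw [embed_mul_disjoint f g hfg, embed_mul_disjoint g f (fun a b h => hfg b a h.symm), mul_comm]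
  congr 1
  exact propext ⟨fun h c h1 h2 => h c h2 h1, fun h c h1 h2 => h c h2 h1⟩

/-- The pair of neighbouring tensor factors `i, i+1` (counted from `0`) of `V^{⊗ (m+1)}`. -/
def site {m : ℕ} (i : Fin m) : Fin 2 → Fin (m + 1) := ![i.castSucc, i.succ]

lemma site_injective {m : ℕ} (i : Fin m) : Function.Injective (site i) := by
  intro a b h
  fin_cases a <;> fin_cases b <;> simp [site, Fin.ext_iff] at h ⊢

/-- `X_{i+1}`: the two-site operator `X` acting in the factors `i, i+1` (counted from `0`). -/
def at2 {m : ℕ} (X : Op ι 2 ℂ) (i : Fin m) : Op ι (m + 1) ℂ := embed (site i) X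

end Embed

/-! ## R-matrices -/

/-- An R-matrix: an invertible operator on `V ⊗ V` that satisfies the Yang-Baxter equation. -/
structure RMatrix (ι : Type) [Fintype ι] [DecidableEq ι] where
  /-- the underlying operator on `V ⊗ V` -/
  mat : Op ι 2 ℂ
  isUnit : IsUnit mat
  yangBaxter : at2 mat (0 : Fin 2) * at2 mat (1 : Fin 2) * at2 mat (0 : Fin 2) =
    at2 mat (1 : Fin 2) * at2 mat (0 : Fin 2) * at2 mat (1 : Fin 2)

section RMatrices

variable {ι : Type} [Fintype ι] [DecidableEq ι]

/-- `Ψ` is the skew inverse of `X`: `Tr_(2) X_{12} Ψ_{23} = Tr_(2) Ψ_{12} X_{23} = P_{13}`. -/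
def IsSkewInverse (X Ψ : Op ι 2 ℂ) : Prop :=
  (∀ a c d e : ι, ∑ b, (at2 X (0 : Fin 2) * at2 Ψ (1 : Fin 2)) ![a, b, c] ![d, b, e] =
    if a = e ∧ c = d then 1 else 0) ∧
  (∀ a c d e : ι, ∑ b, (at2 Ψ (0 : Fin 2) * at2 X (1 : Fin 2)) ![a, b, c] ![d, b, e] =
    if a = e ∧ c = d then 1 else 0)

def IsSkewInvertible (X : Op ι 2 ℂ) : Prop := ∃ Ψ, IsSkewInverse X Ψ

/-- The skew inverse `Ψ_X` (meaningful if `X` is skew invertible; it is then unique). -/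
def skewInverse (X : Op ι 2 ℂ) : Op ι 2 ℂ := Classical.epsilon (IsSkewInverse X)

/-- `C_X = Tr_(1) (Ψ_X)_{12}`. -/
def matC (X : Op ι 2 ℂ) : Matrix ι ι ℂ := fun a b => ∑ x, skewInverse X ![x, a] ![x, b]

/-- `D_X = Tr_(2) (Ψ_X)_{12}`. -/
def matD (X : Op ι 2 ℂ) : Matrix ι ι ℂ := fun a b => ∑ x, skewInverse X ![a, x] ![b, x]

def IsStrictSkewInvertible (X : Op ι 2 ℂ) : Prop :=
  IsSkewInvertible X ∧ (IsUnit (matC X) ∨ IsUnit (matD X))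

/-- Compatible pair: `R_1 F_2 F_1 = F_2 F_1 R_2` and `R_2 F_1 F_2 = F_1 F_2 R_1`. -/
def IsCompatiblePair (R F : Op ι 2 ℂ) : Prop :=
  at2 R (0 : Fin 2) * at2 F (1 : Fin 2) * at2 F (0 : Fin 2) =
      at2 F (1 : Fin 2) * at2 F (0 : Fin 2) * at2 R (1 : Fin 2) ∧
  at2 R (1 : Fin 2) * at2 F (0 : Fin 2) * at2 F (1 : Fin 2) =
      at2 F (0 : Fin 2) * at2 F (1 : Fin 2) * at2 R (0 : Fin 2)

/-- `K = μ⁻¹ (q - q⁻¹)⁻¹ (q I - R) (q⁻¹ I + R)`. -/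
def matK (q μ : ℂ) (R : Op ι 2 ℂ) : Op ι 2 ℂ :=
  (μ⁻¹ * (q - q⁻¹)⁻¹) • ((q • (1 : Op ι 2 ℂ) - R) * (q⁻¹ • (1 : Op ι 2 ℂ) + R))

/-- R-matrices of BMW type with parameters `q`, `μ`. -/
structure IsBMWType (q μ : ℂ) (R : RMatrix ι) : Prop where
  q_ne : q ≠ 0 ∧ q ≠ 1 ∧ q ≠ -1
  mu_ne : μ ≠ 0 ∧ μ ≠ q ∧ μ ≠ -q⁻¹
  minpoly_eq : minpoly ℂ R.mat =
    (Polynomial.X - Polynomial.C q) * (Polynomial.X + Polynomial.C q⁻¹) *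
      (Polynomial.X - Polynomial.C μ)
  K_two_K_one : at2 (matK q μ R.mat) (1 : Fin 2) * at2 (matK q μ R.mat) (0 : Fin 2) =
    at2 R.mat (0 : Fin 2) * at2 R.mat (1 : Fin 2) * at2 (matK q μ R.mat) (0 : Fin 2)
  K_two_K_one_inv : at2 (matK q μ R.mat) (1 : Fin 2) * at2 (matK q μ R.mat) (0 : Fin 2) =
    at2 R.mat⁻¹ (0 : Fin 2) * at2 R.mat⁻¹ (1 : Fin 2) * at2 (matK q μ R.mat) (0 : Fin 2)
  K_K_K : at2 (matK q μ R.mat) (0 : Fin 2) * at2 (matK q μ R.mat) (1 : Fin 2) *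
    at2 (matK q μ R.mat) (0 : Fin 2) = at2 (matK q μ R.mat) (0 : Fin 2)

end RMatrices

/-! ## Braid groups and their R-matrix representations -/

/-- Artin's relations for the generators `σ_0, …, σ_{m-1}` (numbered from `0`). -/
def braidRels (m : ℕ) : Set (FreeGroup (Fin m)) :=
  {r | ∃ i j : Fin m,
    (i.val + 1 = j.val ∧ r = FreeGroup.of i * FreeGroup.of j * FreeGroup.of i *
      (FreeGroup.of j * FreeGroup.of i * FreeGroup.of j)⁻¹) ∨
    (i.val + 1 < j.val ∧ r = FreeGroup.of i * FreeGroup.of j *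
      (FreeGroup.of j * FreeGroup.of i)⁻¹)}

/-- The braid group on `m + 1` strands. -/
abbrev Braid (m : ℕ) : Type := PresentedGroup (braidRels m)

/-- The Artin generator with number `i`, counted from `0`. -/
def sig {m : ℕ} (i : Fin m) : Braid m := PresentedGroup.of i

lemma sig_braid {m : ℕ} (i j : Fin m) (h : i.val + 1 = j.val) :
    sig i * sig j * sig i = sig j * sig i * sig j := by
  have : PresentedGroup.mk (braidRels m) (FreeGroup.of i * FreeGroup.of j * FreeGroup.of i *
      (FreeGroup.of j * FreeGroup.of i * FreeGroup.of j)⁻¹) = 1 :=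
    PresentedGroup.one_of_mem ⟨i, j, Or.inl ⟨h, rfl⟩⟩
  simp only [map_mul, map_inv] at this
  exact mul_inv_eq_one.mp this

lemma sig_comm {m : ℕ} (i j : Fin m) (h : i.val + 1 < j.val) :
    sig i * sig j = sig j * sig i := by
  have : PresentedGroup.mk (braidRels m) (FreeGroup.of i * FreeGroup.of j *
      (FreeGroup.of j * FreeGroup.of i)⁻¹) = 1 :=
    PresentedGroup.one_of_mem ⟨i, j, Or.inr ⟨h, rfl⟩⟩
  simp only [map_mul, map_inv] at this
  exact mul_inv_eq_one.mp this

/-- The homomorphism `σ_i ↦ σ_{i+d}` of braid groups; for `d = 0` it is the inclusion. -/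
def braidShift (d : ℕ) {m m' : ℕ} (h : d + m ≤ m') : Braid m →* Braid m' :=
  PresentedGroup.toGroup (f := fun i : Fin m => sig (⟨d + i.val, by omega⟩ : Fin m')) (by
    rintro r ⟨i, j, ⟨hij, rfl⟩ | ⟨hij, rfl⟩⟩
    · simp only [map_mul, map_inv, FreeGroup.lift_apply_of]
      exact mul_inv_eq_one.mpr (sig_braid _ _ (by simp only; omega))
    · simp only [map_mul, map_inv, FreeGroup.lift_apply_of]
      exact mul_inv_eq_one.mpr (sig_comm _ _ (by simp only; omega)))

/-- The group algebra of the braid group on `m + 1` strands. -/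
abbrev BraidAlg (m : ℕ) : Type := MonoidAlgebra ℂ (Braid m)

/-- `α ↦ α^{↑ d}` on group algebras. -/
def algShift (d : ℕ) {m m' : ℕ} (h : d + m ≤ m') : BraidAlg m →ₐ[ℂ] BraidAlg m' :=
  MonoidAlgebra.mapDomainAlgHom ℂ ℂ (braidShift d h)

/-- The generator `σ_i` as an element of the group algebra. -/
def sigA {m : ℕ} (i : Fin m) : BraidAlg m := MonoidAlgebra.of ℂ (Braid m) (sig i)

section Rho

variable {ι : Type} [Fintype ι] [DecidableEq ι]

/-- The invertible operator `R_i` on `V^{⊗ (m+1)}`. -/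
def RMatrix.unitAt (R : RMatrix ι) {m : ℕ} (i : Fin m) : (Op ι (m + 1) ℂ)ˣ where
  val := at2 R.mat i
  inv := at2 R.mat⁻¹ i
  val_inv := by
    rw [at2, at2, embed_mul _ (site_injective i),
      Matrix.mul_nonsing_inv _ ((Matrix.isUnit_iff_isUnit_det _).mp R.isUnit), embed_one]
  inv_val := by
    rw [at2, at2, embed_mul _ (site_injective i),
      Matrix.nonsing_inv_mul _ ((Matrix.isUnit_iff_isUnit_det _).mp R.isUnit), embed_one]

lemma RMatrix.unitAt_braid (R : RMatrix ι) {m : ℕ} (i j : Fin m) (h : i.val + 1 = j.val) :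
    R.unitAt i * R.unitAt j * R.unitAt i = R.unitAt j * R.unitAt i * R.unitAt j := by
  apply Units.ext
  simp only [Units.val_mul, RMatrix.unitAt]
  let f : Fin 3 → Fin (m + 1) := ![i.castSucc, i.succ, j.succ]
  have hf : Function.Injective f := by
    intro a b hab
    fin_cases a <;> fin_cases b <;> simp [f, Fin.ext_iff] at hab ⊢ <;> omega
  have h0 : at2 R.mat i = embed f (at2 R.mat (0 : Fin 2)) := by
    rw [at2, at2, embed_embed f hf]
    congr 1
    funext a
    fin_cases a <;> simp [site, f]
  have h1 : at2 R.mat j = embed f (at2 R.mat (1 : Fin 2)) := by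
    rw [at2, at2, embed_embed f hf]
    congr 1
    funext a
    fin_cases a
    · simp [site, f, Fin.ext_iff, h]
    · simp [site, f]
  rw [h0, h1]
  simp only [embed_mul f hf, R.yangBaxter]

lemma RMatrix.unitAt_comm (R : RMatrix ι) {m : ℕ} (i j : Fin m) (h : i.val + 1 < j.val) :
    R.unitAt i * R.unitAt j = R.unitAt j * R.unitAt i := by
  apply Units.ext
  simp only [Units.val_mul, RMatrix.unitAt]
  apply embed_comm
  intro a b hab
  fin_cases a <;> fin_cases b <;> simp [site, Fin.ext_iff] at hab <;> omega

/-- The representation `σ_i ↦ R_i` of the braid group on `V^{⊗ (m+1)}`. -/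
def RMatrix.rhoGroup (R : RMatrix ι) (m : ℕ) : Braid m →* (Op ι (m + 1) ℂ)ˣ :=
  PresentedGroup.toGroup (f := fun i : Fin m => R.unitAt i) (by
    rintro r ⟨i, j, ⟨hij, rfl⟩ | ⟨hij, rfl⟩⟩
    · simp only [map_mul, map_inv, FreeGroup.lift_apply_of]
      exact mul_inv_eq_one.mpr (R.unitAt_braid i j hij)
    · simp only [map_mul, map_inv, FreeGroup.lift_apply_of]
      exact mul_inv_eq_one.mpr (R.unitAt_comm i j hij))

/-- `ρ_R`, extended linearly to the group algebra of the braid group. -/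
def RMatrix.rho (R : RMatrix ι) {m : ℕ} : BraidAlg m →ₐ[ℂ] Op ι (m + 1) ℂ :=
  MonoidAlgebra.lift ℂ (Op ι (m + 1) ℂ) (Braid m) ((Units.coeHom _).comp (R.rhoGroup m))

end Rho

/-! ## Antisymmetrizers

The elements below are lifts to the group algebra of the braid group of the elements with the same
names of the Birman-Murakami-Wenzl algebra `W_n(q, μ)` (a quotient of that group algebra); for an
R-matrix of BMW type, `ρ_R` factors through `W_n(q, μ)`. -/

/-- `q`-numbers `i_q = (q^i - q^{-i}) / (q - q⁻¹)`. -/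
def qnum (q : ℂ) (i : ℕ) : ℂ := (q ^ i - q⁻¹ ^ i) / (q - q⁻¹)

/-- `κ_i = (q - σ_i)(q⁻¹ + σ_i) / (μ (q - q⁻¹))`. -/
def kap (q μ : ℂ) {m : ℕ} (i : Fin m) : BraidAlg m :=
  (μ * (q - q⁻¹))⁻¹ • ((q • (1 : BraidAlg m) - sigA i) * (q⁻¹ • (1 : BraidAlg m) + sigA i))

/-- The baxterized elements
`σ_i^-(x) = 1 + (x-1)/(q-q⁻¹) σ_i + (x-1)/(α x + 1) κ_i` with `α = q μ⁻¹`. -/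
def baxMinus (q μ : ℂ) {m : ℕ} (i : Fin m) (x : ℂ) : BraidAlg m :=
  1 + ((x - 1) / (q - q⁻¹)) • sigA i + ((x - 1) / (q * μ⁻¹ * x + 1)) • kap q μ i

/-- `antisym q μ m` is the antisymmetrizer `a^{(m+1)}`: `a^{(1)} = 1` and
`a^{(i+1)} = q^i / (i+1)_q a^{(i)} σ_i^-(q^{-2i}) a^{(i)}`. -/
def antisym (q μ : ℂ) : (m : ℕ) → BraidAlg m
  | 0 => 1
  | m + 1 =>
    (q ^ (m + 1) / qnum q (m + 2)) •
      (algShift 0 (by omega : 0 + m ≤ m + 1) (antisym q μ m) *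
        baxMinus q μ (Fin.last m) (q⁻¹ ^ (2 * (m + 1))) *
        algShift 0 (by omega : 0 + m ≤ m + 1) (antisym q μ m))

/-- `η = (q - μ)(q⁻¹ + μ) / (μ (q - q⁻¹))`. -/
def eta (q μ : ℂ) : ℂ := (q - μ) * (q⁻¹ + μ) / (μ * (q - q⁻¹))

/-- The value `μ = q^{1-k}` of the second BMW parameter in the `O(k)` case. -/
def muO (q : ℂ) (k : ℕ) : ℂ := q ^ (1 - (k : ℤ))

/-- R-matrices of type `O(k)` (with parameter `q`). -/
structure IsOrthogonalType {ι : Type} [Fintype ι] [DecidableEq ι]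
    (q : ℂ) (k : ℕ) (R : RMatrix ι) : Prop where
  two_le : 2 ≤ k
  bmw : IsBMWType q (muO q k) R
  skew : IsSkewInvertible R.mat
  qnum_ne : ∀ i, 2 ≤ i → i ≤ k → qnum q i ≠ 0
  mu_ne : ∀ i : ℕ, 1 ≤ i → i ≤ k → muO q k ≠ -q ^ (1 - 2 * (i : ℤ))
  rank_ne : ∀ m, 2 ≤ m + 1 → m + 1 ≤ k → (R.rho (antisym q (muO q k) m)).rank ≠ 0
  /-- `ρ_R(a^{(k)↑1} σ_1^-(q^{-2k}) a^{(k)↑1}) = 0` -/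
  vanish : ∀ m, m + 1 = k →
    R.rho (algShift 1 (by omega : 1 + m ≤ m + 1) (antisym q (muO q k) m) *
      baxMinus q (muO q k) (0 : Fin (m + 1)) (q⁻¹ ^ (2 * k)) *
      algShift 1 (by omega : 1 + m ≤ m + 1) (antisym q (muO q k) m)) = 0
  rank_one : ∀ m, m + 1 = k → (R.rho (antisym q (muO q k) m)).rank = 1

/-! ## Matrix copies, characters and matrix powers over an arbitrary algebra -/

section Copies

variable {ι : Type} [Fintype ι] [DecidableEq ι] (R F : RMatrix ι)
  {A : Type} [Ring A] [Algebra ℂ A] (N : Matrix ι ι A)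

/-- Scalar operators viewed as operators with entries in `A`. -/
def scal (A : Type) [Ring A] [Algebra ℂ A] {n : ℕ} (X : Op ι n ℂ) : Op ι n A :=
  X.map (algebraMap ℂ A)

/-- `N_1` acting in the first factor of `V^{⊗ (m+1)}`. -/
def first (m : ℕ) : Op ι (m + 1) A :=
  fun s t => if Fin.tail s = Fin.tail t then N (s 0) (t 0) else 0

/-- The copies `N_{\bar 1} = N_1`, `N_{\overline{i+1}} = F_i N_{\bar i} F_i⁻¹`
(numbered from `0`). -/
def copy (m : ℕ) : Fin (m + 1) → Op ι (m + 1) A :=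
  Fin.induction (motive := fun _ => Op ι (m + 1) A) (first N m)
    (fun i X => scal A (at2 F.mat i) * X * scal A (at2 F.mat⁻¹ i))

/-- `N_{\bar 1} ⋯ N_{\overline{m+1}} ρ_R(α)`. -/
def copiesRho {m : ℕ} (α : BraidAlg m) : Op ι (m + 1) A :=
  (List.ofFn (copy F N m)).prod * scal A (R.rho α)

/-- The R-trace over all factors. -/
def trAll {n : ℕ} (X : Op ι n A) : A :=
  ∑ s : Fin n → ι, ∑ t : Fin n → ι, (∏ c, matD R.mat (s c) (t c)) • X t s

/-- The R-trace over all factors but the first one. -/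
def trTail {m : ℕ} (X : Op ι (m + 1) A) : Matrix ι ι A := fun a b =>
  ∑ s : Fin m → ι, ∑ t : Fin m → ι, (∏ c, matD R.mat (s c) (t c)) •
    X (Fin.cons (α := fun _ => ι) a t) (Fin.cons (α := fun _ => ι) b s)

/-- `ch(α) = Tr_{R(1,…,n)} (N_{\bar 1} ⋯ N_{\bar n} ρ_R(α))`, `n = m + 1`. -/
def ch {m : ℕ} (α : BraidAlg m) : A := trAll R (copiesRho R F N α)

/-- The matrix power `N^α = Tr_{R(2,…,n)} (N_{\bar 1} ⋯ N_{\bar n} ρ_R(α))`, `n = m + 1`. -/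
def matPow {m : ℕ} (α : BraidAlg m) : Matrix ι ι A := trTail R (copiesRho R F N α)

/-- The 2-contraction `g = η⁻¹ ch(κ_1)`. -/
def contraction (q μ : ℂ) : A := (eta q μ)⁻¹ • ch R F N (kap q μ (0 : Fin 1))

end Copies

/-! ## The extended quantum matrix algebra -/

section Algebra

variable {ι : Type} [Fintype ι] [DecidableEq ι] (q μ : ℂ) (R F : RMatrix ι)

/-- `G_1 = Tr_{(23)} K_2 F_1⁻¹ F_2⁻¹`. -/
def matG : Matrix ι ι ℂ := fun a b => ∑ c, ∑ d,
  (at2 (matK q μ R.mat) (1 : Fin 2) * at2 F.mat⁻¹ (0 : Fin 2) * at2 F.mat⁻¹ (1 : Fin 2))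
    ![a, c, d] ![b, c, d]

/-- The free algebra on the entries `M_a^b` (`some (a, b)`) and on `g⁻¹` (`none`). -/
abbrev FreeGen (ι : Type) : Type := FreeAlgebra ℂ (Option (ι × ι))

/-- The matrix of free generators. -/
def freeM (ι : Type) : Matrix ι ι (FreeGen ι) := fun a b => FreeAlgebra.ι ℂ (some (a, b))

/-- The free generator `g⁻¹`. -/
def freeGInv (ι : Type) : FreeGen ι := FreeAlgebra.ι ℂ none

/-- Defining relations of the extended quantum matrix algebra:
`R_1 M_{\bar 1} M_{\bar 2} = M_{\bar 1} M_{\bar 2} R_1`, `g⁻¹ g = g g⁻¹ = 1` and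
`g⁻¹ M = (G⁻¹ M G) g⁻¹`. -/
inductive QMRel : FreeGen ι → FreeGen ι → Prop
  | rmm (s t : Fin 2 → ι) : QMRel
      ((scal (FreeGen ι) (at2 R.mat (0 : Fin 1)) *
        (copy F (freeM ι) 1 0 * copy F (freeM ι) 1 1)) s t)
      ((copy F (freeM ι) 1 0 * copy F (freeM ι) 1 1 *
        scal (FreeGen ι) (at2 R.mat (0 : Fin 1))) s t)
  | inv_mul : QMRel (freeGInv ι * contraction R F (freeM ι) q μ) 1
  | mul_inv : QMRel (contraction R F (freeM ι) q μ * freeGInv ι) 1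
  | conj (a b : ι) : QMRel (freeGInv ι * freeM ι a b)
      (((matG q μ R F)⁻¹.map (algebraMap ℂ (FreeGen ι)) * freeM ι *
        (matG q μ R F).map (algebraMap ℂ (FreeGen ι))) a b * freeGInv ι)

/-- The extended quantum matrix algebra `M^•(R, F)`. -/
def QMAlg : Type := RingQuot (QMRel q μ R F)

instance : Ring (QMAlg q μ R F) := inferInstanceAs (Ring (RingQuot (QMRel q μ R F)))

instance : Algebra ℂ (QMAlg q μ R F) := inferInstanceAs (Algebra ℂ (RingQuot (QMRel q μ R F)))

/-- The quotient map from the free algebra. -/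
def toQM : FreeGen ι →ₐ[ℂ] QMAlg q μ R F := RingQuot.mkAlgHom ℂ (QMRel q μ R F)

/-- The matrix `M` of generators. -/
def genM : Matrix ι ι (QMAlg q μ R F) :=
  (freeM ι).map (toQM q μ R F)

/-- The generator `g⁻¹`. -/
def gInv : QMAlg q μ R F := toQM q μ R F (freeGInv ι)

/-- The extended characteristic subalgebra `C^•(R, F)`: it is generated by the elements `ch(α)`,
`α ∈ ℂ B_n`, `n ≥ 1`, and by `g⁻¹`. -/
def charAlg : Subalgebra ℂ (QMAlg q μ R F) :=
  Algebra.adjoin ℂ ({x | ∃ (m : ℕ) (α : BraidAlg m), x = ch R F (genM q μ R F) α} ∪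
    {gInv q μ R F})

/-- `ch(α)` as an element of `C^•(R, F)`. -/
def chC {m : ℕ} (α : BraidAlg m) : charAlg q μ R F :=
  ⟨ch R F (genM q μ R F) α, Algebra.subset_adjoin (Or.inl ⟨m, α, rfl⟩)⟩

/-- `g⁻¹` as an element of `C^•(R, F)`. -/
def gInvC : charAlg q μ R F := ⟨gInv q μ R F, Algebra.subset_adjoin (Or.inr rfl)⟩

/-- The 2-contraction `g`. -/
def gC : charAlg q μ R F := (eta q μ)⁻¹ • chC q μ R F (kap q μ (0 : Fin 1))

/-- `a_0 = 1`, `a_i = ch(a^{(i)})` for `i ≥ 1`. -/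
def aC : ℕ → charAlg q μ R F
  | 0 => 1
  | m + 1 => chC q μ R F (antisym q μ m)

/-- `g^{1/2} = g^{1-ℓ} a_{2ℓ-1}`. -/
def gHalf (l : ℕ) : charAlg q μ R F := gInvC q μ R F ^ (l - 1) * aC q μ R F (2 * l - 1)

/-- Component-wise right multiplication of a matrix by an element of the algebra. -/
def rightMul {A : Type} [Ring A] (N : Matrix ι ι A) (c : A) : Matrix ι ι A :=
  fun a b => N a b * c

/-- The right `C^•(R, F)`-module of matrices that is generated by the identity matrix and by all
`M^α`, `α ∈ ℂ B_n`, `n ≥ 1`. -/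
def matSpace : Submodule ℂ (Matrix ι ι (QMAlg q μ R F)) :=
  Submodule.span ℂ
    ({X | ∃ c : charAlg q μ R F, X = rightMul 1 (c : QMAlg q μ R F)} ∪
     {X | ∃ (m : ℕ) (α : BraidAlg m) (c : charAlg q μ R F),
        X = rightMul (matPow R F (genM q μ R F) α) (c : QMAlg q μ R F)})

lemma rightMul_mem {N : Matrix ι ι (QMAlg q μ R F)} (hN : N ∈ matSpace q μ R F)
    (c : charAlg q μ R F) : rightMul N (c : QMAlg q μ R F) ∈ matSpace q μ R F := by
  have hmul : ∀ (X : Matrix ι ι (QMAlg q μ R F)) (c d : charAlg q μ R F),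
      rightMul (rightMul X (c : QMAlg q μ R F)) (d : QMAlg q μ R F) =
        rightMul X ((c * d : charAlg q μ R F) : QMAlg q μ R F) := by
    intro X c d
    funext a b
    simp [rightMul, mul_assoc]
  refine Submodule.span_induction (p := fun X _ => rightMul X (c : QMAlg q μ R F) ∈
    matSpace q μ R F) ?_ ?_ ?_ ?_ hN
  · rintro X (⟨d, rfl⟩ | ⟨m, α, d, rfl⟩)
    · rw [hmul]
      exact Submodule.subset_span (Or.inl ⟨_, rfl⟩)
    · rw [hmul]
      exact Submodule.subset_span (Or.inr ⟨m, α, _, rfl⟩)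
  · have : rightMul (0 : Matrix ι ι (QMAlg q μ R F)) (c : QMAlg q μ R F) = 0 := by
      funext a b; simp [rightMul]
    rw [this]; exact Submodule.zero_mem _
  · intro X Y _ _ hX hY
    have : rightMul (X + Y) (c : QMAlg q μ R F) =
        rightMul X (c : QMAlg q μ R F) + rightMul Y (c : QMAlg q μ R F) := by
      funext a b; simp [rightMul, add_mul]
    rw [this]; exact Submodule.add_mem _ hX hY
  · intro z X _ hX
    have : rightMul (z • X) (c : QMAlg q μ R F) = z • rightMul X (c : QMAlg q μ R F) := by
      funext a b; simp [rightMul]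
    rw [this]; exact Submodule.smul_mem _ _ hX

/-- The space `P^•(R, F)`. -/
def PSpace : Type := ↥(matSpace q μ R F)

instance : AddCommGroup (PSpace q μ R F) := inferInstanceAs (AddCommGroup ↥(matSpace q μ R F))

instance : Module ℂ (PSpace q μ R F) := inferInstanceAs (Module ℂ ↥(matSpace q μ R F))

/-- `I c` as an element of `P^•(R, F)`. -/
def idP (c : charAlg q μ R F) : PSpace q μ R F :=
  ⟨rightMul 1 (c : QMAlg q μ R F), Submodule.subset_span (Or.inl ⟨c, rfl⟩)⟩

/-- `M^α c` as an element of `P^•(R, F)`. -/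
def powP {m : ℕ} (α : BraidAlg m) (c : charAlg q μ R F) : PSpace q μ R F :=
  ⟨rightMul (matPow R F (genM q μ R F) α) (c : QMAlg q μ R F),
    Submodule.subset_span (Or.inr ⟨m, α, c, rfl⟩)⟩

/-- The matrix `M = M^1` as an element of `P^•(R, F)`. -/
def MP : PSpace q μ R F := powP q μ R F (1 : BraidAlg 0) 1

/-- The right action of `C^•(R, F)` on `P^•(R, F)`. -/
def actP (N : PSpace q μ R F) (c : charAlg q μ R F) : PSpace q μ R F :=
  ⟨rightMul N.val (c : QMAlg q μ R F), rightMul_mem q μ R F N.property c⟩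

/-! ## The `⋆`-product -/

/-- The braid `σ_n ⋯ σ_2 σ_1 σ_2⁻¹ ⋯ σ_n⁻¹` with `n = m + 1` (generators numbered from `1`). -/
def starBraid (m p : ℕ) : Braid (m + p + 1) :=
  ((List.ofFn fun j : Fin m => sig (⟨j.val + 1, by omega⟩ : Fin (m + p + 1))).reverse).prod *
    sig ⟨0, by omega⟩ *
  (((List.ofFn fun j : Fin m => sig (⟨j.val + 1, by omega⟩ : Fin (m + p + 1))).reverse).prod)⁻¹

/-- `α ⋆ β = α β^{↑n} (σ_n ⋯ σ_2 σ_1 σ_2⁻¹ ⋯ σ_n⁻¹)` for `α ∈ ℂ B_n`, `β ∈ ℂ B_i`, where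
`n = m + 1` and `i = p + 1`. -/
def starExp {m p : ℕ} (α : BraidAlg m) (β : BraidAlg p) : BraidAlg (m + p + 1) :=
  algShift 0 (by omega : 0 + m ≤ m + p + 1) α *
    algShift (m + 1) (by omega : m + 1 + p ≤ m + p + 1) β *
    MonoidAlgebra.of ℂ (Braid (m + p + 1)) (starBraid m p)

/-- The bilinear map `s` is the `⋆`-product on `P^•(R, F)`. -/
structure IsStarProduct
    (s : PSpace q μ R F →ₗ[ℂ] PSpace q μ R F →ₗ[ℂ] PSpace q μ R F) : Prop where
  pow_pow : ∀ (m p : ℕ) (α : BraidAlg m) (β : BraidAlg p) (c d : charAlg q μ R F),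
    s (powP q μ R F α c) (powP q μ R F β d) = powP q μ R F (starExp α β) (c * d)
  id_pow : ∀ (p : ℕ) (β : BraidAlg p) (c d : charAlg q μ R F),
    s (idP q μ R F c) (powP q μ R F β d) = powP q μ R F β (c * d)
  pow_id : ∀ (m : ℕ) (α : BraidAlg m) (c d : charAlg q μ R F),
    s (powP q μ R F α c) (idP q μ R F d) = powP q μ R F α (c * d)
  id_id : ∀ c d : charAlg q μ R F,
    s (idP q μ R F c) (idP q μ R F d) = idP q μ R F (c * d)

/-- The `n`-th `⋆`-power `M^{\bar n} = M ⋆ ⋯ ⋆ M`, with `M^{\bar 0} = I`. -/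
def starPow (s : PSpace q μ R F →ₗ[ℂ] PSpace q μ R F →ₗ[ℂ] PSpace q μ R F) :
    ℕ → PSpace q μ R F
  | 0 => idP q μ R F 1
  | n + 1 => s (MP q μ R F) (starPow s n)

/-- `ε_i = ∑_{j ≤ i} a_{i-j} (-g^{1/2})^j` and `ε_{ℓ-1+i} = ε_{ℓ-1-i} g^i` for `0 ≤ i ≤ ℓ-1`. -/
def epsC (l i : ℕ) : charAlg q μ R F :=
  if i ≤ l - 1 then
    ∑ j ∈ Finset.range (i + 1), aC q μ R F (i - j) * (-gHalf q μ R F l) ^ j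
  else
    (∑ j ∈ Finset.range (2 * (l - 1) - i + 1),
      aC q μ R F (2 * (l - 1) - i - j) * (-gHalf q μ R F l) ^ j) * gC q μ R F ^ (i - (l - 1))

/-- The left-hand side
`(M - g^{1/2} I) ⋆ ∑_{i=0}^{2ℓ-2} (-q)^i M^{\overline{2ℓ-2-i}} ε_i`
of the Cayley-Hamilton identity. -/
def cayleyHamilton
    (s : PSpace q μ R F →ₗ[ℂ] PSpace q μ R F →ₗ[ℂ] PSpace q μ R F) (l : ℕ) :
    PSpace q μ R F :=
  s (MP q μ R F - idP q μ R F (gHalf q μ R F l))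
    (∑ i ∈ Finset.range (2 * (l - 1) + 1),
      (-q) ^ i • actP q μ R F (starPow q μ R F s (2 * (l - 1) - i)) (epsC q μ R F l i))

/-! ## Algebraic independence modulo the reciprocal relations -/

/-- Symbols for `a_1, …, a_k` (`a i` stands for `a_{i+1}`), `g` and `g⁻¹`. -/
inductive CharSym (k : ℕ) : Type
  | a (i : Fin k)
  | g
  | gi

/-- The value of a symbol in `C^•(R, F)`. -/
def CharSym.val {k : ℕ} : CharSym k → charAlg q μ R F
  | .a i => aC q μ R F (i.val + 1)
  | .g => gC q μ R F
  | .gi => gInvC q μ R F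

/-- The variable for `a_i`, `0 ≤ i ≤ k`, with `a_0 = 1`. -/
def symA (k i : ℕ) : MvPolynomial (CharSym k) ℂ :=
  if h : 1 ≤ i ∧ i ≤ k then MvPolynomial.X (CharSym.a ⟨i - 1, by omega⟩) else 1

/-- The ideal generated by the reciprocal relations `g^{k-i} a_i = a_k a_{k-i}`,
`i = 0, 1, …, k`, and by `g g⁻¹ = 1`. -/
def reciprocalIdeal (k : ℕ) : Ideal (MvPolynomial (CharSym k) ℂ) :=
  Ideal.span ({f | ∃ i, i ≤ k ∧
      f = MvPolynomial.X CharSym.g ^ (k - i) * symA k i - symA k k * symA k (k - i)} ∪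
    {MvPolynomial.X CharSym.g * MvPolynomial.X CharSym.gi - 1})

/-- Every polynomial relation between `a_1, …, a_k`, `g`, `g⁻¹` in `C^•(R, F)` is, as a relation
between commuting variables, a consequence of the reciprocal relations and of `g g⁻¹ = 1`.
(Polynomial expressions are written as elements of a free algebra, so that no commutativity enters
the formulation.) -/
def OnlyReciprocalRelations (k : ℕ) : Prop :=
  ∀ f : FreeAlgebra ℂ (CharSym k),
    FreeAlgebra.lift ℂ (CharSym.val q μ R F) f = 0 →
    FreeAlgebra.lift ℂ (MvPolynomial.X : CharSym k → MvPolynomial (CharSym k) ℂ) f ∈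
      reciprocalIdeal k

end Algebra

/-! ## Spectral variables -/

/-- The ideal generated by `ν_{i+j} ν_{i+1-j} - ν_0²`, `j = 1, …, i`. -/
def spectralIdeal (i : ℕ) : Ideal (MvPolynomial (Fin (2 * i + 1)) ℂ) :=
  Ideal.span {f | ∃ (j : ℕ) (x y : Fin (2 * i + 1)), 1 ≤ j ∧ j ≤ i ∧
    x.val = i + j ∧ y.val = i + 1 - j ∧
    f = MvPolynomial.X x * MvPolynomial.X y - MvPolynomial.X 0 ^ 2}

/-- The algebra `E_{2i}` of polynomials in the spectral variables `ν_0, …, ν_{2i}`. -/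
abbrev SpecPoly (i : ℕ) : Type := MvPolynomial (Fin (2 * i + 1)) ℂ ⧸ spectralIdeal i

/-- The algebra `E^•_{2i}`: the extension of `E_{2i}` by `ν_0⁻¹`. -/
abbrev SpecAlg (i : ℕ) : Type :=
  Localization.Away (Ideal.Quotient.mk (spectralIdeal i) (MvPolynomial.X 0))

/-- The spectral variable `ν_j` in `E^•_{2i}`. -/
def nu (i : ℕ) (j : Fin (2 * i + 1)) : SpecAlg i :=
  algebraMap (SpecPoly i) (SpecAlg i) (Ideal.Quotient.mk (spectralIdeal i) (MvPolynomial.X j))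

/-- The elementary symmetric function `e_n(ν_0, …, ν_{2i})`. -/
def elemSym (i n : ℕ) : SpecAlg i := ((Finset.univ : Finset (Fin (2 * i + 1))).val.map (nu i)).esymm n

/-! ## The completed algebra -/

section Completion

variable {ι : Type} [Fintype ι] [DecidableEq ι] (q μ : ℂ) (R F : RMatrix ι)

/-- The homomorphism `g^{1/2} ↦ ν_0`, `a_i ↦ e_i(ν_0, …, ν_{2ℓ-2})`, `i = 1, …, 2ℓ-1`. -/
def IsSpectralHom (l : ℕ) (π : charAlg q μ R F →ₐ[ℂ] SpecAlg (l - 1)) : Prop :=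
  π (gHalf q μ R F l) = nu (l - 1) 0 ∧
    ∀ i, 1 ≤ i → i ≤ 2 * l - 1 → π (aC q μ R F i) = elemSym (l - 1) i

variable {q μ R F} {E : Type} [CommRing E] [Algebra ℂ E] (π : charAlg q μ R F →ₐ[ℂ] E)

/-- The subspace of `P^• ⊗_ℂ E` spanned by all `N c ⊗ e - N ⊗ π(c) e`. -/
def balanced : Submodule ℂ (PSpace q μ R F ⊗[ℂ] E) :=
  Submodule.span ℂ {x | ∃ (N : PSpace q μ R F) (c : charAlg q μ R F) (e : E),
    x = (actP q μ R F N c) ⊗ₜ[ℂ] e - N ⊗ₜ[ℂ] (π c * e)}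

/-- The tensor product `P^• ⊗_{C^•} E` of the right `C^•`-module `P^•` with the left `C^•`-module
`E`, on which `c` acts as multiplication by `π(c)`. -/
abbrev Completed : Type := (PSpace q μ R F ⊗[ℂ] E) ⧸ balanced π

/-- The element `N ⊗ e` of `P^• ⊗_{C^•} E`. -/
def tens (N : PSpace q μ R F) (e : E) : Completed π := (balanced π).mkQ (N ⊗ₜ[ℂ] e)

/-- `t` is the `⋆`-product on the completion: `(N ⊗ e) ⋆ (N' ⊗ e') = (N ⋆ N') ⊗ e e'`. -/
def IsCompletedStar (s : PSpace q μ R F →ₗ[ℂ] PSpace q μ R F →ₗ[ℂ] PSpace q μ R F)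
    (t : Completed π →ₗ[ℂ] Completed π →ₗ[ℂ] Completed π) : Prop :=
  ∀ (N N' : PSpace q μ R F) (e e' : E),
    t (tens π N e) (tens π N' e') = tens π (s N N') (e * e')

/-- The matrix `M - e I` in the completion. -/
def linFactor (e : E) : Completed π :=
  tens π (MP q μ R F) 1 - tens π (idP q μ R F 1) e

/-- The `⋆`-product of a list of elements of the completion. -/
def starProd (t : Completed π →ₗ[ℂ] Completed π →ₗ[ℂ] Completed π) (L : List (Completed π)) :
    Completed π :=
  L.foldr (fun x y => t x y) (tens π (idP q μ R F 1) 1)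

end Completion

end

end QMA

namespace QMA

set_option linter.unusedSectionVars false

noncomputable section

/-! ## Operators on an infinite chain of sites -/

/-- Linear operators on `A`-valued functions of the configurations of an infinite chain. -/
abbrev ChainOp (ι A : Type) [Ring A] [Algebra ℂ A] : Type := Module.End ℂ ((ℕ → ι) → A)

section Chain

variable {ι : Type} [Fintype ι] [DecidableEq ι] {A : Type} [Ring A] [Algebra ℂ A]

/-- The operator `X` acting in the sites `σ 0, σ 1, …` of the chain. -/
def place {n : ℕ} (σ : Fin n → ℕ) (X : Op ι n A) : ChainOp ι A where
  toFun f x := ∑ t : Fin n → ι, X (x ∘ σ) t * f (Function.extend σ t x)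
  map_add' f g := by funext x; simp [mul_add, Finset.sum_add_distrib]
  map_smul' c f := by funext x; simp [Finset.smul_sum]

lemma place_apply {n : ℕ} (σ : Fin n → ℕ) (X : Op ι n A) (f : (ℕ → ι) → A) (x : ℕ → ι) :
    place σ X f x = ∑ t : Fin n → ι, X (x ∘ σ) t * f (Function.extend σ t x) := rfl

lemma extend_comp_self {n : ℕ} {σ : Fin n → ℕ} (hσ : Function.Injective σ) (t : Fin n → ι)
    (x : ℕ → ι) : Function.extend σ t x ∘ σ = t := by
  funext c; simp [hσ.extend_apply]

lemma extend_extend {n : ℕ} {σ : Fin n → ℕ} (hσ : Function.Injective σ) (t u : Fin n → ι)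
    (x : ℕ → ι) : Function.extend σ u (Function.extend σ t x) = Function.extend σ u x := by
  funext k
  by_cases h : ∃ c, σ c = k
  · obtain ⟨c, rfl⟩ := h; simp [hσ.extend_apply]
  · rw [Function.extend_apply' _ _ _ h, Function.extend_apply' _ _ _ h,
      Function.extend_apply' _ _ _ h]

lemma extend_self {n : ℕ} {σ : Fin n → ℕ} (hσ : Function.Injective σ) (x : ℕ → ι) :
    Function.extend σ (x ∘ σ) x = x := by
  funext k
  by_cases h : ∃ c, σ c = k
  · obtain ⟨c, rfl⟩ := h; simp [hσ.extend_apply]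
  · rw [Function.extend_apply' _ _ _ h]

lemma place_mul {n : ℕ} {σ : Fin n → ℕ} (hσ : Function.Injective σ) (X Y : Op ι n A) :
    place σ (X * Y) = place σ X * place σ Y := by
  ext f x
  simp only [place_apply, Module.End.mul_apply, Matrix.mul_apply, Finset.sum_mul,
    extend_comp_self hσ, extend_extend hσ, Finset.mul_sum]
  rw [Finset.sum_comm]
  simp only [mul_assoc]

lemma place_one {n : ℕ} {σ : Fin n → ℕ} (hσ : Function.Injective σ) :
    place σ (1 : Op ι n A) = 1 := by
  ext f x
  simp [place_apply, Matrix.one_apply, extend_self hσ]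

lemma place_add {n : ℕ} (σ : Fin n → ℕ) (X Y : Op ι n A) :
    place σ (X + Y) = place σ X + place σ Y := by
  ext f x
  simp [place_apply, add_mul, Finset.sum_add_distrib]

lemma place_smul {n : ℕ} (σ : Fin n → ℕ) (c : ℂ) (X : Op ι n A) :
    place σ (c • X) = c • place σ X := by
  ext f x
  simp [place_apply, Finset.smul_sum]

/-- `place` as an algebra homomorphism. -/
def placeHom {n : ℕ} (σ : Fin n → ℕ) (hσ : Function.Injective σ) : Op ι n A →ₐ[ℂ] ChainOp ι A :=
  AlgHom.ofLinearMap
    { toFun := place σ, map_add' := place_add σ, map_smul' := place_smul σ }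
    (place_one hσ) (place_mul hσ)

@[simp] lemma placeHom_apply {n : ℕ} (σ : Fin n → ℕ) (hσ : Function.Injective σ) (X : Op ι n A) :
    placeHom σ hσ X = place σ X := rfl

/-- `scal` as an algebra homomorphism. -/
def scalHom (A : Type) [Ring A] [Algebra ℂ A] (n : ℕ) : Op ι n ℂ →ₐ[ℂ] Op ι n A :=
  (Algebra.ofId ℂ A).mapMatrix

@[simp] lemma scalHom_apply {n : ℕ} (X : Op ι n ℂ) : scalHom A n X = scal A X := rfl

lemma scal_mul {n : ℕ} (X Y : Op ι n ℂ) : scal A (X * Y) = scal A X * scal A Y :=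
  map_mul (scalHom A n) X Y

lemma scal_one {n : ℕ} : scal A (1 : Op ι n ℂ) = 1 := map_one (scalHom A n)

/-- Left multiplication by an element of `A`. -/
def lmul : A →ₐ[ℂ] ChainOp ι A where
  toFun c :=
    { toFun := fun f x => c * f x
      map_add' := fun f g => by funext x; simp [mul_add]
      map_smul' := fun z f => by funext x; simp }
  map_one' := by ext f x; simp
  map_mul' a b := by ext f x; simp [mul_assoc]
  map_zero' := by ext f x; simp
  map_add' a b := by ext f x; simp [add_mul]
  commutes' z := by ext f x; simp [Algebra.smul_def]

lemma lmul_apply (c : A) (f : (ℕ → ι) → A) (x : ℕ → ι) : lmul c f x = c * f x := rfl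

lemma lmul_injective [Nonempty ι] : Function.Injective (lmul : A →ₐ[ℂ] ChainOp ι A) := by
  intro a b h
  have := congrFun (congrArg (fun T : ChainOp ι A => T (fun _ => 1)) h)
    (fun _ => Classical.arbitrary ι)
  simpa [lmul_apply] using this

/-- The matrix unit `e_{ab}` in the site `j`. -/
def eu (A : Type) [Ring A] [Algebra ℂ A] (j : ℕ) (a b : ι) : ChainOp ι A where
  toFun f x := if x j = a then f (Function.update x j b) else 0
  map_add' f g := by
    funext x; by_cases h : x j = a <;> simp [h]
  map_smul' c f := by
    funext x; by_cases h : x j = a <;> simp [h]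

lemma eu_apply (j : ℕ) (a b : ι) (f : (ℕ → ι) → A) (x : ℕ → ι) :
    eu A j a b f x = if x j = a then f (Function.update x j b) else 0 := rfl

lemma eu_mul (j : ℕ) (a b c d : ι) :
    eu A j a b * eu A j c d = if b = c then eu A j a d else 0 := by
  ext f x
  by_cases h : b = c
  · by_cases h1 : x j = a <;> simp [eu_apply, h, h1]
  · by_cases h1 : x j = a <;> simp [eu_apply, h, h1]

lemma eu_comm {i j : ℕ} (h : i ≠ j) (a b c d : ι) :
    eu A i a b * eu A j c d = eu A j c d * eu A i a b := by
  ext f x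
  simp only [Module.End.mul_apply, eu_apply, Function.update_of_ne h, Function.update_of_ne h.symm,
    Function.update_comm h]
  split_ifs <;> rfl

lemma sum_eu (j : ℕ) : ∑ a : ι, eu A j a a = 1 := by
  ext f x
  simp [LinearMap.sum_apply, Finset.sum_apply, eu_apply]

/-- Operators that act trivially on the site `j`. -/
def off (ι A : Type) [Fintype ι] [DecidableEq ι] [Ring A] [Algebra ℂ A] (j : ℕ) :
    Subalgebra ℂ (ChainOp ι A) :=
  Subalgebra.centralizer ℂ {T | ∃ a b : ι, T = eu A j a b}

lemma mem_off {j : ℕ} {T : ChainOp ι A} :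
    T ∈ off ι A j ↔ ∀ a b : ι, eu A j a b * T = T * eu A j a b := by
  rw [off, Subalgebra.mem_centralizer_iff]
  constructor
  · intro h a b; exact h _ ⟨a, b, rfl⟩
  · rintro h _ ⟨a, b, rfl⟩; exact h a b

lemma lmul_mem_off (c : A) (j : ℕ) : (lmul c : ChainOp ι A) ∈ off ι A j := by
  rw [mem_off]
  intro a b
  ext f x
  by_cases h : x j = a <;> simp [eu_apply, lmul_apply, h]

lemma eu_mem_off {i j : ℕ} (h : i ≠ j) (a b : ι) : eu A i a b ∈ off ι A j := by
  rw [mem_off]; intro c d; exact eu_comm h.symm _ _ _ _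

lemma place_mem_off {n : ℕ} {σ : Fin n → ℕ} (hσ : Function.Injective σ) (X : Op ι n A) {j : ℕ}
    (hj : j ∉ Set.range σ) : place σ X ∈ off ι A j := by
  rw [mem_off]
  intro a b
  have hj' : ¬ ∃ c, σ c = j := hj
  ext f x
  have h1 : Function.update x j b ∘ σ = x ∘ σ := by
    funext c
    have : σ c ≠ j := fun h => hj ⟨c, h⟩
    simp [Function.update_of_ne this]
  have h2 : ∀ t : Fin n → ι, Function.extend σ t (Function.update x j b) =
      Function.update (Function.extend σ t x) j b := by
    intro t
    funext k
    by_cases hk : k = j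
    · subst hk
      rw [Function.extend_apply' _ _ _ hj']; simp
    · rw [Function.update_of_ne hk]
      by_cases h : ∃ c, σ c = k
      · obtain ⟨c, rfl⟩ := h; simp [hσ.extend_apply]
      · rw [Function.extend_apply' _ _ _ h, Function.extend_apply' _ _ _ h,
          Function.update_of_ne hk]
  simp only [Module.End.mul_apply, eu_apply, place_apply, h1, h2,
    Function.extend_apply' _ _ _ hj']
  by_cases h : x j = a <;> simp [h]

/-- Scalar operators acting in the sites of `S`. -/
def onSites (ι A : Type) [Fintype ι] [DecidableEq ι] [Ring A] [Algebra ℂ A] (S : Set ℕ) :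
    Subalgebra ℂ (ChainOp ι A) :=
  Algebra.adjoin ℂ {T | ∃ j ∈ S, ∃ a b : ι, T = eu A j a b}

lemma eu_mem_onSites {S : Set ℕ} {j : ℕ} (hj : j ∈ S) (a b : ι) : eu A j a b ∈ onSites ι A S :=
  Algebra.subset_adjoin ⟨j, hj, a, b, rfl⟩

lemma mul_comm_of_onSites {S : Set ℕ} {T Z : ChainOp ι A} (hZ : Z ∈ onSites ι A S)
    (hT : ∀ j ∈ S, T ∈ off ι A j) : T * Z = Z * T := by
  have : onSites ι A S ≤ Subalgebra.centralizer ℂ {T} := by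
    apply Algebra.adjoin_le
    rintro _ ⟨j, hj, a, b, rfl⟩
    simp only [SetLike.mem_coe, Subalgebra.mem_centralizer_iff, Set.mem_singleton_iff, forall_eq]
    exact (mem_off.mp (hT j hj) a b).symm
  have h := this hZ
  simp only [Subalgebra.mem_centralizer_iff, Set.mem_singleton_iff, forall_eq] at h
  exact h

lemma onSites_le_off {S : Set ℕ} {j : ℕ} (hj : j ∉ S) : onSites ι A S ≤ off ι A j := by
  apply Algebra.adjoin_le
  rintro _ ⟨i, hi, a, b, rfl⟩
  exact eu_mem_off (by rintro rfl; exact hj hi) a b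

/-- A one-site operator in the site `i`. -/
def op1 (A : Type) [Ring A] [Algebra ℂ A] (X : Matrix ι ι ℂ) (i : ℕ) : ChainOp ι A :=
  ∑ a, ∑ b, X a b • eu A i a b

/-- A two-site operator in the sites `i` and `j`. -/
def op2 (A : Type) [Ring A] [Algebra ℂ A] (X : Op ι 2 ℂ) (i j : ℕ) : ChainOp ι A :=
  ∑ a, ∑ b, ∑ c, ∑ d, X ![a, b] ![c, d] • (eu A i a c * eu A j b d)

lemma op1_mem (X : Matrix ι ι ℂ) (i : ℕ) : op1 A X i ∈ onSites ι A {i} := by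
  unfold op1
  refine sum_mem fun a _ => sum_mem fun b _ => ?_
  exact Subalgebra.smul_mem _ (eu_mem_onSites (Set.mem_singleton i) _ _) _

lemma op2_mem (X : Op ι 2 ℂ) (i j : ℕ) : op2 A X i j ∈ onSites ι A {i, j} := by
  unfold op2
  refine sum_mem fun a _ => sum_mem fun b _ => sum_mem fun c _ => sum_mem fun d _ => ?_
  exact Subalgebra.smul_mem _ (mul_mem (eu_mem_onSites (by simp) _ _)
      (eu_mem_onSites (by simp) _ _)) _

lemma pair_injective {i j : ℕ} (h : i ≠ j) : Function.Injective ![i, j] := by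
  intro a b hab
  fin_cases a <;> fin_cases b <;> simp_all

lemma triple_injective {i j k : ℕ} (h1 : i ≠ j) (h2 : i ≠ k) (h3 : j ≠ k) :
    Function.Injective ![i, j, k] := by
  intro a b hab
  fin_cases a <;> fin_cases b <;> simp_all

lemma sum_fin_two {B : Type} [AddCommMonoid B] (f : (Fin 2 → ι) → B) :
    ∑ t, f t = ∑ a, ∑ b, f ![a, b] := by
  rw [← (finTwoArrowEquiv ι).symm.sum_comp, Fintype.sum_prod_type]
  simp [finTwoArrowEquiv]

lemma place_pair {i j : ℕ} (h : i ≠ j) (X : Op ι 2 ℂ) : place ![i, j] (scal A X) = op2 A X i j := by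
  ext f x
  have h1 : x ∘ ![i, j] = ![x i, x j] := by
    funext c; fin_cases c <;> rfl
  have h2 : ∀ c d, Function.extend ![i, j] ![c, d] x =
      Function.update (Function.update x i c) j d := by
    intro c d
    funext k
    by_cases hj : k = j
    · subst hj
      have := (pair_injective h).extend_apply ![c, d] x 1
      simpa using this
    · by_cases hi : k = i
      · subst hi
        have := (pair_injective h).extend_apply ![c, d] x 0
        simpa [Function.update_of_ne h] using this
      · rw [Function.update_of_ne hj, Function.update_of_ne hi, Function.extend_apply']
        rintro ⟨c, hc⟩
        fin_cases c <;> simp at hc <;> simp_all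
  simp only [place_apply, op2, LinearMap.sum_apply, Finset.sum_apply, LinearMap.smul_apply,
    Pi.smul_apply, Module.End.mul_apply, eu_apply, sum_fin_two, h1, h2]
  symm
  rw [Finset.sum_eq_single (x i) (by
      intro b _ hb
      refine Finset.sum_eq_zero fun _ _ => Finset.sum_eq_zero fun _ _ =>
        Finset.sum_eq_zero fun _ _ => ?_
      rw [if_neg hb.symm, smul_zero]) (by simp)]
  rw [Finset.sum_eq_single (x j) (by
      intro b _ hb
      refine Finset.sum_eq_zero fun _ _ => Finset.sum_eq_zero fun _ _ => ?_
      rw [Function.update_of_ne h.symm, if_neg hb.symm]; simp) (by simp)]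
  simp [Function.update_of_ne h.symm, scal, Algebra.smul_def]

lemma scal_embed {p n : ℕ} (f : Fin p → Fin n) (X : Op ι p ℂ) :
    scal A (embed f X) = embed f (scal A X) := by
  ext s t
  simp only [scal, Matrix.map_apply, embed]
  split_ifs <;> simp

lemma place_embed {p n : ℕ} {σ : Fin n → ℕ} (hσ : Function.Injective σ) {f : Fin p → Fin n}
    (hf : Function.Injective f) (X : Op ι p A) : place σ (embed f X) = place (σ ∘ f) X := by
  ext g x
  simp only [place_apply, embed]
  symm
  apply Fintype.sum_of_injective (fun v : Fin p → ι => Function.extend f v (x ∘ σ))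
  · intro v w hvw
    funext k
    have := congrFun hvw (f k)
    simpa [hf.extend_apply] using this
  · intro u hu
    rw [if_neg, zero_mul]
    intro h
    apply hu
    refine ⟨u ∘ f, ?_⟩
    funext c
    by_cases hc : c ∈ Set.range f
    · obtain ⟨k, rfl⟩ := hc
      simp [hf.extend_apply]
    · rw [← h c hc]
      exact Function.extend_apply' _ _ _ hc
  · intro v
    have hv : ∀ c, c ∉ Set.range f → (x ∘ σ) c = Function.extend f v (x ∘ σ) c :=
      fun c hc => (Function.extend_apply' _ _ _ hc).symm
    rw [if_pos hv]
    have e1 : (Function.extend f v (x ∘ σ)) ∘ f = v := by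
      funext k; simp [hf.extend_apply]
    have e2 : Function.extend σ (Function.extend f v (x ∘ σ)) x =
        Function.extend (σ ∘ f) v x := by
      funext k
      by_cases h : ∃ c, σ c = k
      · obtain ⟨c, rfl⟩ := h
        rw [hσ.extend_apply]
        by_cases hc : ∃ b, f b = c
        · obtain ⟨b, rfl⟩ := hc
          rw [hf.extend_apply]
          exact ((hσ.comp hf).extend_apply v x b).symm
        · rw [Function.extend_apply' _ _ _ hc, Function.extend_apply']
          · rfl
          · rintro ⟨b, hb⟩
            exact hc ⟨b, hσ hb⟩
      · rw [Function.extend_apply' _ _ _ h, Function.extend_apply']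
        rintro ⟨b, hb⟩
        exact h ⟨f b, hb⟩
    rw [e1, e2]
    rfl

lemma place_at2 {m : ℕ} {σ : Fin (m + 1) → ℕ} (hσ : Function.Injective σ) (X : Op ι 2 ℂ)
    (i : Fin m) : place σ (scal A (at2 X i)) = op2 A X (σ i.castSucc) (σ i.succ) := by
  have h : σ i.castSucc ≠ σ i.succ := by
    intro h
    have := hσ h
    simp [Fin.ext_iff] at this
  rw [at2, scal_embed, place_embed hσ (site_injective i), ← place_pair h]
  congr 1
  funext a
  fin_cases a <;> rfl

lemma op2_mul {i j : ℕ} (h : i ≠ j) (X Y : Op ι 2 ℂ) :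
    op2 A (X * Y) i j = op2 A X i j * op2 A Y i j := by
  simp only [← place_pair h, scal_mul, place_mul (pair_injective h)]

lemma op2_one {i j : ℕ} (h : i ≠ j) : op2 A (1 : Op ι 2 ℂ) i j = 1 := by
  rw [← place_pair h, scal_one, place_one (pair_injective h)]

lemma op2_three {i j k : ℕ} (h1 : i ≠ j) (h2 : i ≠ k) (h3 : j ≠ k) (X : Op ι 2 ℂ) :
    place ![i, j, k] (scal A (at2 X (0 : Fin 2))) = op2 A X i j ∧
    place ![i, j, k] (scal A (at2 X (1 : Fin 2))) = op2 A X j k := by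
  constructor <;> rw [place_at2 (triple_injective h1 h2 h3)] <;> rfl

end Chain

end
noncomputable section
section Trace

variable {ι : Type} [Fintype ι] [DecidableEq ι] {A : Type} [Ring A] [Algebra ℂ A]

/-- The trace over the site `j`. -/
def trS (j : ℕ) : ChainOp ι A →ₗ[ℂ] ChainOp ι A where
  toFun T := ∑ b, ∑ c, eu A j c b * T * eu A j b c
  map_add' S T := by simp [mul_add, add_mul, Finset.sum_add_distrib]
  map_smul' z T := by simp [Finset.smul_sum]

lemma trS_def (j : ℕ) (T : ChainOp ι A) : trS j T = ∑ b, ∑ c, eu A j c b * T * eu A j b c := rfl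

lemma trS_mul_left {j : ℕ} {X : ChainOp ι A} (hX : X ∈ off ι A j) (T : ChainOp ι A) :
    trS j (X * T) = X * trS j T := by
  simp only [trS_def, Finset.mul_sum]
  refine Finset.sum_congr rfl fun b _ => Finset.sum_congr rfl fun c _ => ?_
  rw [← mul_assoc, mem_off.mp hX, mul_assoc, mul_assoc, mul_assoc]

lemma trS_mul_right {j : ℕ} {X : ChainOp ι A} (hX : X ∈ off ι A j) (T : ChainOp ι A) :
    trS j (T * X) = trS j T * X := by
  simp only [trS_def, Finset.sum_mul]
  refine Finset.sum_congr rfl fun b _ => Finset.sum_congr rfl fun c _ => ?_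
  simp only [mul_assoc]
  rw [mem_off.mp hX]

lemma trS_mem (j : ℕ) (T : ChainOp ι A) : trS j T ∈ off ι A j := by
  rw [mem_off]
  intro s t
  simp only [trS_def, Finset.mul_sum, Finset.sum_mul]
  refine Finset.sum_congr rfl fun b _ => ?_
  have h1 : ∀ c, eu A j s t * (eu A j c b * T * eu A j b c) =
      if t = c then eu A j s b * T * eu A j b c else 0 := by
    intro c
    rw [← mul_assoc, ← mul_assoc, eu_mul]
    split_ifs <;> simp
  have h2 : ∀ c, eu A j c b * T * eu A j b c * eu A j s t =
      if c = s then eu A j c b * T * eu A j b t else 0 := by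
    intro c
    rw [mul_assoc, eu_mul]
    split_ifs <;> simp
  simp [h1, h2]

lemma trS_mem_of {i j : ℕ} {T : ChainOp ι A} (hT : T ∈ off ι A i) : trS j T ∈ off ι A i := by
  by_cases h : j = i
  · subst h; exact trS_mem _ _
  · exact sum_mem fun b _ => sum_mem fun c _ =>
      mul_mem (mul_mem (eu_mem_off h _ _) hT) (eu_mem_off h _ _)

lemma trS_cyc_eu (j : ℕ) (T : ChainOp ι A) (s t : ι) :
    trS j (T * eu A j s t) = trS j (eu A j s t * T) := by
  simp only [trS_def]
  have h1 : ∀ b c, eu A j c b * (T * eu A j s t) * eu A j b c =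
      if t = b then eu A j c b * T * eu A j s c else 0 := by
    intro b c
    rw [mul_assoc, mul_assoc, eu_mul]
    split_ifs <;> simp [mul_assoc]
  have h2 : ∀ b c, eu A j c b * (eu A j s t * T) * eu A j b c =
      if b = s then eu A j c t * T * eu A j b c else 0 := by
    intro b c
    rw [← mul_assoc, eu_mul]
    split_ifs <;> simp
  simp only [h1, h2]
  rw [Finset.sum_comm]
  conv_rhs => rw [Finset.sum_comm]
  simp

lemma trS_cyc_pair {i j : ℕ} (hij : i ≠ j) {Z : ChainOp ι A} (hZ : Z ∈ onSites ι A {i, j}) :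
    ∀ T, trS i (trS j (T * Z)) = trS i (trS j (Z * T)) := by
  induction hZ using Algebra.adjoin_induction with
  | mem Z h =>
    obtain ⟨k, hk, a, b, rfl⟩ := h
    intro T
    rcases hk with rfl | hk
    · rw [trS_mul_right (eu_mem_off hij _ _), trS_mul_left (eu_mem_off hij _ _), trS_cyc_eu]
    · simp only [Set.mem_singleton_iff] at hk
      subst hk
      rw [trS_cyc_eu]
  | algebraMap r => intro T; rw [Algebra.commutes]
  | add X Y _ _ hX hY => intro T; simp [mul_add, add_mul, hX, hY]
  | mul X Y _ _ hX hY => intro T; rw [← mul_assoc, hY, ← mul_assoc, hX, mul_assoc]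

lemma trS_cyc_single {j : ℕ} {Z : ChainOp ι A} (hZ : Z ∈ onSites ι A {j}) :
    ∀ T, trS j (T * Z) = trS j (Z * T) := by
  induction hZ using Algebra.adjoin_induction with
  | mem Z h =>
    obtain ⟨k, hk, a, b, rfl⟩ := h
    intro T
    simp only [Set.mem_singleton_iff] at hk
    subst hk
    rw [trS_cyc_eu]
  | algebraMap r => intro T; rw [Algebra.commutes]
  | add X Y _ _ hX hY => intro T; simp [mul_add, add_mul, hX, hY]
  | mul X Y _ _ hX hY => intro T; rw [← mul_assoc, hY, ← mul_assoc, hX, mul_assoc]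

/-- The ordinary trace over the last tensor factor. -/
def ptrLast {n : ℕ} (X : Op ι (n + 1) A) : Op ι n A := fun s t =>
  ∑ b, X (Fin.snoc (α := fun _ => ι) s b) (Fin.snoc (α := fun _ => ι) t b)

lemma sum_snoc {B : Type} [AddCommMonoid B] {n : ℕ} (f : (Fin (n + 1) → ι) → B) :
    ∑ t, f t = ∑ t : Fin n → ι, ∑ b, f (Fin.snoc (α := fun _ => ι) t b) := by
  rw [← (Fin.snocEquiv (fun _ => ι)).sum_comp, Fintype.sum_prod_type, Finset.sum_comm]
  rfl

lemma trS_place {n : ℕ} {σ : Fin (n + 1) → ℕ} (hσ : Function.Injective σ) (X : Op ι (n + 1) A) :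
    trS (σ (Fin.last n)) (place σ X) = place (σ ∘ Fin.castSucc) (ptrLast X) := by
  ext f x
  set j := σ (Fin.last n) with hj
  have hc : ∀ c : Fin n, σ c.castSucc ≠ j := fun c h => by
    have := hσ h; simp [Fin.ext_iff] at this; omega
  have hσ' : Function.Injective (σ ∘ Fin.castSucc) := hσ.comp (Fin.castSucc_injective n)
  have e1 : ∀ b, Function.update x j b ∘ σ =
      Fin.snoc (α := fun _ => ι) (x ∘ σ ∘ Fin.castSucc) b := by
    intro b; funext c
    refine Fin.lastCases ?_ (fun c => ?_) c
    · simp [hj]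
    · simp [Function.update_of_ne (hc c)]
  have e2 : ∀ (t : Fin n → ι) (b b' : ι),
      Function.extend σ (Fin.snoc (α := fun _ => ι) t b) (Function.update x j b') j = b := by
    intro t b b'
    have := hσ.extend_apply (Fin.snoc (α := fun _ => ι) t b) (Function.update x j b') (Fin.last n)
    simpa using this
  have e3 : ∀ (t : Fin n → ι) (b b' : ι),
      Function.update (Function.extend σ (Fin.snoc (α := fun _ => ι) t b)
        (Function.update x j b')) j (x j) = Function.extend (σ ∘ Fin.castSucc) t x := by
    intro t b b'
    funext k
    by_cases hk : k = j
    · subst hk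
      rw [Function.update_self, Function.extend_apply']
      rintro ⟨c, h⟩; exact hc c h
    · rw [Function.update_of_ne hk]
      by_cases h : ∃ c, σ c = k
      · obtain ⟨c, rfl⟩ := h
        rw [hσ.extend_apply]
        revert hk
        refine Fin.lastCases (fun hk => absurd rfl hk) (fun c _ => ?_) c
        have := hσ'.extend_apply t x c
        simp only [Function.comp] at this
        rw [this]; simp
      · rw [Function.extend_apply' _ _ _ h, Function.update_of_ne hk, Function.extend_apply']
        rintro ⟨c, h'⟩; exact h ⟨_, h'⟩
  simp only [trS_def, LinearMap.sum_apply, Finset.sum_apply, Module.End.mul_apply, eu_apply,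
    place_apply, Finset.sum_ite_eq, Finset.mem_univ, if_true, e1]
  simp only [sum_snoc, e2, e3, ptrLast, mul_ite, mul_zero, Finset.sum_ite_eq',
    Finset.mem_univ, if_true, Finset.sum_mul]
  rw [Finset.sum_comm]

/-- The permutation of the sites `i` and `k`. -/
def perm (A : Type) [Ring A] [Algebra ℂ A] (i k : ℕ) : ChainOp ι A :=
  ∑ a, ∑ d, eu A i a d * eu A k d a

lemma perm_mem (i k : ℕ) : (perm A i k : ChainOp ι A) ∈ onSites ι A {i, k} := by
  unfold perm
  exact sum_mem fun a _ => sum_mem fun b _ => mul_mem (eu_mem_onSites (by simp) _ _)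
    (eu_mem_onSites (by simp) _ _)

lemma perm_mul_eu {i k : ℕ} (h : i ≠ k) (s t : ι) :
    perm A i k * eu A i s t = eu A k s t * perm A i k := by
  unfold perm
  simp only [Finset.mul_sum, Finset.sum_mul]
  have h1 : ∀ a d : ι, eu A i a d * eu A k d a * eu A i s t =
      if d = s then eu A i a t * eu A k d a else 0 := by
    intro a d
    rw [mul_assoc, eu_comm h.symm, ← mul_assoc, eu_mul]; split_ifs <;> simp
  have h2 : ∀ a d : ι, eu A k s t * (eu A i a d * eu A k d a) =
      if t = d then eu A i a d * eu A k s a else 0 := by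
    intro a d
    rw [← mul_assoc, eu_comm h.symm, mul_assoc, eu_mul]; split_ifs <;> simp
  simp [h1, h2]

lemma perm_comm {i k : ℕ} (h : i ≠ k) : (perm A i k : ChainOp ι A) = perm A k i := by
  unfold perm
  rw [Finset.sum_comm]
  refine Finset.sum_congr rfl fun a _ => Finset.sum_congr rfl fun b _ => ?_
  exact eu_comm h _ _ _ _

lemma perm_mul_op1 {i k : ℕ} (h : i ≠ k) (X : Matrix ι ι ℂ) :
    perm A i k * op1 A X i = op1 A X k * perm A i k := by
  simp only [op1, Finset.mul_sum, Finset.sum_mul, smul_mul_assoc, mul_smul_comm, perm_mul_eu h]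

lemma perm_mul_op2_left {i j k : ℕ} (h : i ≠ k) (hi : j ≠ i) (hk : j ≠ k) (X : Op ι 2 ℂ) :
    perm A i k * op2 A X i j = op2 A X k j * perm A i k := by
  have e : ∀ b d : ι, perm A i k * eu A j b d = eu A j b d * perm A i k := fun b d =>
    (mul_comm_of_onSites (perm_mem i k) (by
      rintro l (rfl | hl)
      · exact eu_mem_off hi _ _
      · rw [Set.mem_singleton_iff] at hl; subst hl; exact eu_mem_off hk _ _)).symm
  simp only [op2, Finset.mul_sum, Finset.sum_mul, smul_mul_assoc, mul_smul_comm]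
  refine Finset.sum_congr rfl fun a _ => Finset.sum_congr rfl fun b _ =>
    Finset.sum_congr rfl fun c _ => Finset.sum_congr rfl fun d _ => ?_
  rw [← mul_assoc, perm_mul_eu h, mul_assoc, e, mul_assoc]

lemma perm_mul_op2_right {i j k : ℕ} (h : i ≠ k) (hi : j ≠ i) (hk : j ≠ k) (X : Op ι 2 ℂ) :
    perm A i k * op2 A X j i = op2 A X j k * perm A i k := by
  have e : ∀ b d : ι, perm A i k * eu A j b d = eu A j b d * perm A i k := fun b d =>
    (mul_comm_of_onSites (perm_mem i k) (by
      rintro l (rfl | hl)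
      · exact eu_mem_off hi _ _
      · rw [Set.mem_singleton_iff] at hl; subst hl; exact eu_mem_off hk _ _)).symm
  simp only [op2, Finset.mul_sum, Finset.sum_mul, smul_mul_assoc, mul_smul_comm]
  refine Finset.sum_congr rfl fun a _ => Finset.sum_congr rfl fun b _ =>
    Finset.sum_congr rfl fun c _ => Finset.sum_congr rfl fun d _ => ?_
  rw [← mul_assoc, e, mul_assoc, perm_mul_eu h, mul_assoc]

lemma trS_eu (k : ℕ) (d a : ι) : trS k (eu A k d a) = if a = d then (1 : ChainOp ι A) else 0 := by
  have : ∀ b c, eu A k c b * eu A k d a * eu A k b c =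
      if b = d then (if a = b then eu A k c c else 0) else 0 := by
    intro b c
    rw [eu_mul]
    by_cases hb : b = d
    · rw [if_pos hb, if_pos hb, eu_mul]
    · simp [hb]
  simp only [trS_def, this]
  rw [Finset.sum_comm]
  by_cases had : a = d <;> simp [had, sum_eu]

lemma trS_perm (i k : ℕ) (h : i ≠ k) : trS k (perm A i k : ChainOp ι A) = 1 := by
  simp only [perm, map_sum, trS_mul_left (eu_mem_off h _ _), trS_eu]
  simp [sum_eu]

lemma trS_op2 {i j : ℕ} (h : i ≠ j) (X : Op ι 2 ℂ) :
    trS j (op2 A X i j) = op1 A (fun a b => ∑ x, X ![a, x] ![b, x]) i := by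
  simp only [op2, op1, map_sum, map_smul, trS_mul_left (eu_mem_off h _ _), trS_eu]
  refine Finset.sum_congr rfl fun a _ => ?_
  simp only [mul_ite, mul_one, mul_zero, smul_ite, smul_zero, Finset.sum_ite_eq', Finset.mem_univ,
    if_true]
  rw [Finset.sum_comm]
  simp [Finset.sum_smul]

lemma trS_op1_mul_eu (i : ℕ) (X : Matrix ι ι ℂ) (s t : ι) :
    trS i (op1 A X i * eu A i s t) = algebraMap ℂ _ (X t s) := by
  simp only [op1, Finset.sum_mul, smul_mul_assoc, eu_mul, map_sum, map_smul]
  have : ∀ a b : ι, X a b • trS i (if b = s then eu A i a t else 0) =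
      if b = s then (if t = a then algebraMap ℂ (ChainOp ι A) (X a b) else 0) else 0 := by
    intro a b
    split_ifs with h1 h2 <;> simp [trS_eu, Algebra.algebraMap_eq_smul_one, *]
  simp [this]

lemma trS_comm {i j : ℕ} (h : i ≠ j) (T : ChainOp ι A) : trS i (trS j T) = trS j (trS i T) := by
  simp only [trS_def, Finset.mul_sum, Finset.sum_mul]
  have e : ∀ b c b' c' : ι, eu A i c b * (eu A j c' b' * T * eu A j b' c') * eu A i b c =
      eu A j c' b' * (eu A i c b * T * eu A i b c) * eu A j b' c' := by
    intro b c b' c'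
    calc _ = (eu A i c b * eu A j c' b') * T * (eu A j b' c' * eu A i b c) := by
          simp only [mul_assoc]
      _ = (eu A j c' b' * eu A i c b) * T * (eu A i b c * eu A j b' c') := by
          rw [eu_comm h, eu_comm h]
      _ = _ := by simp only [mul_assoc]
  simp only [e]
  have := fun (f : ι → ι → ι → ι → ChainOp ι A) =>
    show ∑ b, ∑ c, ∑ b', ∑ c', f b c b' c' = ∑ b', ∑ c', ∑ b, ∑ c, f b c b' c' from by
      simp only [← Fintype.sum_prod_type']
      exact Fintype.sum_equiv ⟨fun x => (x.2.2.1, x.2.2.2, x.1, x.2.1),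
        fun x => (x.2.2.1, x.2.2.2, x.1, x.2.1), fun _ => rfl, fun _ => rfl⟩ _ _ (fun _ => rfl)
  exact this fun b c b' c' => eu A j c' b' * (eu A i c b * T * eu A i b c) * eu A j b' c'

lemma trS_middle {i j k : ℕ} (h1 : i ≠ j) (h2 : i ≠ k) (h3 : j ≠ k) (Z : Op ι 3 ℂ)
    (hZ : ∀ a c d e : ι, ∑ b, Z ![a, b, c] ![d, b, e] = if a = e ∧ c = d then 1 else 0) :
    trS j (place ![i, j, k] (scal A Z)) = perm A i k := by
  let f : Fin 3 → Fin 3 := ![0, 2, 1]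
  have hf : Function.Injective f := by decide
  have e : (![i, k, j] : Fin 3 → ℕ) ∘ f = ![i, j, k] := by
    funext c; fin_cases c <;> rfl
  have hσ : Function.Injective ![i, k, j] := triple_injective h2 h1 h3.symm
  rw [← e, ← place_embed hσ hf]
  have := trS_place (A := A) hσ (embed f (scal A Z))
  have e1 : (![i, k, j] : Fin 3 → ℕ) (Fin.last 2) = j := rfl
  have e2 : (![i, k, j] : Fin 3 → ℕ) ∘ Fin.castSucc = ![i, k] := by
    funext c; fin_cases c <;> rfl
  rw [e1, e2] at this
  rw [this]
  let Pm : Op ι 2 ℂ := fun s t => if s 0 = t 1 ∧ s 1 = t 0 then 1 else 0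
  have e3 : ptrLast (embed f (scal A Z)) = scal A Pm := by
    ext s t
    have hs : ∀ (s : Fin 2 → ι) b, (Fin.snoc (α := fun _ => ι) s b : Fin 3 → ι) ∘ f =
        ![s 0, b, s 1] := by
      intro s b; funext c; fin_cases c <;> rfl
    have hr : ∀ c : Fin 3, c ∈ Set.range f := by
      intro c; fin_cases c
      · exact ⟨0, rfl⟩
      · exact ⟨2, rfl⟩
      · exact ⟨1, rfl⟩
    have hP : Pm s t = ∑ b, Z ![s 0, b, s 1] ![t 0, b, t 1] := (hZ _ _ _ _).symm
    simp only [ptrLast, embed, scal, Matrix.map_apply, hs]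
    rw [hP, map_sum]
    refine Finset.sum_congr rfl fun b _ => ?_
    rw [if_pos]
    intro c hc; exact absurd (hr c) hc
  rw [e3, place_pair h2]
  unfold op2 perm
  refine Finset.sum_congr rfl fun a _ => ?_
  simp only [Pm]
  have : ∀ b c d : ι, (if (![a, b] : Fin 2 → ι) 0 = (![c, d] : Fin 2 → ι) 1 ∧
      (![a, b] : Fin 2 → ι) 1 = (![c, d] : Fin 2 → ι) 0 then (1 : ℂ) else 0) • (eu A i a c *
      eu A k b d) = if a = d then (if b = c then eu A i a c * eu A k b d else 0) else 0 := by
    intro b c d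
    by_cases h : a = d <;> by_cases h' : b = c <;> simp [h, h']
  simp only [this]
  simp

end Trace

end
noncomputable section
section SkewTrace

variable {ι : Type} [Fintype ι] [DecidableEq ι] {A : Type} [Ring A] [Algebra ℂ A]

lemma op2_mem_off {i j k : ℕ} (hi : k ≠ i) (hj : k ≠ j) (X : Op ι 2 ℂ) :
    op2 A X i j ∈ off ι A k :=
  onSites_le_off (S := {i, j}) (by simp [hi, hj]) (op2_mem X i j)

lemma op1_mem_off {i k : ℕ} (hi : k ≠ i) (X : Matrix ι ι ℂ) : op1 A X i ∈ off ι A k :=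
  onSites_le_off (S := {i}) (by simp [hi]) (op1_mem X i)

lemma perm_mem_off {i j k : ℕ} (hi : k ≠ i) (hj : k ≠ j) :
    (perm A i j : ChainOp ι A) ∈ off ι A k :=
  onSites_le_off (S := {i, j}) (by simp [hi, hj]) (perm_mem i j)

lemma op2_comm_of {i j : ℕ} {T : ChainOp ι A} (hi : T ∈ off ι A i) (hj : T ∈ off ι A j)
    (X : Op ι 2 ℂ) : op2 A X i j * T = T * op2 A X i j :=
  (mul_comm_of_onSites (op2_mem X i j) (by
    rintro l (rfl | hl)
    · exact hi
    · rw [Set.mem_singleton_iff] at hl; subst hl; exact hj)).symm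

lemma op1_comm_of {i : ℕ} {T : ChainOp ι A} (hi : T ∈ off ι A i) (X : Matrix ι ι ℂ) :
    op1 A X i * T = T * op1 A X i :=
  (mul_comm_of_onSites (op1_mem X i) (by
    intro l hl; rw [Set.mem_singleton_iff] at hl; subst hl; exact hi)).symm

lemma trS_skew_left {X Ψ : Op ι 2 ℂ} (h : IsSkewInverse X Ψ) {i j k : ℕ} (h1 : i ≠ j) (h2 : i ≠ k)
    (h3 : j ≠ k) : trS j (op2 A X i j * op2 A Ψ j k) = perm A i k := by
  rw [← trS_middle h1 h2 h3 _ h.1, scal_mul, place_mul (triple_injective h1 h2 h3),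
    (op2_three h1 h2 h3 X).1, (op2_three h1 h2 h3 Ψ).2]

lemma trS_skew_right {X Ψ : Op ι 2 ℂ} (h : IsSkewInverse X Ψ) {i j k : ℕ} (h1 : i ≠ j) (h2 : i ≠ k)
    (h3 : j ≠ k) : trS j (op2 A Ψ i j * op2 A X j k) = perm A i k := by
  rw [← trS_middle h1 h2 h3 _ h.2, scal_mul, place_mul (triple_injective h1 h2 h3),
    (op2_three h1 h2 h3 Ψ).1, (op2_three h1 h2 h3 X).2]

/-- Partial trace of a skew inverse over the second factor. -/
def partialD (Ψ : Op ι 2 ℂ) : Matrix ι ι ℂ := fun a b => ∑ x, Ψ ![a, x] ![b, x]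

lemma trS_mul_skew {X Ψ : Op ι 2 ℂ} (h : IsSkewInverse X Ψ) {i j k : ℕ} (h1 : i ≠ j) (h2 : i ≠ k)
    (h3 : j ≠ k) : trS j (op1 A (partialD Ψ) j * op2 A X i j) = 1 := by
  rw [← trS_cyc_single (op1_mem _ _), ← trS_perm (A := A) (ι := ι) i k h2,
    ← trS_skew_left h h1 h2 h3, trS_comm h3.symm, trS_mul_left (op2_mem_off h2.symm h3.symm X),
    trS_op2 h3]
  rfl

variable {X Ψ F Fi : Op ι 2 ℂ} (h : IsSkewInverse X Ψ) (hF : F * Fi = 1) (hF' : Fi * F = 1)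
  {p : Fin 5 → ℕ} (hp : Function.Injective p)

include h hF hF' hp in
lemma trS_conj_perm
    (hc : at2 X (1 : Fin 2) * at2 F (0 : Fin 2) * at2 F (1 : Fin 2) =
      at2 F (0 : Fin 2) * at2 F (1 : Fin 2) * at2 X (0 : Fin 2)) :
    trS (p 3) (op2 A F (p 2) (p 3) * perm A (p 0) (p 2) * op2 A Fi (p 2) (p 3) *
      op1 A (partialD Ψ) (p 3)) = op1 A (partialD Ψ) (p 0) := by
  have n : ∀ a b : Fin 5, a ≠ b → p a ≠ p b := fun a b hab => hp.ne hab
  have n01 := n 0 1 (by decide); have n02 := n 0 2 (by decide); have n03 := n 0 3 (by decide)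
  have n04 := n 0 4 (by decide); have n12 := n 1 2 (by decide); have n13 := n 1 3 (by decide)
  have n14 := n 1 4 (by decide); have n23 := n 2 3 (by decide); have n24 := n 2 4 (by decide)
  have n34 := n 3 4 (by decide)
  have hc' := congrArg (fun Z => place ![p 1, p 2, p 3] (scal A Z)) hc
  simp only [scal_mul, place_mul (triple_injective n12 n13 n23), op2_three n12 n13 n23] at hc'
  have i1 : op2 A Fi (p 1) (p 2) * op2 A F (p 1) (p 2) = 1 := by
    rw [← op2_mul n12, hF', op2_one n12]
  have i2 : op2 A F (p 2) (p 3) * op2 A Fi (p 2) (p 3) = 1 := by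
    rw [← op2_mul n23, hF, op2_one n23]
  have key : op2 A Fi (p 1) (p 2) * op2 A X (p 2) (p 3) * op2 A F (p 1) (p 2) =
      op2 A F (p 2) (p 3) * op2 A X (p 1) (p 2) * op2 A Fi (p 2) (p 3) := by
    calc _ = op2 A Fi (p 1) (p 2) * (op2 A X (p 2) (p 3) * op2 A F (p 1) (p 2) *
          op2 A F (p 2) (p 3)) * op2 A Fi (p 2) (p 3) := by simp only [mul_assoc, i2, mul_one]
      _ = (op2 A Fi (p 1) (p 2) * op2 A F (p 1) (p 2)) * op2 A F (p 2) (p 3) *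
          op2 A X (p 1) (p 2) * op2 A Fi (p 2) (p 3) := by rw [hc']; simp only [mul_assoc]
      _ = _ := by rw [i1, one_mul]
  have key2 := congrArg (fun Z => trS (p 4) (trS (p 3) (trS (p 1)
    (op2 A Ψ (p 0) (p 1) * Z * op2 A Ψ (p 3) (p 4))))) key
  have lhs : trS (p 4) (trS (p 3) (trS (p 1) (op2 A Ψ (p 0) (p 1) * (op2 A Fi (p 1) (p 2) *
      op2 A X (p 2) (p 3) * op2 A F (p 1) (p 2)) * op2 A Ψ (p 3) (p 4)))) =
      op1 A (partialD Ψ) (p 0) := by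
    rw [trS_comm n13.symm]
    have e1 : op2 A Ψ (p 0) (p 1) * (op2 A Fi (p 1) (p 2) * op2 A X (p 2) (p 3) *
        op2 A F (p 1) (p 2)) * op2 A Ψ (p 3) (p 4) = (op2 A Ψ (p 0) (p 1) * op2 A Fi (p 1) (p 2)) *
        ((op2 A X (p 2) (p 3) * op2 A Ψ (p 3) (p 4)) * op2 A F (p 1) (p 2)) := by
      have := op2_comm_of (op2_mem_off n13.symm n23.symm F) (op2_mem_off n14.symm n24.symm F)
        (A := A) Ψ
      simp only [mul_assoc]
      rw [this]
    rw [e1, trS_mul_left (mul_mem (op2_mem_off n03.symm n13.symm Ψ)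
      (op2_mem_off n13.symm n23.symm Fi)), trS_mul_right (op2_mem_off n13.symm n23.symm F),
      trS_skew_left h n23 n24 n34, trS_comm n14.symm,
      trS_mul_left (mul_mem (op2_mem_off n04.symm n14.symm Ψ) (op2_mem_off n14.symm n24.symm Fi)),
      trS_mul_right (op2_mem_off n14.symm n24.symm F), trS_perm _ _ n24, one_mul, mul_assoc, i1,
      mul_one, trS_op2 n01]
    rfl
  have rhs : trS (p 4) (trS (p 3) (trS (p 1) (op2 A Ψ (p 0) (p 1) * (op2 A F (p 2) (p 3) *
      op2 A X (p 1) (p 2) * op2 A Fi (p 2) (p 3)) * op2 A Ψ (p 3) (p 4)))) =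
      trS (p 3) (op2 A F (p 2) (p 3) * perm A (p 0) (p 2) * op2 A Fi (p 2) (p 3) *
      op1 A (partialD Ψ) (p 3)) := by
    have e1 : op2 A Ψ (p 0) (p 1) * (op2 A F (p 2) (p 3) * op2 A X (p 1) (p 2) *
        op2 A Fi (p 2) (p 3)) * op2 A Ψ (p 3) (p 4) = op2 A F (p 2) (p 3) * ((op2 A Ψ (p 0) (p 1) *
        op2 A X (p 1) (p 2)) * (op2 A Fi (p 2) (p 3) * op2 A Ψ (p 3) (p 4))) := by
      have := op2_comm_of (op2_mem_off n02.symm n12.symm Ψ) (op2_mem_off n03.symm n13.symm Ψ)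
        (A := A) F
      simp only [← mul_assoc]
      rw [this]
    rw [e1, trS_mul_left (op2_mem_off n12 n13 F), trS_mul_right (mul_mem (op2_mem_off n12 n13 Fi)
      (op2_mem_off n13 n14 Ψ)), trS_skew_right h n01 n02 n12, trS_comm n34.symm]
    simp only [← mul_assoc]
    rw [trS_mul_left (mul_mem (mul_mem (op2_mem_off n24.symm n34.symm F)
      (perm_mem_off n04.symm n24.symm)) (op2_mem_off n24.symm n34.symm Fi)), trS_op2 n34]
    rfl
  rw [← rhs, ← lhs]
  exact key2.symm

include h hF hF' hp in
lemma trS_conj_perm'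
    (hc : at2 X (0 : Fin 2) * at2 F (1 : Fin 2) * at2 F (0 : Fin 2) =
      at2 F (1 : Fin 2) * at2 F (0 : Fin 2) * at2 X (1 : Fin 2)) :
    trS (p 3) (op2 A Fi (p 2) (p 3) * perm A (p 0) (p 2) * op2 A F (p 2) (p 3) *
      op1 A (partialD Ψ) (p 3)) = op1 A (partialD Ψ) (p 0) := by
  have n : ∀ a b : Fin 5, a ≠ b → p a ≠ p b := fun a b hab => hp.ne hab
  have n01 := n 0 1 (by decide); have n02 := n 0 2 (by decide); have n03 := n 0 3 (by decide)
  have n04 := n 0 4 (by decide); have n12 := n 1 2 (by decide); have n13 := n 1 3 (by decide)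
  have n14 := n 1 4 (by decide); have n23 := n 2 3 (by decide); have n24 := n 2 4 (by decide)
  have n34 := n 3 4 (by decide)
  have hc' := congrArg (fun Z => place ![p 1, p 2, p 3] (scal A Z)) hc
  simp only [scal_mul, place_mul (triple_injective n12 n13 n23), op2_three n12 n13 n23] at hc'
  have i1 : op2 A F (p 1) (p 2) * op2 A Fi (p 1) (p 2) = 1 := by
    rw [← op2_mul n12, hF, op2_one n12]
  have i2 : op2 A Fi (p 2) (p 3) * op2 A F (p 2) (p 3) = 1 := by
    rw [← op2_mul n23, hF', op2_one n23]
  have key : op2 A F (p 1) (p 2) * op2 A X (p 2) (p 3) * op2 A Fi (p 1) (p 2) =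
      op2 A Fi (p 2) (p 3) * op2 A X (p 1) (p 2) * op2 A F (p 2) (p 3) := by
    calc _ = op2 A Fi (p 2) (p 3) * (op2 A F (p 2) (p 3) * op2 A F (p 1) (p 2) *
          op2 A X (p 2) (p 3)) * op2 A Fi (p 1) (p 2) := by
          simp only [← mul_assoc, i2, one_mul]
      _ = op2 A Fi (p 2) (p 3) * op2 A X (p 1) (p 2) * op2 A F (p 2) (p 3) *
          (op2 A F (p 1) (p 2) * op2 A Fi (p 1) (p 2)) := by
          rw [← hc']; simp only [mul_assoc]
      _ = _ := by rw [i1, mul_one]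
  have key2 := congrArg (fun Z => trS (p 4) (trS (p 3) (trS (p 1)
    (op2 A Ψ (p 0) (p 1) * Z * op2 A Ψ (p 3) (p 4))))) key
  have lhs : trS (p 4) (trS (p 3) (trS (p 1) (op2 A Ψ (p 0) (p 1) * (op2 A F (p 1) (p 2) *
      op2 A X (p 2) (p 3) * op2 A Fi (p 1) (p 2)) * op2 A Ψ (p 3) (p 4)))) =
      op1 A (partialD Ψ) (p 0) := by
    rw [trS_comm n13.symm]
    have e1 : op2 A Ψ (p 0) (p 1) * (op2 A F (p 1) (p 2) * op2 A X (p 2) (p 3) *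
        op2 A Fi (p 1) (p 2)) * op2 A Ψ (p 3) (p 4) = (op2 A Ψ (p 0) (p 1) * op2 A F (p 1) (p 2)) *
        ((op2 A X (p 2) (p 3) * op2 A Ψ (p 3) (p 4)) * op2 A Fi (p 1) (p 2)) := by
      have := op2_comm_of (op2_mem_off n13.symm n23.symm Fi) (op2_mem_off n14.symm n24.symm Fi)
        (A := A) Ψ
      simp only [mul_assoc]
      rw [this]
    rw [e1, trS_mul_left (mul_mem (op2_mem_off n03.symm n13.symm Ψ)
      (op2_mem_off n13.symm n23.symm F)), trS_mul_right (op2_mem_off n13.symm n23.symm Fi),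
      trS_skew_left h n23 n24 n34, trS_comm n14.symm,
      trS_mul_left (mul_mem (op2_mem_off n04.symm n14.symm Ψ) (op2_mem_off n14.symm n24.symm F)),
      trS_mul_right (op2_mem_off n14.symm n24.symm Fi), trS_perm _ _ n24, one_mul, mul_assoc, i1,
      mul_one, trS_op2 n01]
    rfl
  have rhs : trS (p 4) (trS (p 3) (trS (p 1) (op2 A Ψ (p 0) (p 1) * (op2 A Fi (p 2) (p 3) *
      op2 A X (p 1) (p 2) * op2 A F (p 2) (p 3)) * op2 A Ψ (p 3) (p 4)))) =
      trS (p 3) (op2 A Fi (p 2) (p 3) * perm A (p 0) (p 2) * op2 A F (p 2) (p 3) *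
      op1 A (partialD Ψ) (p 3)) := by
    have e1 : op2 A Ψ (p 0) (p 1) * (op2 A Fi (p 2) (p 3) * op2 A X (p 1) (p 2) *
        op2 A F (p 2) (p 3)) * op2 A Ψ (p 3) (p 4) = op2 A Fi (p 2) (p 3) * ((op2 A Ψ (p 0) (p 1) *
        op2 A X (p 1) (p 2)) * (op2 A F (p 2) (p 3) * op2 A Ψ (p 3) (p 4))) := by
      have := op2_comm_of (op2_mem_off n02.symm n12.symm Ψ) (op2_mem_off n03.symm n13.symm Ψ)
        (A := A) Fi
      simp only [← mul_assoc]
      rw [this]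
    rw [e1, trS_mul_left (op2_mem_off n12 n13 Fi), trS_mul_right (mul_mem (op2_mem_off n12 n13 F)
      (op2_mem_off n13 n14 Ψ)), trS_skew_right h n01 n02 n12, trS_comm n34.symm]
    simp only [← mul_assoc]
    rw [trS_mul_left (mul_mem (mul_mem (op2_mem_off n24.symm n34.symm Fi)
      (perm_mem_off n04.symm n24.symm)) (op2_mem_off n24.symm n34.symm F)), trS_op2 n34]
    rfl
  rw [← rhs, ← lhs]
  exact key2.symm

end SkewTrace

end
noncomputable section
section WeightedTrace

variable {ι : Type} [Fintype ι] [DecidableEq ι] {A : Type} [Ring A] [Algebra ℂ A]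

/-- The trace over the site `j`, weighted by `D`. -/
def wtr (A : Type) [Ring A] [Algebra ℂ A] (D : Matrix ι ι ℂ) (j : ℕ) :
    ChainOp ι A →ₗ[ℂ] ChainOp ι A :=
  trS j ∘ₗ LinearMap.mulLeft ℂ (op1 A D j)

variable {D : Matrix ι ι ℂ}

lemma wtr_def (j : ℕ) (T : ChainOp ι A) : wtr A D j T = trS j (op1 A D j * T) := rfl

lemma wtr_mul_left {j : ℕ} {X : ChainOp ι A} (hX : X ∈ off ι A j) (T : ChainOp ι A) :
    wtr A D j (X * T) = X * wtr A D j T := by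
  rw [wtr_def, wtr_def, ← mul_assoc, op1_comm_of hX, mul_assoc, trS_mul_left hX]

lemma wtr_mul_right {j : ℕ} {X : ChainOp ι A} (hX : X ∈ off ι A j) (T : ChainOp ι A) :
    wtr A D j (T * X) = wtr A D j T * X := by
  rw [wtr_def, wtr_def, ← mul_assoc, trS_mul_right hX]

lemma wtr_mem (j : ℕ) (T : ChainOp ι A) : wtr A D j T ∈ off ι A j := trS_mem _ _

lemma wtr_mem_of {i : ℕ} (j : ℕ) {T : ChainOp ι A} (hT : T ∈ off ι A i) :
    wtr A D j T ∈ off ι A i := by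
  by_cases h : i = j
  · subst h; exact wtr_mem _ _
  · exact trS_mem_of (mul_mem (op1_mem_off h D) hT)

lemma wtr_eu (i : ℕ) (s t : ι) : wtr A D i (eu A i s t) = algebraMap ℂ _ (D t s) :=
  trS_op1_mul_eu i D s t

lemma exists_expansion {i j : ℕ} (h : i ≠ j) {T : ChainOp ι A} (hT : T ∈ off ι A j) :
    ∃ Z : ι → ι → ChainOp ι A, (∀ s t, Z s t ∈ off ι A i ∧ Z s t ∈ off ι A j) ∧
      T = ∑ s, ∑ t, eu A i s t * Z s t := by
  refine ⟨fun s t => ∑ c, eu A i c s * T * eu A i t c, fun s t => ⟨?_, ?_⟩, ?_⟩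
  · rw [mem_off]
    intro a b
    have h1 : ∀ c, eu A i a b * (eu A i c s * T * eu A i t c) =
        if b = c then eu A i a s * T * eu A i t c else 0 := by
      intro c
      rw [← mul_assoc, ← mul_assoc, eu_mul]
      split_ifs <;> simp
    have h2 : ∀ c, eu A i c s * T * eu A i t c * eu A i a b =
        if c = a then eu A i c s * T * eu A i t b else 0 := by
      intro c
      rw [mul_assoc, eu_mul]
      split_ifs <;> simp
    simp [Finset.mul_sum, Finset.sum_mul, h1, h2]
  · exact sum_mem fun c _ => mul_mem (mul_mem (eu_mem_off h _ _) hT) (eu_mem_off h _ _)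
  · have h1 : ∀ s t, eu A i s t * ∑ c, eu A i c s * T * eu A i t c =
        eu A i s s * T * eu A i t t := by
      intro s t
      rw [Finset.mul_sum, Finset.sum_eq_single t]
      · rw [← mul_assoc, ← mul_assoc, eu_mul, if_pos rfl]
      · intro c _ hc
        rw [← mul_assoc, ← mul_assoc, eu_mul, if_neg hc.symm]; simp
      · simp
    simp only [h1, ← Finset.mul_sum, ← Finset.sum_mul, sum_eu, one_mul, mul_one]

variable {X Ψ F Fi : Op ι 2 ℂ}

lemma exists_five_sites {i j : ℕ} (h : i ≠ j) :
    ∃ p : Fin 5 → ℕ, Function.Injective p ∧ p 2 = i ∧ p 3 = j := by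
  refine ⟨![i + j + 1, i + j + 2, i, j, i + j + 3], ?_, rfl, rfl⟩
  intro a b hab
  fin_cases a <;> fin_cases b <;> simp at hab ⊢ <;> omega

lemma exists_five_sites' {i j : ℕ} (h : i ≠ j) :
    ∃ p : Fin 5 → ℕ, Function.Injective p ∧ p 0 = i ∧ p 1 = j :=
  ⟨![i, j, i + j + 1, i + j + 2, i + j + 3], by
    intro a b hab
    fin_cases a <;> fin_cases b <;> simp at hab ⊢ <;> omega, rfl, rfl⟩

lemma wtr_conj (hX : IsSkewInverse X Ψ) (hF : F * Fi = 1) (hF' : Fi * F = 1)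
    (hc : at2 X (1 : Fin 2) * at2 F (0 : Fin 2) * at2 F (1 : Fin 2) =
      at2 F (0 : Fin 2) * at2 F (1 : Fin 2) * at2 X (0 : Fin 2))
    {i j : ℕ} (h : i ≠ j) {T : ChainOp ι A} (hT : T ∈ off ι A j) :
    wtr A (partialD Ψ) j (op2 A F i j * T * op2 A Fi i j) = wtr A (partialD Ψ) i T := by
  have base : ∀ s t, wtr A (partialD Ψ) j (op2 A F i j * eu A i s t * op2 A Fi i j) =
      algebraMap ℂ _ (partialD Ψ t s) := by
    intro s t
    obtain ⟨p, hp, rfl, rfl⟩ := exists_five_sites h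
    have key := trS_conj_perm (A := A) hX hF hF' hp hc
    have hxi : p 0 ≠ p 2 := hp.ne (by decide)
    have hxj : p 0 ≠ p 3 := hp.ne (by decide)
    generalize p 0 = x at *
    generalize p 2 = i at *
    generalize p 3 = j at *
    clear hp
    have key2 := congrArg (fun Z => trS x (Z * eu A x s t)) key
    simp only [trS_op1_mul_eu] at key2
    rw [← key2, ← trS_mul_right (eu_mem_off hxj _ _), trS_comm hxj, wtr_def]
    have e : op2 A F i j * perm A x i * op2 A Fi i j * op1 A (partialD Ψ) j * eu A x s t =
        (op2 A F i j * eu A i s t) * (perm A x i * (op2 A Fi i j * op1 A (partialD Ψ) j)) := by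
      have e1 := op2_comm_of (A := A) (eu_mem_off hxi s t) (eu_mem_off hxj s t) Fi
      have e2 := op1_comm_of (A := A) (eu_mem_off hxj s t) (partialD Ψ)
      have e3 := perm_mul_eu (A := A) hxi s t
      simp only [mul_assoc]
      rw [e2, ← mul_assoc (op2 A Fi i j), e1, mul_assoc, ← mul_assoc (perm A x i), e3, mul_assoc]
    rw [e, trS_mul_left (mul_mem (op2_mem_off hxi hxj F) (eu_mem_off hxi.symm _ _)),
      trS_mul_right (mul_mem (op2_mem_off hxi hxj Fi) (op1_mem_off hxj _)),
      perm_comm hxi, trS_perm _ _ hxi.symm, one_mul,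
      ← trS_cyc_single (op1_mem (partialD Ψ) j)]
    simp only [mul_assoc]
  obtain ⟨Z, hZ, rfl⟩ := exists_expansion h hT
  simp only [Finset.mul_sum, Finset.sum_mul, map_sum]
  refine Finset.sum_congr rfl fun s _ => Finset.sum_congr rfl fun t _ => ?_
  obtain ⟨h1, h2⟩ := hZ s t
  rw [wtr_mul_right h1, wtr_eu, ← base]
  rw [← wtr_mul_right h2]
  congr 1
  simp only [mul_assoc]
  rw [op2_comm_of h1 h2]

lemma perm_mul_self {i k : ℕ} (hik : i ≠ k) : (perm A i k : ChainOp ι A) * perm A i k = 1 := by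
  have : ∀ a d : ι, eu A i a d * eu A k d a * perm A i k =
      eu A i a d * perm A i k * eu A i d a := by
    intro a d; rw [mul_assoc, mul_assoc, ← perm_mul_eu hik]
  have e1 : (perm A i k : ChainOp ι A) * perm A i k = ∑ a, ∑ d, eu A i a d * eu A k d a * perm A i k := by
    conv_lhs => rw [perm, Finset.sum_mul]
    simp only [Finset.sum_mul]
    rfl
  rw [e1]
  simp only [this]
  have e2 := trS_perm (A := A) (ι := ι) k i hik.symm
  rw [perm_comm hik.symm, trS_def, Finset.sum_comm] at e2
  exact e2

lemma op2_mul_D (hX : IsSkewInverse X Ψ) {Xi : Op ι 2 ℂ} (h1 : X * Xi = 1) (h2 : Xi * X = 1)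
    (hyb : at2 X (0 : Fin 2) * at2 X (1 : Fin 2) * at2 X (0 : Fin 2) =
      at2 X (1 : Fin 2) * at2 X (0 : Fin 2) * at2 X (1 : Fin 2)) {i j : ℕ} (h : i ≠ j) :
    op2 A Xi i j * op1 A (partialD Ψ) j = op1 A (partialD Ψ) i * op2 A Ψ j i := by
  obtain ⟨p, hp, rfl, rfl⟩ := exists_five_sites' h
  have hik : p 0 ≠ p 2 := hp.ne (by decide)
  have hjk : p 1 ≠ p 2 := hp.ne (by decide)
  have him : p 0 ≠ p 3 := hp.ne (by decide)
  have hjm : p 1 ≠ p 3 := hp.ne (by decide)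
  have hkm : p 2 ≠ p 3 := hp.ne (by decide)
  have TT := trS_conj_perm (A := A) hX h1 h2 hp hyb.symm
  generalize p 0 = i at *
  generalize p 1 = j at *
  generalize p 2 = k at *
  generalize p 3 = m at *
  generalize partialD Ψ = D at *
  clear hp
  have e1 : trS m (op2 A X k m * (op2 A Xi i m * op1 A D m)) = op1 A D i * perm A i k := by
    have : op2 A X k m * perm A i k * op2 A Xi k m * op1 A D m =
        op2 A X k m * (op2 A Xi i m * op1 A D m) * perm A i k := by
      have c1 := op1_comm_of (A := A) (perm_mem_off him.symm hkm.symm) D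
      have c2 := perm_mul_op2_left (A := A) hik.symm hkm.symm him.symm Xi
      simp only [perm_comm hik.symm] at c2
      simp only [mul_assoc]
      rw [← mul_assoc (perm A i k), c2, mul_assoc, c1]
    rw [this, trS_mul_right (perm_mem_off him.symm hkm.symm)] at TT
    calc _ = trS m (op2 A X k m * (op2 A Xi i m * op1 A D m)) * (perm A i k * perm A i k) := by
          rw [perm_mul_self hik, mul_one]
      _ = _ := by rw [← mul_assoc, TT]
  have e2 := congrArg (fun Z => trS k (op2 A Ψ j k * Z)) e1
  beta_reduce at e2
  rw [← trS_mul_left (op2_mem_off hjm.symm hkm.symm Ψ), trS_comm hkm, ← mul_assoc,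
    trS_mul_right (mul_mem (op2_mem_off hik.symm hkm Xi) (op1_mem_off hkm D)),
    trS_skew_right hX hjk hjm hkm, ← mul_assoc] at e2
  have c3 := perm_mul_op2_right (A := A) hjm.symm him h Xi
  rw [perm_comm hjm.symm] at c3
  have c4 := perm_mul_op1 (A := A) hjm.symm D
  rw [perm_comm hjm.symm] at c4
  rw [c3, mul_assoc, c4, ← mul_assoc, trS_mul_left (mul_mem (op2_mem_off him.symm hjm.symm Xi)
    (op1_mem_off hjm.symm D)), trS_perm _ _ hjm, mul_one] at e2
  rw [e2]
  have c5 := op2_comm_of (A := A) (op1_mem_off h.symm D) (op1_mem_off hik.symm D) Ψ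
  have c6 := perm_mul_op2_right (A := A) hik h.symm hjk Ψ
  rw [← mul_assoc, c5, mul_assoc, ← c6, ← mul_assoc,
    trS_mul_left (op1_mem_off hik.symm D)
      |> fun t => (by rw [mul_assoc, t] : trS k (op1 A D i * perm A i k * op2 A Ψ j i) = _),
    trS_mul_right (op2_mem_off hjk.symm hik.symm Ψ), trS_perm _ _ hik, one_mul]

lemma D_mul_op2 (hX : IsSkewInverse X Ψ) {Xi : Op ι 2 ℂ} (h1 : X * Xi = 1) (h2 : Xi * X = 1)
    (hyb : at2 X (0 : Fin 2) * at2 X (1 : Fin 2) * at2 X (0 : Fin 2) =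
      at2 X (1 : Fin 2) * at2 X (0 : Fin 2) * at2 X (1 : Fin 2)) {i j : ℕ} (h : i ≠ j) :
    op1 A (partialD Ψ) j * op2 A Xi i j = op2 A Ψ j i * op1 A (partialD Ψ) i := by
  obtain ⟨p, hp, rfl, rfl⟩ := exists_five_sites' h
  have hik : p 0 ≠ p 2 := hp.ne (by decide)
  have hjk : p 1 ≠ p 2 := hp.ne (by decide)
  have him : p 0 ≠ p 3 := hp.ne (by decide)
  have hjm : p 1 ≠ p 3 := hp.ne (by decide)
  have hkm : p 2 ≠ p 3 := hp.ne (by decide)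
  have TT := trS_conj_perm' (A := A) hX h1 h2 hp hyb
  generalize p 0 = i at *
  generalize p 1 = j at *
  generalize p 2 = k at *
  generalize p 3 = m at *
  generalize partialD Ψ = D at *
  clear hp
  have e1 : trS m (op1 A D m * (op2 A Xi i m * op2 A X k m)) = perm A i k * op1 A D i := by
    have : op2 A Xi k m * perm A i k * op2 A X k m * op1 A D m =
        perm A i k * ((op2 A Xi i m * op2 A X k m) * op1 A D m) := by
      have c2 := perm_mul_op2_left (A := A) hik him.symm hkm.symm Xi
      rw [← c2]; simp only [mul_assoc]
    rw [this, trS_mul_left (perm_mem_off him.symm hkm.symm), trS_cyc_single (op1_mem _ _)] at TT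
    calc _ = (perm A i k * perm A i k) * trS m (op1 A D m * (op2 A Xi i m * op2 A X k m)) := by
          rw [perm_mul_self hik, one_mul]
      _ = _ := by rw [mul_assoc, TT]
  have e2 := congrArg (fun Z => trS k (op2 A Ψ j k * Z)) e1
  beta_reduce at e2
  have e3 : op2 A Ψ j k * (op1 A D m * (op2 A Xi i m * op2 A X k m)) =
      op1 A D m * op2 A Xi i m * (op2 A Ψ j k * op2 A X k m) := by
    have c1 := op2_comm_of (A := A) (mul_mem (op1_mem_off hjm D) (op2_mem_off h.symm hjm Xi))
      (mul_mem (op1_mem_off hkm D) (op2_mem_off hik.symm hkm Xi)) Ψ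
    simp only [← mul_assoc] at c1 ⊢
    rw [c1]
  rw [← trS_mul_left (op2_mem_off hjm.symm hkm.symm Ψ), trS_comm hkm, e3,
    trS_mul_left (mul_mem (op1_mem_off hkm D) (op2_mem_off hik.symm hkm Xi)),
    trS_skew_right hX hjk hjm hkm] at e2
  have c3 := perm_mul_op2_right (A := A) hjm h him Xi
  have c4 := perm_mul_op1 (A := A) hjm D
  have c3' : op2 A Xi i m * perm A j m = perm A j m * op2 A Xi i j := c3.symm
  rw [mul_assoc, c3', ← mul_assoc, ← c4, mul_assoc, trS_mul_right (mul_mem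
    (op1_mem_off hjm.symm D) (op2_mem_off him.symm hjm.symm Xi)), trS_perm _ _ hjm, one_mul] at e2
  rw [e2]
  have c6 := perm_mul_op2_right (A := A) hik h.symm hjk Ψ
  rw [← mul_assoc, ← c6, mul_assoc, trS_mul_right (mul_mem (op2_mem_off hjk.symm hik.symm Ψ)
    (op1_mem_off hik.symm D)), trS_perm _ _ hik, one_mul]

lemma op2_cyc_D (hX : IsSkewInverse X Ψ) {Xi : Op ι 2 ℂ} (h1 : X * Xi = 1) (h2 : Xi * X = 1)
    (hyb : at2 X (0 : Fin 2) * at2 X (1 : Fin 2) * at2 X (0 : Fin 2) =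
      at2 X (1 : Fin 2) * at2 X (0 : Fin 2) * at2 X (1 : Fin 2)) {i j : ℕ} (h : i ≠ j) :
    op1 A (partialD Ψ) i * op1 A (partialD Ψ) j * op2 A Xi i j =
      op2 A Xi i j * (op1 A (partialD Ψ) i * op1 A (partialD Ψ) j) := by
  have c : op1 A (partialD Ψ) i * op1 A (partialD Ψ) j =
      op1 A (partialD Ψ) j * op1 A (partialD Ψ) i := op1_comm_of (op1_mem_off h _) _
  rw [mul_assoc, D_mul_op2 hX h1 h2 hyb h, c, ← mul_assoc, ← op2_mul_D hX h1 h2 hyb h, mul_assoc]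

lemma op2_cyc_D' (hX : IsSkewInverse X Ψ) {Xi : Op ι 2 ℂ} (h1 : X * Xi = 1) (h2 : Xi * X = 1)
    (hyb : at2 X (0 : Fin 2) * at2 X (1 : Fin 2) * at2 X (0 : Fin 2) =
      at2 X (1 : Fin 2) * at2 X (0 : Fin 2) * at2 X (1 : Fin 2)) {i j : ℕ} (h : i ≠ j)
    (T : ChainOp ι A) :
    wtr A (partialD Ψ) i (wtr A (partialD Ψ) j (T * op2 A X i j)) =
      wtr A (partialD Ψ) i (wtr A (partialD Ψ) j (op2 A X i j * T)) := by
  have e : ∀ T, wtr A (partialD Ψ) i (wtr A (partialD Ψ) j T) =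
      trS i (trS j (op1 A (partialD Ψ) i * op1 A (partialD Ψ) j * T)) := by
    intro T
    rw [wtr_def, wtr_def, ← trS_mul_left (op1_mem_off h.symm _), mul_assoc]
  have a1 : op2 A X i j * op2 A Xi i j = 1 := by rw [← op2_mul h, h1, op2_one h]
  have a2 : op2 A Xi i j * op2 A X i j = 1 := by rw [← op2_mul h, h2, op2_one h]
  have c := op2_cyc_D (A := A) hX h1 h2 hyb h
  have c' : op2 A X i j * (op1 A (partialD Ψ) i * op1 A (partialD Ψ) j) =
      op1 A (partialD Ψ) i * op1 A (partialD Ψ) j * op2 A X i j := by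
    calc _ = op2 A X i j * (op1 A (partialD Ψ) i * op1 A (partialD Ψ) j * op2 A Xi i j) *
          op2 A X i j := by rw [mul_assoc, mul_assoc _ (op2 A Xi i j), a2, mul_one]
      _ = _ := by rw [c, ← mul_assoc (op2 A X i j), a1, one_mul]
  rw [e, e, ← mul_assoc, trS_cyc_pair h (op2_mem X i j), ← mul_assoc, c', mul_assoc]

end WeightedTrace

end
noncomputable section
/-! ## Chains with weighted traces

An axiomatic description of the operators `R_i`, `F_i`, of the weighted traces over single sites and
of the quantum matrix `M`, all acting on one infinite chain. -/

/-- A chain of sites with an R-matrix `R`, a compatible R-matrix `F`, weighted traces `E` over the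
sites, and a quantum matrix `M` in the first site. -/
structure QChain (O : Type) [Ring O] [Algebra ℂ O] where
  /-- operators that act trivially on a site -/
  off : ℕ → Subalgebra ℂ O
  /-- weighted trace over a site -/
  E : ℕ → O →ₗ[ℂ] O
  E_mul_left : ∀ {j X}, X ∈ off j → ∀ T, E j (X * T) = X * E j T
  E_mul_right : ∀ {j X}, X ∈ off j → ∀ T, E j (T * X) = E j T * X
  E_mem : ∀ j T, E j T ∈ off j
  E_mem_of : ∀ {i} j {T}, T ∈ off i → E j T ∈ off i
  /-- the R-matrix in the sites `i`, `i + 1` -/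
  R : ℕ → Oˣ
  /-- the compatible R-matrix in the sites `i`, `i + 1` -/
  F : ℕ → Oˣ
  R_off : ∀ {i j}, j ≠ i → j ≠ i + 1 → (R i : O) ∈ off j
  Ri_off : ∀ {i j}, j ≠ i → j ≠ i + 1 → (↑(R i)⁻¹ : O) ∈ off j
  F_off : ∀ {i j}, j ≠ i → j ≠ i + 1 → (F i : O) ∈ off j
  Fi_off : ∀ {i j}, j ≠ i → j ≠ i + 1 → (↑(F i)⁻¹ : O) ∈ off j
  R_comm : ∀ {i T}, T ∈ off i → T ∈ off (i + 1) → (R i : O) * T = T * R i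
  F_comm : ∀ {i T}, T ∈ off i → T ∈ off (i + 1) → (F i : O) * T = T * F i
  R_braid : ∀ i, R i * R (i + 1) * R i = R (i + 1) * R i * R (i + 1)
  F_braid : ∀ i, F i * F (i + 1) * F i = F (i + 1) * F i * F (i + 1)
  compat₁ : ∀ i, R i * F (i + 1) * F i = F (i + 1) * F i * R (i + 1)
  compat₂ : ∀ i, R (i + 1) * F i * F (i + 1) = F i * F (i + 1) * R i
  E_R : ∀ i, E (i + 1) (R i) = 1
  E_cyc : ∀ i T, E i (E (i + 1) (T * R i)) = E i (E (i + 1) (R i * T))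
  E_conjR : ∀ i {T}, T ∈ off (i + 1) → E (i + 1) (R i * T * ↑(R i)⁻¹) = E i T
  E_conjF : ∀ i {T}, T ∈ off (i + 1) → E (i + 1) (F i * T * ↑(F i)⁻¹) = E i T
  /-- the quantum matrix in the site `0` -/
  M₀ : O
  M₀_off : ∀ j, M₀ ∈ off (j + 1)
  RMM : (R 0 : O) * (M₀ * (F 0 * M₀ * ↑(F 0)⁻¹)) = M₀ * (F 0 * M₀ * ↑(F 0)⁻¹) * R 0

namespace QChain

variable {O : Type} [Ring O] [Algebra ℂ O] (C : QChain O)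

lemma Ru_comm {i j : ℕ} (h : i + 1 < j) : C.R i * C.R j = C.R j * C.R i :=
  Units.ext (C.R_comm (C.R_off (by omega) (by omega)) (C.R_off (by omega) (by omega)))

lemma FR_comm {i j : ℕ} (h : i + 1 < j) : C.F i * C.R j = C.R j * C.F i :=
  Units.ext (C.F_comm (C.R_off (by omega) (by omega)) (C.R_off (by omega) (by omega)))

lemma RF_comm {i j : ℕ} (h : i + 1 < j) : C.R i * C.F j = C.F j * C.R i :=
  Units.ext (C.R_comm (C.F_off (by omega) (by omega)) (C.F_off (by omega) (by omega)))

lemma FF_comm {i j : ℕ} (h : i + 1 < j) : C.F i * C.F j = C.F j * C.F i :=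
  Units.ext (C.F_comm (C.F_off (by omega) (by omega)) (C.F_off (by omega) (by omega)))

/-- Conjugation by a unit. -/
def cj (u : Oˣ) : O →ₐ[ℂ] O := (MulSemiringAction.toAlgEquiv ℂ O (ConjAct.toConjAct u)).toAlgHom

lemma cj_def (u : Oˣ) (X : O) : cj u X = u * X * ↑u⁻¹ := rfl

lemma cj_mul (u v : Oˣ) (X : O) : cj (u * v) X = cj u (cj v X) := by
  simp [cj_def, mul_assoc]

@[simp] lemma cj_one (X : O) : cj (1 : Oˣ) X = X := by simp [cj_def]

lemma cj_eq_of_comm {u : Oˣ} {X : O} (h : (u : O) * X = X * u) : cj u X = X := by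
  rw [cj_def, h, mul_assoc, Units.mul_inv, mul_one]

lemma comm_iff_cj {u : Oˣ} {X : O} : (u : O) * X = X * u ↔ cj u X = X :=
  ⟨cj_eq_of_comm, fun h => by
    conv_rhs => rw [← h]
    rw [cj_def, mul_assoc, Units.inv_mul, mul_one]⟩

lemma cj_units (u v w : Oˣ) (h : u * v = w * u) : cj u (v : O) = w := by
  rw [cj_def, ← Units.val_mul, h, Units.val_mul, mul_assoc, Units.mul_inv, mul_one]

lemma cj_units_inv (u v w : Oˣ) (h : u * v = w * u) : cj u (↑v⁻¹ : O) = ↑w⁻¹ := by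
  apply cj_units
  rw [eq_inv_mul_iff_mul_eq, ← mul_assoc, ← h, mul_assoc, mul_inv_cancel, mul_one]

lemma inv_comm {u : Oˣ} {X : O} (h : (u : O) * X = X * u) : (↑u⁻¹ : O) * X = X * ↑u⁻¹ := by
  rw [Units.inv_mul_eq_iff_eq_mul, ← mul_assoc, h, mul_assoc, Units.mul_inv, mul_one]

/-! ### Iterated traces -/

/-- The weighted trace over the sites `a, …, a + p - 1`. -/
def ET (a : ℕ) : ℕ → O →ₗ[ℂ] O
  | 0 => LinearMap.id
  | p + 1 => ET a p ∘ₗ C.E (a + p)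

@[simp] lemma ET_zero (a : ℕ) (T : O) : C.ET a 0 T = T := rfl

lemma ET_succ (a p : ℕ) (T : O) : C.ET a (p + 1) T = C.ET a p (C.E (a + p) T) := rfl

lemma ET_succ' (a p : ℕ) (T : O) : C.ET a (p + 1) T = C.E a (C.ET (a + 1) p T) := by
  induction p generalizing T with
  | zero => rfl
  | succ p ih =>
    rw [ET_succ, ih, ET_succ]
    congr 4; omega

lemma ET_add (a p r : ℕ) (T : O) : C.ET a (p + r) T = C.ET a p (C.ET (a + p) r T) := by
  induction r generalizing T with
  | zero => rfl
  | succ r ih => rw [← add_assoc, ET_succ, ih, ET_succ]; congr 4; omega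

lemma ET_mul_left {a p : ℕ} {X : O} (h : ∀ j, a ≤ j → j < a + p → X ∈ C.off j) (T : O) :
    C.ET a p (X * T) = X * C.ET a p T := by
  induction p generalizing T with
  | zero => rfl
  | succ p ih =>
    rw [ET_succ, C.E_mul_left (h _ (by omega) (by omega)), ih (fun j h1 h2 => h j h1 (by omega)),
      ET_succ]

lemma ET_mul_right {a p : ℕ} {X : O} (h : ∀ j, a ≤ j → j < a + p → X ∈ C.off j) (T : O) :
    C.ET a p (T * X) = C.ET a p T * X := by
  induction p generalizing T with
  | zero => rfl
  | succ p ih =>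
    rw [ET_succ, C.E_mul_right (h _ (by omega) (by omega)), ih (fun j h1 h2 => h j h1 (by omega)),
      ET_succ]

lemma ET_mem_of {i : ℕ} (a p : ℕ) {T : O} (h : T ∈ C.off i) : C.ET a p T ∈ C.off i := by
  induction p generalizing T with
  | zero => exact h
  | succ p ih => exact ih (C.E_mem_of _ h)

lemma ET_mem {i a p : ℕ} (h1 : a ≤ i) (h2 : i < a + p) (T : O) : C.ET a p T ∈ C.off i := by
  induction p generalizing T with
  | zero => omega
  | succ p ih =>
    rw [ET_succ]
    by_cases h : i = a + p
    · subst h; exact C.ET_mem_of _ _ (C.E_mem _ _)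
    · exact ih (by omega) _

lemma ET_cyc_R {a p i : ℕ} (h1 : a ≤ i) (h2 : i + 1 < a + p) (T : O) :
    C.ET a p (T * C.R i) = C.ET a p (C.R i * T) := by
  obtain ⟨s, rfl⟩ : ∃ s, p = (i - a) + (2 + s) := ⟨p - (i - a) - 2, by omega⟩
  rw [ET_add, ET_add _ _ 2, ET_add, ET_add _ _ 2]
  congr 1
  have e : a + (i - a) = i := by omega
  rw [e]
  rw [C.ET_mul_left (fun j h3 h4 => C.R_off (by omega) (by omega)),
    C.ET_mul_right (fun j h3 h4 => C.R_off (by omega) (by omega))]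
  simp only [ET_succ, ET_zero, add_zero]
  exact C.E_cyc i _

/-! ### Words in the R-matrices -/

/-- The algebra generated by the R-matrices on the strands `a, …, a + n - 1`. -/
def W (a n : ℕ) : Subalgebra ℂ O :=
  Algebra.adjoin ℂ {x | ∃ i, a ≤ i ∧ i + 1 < a + n ∧ (x = C.R i ∨ x = ↑(C.R i)⁻¹)}

lemma R_mem_W {a n i : ℕ} (h1 : a ≤ i) (h2 : i + 1 < a + n) : (C.R i : O) ∈ C.W a n :=
  Algebra.subset_adjoin ⟨i, h1, h2, Or.inl rfl⟩

lemma Ri_mem_W {a n i : ℕ} (h1 : a ≤ i) (h2 : i + 1 < a + n) : (↑(C.R i)⁻¹ : O) ∈ C.W a n :=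
  Algebra.subset_adjoin ⟨i, h1, h2, Or.inr rfl⟩

lemma W_le {a n : ℕ} {S : Subalgebra ℂ O}
    (h : ∀ i, a ≤ i → i + 1 < a + n → (C.R i : O) ∈ S ∧ (↑(C.R i)⁻¹ : O) ∈ S) : C.W a n ≤ S := by
  apply Algebra.adjoin_le
  rintro x ⟨i, h1, h2, rfl | rfl⟩
  · exact (h i h1 h2).1
  · exact (h i h1 h2).2

lemma W_mono {a n b m : ℕ} (h1 : b ≤ a) (h2 : a + n ≤ b + m) : C.W a n ≤ C.W b m :=
  C.W_le fun _ h3 h4 => ⟨C.R_mem_W (by omega) (by omega), C.Ri_mem_W (by omega) (by omega)⟩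

lemma W_off {a n j : ℕ} (h : j < a ∨ a + n ≤ j) : C.W a n ≤ C.off j :=
  C.W_le fun i h3 h4 =>
    ⟨C.R_off (i := i) (by omega) (by omega), C.Ri_off (i := i) (by omega) (by omega)⟩

lemma W_comm {a n : ℕ} {T w : O} (hw : w ∈ C.W a n)
    (h : ∀ i, a ≤ i → i + 1 < a + n → (C.R i : O) * T = T * C.R i) : w * T = T * w := by
  have : C.W a n ≤ Subalgebra.centralizer ℂ {T} := C.W_le fun i h1 h2 => by
    simp only [Subalgebra.mem_centralizer_iff, Set.mem_singleton_iff, forall_eq]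
    exact ⟨(h i h1 h2).symm, (inv_comm (h i h1 h2)).symm⟩
  have h2 := this hw
  simp only [Subalgebra.mem_centralizer_iff, Set.mem_singleton_iff, forall_eq] at h2
  exact h2.symm

lemma W_comm_of_off {a n : ℕ} {T w : O} (hw : w ∈ C.W a n)
    (h : ∀ j, a ≤ j → j < a + n → T ∈ C.off j) : w * T = T * w :=
  C.W_comm hw fun i h1 h2 => C.R_comm (h i h1 (by omega)) (h (i + 1) (by omega) h2)

lemma ET_cyc {a p : ℕ} {w : O} (hw : w ∈ C.W a p) (T : O) :
    C.ET a p (T * w) = C.ET a p (w * T) := by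
  revert T
  refine Algebra.adjoin_induction (p := fun w _ => ∀ T, C.ET a p (T * w) = C.ET a p (w * T))
    ?_ ?_ ?_ ?_ hw
  · rintro x ⟨i, h1, h2, rfl | rfl⟩ T
    · exact C.ET_cyc_R h1 h2 T
    · have := C.ET_cyc_R h1 h2 (↑(C.R i)⁻¹ * T * ↑(C.R i)⁻¹)
      simpa [mul_assoc] using this.symm
  · intro r T; rw [Algebra.commutes]
  · intro x y _ _ hx hy T; simp [mul_add, add_mul, hx, hy]
  · intro x y _ _ hx hy T; rw [← mul_assoc, hy, ← mul_assoc, hx, mul_assoc]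

/-! ### Copies of a one-site operator -/

/-- The copy of `X` in the site `d`: `X_{\bar 1} = X`, `X_{\overline{d+1}} = F_d X_{\bar d} F_d⁻¹`. -/
def bar : ℕ → O → O
  | 0, X => X
  | d + 1, X => cj (C.F d) (bar d X)

@[simp] lemma bar_zero (X : O) : C.bar 0 X = X := rfl

lemma bar_succ (d : ℕ) (X : O) : C.bar (d + 1) X = cj (C.F d) (C.bar d X) := rfl

/-- One-site operators: those that act trivially on all sites but `0`. -/
def one : Subalgebra ℂ O := ⨅ j : ℕ, C.off (j + 1)

lemma mem_one {X : O} : X ∈ C.one ↔ ∀ j, X ∈ C.off (j + 1) := by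
  simp [one, Algebra.mem_iInf]

lemma M₀_mem : C.M₀ ∈ C.one := C.mem_one.mpr C.M₀_off

/-- `bar d` as an algebra homomorphism. -/
lemma bar_mul (d : ℕ) (X Y : O) : C.bar d (X * Y) = C.bar d X * C.bar d Y := by
  induction d with
  | zero => rfl
  | succ d ih => rw [bar_succ, ih, map_mul]; rfl

lemma bar_add (d : ℕ) (X Y : O) : C.bar d (X + Y) = C.bar d X + C.bar d Y := by
  induction d with
  | zero => rfl
  | succ d ih => rw [bar_succ, ih, map_add]; rfl

lemma bar_smul (d : ℕ) (z : ℂ) (X : O) : C.bar d (z • X) = z • C.bar d X := by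
  induction d with
  | zero => rfl
  | succ d ih => rw [bar_succ, ih, map_smul]; rfl

lemma bar_one (d : ℕ) : C.bar d 1 = 1 := by
  induction d with
  | zero => rfl
  | succ d ih => rw [bar_succ, ih, map_one]

lemma bar_of_off {X : O} (h : ∀ j, X ∈ C.off j) (d : ℕ) : C.bar d X = X := by
  induction d with
  | zero => rfl
  | succ d ih => rw [bar_succ, ih, cj_eq_of_comm (C.F_comm (h _) (h _))]

lemma bar_off {X : O} (hX : X ∈ C.one) {d j : ℕ} (h : d < j) : C.bar d X ∈ C.off j := by
  induction d with
  | zero =>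
    obtain ⟨j, rfl⟩ : ∃ i, j = i + 1 := ⟨j - 1, by omega⟩
    exact C.mem_one.mp hX j
  | succ d ih =>
    exact mul_mem (mul_mem (C.F_off (by omega) (by omega)) (ih (by omega)))
      (C.Fi_off (by omega) (by omega))

lemma bar_comm_R {X : O} (hX : X ∈ C.one) {d i : ℕ} (h : d < i ∨ i + 1 < d) :
    (C.R i : O) * C.bar d X = C.bar d X * C.R i := by
  rcases h with h | h
  · exact C.R_comm (C.bar_off hX h) (C.bar_off hX (by omega))
  · obtain ⟨e, rfl⟩ : ∃ e, d = i + 2 + e := ⟨d - i - 2, by omega⟩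
    clear h
    rw [comm_iff_cj]
    induction e with
    | zero =>
      rw [add_zero, show i + 2 = (i + 1) + 1 from rfl, bar_succ, bar_succ, ← cj_mul, ← cj_mul,
        C.compat₁, cj_mul,
        cj_eq_of_comm (C.R_comm (C.bar_off hX (by omega)) (C.bar_off hX (by omega))), cj_mul]
    | succ e ih =>
      rw [← add_assoc, bar_succ, ← cj_mul, C.RF_comm (by omega), cj_mul, ih]

lemma bar_comm_F {X : O} (hX : X ∈ C.one) {d i : ℕ} (h : d < i ∨ i + 1 < d) :
    (C.F i : O) * C.bar d X = C.bar d X * C.F i := by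
  rcases h with h | h
  · exact C.F_comm (C.bar_off hX h) (C.bar_off hX (by omega))
  · obtain ⟨e, rfl⟩ : ∃ e, d = i + 2 + e := ⟨d - i - 2, by omega⟩
    clear h
    rw [comm_iff_cj]
    induction e with
    | zero =>
      rw [add_zero, show i + 2 = (i + 1) + 1 from rfl, bar_succ, bar_succ, ← cj_mul, ← cj_mul,
        C.F_braid, cj_mul,
        cj_eq_of_comm (C.F_comm (C.bar_off hX (by omega)) (C.bar_off hX (by omega))), cj_mul]
    | succ e ih =>
      rw [← add_assoc, bar_succ, ← cj_mul, C.FF_comm (by omega), cj_mul, ih]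

lemma E_bar {X : O} (hX : X ∈ C.one) (d : ℕ) : C.E d (C.bar d X) = C.E 0 X := by
  induction d with
  | zero => rfl
  | succ d ih => rw [bar_succ, cj_def, C.E_conjF d (C.bar_off hX (by omega)), ih]

lemma E_zero_off {X : O} (hX : X ∈ C.one) (j : ℕ) : C.E 0 X ∈ C.off j := by
  rcases j with _ | j
  · exact C.E_mem _ _
  · exact C.E_mem_of _ (C.mem_one.mp hX j)

/-- The copy `M_{\bar d}`. -/
def M (d : ℕ) : O := C.bar d C.M₀

/-- `M_{\bar d} ⋯ M_{\overline{d+n-1}}`. -/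
def Mseq (d : ℕ) : ℕ → O
  | 0 => 1
  | n + 1 => Mseq d n * C.M (d + n)

@[simp] lemma Mseq_zero (d : ℕ) : C.Mseq d 0 = 1 := rfl

lemma Mseq_succ (d n : ℕ) : C.Mseq d (n + 1) = C.Mseq d n * C.M (d + n) := rfl

lemma Mseq_add (d n p : ℕ) : C.Mseq d (n + p) = C.Mseq d n * C.Mseq (d + n) p := by
  induction p with
  | zero => simp
  | succ p ih => rw [← add_assoc, Mseq_succ, ih, Mseq_succ, mul_assoc, add_assoc d n p]

lemma M_off {d j : ℕ} (h : d < j) : C.M d ∈ C.off j := C.bar_off C.M₀_mem h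

lemma Mseq_off {d n j : ℕ} (h : d + n ≤ j) : C.Mseq d n ∈ C.off j := by
  induction n with
  | zero => exact one_mem _
  | succ n ih => exact mul_mem (ih (by omega)) (C.M_off (by omega))

lemma M_comm_R {d i : ℕ} (h : d < i ∨ i + 1 < d) : (C.R i : O) * C.M d = C.M d * C.R i :=
  C.bar_comm_R C.M₀_mem h

lemma M_comm_F {d i : ℕ} (h : d < i ∨ i + 1 < d) : (C.F i : O) * C.M d = C.M d * C.F i :=
  C.bar_comm_F C.M₀_mem h

lemma cj_F_M (d : ℕ) : cj (C.F d) (C.M d) = C.M (d + 1) := rfl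

lemma RMM_all (i : ℕ) : (C.R i : O) * (C.M i * C.M (i + 1)) = C.M i * C.M (i + 1) * C.R i := by
  induction i with
  | zero => exact C.RMM
  | succ i ih =>
    rw [comm_iff_cj] at ih ⊢
    have e : C.M (i + 1) * C.M (i + 1 + 1) = cj (C.F i * C.F (i + 1)) (C.M i * C.M (i + 1)) := by
      rw [map_mul, cj_mul, cj_mul, cj_F_M, cj_eq_of_comm (C.M_comm_F (Or.inl (by omega))), cj_F_M,
        cj_eq_of_comm (C.M_comm_F (Or.inr (by omega)))]
    rw [e, ← cj_mul, ← mul_assoc, C.compat₂, cj_mul, ih]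

lemma Mseq_comm_R {d n i : ℕ} (h : i + 1 < d ∨ d + n ≤ i) :
    (C.R i : O) * C.Mseq d n = C.Mseq d n * C.R i := by
  induction n with
  | zero => simp
  | succ n ih =>
    rw [Mseq_succ, ← mul_assoc, ih (by omega), mul_assoc, C.M_comm_R (by omega), mul_assoc]

lemma Mseq_comm_R_of_mem {d n i : ℕ} (h1 : d ≤ i) (h2 : i + 1 < d + n) :
    (C.R i : O) * C.Mseq d n = C.Mseq d n * C.R i := by
  obtain ⟨s, r, rfl, rfl⟩ : ∃ s r, i = d + s ∧ n = s + (2 + r) :=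
    ⟨i - d, n - (i - d) - 2, by omega, by omega⟩
  have e : C.Mseq (d + s) 2 = C.M (d + s) * C.M (d + s + 1) := by simp [Mseq_succ]
  rw [Mseq_add, Mseq_add, ← mul_assoc, C.Mseq_comm_R (Or.inr le_rfl), mul_assoc, ← mul_assoc _ _
    (C.Mseq (d + s + 2) r), e, C.RMM_all, mul_assoc _ _ (C.Mseq (d + s + 2) r),
    C.Mseq_comm_R (Or.inl (by omega))]
  simp only [mul_assoc]

lemma Mseq_comm_W {d n : ℕ} {w : O} (hw : w ∈ C.W d n) : w * C.Mseq d n = C.Mseq d n * w :=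
  C.W_comm hw fun _ h1 h2 => C.Mseq_comm_R_of_mem h1 h2

/-! ### Shifting by one site -/

/-- `F_0 ⋯ F_{n-1}`. -/
def Fw : ℕ → Oˣ
  | 0 => 1
  | n + 1 => Fw n * C.F n

lemma Fw_succ (n : ℕ) : C.Fw (n + 1) = C.Fw n * C.F n := rfl

lemma Fw_mem {n j : ℕ} (h : n < j) : (C.Fw n : O) ∈ C.off j ∧ (↑(C.Fw n)⁻¹ : O) ∈ C.off j := by
  induction n with
  | zero => simp [Fw, one_mem]
  | succ n ih =>
    rw [Fw_succ, mul_inv_rev, Units.val_mul, Units.val_mul]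
    exact ⟨mul_mem (ih (by omega)).1 (C.F_off (by omega) (by omega)),
      mul_mem (C.Fi_off (by omega) (by omega)) (ih (by omega)).2⟩

lemma cj_Fw_eq {n : ℕ} {X : O} (h : ∀ i, i < n → cj (C.F i) X = X) : cj (C.Fw n) X = X := by
  induction n with
  | zero => simp [Fw]
  | succ n ih => rw [Fw_succ, cj_mul, h n (by omega), ih fun i hi => h i (by omega)]

lemma cj_Fw_bar {X : O} (hX : X ∈ C.one) {d n : ℕ} (h : d < n) :
    cj (C.Fw n) (C.bar d X) = C.bar (d + 1) X := by
  obtain ⟨e, rfl⟩ : ∃ e, n = d + 1 + e := ⟨n - d - 1, by omega⟩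
  clear h
  induction e with
  | zero =>
    rw [add_zero, Fw_succ, cj_mul, ← bar_succ]
    exact C.cj_Fw_eq fun i hi => cj_eq_of_comm (C.bar_comm_F hX (Or.inr (by omega)))
  | succ e ih =>
    rw [← add_assoc, Fw_succ, cj_mul, cj_eq_of_comm (C.bar_comm_F hX (Or.inl (by omega))), ih]

lemma cj_Fw_R_aux (i : ℕ) (e : ℕ) :
    C.Fw (i + 2 + e) * C.R i = C.R (i + 1) * C.Fw (i + 2 + e) := by
  induction e with
  | zero =>
    rw [add_zero, show i + 2 = (i + 1) + 1 from rfl, Fw_succ, Fw_succ, mul_assoc, mul_assoc,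
      ← mul_assoc (C.F i), ← C.compat₂, ← mul_assoc, ← mul_assoc, ← mul_assoc]
    have : C.Fw i * C.R (i + 1) = C.R (i + 1) * C.Fw i := by
      have : ∀ n, n ≤ i → C.Fw n * C.R (i + 1) = C.R (i + 1) * C.Fw n := by
        intro n
        induction n with
        | zero => simp [Fw]
        | succ n ih =>
          intro h
          rw [Fw_succ, mul_assoc, C.FR_comm (by omega), ← mul_assoc, ih (by omega), mul_assoc]
      exact this i le_rfl
    rw [this]
    simp only [mul_assoc]
  | succ e ih =>
    rw [← add_assoc, Fw_succ, mul_assoc, ← C.RF_comm (by omega), ← mul_assoc, ih, mul_assoc]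

lemma Fw_mul_R {i n : ℕ} (h : i + 1 < n) : C.Fw n * C.R i = C.R (i + 1) * C.Fw n := by
  obtain ⟨e, rfl⟩ : ∃ e, n = i + 2 + e := ⟨n - i - 2, by omega⟩
  exact C.cj_Fw_R_aux i e

lemma cj_Fw_M {d n : ℕ} (h : d < n) : cj (C.Fw n) (C.M d) = C.M (d + 1) :=
  C.cj_Fw_bar C.M₀_mem h

lemma cj_Fw_Mseq {d n p : ℕ} (h : d + p ≤ n) :
    cj (C.Fw n) (C.Mseq d p) = C.Mseq (d + 1) p := by
  induction p with
  | zero => simp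
  | succ p ih =>
    rw [Mseq_succ, map_mul, ih (by omega), C.cj_Fw_M (by omega), Mseq_succ]
    congr 2; omega

lemma ET_cj_Fw (d p : ℕ) {X : O} (hX : ∀ j, d + p ≤ j → X ∈ C.off j) :
    C.ET (d + 1) p (cj (C.Fw (d + p)) X) = cj (C.Fw d) (C.ET d p X) := by
  induction p generalizing X with
  | zero => rfl
  | succ p ih =>
    rw [ET_succ, ET_succ, ← ih]
    · congr 1
      have e : d + 1 + p = d + p + 1 := by omega
      rw [e, ← add_assoc, Fw_succ, cj_mul, cj_def, C.E_mul_right (C.Fw_mem (by omega)).2,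
        C.E_mul_left (C.Fw_mem (by omega)).1, cj_def (C.F (d + p)), C.E_conjF _ (hX _ (by omega)),
        cj_def]
    · intro j hj
      by_cases h : j = d + p
      · subst h; exact C.E_mem _ _
      · exact C.E_mem_of _ (hX j (by omega))

/-! ### The braid group representation -/

/-- The representation `σ_i ↦ R_{d+i}` of the braid group. -/
def repGroup (d m : ℕ) : Braid m →* Oˣ :=
  PresentedGroup.toGroup (f := fun i : Fin m => C.R (d + i.val)) (by
    rintro r ⟨i, j, ⟨hij, rfl⟩ | ⟨hij, rfl⟩⟩
    · simp only [map_mul, map_inv, FreeGroup.lift_apply_of]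
      rw [← hij, ← add_assoc]
      exact mul_inv_eq_one.mpr (C.R_braid _)
    · simp only [map_mul, map_inv, FreeGroup.lift_apply_of]
      exact mul_inv_eq_one.mpr (C.Ru_comm (by omega)))

lemma repGroup_sig (d : ℕ) {m : ℕ} (i : Fin m) : C.repGroup d m (sig i) = C.R (d + i.val) :=
  PresentedGroup.toGroup.of _

/-- The representation `σ_i ↦ R_{d+i}` of the group algebra of the braid group. -/
def rep (d : ℕ) {m : ℕ} : BraidAlg m →ₐ[ℂ] O :=
  MonoidAlgebra.lift ℂ O (Braid m) ((Units.coeHom O).comp (C.repGroup d m))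

lemma rep_of (d : ℕ) {m : ℕ} (b : Braid m) :
    C.rep d (MonoidAlgebra.of ℂ (Braid m) b) = C.repGroup d m b := by
  simp [rep]

@[simp] lemma rep_sigA (d : ℕ) {m : ℕ} (i : Fin m) : C.rep d (sigA i) = C.R (d + i.val) := by
  rw [sigA, rep_of, repGroup_sig]

lemma repGroup_shift (d e : ℕ) {m m' : ℕ} (h : e + m ≤ m') (b : Braid m) :
    C.repGroup d m' (braidShift e h b) = C.repGroup (d + e) m b := by
  have : (C.repGroup d m').comp (braidShift e h) = C.repGroup (d + e) m := by
    apply PresentedGroup.ext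
    intro i
    have h1 : braidShift e h (PresentedGroup.of i) = sig (⟨e + i.val, by omega⟩ : Fin m') :=
      PresentedGroup.toGroup.of _
    rw [MonoidHom.comp_apply, h1, repGroup_sig, ← sig, repGroup_sig]
    simp [add_assoc]
  exact DFunLike.congr_fun this b

lemma rep_shift (d e : ℕ) {m m' : ℕ} (h : e + m ≤ m') (α : BraidAlg m) :
    C.rep d (algShift e h α) = C.rep (d + e) α := by
  have : (C.rep d).comp (algShift e h) = C.rep (d + e) := by
    refine MonoidAlgebra.algHom_ext (fun b => ?_) (Subsingleton.elim _ _)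
    have h2 : algShift e h (MonoidAlgebra.single b 1) =
        MonoidAlgebra.of ℂ (Braid m') (braidShift e h b) := by
      simp [algShift]
    have h3 : (MonoidAlgebra.single b 1 : BraidAlg m) = MonoidAlgebra.of ℂ (Braid m) b := rfl
    rw [AlgHom.comp_apply, h2, rep_of, repGroup_shift, h3, rep_of]
  exact DFunLike.congr_fun this α

lemma rep_induction {m : ℕ} {P : BraidAlg m → Prop} (α : BraidAlg m)
    (h1 : ∀ z : ℂ, P (algebraMap ℂ _ z)) (hs : ∀ i, P (sigA i))
    (hi : ∀ i, P (MonoidAlgebra.of ℂ (Braid m) (sig i)⁻¹))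
    (ha : ∀ x y, P x → P y → P (x + y)) (hm : ∀ x y, P x → P y → P (x * y)) : P α := by
  have hb : ∀ b : Braid m, P (MonoidAlgebra.of ℂ (Braid m) b) := by
    intro b
    have : b ∈ Subgroup.closure (Set.range (PresentedGroup.of (rels := braidRels m))) := by
      rw [PresentedGroup.closure_range_of]; trivial
    refine Subgroup.closure_induction'' (p := fun b _ => P (MonoidAlgebra.of ℂ (Braid m) b))
      ?_ ?_ ?_ ?_ this
    · rintro _ ⟨i, rfl⟩; exact hs i
    · rintro _ ⟨i, rfl⟩; exact hi i
    · have := h1 1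
      rwa [map_one] at this ⊢
    · intro x y _ _ hx hy
      rw [map_mul]; exact hm _ _ hx hy
  induction α using MonoidAlgebra.induction_on with
  | of b => exact hb b
  | add f g hf hg => exact ha _ _ hf hg
  | smul r f hf => rw [Algebra.smul_def]; exact hm _ _ (h1 r) hf

lemma rep_mem_W (d : ℕ) {m : ℕ} (α : BraidAlg m) : C.rep d α ∈ C.W d (m + 1) := by
  refine rep_induction (P := fun α => C.rep d α ∈ C.W d (m + 1)) α ?_ ?_ ?_ ?_ ?_
  · intro z; rw [AlgHom.commutes]; exact Subalgebra.algebraMap_mem _ _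
  · intro i; rw [rep_sigA]; exact C.R_mem_W (by omega) (by omega)
  · intro i; rw [rep_of, map_inv, repGroup_sig]; exact C.Ri_mem_W (by omega) (by omega)
  · intro x y hx hy; rw [map_add]; exact add_mem hx hy
  · intro x y hx hy; rw [map_mul]; exact mul_mem hx hy

lemma exists_rep {d m : ℕ} {w : O} (hw : w ∈ C.W d (m + 1)) :
    ∃ α : BraidAlg m, C.rep d α = w := by
  have : C.W d (m + 1) ≤ (C.rep d (m := m)).range := C.W_le fun i h1 h2 => by
    obtain ⟨j, rfl⟩ : ∃ j, i = d + j := ⟨i - d, by omega⟩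
    refine ⟨⟨sigA ⟨j, by omega⟩, by simp⟩,
      ⟨MonoidAlgebra.of ℂ _ (sig (⟨j, by omega⟩ : Fin m))⁻¹, ?_⟩⟩
    change C.rep d _ = _
    rw [rep_of, map_inv, repGroup_sig]
  exact this hw

lemma cj_rep (u : Oˣ) {d e m : ℕ} (h : ∀ i, i < m → u * C.R (d + i) = C.R (e + i) * u)
    (α : BraidAlg m) : cj u (C.rep d α) = C.rep e α := by
  refine rep_induction (P := fun α => cj u (C.rep d α) = C.rep e α) α ?_ ?_ ?_ ?_ ?_
  · intro z; simp only [AlgHom.commutes]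
  · intro i; rw [rep_sigA, rep_sigA]; exact cj_units _ _ _ (h i i.isLt)
  · intro i; rw [rep_of, rep_of, map_inv, map_inv, repGroup_sig, repGroup_sig]
    exact cj_units_inv _ _ _ (h i i.isLt)
  · intro x y hx hy; rw [map_add, map_add, hx, hy, map_add]
  · intro x y hx hy; rw [map_mul, map_mul, hx, hy, map_mul]

lemma cj_Fw_rep {d m n : ℕ} (h : d + m + 1 ≤ n) (α : BraidAlg m) :
    cj (C.Fw n) (C.rep d α) = C.rep (d + 1) α :=
  C.cj_rep _ (fun i hi => by rw [C.Fw_mul_R (by omega)]; congr 2; omega) α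

/-! ### Matrix powers and characters -/

/-- `Tr_{(1,…,m)} M_{\bar 0} ⋯ M_{\bar m} w`. -/
def mp (m : ℕ) (w : O) : O := C.ET 1 m (C.Mseq 0 (m + 1) * w)

/-- `Tr_{(0,…,m)} M_{\bar 0} ⋯ M_{\bar m} w`. -/
def chi (m : ℕ) (w : O) : O := C.ET 0 (m + 1) (C.Mseq 0 (m + 1) * w)

lemma chi_eq (m : ℕ) (w : O) : C.chi m w = C.E 0 (C.mp m w) := by
  rw [chi, ET_succ', mp]

lemma mp_add (m : ℕ) (v w : O) : C.mp m (v + w) = C.mp m v + C.mp m w := by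
  rw [mp, mul_add, map_add]; rfl

lemma mp_smul (m : ℕ) (z : ℂ) (w : O) : C.mp m (z • w) = z • C.mp m w := by
  rw [mp, mul_smul_comm, map_smul]; rfl

lemma chi_add (m : ℕ) (v w : O) : C.chi m (v + w) = C.chi m v + C.chi m w := by
  rw [chi, mul_add, map_add]; rfl

lemma chi_smul (m : ℕ) (z : ℂ) (w : O) : C.chi m (z • w) = z • C.chi m w := by
  rw [chi, mul_smul_comm, map_smul]; rfl

lemma mp_zero (w : O) : C.mp 0 w = C.M₀ * w := by
  simp [mp, Mseq_succ, M]

lemma mp_mem_one {m : ℕ} {w : O} (hw : ∀ j, m < j → w ∈ C.off j) : C.mp m w ∈ C.one := by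
  rw [mem_one]
  intro j
  by_cases h : j < m
  · exact C.ET_mem (by omega) (by omega) _
  · exact C.ET_mem_of _ _ (mul_mem (C.Mseq_off (by omega)) (hw _ (by omega)))

lemma W_zero_off {m : ℕ} {w : O} (hw : w ∈ C.W 0 (m + 1)) : ∀ j, m < j → w ∈ C.off j :=
  fun _ hj => C.W_off (by omega) hw

lemma chi_off {m : ℕ} {w : O} (hw : ∀ j, m < j → w ∈ C.off j) (j : ℕ) : C.chi m w ∈ C.off j := by
  rw [chi_eq]; exact C.E_zero_off (C.mp_mem_one hw) j

lemma mp_cyc {m : ℕ} {u : O} (hu : u ∈ C.W 1 m) (w : O) : C.mp m (w * u) = C.mp m (u * w) := by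
  rw [mp, mp, ← mul_assoc, C.ET_cyc hu, ← mul_assoc, ← mul_assoc,
    C.Mseq_comm_W (C.W_mono (by omega) (by omega) hu)]

lemma chi_cyc {m : ℕ} {u : O} (hu : u ∈ C.W 0 (m + 1)) (w : O) :
    C.chi m (w * u) = C.chi m (u * w) := by
  rw [chi, chi, ← mul_assoc, C.ET_cyc (by simpa using hu), ← mul_assoc, ← mul_assoc,
    C.Mseq_comm_W hu]

lemma ET_Mseq_rep (d : ℕ) {m : ℕ} (α : BraidAlg m) :
    C.ET (d + 1) m (C.Mseq d (m + 1) * C.rep d α) = C.bar d (C.mp m (C.rep 0 α)) := by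
  induction d with
  | zero => rw [mp]; rfl
  | succ d ih =>
    have h1 : C.Mseq (d + 1) (m + 1) * C.rep (d + 1) α =
        cj (C.Fw (d + 1 + m)) (C.Mseq d (m + 1) * C.rep d α) := by
      rw [map_mul, C.cj_Fw_Mseq (by omega), C.cj_Fw_rep (by omega)]
    rw [h1, C.ET_cj_Fw, ih, C.cj_Fw_bar (C.mp_mem_one (C.W_zero_off (C.rep_mem_W 0 α))) (by omega)]
    intro j hj
    exact mul_mem (C.Mseq_off (by omega)) (C.W_off (by omega) (C.rep_mem_W d α))

lemma ET_Mseq_rep' (d : ℕ) {m : ℕ} (α : BraidAlg m) :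
    C.ET d (m + 1) (C.Mseq d (m + 1) * C.rep d α) = C.chi m (C.rep 0 α) := by
  rw [ET_succ', C.ET_Mseq_rep, C.E_bar (C.mp_mem_one (C.W_zero_off (C.rep_mem_W 0 α))), chi_eq]

lemma mp_mul_chi {m p : ℕ} (α : BraidAlg m) (β : BraidAlg p) :
    C.mp (m + p + 1) (C.rep 0 α * C.rep (m + 1) β) = C.mp m (C.rep 0 α) * C.chi p (C.rep 0 β) := by
  have h1 : C.Mseq 0 (m + p + 1 + 1) = C.Mseq 0 (m + 1) * C.Mseq (m + 1) (p + 1) := by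
    rw [show m + p + 1 + 1 = (m + 1) + (p + 1) by omega, Mseq_add, zero_add]
  have h2 : C.rep 0 α * C.Mseq (m + 1) (p + 1) = C.Mseq (m + 1) (p + 1) * C.rep 0 α :=
    C.W_comm (C.rep_mem_W 0 α) fun i _ h => C.Mseq_comm_R (Or.inl (by omega))
  have hc : ∀ j, C.chi p (C.rep 0 β) ∈ C.off j := C.chi_off (C.W_zero_off (C.rep_mem_W 0 β))
  rw [mp, h1, show m + p + 1 = m + (p + 1) by omega, ET_add]
  have h3 : C.Mseq 0 (m + 1) * C.Mseq (m + 1) (p + 1) * (C.rep 0 α * C.rep (m + 1) β) =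
      (C.Mseq 0 (m + 1) * C.rep 0 α) * (C.Mseq (m + 1) (p + 1) * C.rep (m + 1) β) := by
    simp only [mul_assoc]
    rw [← mul_assoc (C.rep 0 α), h2, mul_assoc]
  rw [h3, C.ET_mul_left, add_comm 1 m, C.ET_Mseq_rep', C.ET_mul_right fun j _ _ => hc j]
  · rfl
  · intro j h4 h5
    exact mul_mem (C.Mseq_off (by omega)) (C.W_off (by omega) (C.rep_mem_W 0 α))

lemma chi_mul_chi {m p : ℕ} (α : BraidAlg m) (β : BraidAlg p) :
    C.chi (m + p + 1) (C.rep 0 α * C.rep (m + 1) β) =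
      C.chi m (C.rep 0 α) * C.chi p (C.rep 0 β) := by
  rw [chi_eq, mp_mul_chi, C.E_mul_right (C.chi_off (C.W_zero_off (C.rep_mem_W 0 β)) 0), ← chi_eq]

end QChain

end
noncomputable section
namespace QChain

variable {O : Type} [Ring O] [Algebra ℂ O] (C : QChain O)

/-! ### Block braids -/

/-- `R_{j+p-1}⁻¹ ⋯ R_j⁻¹`. -/
def Dw (j : ℕ) : ℕ → Oˣ
  | 0 => 1
  | p + 1 => (C.R (j + p))⁻¹ * Dw j p

/-- `Dw 0 p ⋯ Dw (n-1) p`, which interchanges blocks of `n` and of `p` strands. -/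
def Xw (p : ℕ) : ℕ → Oˣ
  | 0 => 1
  | n + 1 => Xw p n * C.Dw n p

/-- `Dw 1 p ⋯ Dw n p`. -/
def Xw' (p : ℕ) : ℕ → Oˣ
  | 0 => 1
  | n + 1 => Xw' p n * C.Dw (n + 1) p

/-- `R_0 ⋯ R_{n-1}`. -/
def Yw : ℕ → Oˣ
  | 0 => 1
  | n + 1 => Yw n * C.R n

/-- `R_m ⋯ R_1 R_0 R_1⁻¹ ⋯ R_m⁻¹`. -/
def uw : ℕ → Oˣ
  | 0 => C.R 0
  | m + 1 => C.R (m + 1) * uw m * (C.R (m + 1))⁻¹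

lemma Dw_succ (j p : ℕ) : C.Dw j (p + 1) = (C.R (j + p))⁻¹ * C.Dw j p := rfl

lemma Dw_succ' (j p : ℕ) : C.Dw j (p + 1) = C.Dw (j + 1) p * (C.R j)⁻¹ := by
  induction p with
  | zero => simp [Dw]
  | succ p ih => rw [Dw_succ, ih, Dw_succ, ← mul_assoc]; congr 4; omega

lemma Ru_comm' {i j : ℕ} (h : i + 1 < j ∨ j + 1 < i) : C.R i * C.R j = C.R j * C.R i := by
  rcases h with h | h
  · exact C.Ru_comm h
  · exact (C.Ru_comm h).symm

lemma Ri_comm' {i j : ℕ} (h : i + 1 < j ∨ j + 1 < i) :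
    (C.R i)⁻¹ * C.R j = C.R j * (C.R i)⁻¹ :=
  (show Commute (C.R i) (C.R j) from C.Ru_comm' h).inv_left

lemma Dw_comm {i j p : ℕ} (h : i + 1 < j ∨ j + p < i) : C.Dw j p * C.R i = C.R i * C.Dw j p := by
  induction p with
  | zero => simp [Dw]
  | succ p ih =>
    rw [Dw_succ, mul_assoc, ih (by omega), ← mul_assoc, C.Ri_comm' (by omega), mul_assoc]

lemma braid_inv {G : Type} [Group G] {a b : G} (h : a * b * a = b * a * b) :
    a⁻¹ * b⁻¹ * a = b * a⁻¹ * b⁻¹ := by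
  rw [eq_mul_inv_iff_mul_eq, eq_mul_inv_iff_mul_eq]
  calc a⁻¹ * b⁻¹ * a * b * a = a⁻¹ * b⁻¹ * (a * b * a) := by group
    _ = b := by rw [h]; group

lemma R_mul_inv (i : ℕ) : (C.R (i + 1))⁻¹ * (C.R i)⁻¹ * C.R (i + 1) =
    C.R i * (C.R (i + 1))⁻¹ * (C.R i)⁻¹ := braid_inv (C.R_braid i).symm

lemma Dw_shift {i j p : ℕ} (h : i + 1 < p) :
    C.Dw j p * C.R (j + 1 + i) = C.R (j + i) * C.Dw j p := by
  obtain ⟨e, rfl⟩ : ∃ e, p = i + 2 + e := ⟨p - i - 2, by omega⟩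
  clear h
  induction e with
  | zero =>
    rw [add_zero, Dw_succ, Dw_succ, show j + 1 + i = j + i + 1 by omega,
      show j + (i + 1) = j + i + 1 by omega, mul_assoc, mul_assoc, C.Dw_comm (Or.inr (by omega)),
      ← mul_assoc, ← mul_assoc, C.R_mul_inv]
    simp only [mul_assoc]
  | succ e ih =>
    rw [← add_assoc, Dw_succ, mul_assoc, ih, ← mul_assoc, C.Ri_comm' (by omega), mul_assoc]

lemma Dw_pair (i p : ℕ) :
    C.Dw i p * C.Dw (i + 1) p * C.R i = C.R (i + p) * (C.Dw i p * C.Dw (i + 1) p) := by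
  induction p with
  | zero => simp [Dw]
  | succ p ih =>
    have e1 : C.Dw i p * (C.R (i + p + 1))⁻¹ = (C.R (i + p + 1))⁻¹ * C.Dw i p :=
      (show Commute _ _ from C.Dw_comm (Or.inr (by omega))).inv_right
    rw [Dw_succ, Dw_succ, show i + 1 + p = i + p + 1 by omega, show i + (p + 1) = i + p + 1 by omega]
    calc _ = (C.R (i + p))⁻¹ * (C.Dw i p * (C.R (i + p + 1))⁻¹) * C.Dw (i + 1) p * C.R i := by
          simp only [mul_assoc]
      _ = (C.R (i + p))⁻¹ * (C.R (i + p + 1))⁻¹ * (C.Dw i p * C.Dw (i + 1) p * C.R i) := by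
          rw [e1]; simp only [mul_assoc]
      _ = ((C.R (i + p))⁻¹ * (C.R (i + p + 1))⁻¹ * C.R (i + p)) *
          (C.Dw i p * C.Dw (i + 1) p) := by rw [ih]; simp only [mul_assoc]
      _ = (C.R (i + p + 1) * (C.R (i + p))⁻¹ * (C.R (i + p + 1))⁻¹) *
          (C.Dw i p * C.Dw (i + 1) p) := by
          congr 1
          exact braid_inv (C.R_braid (i + p))
      _ = _ := by
          have e2 := e1.symm
          simp only [mul_assoc]
          rw [← mul_assoc (C.R (i + p + 1))⁻¹, e2]
          simp only [mul_assoc]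

lemma Xw_mul_R {p n i : ℕ} (h : i + 1 < n) : C.Xw p n * C.R i = C.R (p + i) * C.Xw p n := by
  obtain ⟨e, rfl⟩ : ∃ e, n = i + 2 + e := ⟨n - i - 2, by omega⟩
  clear h
  induction e with
  | zero =>
    have e1 : ∀ m, m ≤ i → C.Xw p m * C.R (p + i) = C.R (p + i) * C.Xw p m := by
      intro m
      induction m with
      | zero => simp [Xw]
      | succ m ih =>
        intro hm
        rw [Xw, mul_assoc, C.Dw_comm (by omega), ← mul_assoc, ih (by omega), mul_assoc]
    rw [add_zero, Xw, Xw, mul_assoc, mul_assoc, ← mul_assoc (C.Dw i p), C.Dw_pair, ← mul_assoc,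
      add_comm i p, e1 i le_rfl]
    simp only [mul_assoc]
  | succ e ih =>
    rw [← add_assoc, Xw, mul_assoc, C.Dw_comm (by omega), ← mul_assoc, ih, mul_assoc]

lemma Xw_mul_R' {p i : ℕ} (h : i + 1 < p) (n : ℕ) :
    C.Xw p n * C.R (n + i) = C.R i * C.Xw p n := by
  induction n with
  | zero => simp [Xw]
  | succ n ih => rw [Xw, mul_assoc, C.Dw_shift h, ← mul_assoc, ih, mul_assoc]

lemma Yw_eq (p : ℕ) : C.Dw 0 p = (C.Yw p)⁻¹ := by
  induction p with
  | zero => simp [Dw, Yw]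
  | succ p ih => rw [Dw_succ, ih, Yw, mul_inv_rev, zero_add]

lemma Xw_eq (p n : ℕ) : C.Yw p * C.Xw p (n + 1) = C.Xw' p n := by
  induction n with
  | zero => simp [Xw, Xw', Yw_eq]
  | succ n ih => rw [Xw, ← mul_assoc, ih, Xw']

lemma Yw_mul_R {i p : ℕ} (h : i + 1 < p) : C.Yw p * C.R i = C.R (i + 1) * C.Yw p := by
  have := C.Dw_shift (j := 0) h
  rw [Yw_eq, inv_mul_eq_iff_eq_mul, ← mul_assoc, eq_mul_inv_iff_mul_eq] at this
  rw [show 0 + 1 + i = i + 1 by omega, zero_add] at this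
  exact this.symm

lemma uw_mem (m : ℕ) : ∀ {i}, m + 1 < i → C.uw m * C.R i = C.R i * C.uw m := by
  induction m with
  | zero => intro i h; exact C.Ru_comm h
  | succ m ih =>
    intro i h
    have e1 : Commute (C.R (m + 1)) (C.R i) := C.Ru_comm (by omega)
    have e2 : Commute (C.uw m) (C.R i) := ih (by omega)
    exact ((e1.mul_left e2).mul_left e1.inv_left)

lemma uw_comm_Dw (m : ℕ) {j : ℕ} (h : m + 1 < j) (p : ℕ) :
    C.Dw j p * C.uw m = C.uw m * C.Dw j p := by
  induction p with
  | zero => simp [Dw]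
  | succ p ih =>
    have e2 : Commute (C.R (j + p)) (C.uw m) := (C.uw_mem m (by omega)).symm
    exact (e2.inv_left.mul_left ih)

lemma Xw'_mul_uw (p m : ℕ) : C.Xw' (p + 1) m * C.uw m = C.R 0 * C.Xw' (p + 1) m := by
  induction m with
  | zero => simp [Xw', uw]
  | succ m ih =>
    rw [Xw', Dw_succ', uw]
    calc _ = C.Xw' (p + 1) m * (C.Dw (m + 1 + 1) p * C.uw m) * (C.R (m + 1))⁻¹ := by
          simp [mul_assoc]
      _ = (C.Xw' (p + 1) m * C.uw m) * C.Dw (m + 1 + 1) p * (C.R (m + 1))⁻¹ := by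
          rw [C.uw_comm_Dw m (by omega)]; simp only [mul_assoc]
      _ = _ := by rw [ih]; simp only [mul_assoc]

/-- Units whose value and inverse are both in the algebra of words. -/
def WU (a n : ℕ) : Subgroup Oˣ where
  carrier := {u | (u : O) ∈ C.W a n ∧ (↑u⁻¹ : O) ∈ C.W a n}
  one_mem' := by simp [one_mem]
  mul_mem' := by
    rintro u v ⟨h1, h2⟩ ⟨h3, h4⟩
    simp only [Set.mem_ofPred_eq, Units.val_mul, mul_inv_rev]
    exact ⟨mul_mem h1 h3, mul_mem h4 h2⟩
  inv_mem' := by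
    rintro u ⟨h1, h2⟩
    exact ⟨h2, by simpa using h1⟩

lemma R_mem_WU {a n i : ℕ} (h1 : a ≤ i) (h2 : i + 1 < a + n) : C.R i ∈ C.WU a n :=
  ⟨C.R_mem_W h1 h2, C.Ri_mem_W h1 h2⟩

lemma WU_off {a n j : ℕ} {u : Oˣ} (hu : u ∈ C.WU a n) (h : j < a ∨ a + n ≤ j) :
    (u : O) ∈ C.off j ∧ (↑u⁻¹ : O) ∈ C.off j := ⟨C.W_off h hu.1, C.W_off h hu.2⟩

lemma Dw_mem_WU {a n j p : ℕ} (h1 : a ≤ j) (h2 : j + p < a + n) : C.Dw j p ∈ C.WU a n := by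
  induction p with
  | zero => exact one_mem _
  | succ p ih => exact mul_mem (inv_mem (C.R_mem_WU (by omega) (by omega))) (ih (by omega))

lemma Xw_mem_WU {p n m : ℕ} (h : n + p ≤ m) : C.Xw p n ∈ C.WU 0 m := by
  induction n with
  | zero => exact one_mem _
  | succ n ih => exact mul_mem (ih (by omega)) (C.Dw_mem_WU (by omega) (by omega))

lemma Xw'_mem_WU {p n m : ℕ} (h : n + p ≤ m) : C.Xw' p n ∈ C.WU 1 m := by
  induction n with
  | zero => exact one_mem _
  | succ n ih => exact mul_mem (ih (by omega)) (C.Dw_mem_WU (by omega) (by omega))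

lemma Yw_mem_WU {n m : ℕ} (h : n < m) : C.Yw n ∈ C.WU 0 m := by
  induction n with
  | zero => exact one_mem _
  | succ n ih => exact mul_mem (ih (by omega)) (C.R_mem_WU (by omega) (by omega))

lemma uw_mem_WU {n m : ℕ} (h : n + 1 < m) : C.uw n ∈ C.WU 0 m := by
  induction n with
  | zero => exact C.R_mem_WU (by omega) (by omega)
  | succ n ih =>
    have := C.R_mem_WU (a := 0) (n := m) (i := n + 1) (by omega) (by omega)
    exact mul_mem (mul_mem this (ih (by omega))) (inv_mem this)

lemma mp_cj {m : ℕ} {u : Oˣ} (hu : u ∈ C.WU 1 m) (w : O) : C.mp m (cj u w) = C.mp m w := by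
  rw [cj_def, C.mp_cyc hu.2, ← mul_assoc, Units.inv_mul, one_mul]

lemma chi_cj {m : ℕ} {u : Oˣ} (hu : u ∈ C.WU 0 (m + 1)) (w : O) :
    C.chi m (cj u w) = C.chi m w := by
  rw [cj_def, C.chi_cyc hu.2, ← mul_assoc, Units.inv_mul, one_mul]

lemma chi_comm {m p : ℕ} (α : BraidAlg m) (β : BraidAlg p) :
    C.chi m (C.rep 0 α) * C.chi p (C.rep 0 β) = C.chi p (C.rep 0 β) * C.chi m (C.rep 0 α) := by
  rw [← chi_mul_chi, ← chi_mul_chi, ← C.chi_cj (C.Xw_mem_WU (p := p + 1) (n := m + 1)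
    (by omega)), map_mul, C.cj_rep (C.Xw (p + 1) (m + 1)) (d := 0) (e := p + 1)
      (fun i hi => by rw [zero_add, C.Xw_mul_R (by omega)]),
    C.cj_rep (C.Xw (p + 1) (m + 1)) (d := m + 1) (e := 0)
      (fun i hi => by rw [zero_add, C.Xw_mul_R' (by omega)])]
  have e : C.rep 0 β * C.rep (p + 1) α = C.rep (p + 1) α * C.rep 0 β :=
    C.W_comm_of_off (C.rep_mem_W 0 β) fun j _ h =>
      C.W_off (by omega) (C.rep_mem_W (p + 1) α)
  rw [e, show m + p + 1 = p + m + 1 by omega]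

/-! ### The `⋆`-product -/

/-- `R_{d+m} ⋯ R_{d+1} R_d R_{d+1}⁻¹ ⋯ R_{d+m}⁻¹`. -/
def uwd (d : ℕ) : ℕ → Oˣ
  | 0 => C.R d
  | m + 1 => C.R (d + m + 1) * uwd d m * (C.R (d + m + 1))⁻¹

lemma uwd_zero (m : ℕ) : C.uwd 0 m = C.uw m := by
  induction m with
  | zero => rfl
  | succ m ih => rw [uwd, uw, ih, zero_add]

lemma repGroup_starBraid (d m p : ℕ) : C.repGroup d (m + p + 1) (starBraid m p) = C.uwd d m := by
  have hV : C.repGroup d (m + p + 1) (((List.ofFn fun j : Fin m =>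
      sig (⟨j.val + 1, by omega⟩ : Fin (m + p + 1))).reverse).prod) =
      ((List.ofFn fun j : Fin m => C.R (d + j.val + 1)).reverse).prod := by
    rw [map_list_prod, List.map_reverse, List.map_ofFn]
    congr 3
    funext j
    simp [repGroup_sig, add_assoc]
  have hu : ∀ m, ((List.ofFn fun j : Fin m => C.R (d + j.val + 1)).reverse).prod * C.R d *
      (((List.ofFn fun j : Fin m => C.R (d + j.val + 1)).reverse).prod)⁻¹ = C.uwd d m := by
    intro m
    induction m with
    | zero => simp [uwd]
    | succ m ih =>
      rw [List.ofFn_succ_last, List.reverse_append, List.prod_append, uwd, ← ih]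
      simp [mul_assoc]
  rw [starBraid, map_mul, map_mul, map_inv, hV, repGroup_sig, ← hu]
  rfl

lemma rep_starExp' (d : ℕ) {m p : ℕ} (α : BraidAlg m) (β : BraidAlg p) :
    C.rep d (starExp α β) = C.rep d α * C.rep (d + m + 1) β * C.uwd d m := by
  rw [starExp, map_mul, map_mul, rep_shift, rep_shift, rep_of, repGroup_starBraid]
  rfl

lemma rep_starExp {m p : ℕ} (α : BraidAlg m) (β : BraidAlg p) :
    C.rep 0 (starExp α β) = C.rep 0 α * C.rep (m + 1) β * C.uw m := by
  rw [rep_starExp', uwd_zero, zero_add]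

/-- `R_0⁻¹ ⋯ R_{n-1}⁻¹`. -/
def Zw : ℕ → Oˣ
  | 0 => 1
  | n + 1 => Zw n * (C.R n)⁻¹

lemma Zw_mem_WU {n m : ℕ} (h : n < m) : C.Zw n ∈ C.WU 0 m := by
  induction n with
  | zero => exact one_mem _
  | succ n ih => exact mul_mem (ih (by omega)) (inv_mem (C.R_mem_WU (by omega) (by omega)))

lemma Zw_comm {n i : ℕ} (h : n < i) : C.R i * C.Zw n = C.Zw n * C.R i := by
  induction n with
  | zero => simp [Zw]
  | succ n ih =>
    rw [Zw, ← mul_assoc, ih (by omega), mul_assoc, mul_assoc, ← C.Ri_comm' (Or.inl (by omega))]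

lemma Yw_comm {n i : ℕ} (h : n < i) : C.R i * C.Yw n = C.Yw n * C.R i := by
  induction n with
  | zero => simp [Yw]
  | succ n ih =>
    rw [Yw, ← mul_assoc, ih (by omega), mul_assoc, mul_assoc, ← C.Ru_comm (by omega)]

lemma uw_eq (m : ℕ) : C.uw m = C.Zw m * C.R m * (C.Zw m)⁻¹ := by
  induction m with
  | zero => simp [uw, Zw]
  | succ m ih =>
    have e1 := C.Zw_comm (n := m) (i := m + 1) (by omega)
    have e2 : (C.Zw m)⁻¹ * (C.R (m + 1))⁻¹ = (C.R (m + 1))⁻¹ * (C.Zw m)⁻¹ := by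
      rw [← mul_inv_rev, ← mul_inv_rev, e1]
    have e3 : C.R (m + 1) * C.R m * (C.R (m + 1))⁻¹ = (C.R m)⁻¹ * C.R (m + 1) * C.R m := by
      rw [mul_inv_eq_iff_eq_mul, mul_assoc, mul_assoc, eq_inv_mul_iff_mul_eq, ← mul_assoc,
        ← mul_assoc, C.R_braid]
    rw [uw, ih, Zw]
    calc _ = (C.R (m + 1) * C.Zw m) * C.R m * ((C.Zw m)⁻¹ * (C.R (m + 1))⁻¹) := by
          simp only [mul_assoc]
      _ = C.Zw m * (C.R (m + 1) * C.R m * (C.R (m + 1))⁻¹) * (C.Zw m)⁻¹ := by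
          rw [e1, e2]; simp only [mul_assoc]
      _ = _ := by rw [e3]; simp [mul_assoc]

lemma uw_mul_uw (m p : ℕ) : C.uw m * C.uw (m + p + 1) = C.uwd (m + 1) p * C.uw m := by
  induction p with
  | zero =>
    have h : C.uw m * C.R (m + 1) * C.uw m = C.R (m + 1) * C.uw m * C.R (m + 1) := by
      have e1 : Commute (C.R (m + 1)) (C.Zw m) := C.Zw_comm (by omega)
      have e2 : (C.Zw m)⁻¹ * (C.R (m + 1) * C.Zw m) = C.R (m + 1) := by
        rw [e1.eq, inv_mul_cancel_left]
      have e3 : (C.Zw m)⁻¹ * C.R (m + 1) = C.R (m + 1) * (C.Zw m)⁻¹ := e1.symm.inv_left.eq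
      rw [uw_eq]
      calc _ = C.Zw m * C.R m * ((C.Zw m)⁻¹ * (C.R (m + 1) * C.Zw m)) * C.R m * (C.Zw m)⁻¹ := by
            simp only [mul_assoc]
        _ = C.Zw m * (C.R m * C.R (m + 1) * C.R m) * (C.Zw m)⁻¹ := by
            rw [e2]; simp only [mul_assoc]
        _ = (C.Zw m * C.R (m + 1)) * C.R m * (C.R (m + 1) * (C.Zw m)⁻¹) := by
            rw [C.R_braid]; simp only [mul_assoc]
        _ = _ := by rw [← e1.eq, ← e3]; simp only [mul_assoc]
    rw [add_zero, uwd, uw, ← mul_assoc, ← mul_assoc, h, mul_inv_cancel_right]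
  | succ p ih =>
    have e : Commute (C.uw m) (C.R (m + p + 1 + 1)) := C.uw_mem m (by omega)
    rw [show m + (p + 1) + 1 = m + p + 1 + 1 by omega, uw, uwd,
      show m + 1 + p + 1 = m + p + 1 + 1 by omega]
    calc _ = (C.uw m * C.R (m + p + 1 + 1)) * C.uw (m + p + 1) * (C.R (m + p + 1 + 1))⁻¹ := by
          simp only [mul_assoc]
      _ = C.R (m + p + 1 + 1) * C.uwd (m + 1) p * (C.uw m * (C.R (m + p + 1 + 1))⁻¹) := by
          rw [e.eq, mul_assoc (C.R _) (C.uw m), ih]; simp only [mul_assoc]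
      _ = _ := by rw [e.inv_right.eq]; simp only [mul_assoc]

lemma mp_starExp_assoc {m p r : ℕ} (α : BraidAlg m) (β : BraidAlg p) (γ : BraidAlg r) :
    C.mp (m + p + 1 + r + 1) (C.rep 0 (starExp (starExp α β) γ)) =
      C.mp (m + (p + r + 1) + 1) (C.rep 0 (starExp α (starExp β γ))) := by
  have h : C.rep 0 (starExp (starExp α β) γ) = C.rep 0 (starExp α (starExp β γ)) := by
    rw [rep_starExp, rep_starExp, rep_starExp, rep_starExp']
    have e : (C.uw m : O) * C.rep (m + p + 1 + 1) γ = C.rep (m + p + 1 + 1) γ * C.uw m :=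
      C.W_comm_of_off (C.uw_mem_WU (m := m + 2) (by omega)).1 fun j _ _ =>
        C.W_off (by omega) (C.rep_mem_W _ γ)
    have e2 : (C.uw m : O) * C.uw (m + p + 1) = C.uwd (m + 1) p * C.uw m := by
      rw [← Units.val_mul, uw_mul_uw, Units.val_mul]
    rw [show m + 1 + p + 1 = m + p + 1 + 1 by omega]
    calc _ = C.rep 0 α * C.rep (m + 1) β * (C.uw m * C.rep (m + p + 1 + 1) γ) *
          C.uw (m + p + 1) := by simp only [mul_assoc]
      _ = C.rep 0 α * C.rep (m + 1) β * C.rep (m + p + 1 + 1) γ *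
          (C.uw m * C.uw (m + p + 1)) := by rw [e]; simp only [mul_assoc]
      _ = _ := by rw [e2]; simp only [mul_assoc]
  rw [h, show m + p + 1 + r + 1 = m + (p + r + 1) + 1 by omega]

lemma Yw_conj (p : ℕ) : (C.Yw (p + 1))⁻¹ * C.R 0 * C.Yw (p + 1) =
    C.Yw p * C.R p * (C.Yw p)⁻¹ := by
  induction p with
  | zero => simp [Yw]
  | succ p ih =>
    have e1 := C.Yw_comm (n := p) (i := p + 1) (by omega)
    have e2 : (C.R (p + 1))⁻¹ * C.Yw p = C.Yw p * (C.R (p + 1))⁻¹ :=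
      (show Commute (C.R (p + 1)) (C.Yw p) from e1).inv_left
    have e3 : (C.Yw p)⁻¹ * C.R (p + 1) = C.R (p + 1) * (C.Yw p)⁻¹ :=
      (show Commute (C.Yw p) (C.R (p + 1)) from e1.symm).inv_left
    have e4 : (C.R (p + 1))⁻¹ * C.R p * C.R (p + 1) = C.R p * C.R (p + 1) * (C.R p)⁻¹ := by
      rw [eq_mul_inv_iff_mul_eq, mul_assoc, mul_assoc, inv_mul_eq_iff_eq_mul, ← mul_assoc,
        C.R_braid]
      simp only [mul_assoc]
    calc _ = (C.R (p + 1))⁻¹ * ((C.Yw (p + 1))⁻¹ * C.R 0 * C.Yw (p + 1)) * C.R (p + 1) := by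
          conv_lhs => rw [Yw]
          simp [mul_assoc]
      _ = ((C.R (p + 1))⁻¹ * C.Yw p) * C.R p * ((C.Yw p)⁻¹ * C.R (p + 1)) := by
          rw [ih]; simp only [mul_assoc]
      _ = C.Yw p * ((C.R (p + 1))⁻¹ * C.R p * C.R (p + 1)) * (C.Yw p)⁻¹ := by
          rw [e2, e3]; simp only [mul_assoc]
      _ = _ := by
          rw [e4]; simp [Yw, mul_assoc]

lemma E_cj_R {u : Oˣ} {m : ℕ} (hu : u ∈ C.WU 0 (m + 1)) :
    C.E (m + 1) (↑(u * C.R m * u⁻¹) : O) = 1 := by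
  have h := C.WU_off (j := m + 1) hu (by omega)
  rw [Units.val_mul, Units.val_mul, C.E_mul_right h.2, C.E_mul_left h.1, C.E_R, mul_one,
    Units.mul_inv]

/-- The right factor of the `⋆`-product as a variable. -/
def starR (m : ℕ) (w : O) (X : O) : O :=
  C.ET 1 (m + 1) (C.Mseq 0 (m + 1) * w * C.bar (m + 1) X * C.uw m)

lemma starR_add (m : ℕ) (w X Y : O) : C.starR m w (X + Y) = C.starR m w X + C.starR m w Y := by
  simp only [starR, bar_add, mul_add, add_mul, map_add]

lemma starR_smul (m : ℕ) (z : ℂ) (w X : O) : C.starR m w (z • X) = z • C.starR m w X := by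
  simp only [starR, bar_smul, mul_smul_comm, smul_mul_assoc, map_smul]

lemma starR_mul {m : ℕ} {w X c : O} (hc : ∀ j, c ∈ C.off j) :
    C.starR m w (X * c) = C.starR m w X * c := by
  have h : (C.uw m : O) * c = c * C.uw m := C.W_comm_of_off (C.uw_mem_WU (m := m + 2)
    (by omega)).1 fun j _ _ => hc j
  rw [starR, bar_mul, C.bar_of_off hc, starR, ← C.ET_mul_right fun j _ _ => hc j]
  simp only [mul_assoc, h]

lemma starR_one {m : ℕ} {w : O} (hw : w ∈ C.off (m + 1)) : C.starR m w 1 = C.mp m w := by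
  rw [starR, bar_one, mul_one, ET_succ, add_comm 1 m,
    C.E_mul_left (mul_mem (C.Mseq_off (by omega)) hw), uw_eq, C.E_cj_R (C.Zw_mem_WU (by omega)),
    mul_one, mp]

lemma starR_mp {m p : ℕ} (α : BraidAlg m) (β : BraidAlg p) :
    C.starR m (C.rep 0 α) (C.mp p (C.rep 0 β)) = C.mp (m + p + 1) (C.rep 0 (starExp α β)) := by
  have h1 : C.Mseq 0 (m + p + 1 + 1) = C.Mseq 0 (m + 1) * C.Mseq (m + 1) (p + 1) := by
    rw [show m + p + 1 + 1 = (m + 1) + (p + 1) by omega, Mseq_add, zero_add]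
  have h2 : C.rep 0 α * C.Mseq (m + 1) (p + 1) = C.Mseq (m + 1) (p + 1) * C.rep 0 α :=
    C.W_comm (C.rep_mem_W 0 α) fun i _ h => C.Mseq_comm_R (Or.inl (by omega))
  rw [starR, ← ET_Mseq_rep, rep_starExp, mp, h1, show m + p + 1 = (m + 1) + p by omega,
    C.ET_add 1 (m + 1) p, add_comm 1 (m + 1),
    ← C.ET_mul_left, ← C.ET_mul_right]
  · congr 2
    · simp only [mul_assoc]
      rw [← mul_assoc (C.rep 0 α), h2]
      simp only [mul_assoc]
  · intro j h4 _
    exact (C.WU_off (C.uw_mem_WU (n := m) (m := m + 2) (by omega)) (by omega)).1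
  · intro j h4 h5
    exact mul_mem (C.Mseq_off (by omega)) (C.W_off (by omega) (C.rep_mem_W 0 α))

/-- The left factor of the `⋆`-product as a variable. -/
def starL (p : ℕ) (w : O) (X : O) : O :=
  C.ET 1 (p + 1) (C.Yw (p + 1) * C.Mseq 0 (p + 1) * C.bar (p + 1) X *
    (↑(C.Yw (p + 1))⁻¹ * w * C.R 0))

lemma starL_add (m : ℕ) (w X Y : O) : C.starL m w (X + Y) = C.starL m w X + C.starL m w Y := by
  simp only [starL, bar_add, mul_add, add_mul, map_add]

lemma starL_smul (m : ℕ) (z : ℂ) (w X : O) : C.starL m w (z • X) = z • C.starL m w X := by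
  simp only [starL, bar_smul, mul_smul_comm, smul_mul_assoc, map_smul]

lemma starL_mul {p : ℕ} (β : BraidAlg p) {X c : O} (hc : ∀ j, c ∈ C.off j) :
    C.starL p (C.rep 1 β) (X * c) = C.starL p (C.rep 1 β) X * c := by
  have h : (↑(C.Yw (p + 1))⁻¹ * C.rep 1 β * C.R 0) * c =
      c * (↑(C.Yw (p + 1))⁻¹ * C.rep 1 β * C.R 0) :=
    C.W_comm_of_off (a := 0) (n := p + 2) (mul_mem (mul_mem (C.Yw_mem_WU (by omega)).2
      (C.W_mono (by omega) (by omega) (C.rep_mem_W 1 β))) (C.R_mem_W (by omega) (by omega)))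
      fun j _ _ => hc j
  rw [starL, bar_mul, C.bar_of_off hc, starL, ← C.ET_mul_right fun j _ _ => hc j]
  congr 1
  rw [mul_assoc _ _ c, h]
  simp only [mul_assoc]

lemma cj_Yw_rep {p n : ℕ} (h : p < n) (β : BraidAlg p) : cj (C.Yw n) (C.rep 0 β) = C.rep 1 β :=
  C.cj_rep _ (fun i hi => by rw [zero_add, C.Yw_mul_R (by omega), add_comm 1]) β

lemma Yw_succ_mem (p : ℕ) : (C.R 0)⁻¹ * C.Yw (p + 1) ∈ C.WU 1 (p + 1) := by
  induction p with
  | zero => simp [Yw, one_mem]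
  | succ p ih =>
    rw [Yw, ← mul_assoc]
    refine mul_mem ?_ (C.R_mem_WU (by omega) (by omega))
    have hle : C.W 1 (p + 1) ≤ C.W 1 (p + 1 + 1) := C.W_mono le_rfl (by omega)
    exact ⟨hle ih.1, hle ih.2⟩

lemma starL_one {p : ℕ} (β : BraidAlg p) : C.starL p (C.rep 1 β) 1 = C.mp p (C.rep 0 β) := by
  set v := (C.R 0)⁻¹ * C.Yw (p + 1) with hv
  have hY : C.Yw (p + 1) = C.R 0 * v := by rw [hv, mul_inv_cancel_left]
  have hmem : v ∈ C.WU 1 (p + 1) := C.Yw_succ_mem p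
  have e1 : (↑(C.Yw (p + 1))⁻¹ : O) * C.rep 1 β * C.R 0 = C.rep 0 β * ↑v⁻¹ := by
    rw [← C.cj_Yw_rep (n := p + 1) (by omega), cj_def]
    have : (↑(C.Yw (p + 1))⁻¹ : O) * C.R 0 = ↑v⁻¹ := by
      rw [hY, ← Units.val_mul]; simp
    rw [← this]
    simp [mul_assoc]
  have e2 : v⁻¹ * C.Yw (p + 1) = C.Yw p * C.R p * (C.Yw p)⁻¹ := by
    rw [← C.Yw_conj, hv]; simp [mul_assoc]
  rw [starL, bar_one, mul_one, e1, ← mul_assoc, C.ET_cyc hmem.2, ← mul_assoc, ← mul_assoc,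
    ← Units.val_mul, e2, ET_succ, add_comm 1 p, mul_assoc,
    C.E_mul_right (mul_mem (C.Mseq_off (by omega)) (C.W_off (by omega) (C.rep_mem_W 0 β))),
    C.E_cj_R (C.Yw_mem_WU (by omega)), one_mul, mp]

lemma starL_mp {m p : ℕ} (α : BraidAlg m) (β : BraidAlg p) :
    C.starL p (C.rep 1 β) (C.mp m (C.rep 0 α)) = C.mp (m + p + 1) (C.rep 0 (starExp α β)) := by
  have h1 : C.Mseq 0 (m + p + 1 + 1) = C.Mseq 0 (p + 1) * C.Mseq (p + 1) (m + 1) := by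
    rw [show m + p + 1 + 1 = (p + 1) + (m + 1) by omega, Mseq_add, zero_add]
  have hY := C.Yw_mem_WU (n := p + 1) (m := p + 2) (by omega)
  have e : C.mp (m + p + 1) (C.rep 0 (starExp α β)) = C.mp (m + p + 1)
      (C.Yw (p + 1) * (C.rep (p + 1) α * (↑(C.Yw (p + 1))⁻¹ * C.rep 1 β * C.R 0))) := by
    have hX := C.Xw'_mem_WU (p := p + 1) (n := m) (m := m + p + 1) (by omega)
    rw [← C.mp_cj hX, rep_starExp, map_mul, map_mul]
    have a1 : cj (C.Xw' (p + 1) m) (C.rep 0 α) = cj (C.Yw (p + 1)) (C.rep (p + 1) α) := by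
      rw [← Xw_eq, cj_mul, C.cj_rep (C.Xw (p + 1) (m + 1)) (d := 0) (e := p + 1)
        (fun i hi => by rw [zero_add, C.Xw_mul_R (by omega)])]
    have a2 : cj (C.Xw' (p + 1) m) (C.rep (m + 1) β) = C.rep 1 β := by
      rw [← Xw_eq, cj_mul, C.cj_rep (C.Xw (p + 1) (m + 1)) (d := m + 1) (e := 0)
        (fun i hi => by rw [zero_add, C.Xw_mul_R' (by omega)]), C.cj_Yw_rep (by omega)]
    rw [a1, a2, cj_units _ _ _ (C.Xw'_mul_uw p m), cj_def]
    simp only [mul_assoc]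
  rw [e, starL, ← ET_Mseq_rep, ← C.ET_mul_left, ← C.ET_mul_right, mp, h1,
    show m + p + 1 = (p + 1) + m by omega, C.ET_add 1 (p + 1) m, add_comm 1 (p + 1)]
  · congr 2
    · have c : (C.Yw (p + 1) : O) * (C.Mseq 0 (p + 1) * C.Mseq (p + 1) (m + 1)) =
          C.Mseq 0 (p + 1) * C.Mseq (p + 1) (m + 1) * C.Yw (p + 1) := by
        rw [← h1]
        exact C.Mseq_comm_W (C.W_mono le_rfl (by omega) hY.1)
      rw [← mul_assoc _ (C.Yw (p + 1) : O), ← c]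
      simp only [mul_assoc]
  · intro j h4 _
    exact mul_mem (mul_mem (C.WU_off hY (by omega)).2 (C.W_off (by omega) (C.rep_mem_W 1 β)))
      (C.R_off (by omega) (by omega))
  · intro j h4 _
    exact mul_mem (C.WU_off hY (by omega)).1 (C.Mseq_off (by omega))

end QChain

end
noncomputable section
section Bridge

variable {ι : Type} [Fintype ι] [DecidableEq ι] {A : Type} [Ring A] [Algebra ℂ A]

/-! ## The chain of an R-matrix -/

lemma first_zero (N : Matrix ι ι A) (s t : Fin 1 → ι) : first N 0 s t = N (s 0) (t 0) :=
  if_pos (Subsingleton.elim _ _)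

/-- The one-site operator `N` with entries in `A` in the first site of the chain. -/
def site0 : Matrix ι ι A →ₗ[ℂ] ChainOp ι A where
  toFun N := place (fun _ : Fin 1 => 0) (first N 0)
  map_add' N N' := by
    rw [← place_add]; congr 1
  map_smul' z N := by
    rw [RingHom.id_apply, ← place_smul]; congr 1

lemma site0_def (N : Matrix ι ι A) : site0 N = place (fun _ : Fin 1 => 0) (first N 0) := rfl

lemma site0_apply (N : Matrix ι ι A) (f : (ℕ → ι) → A) (x : ℕ → ι) :
    site0 N f x = ∑ b, N (x 0) b * f (Function.update x 0 b) := by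
  rw [site0_def, place_apply, ← (Equiv.funUnique (Fin 1) ι).symm.sum_comp]
  refine Finset.sum_congr rfl fun b _ => ?_
  have e : Function.extend (fun _ : Fin 1 => 0) ((Equiv.funUnique (Fin 1) ι).symm b) x =
      Function.update x 0 b := by
    funext k
    by_cases hk : k = 0
    · subst hk
      have := (Function.injective_of_subsingleton (fun _ : Fin 1 => 0)).extend_apply
        ((Equiv.funUnique (Fin 1) ι).symm b) x 0
      simpa using this
    · rw [Function.update_of_ne hk, Function.extend_apply']
      rintro ⟨c, hc⟩; exact hk hc.symm
  rw [e]
  rw [first_zero]; rfl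

/-- The matrix of an operator with respect to the first site. -/
def unsite0 : ChainOp ι A →ₗ[ℂ] Matrix ι ι A where
  toFun T := Matrix.of fun a b => T (fun x => if x 0 = b then 1 else 0) (fun _ => a)
  map_add' S T := by ext a b; simp
  map_smul' z T := by ext a b; simp

lemma unsite0_site0 (N : Matrix ι ι A) : unsite0 (site0 N) = N := by
  ext a b
  simp [unsite0, site0_apply]

lemma site0_injective : Function.Injective (site0 : Matrix ι ι A →ₗ[ℂ] ChainOp ι A) :=
  Function.LeftInverse.injective unsite0_site0

lemma site0_rightMul (N : Matrix ι ι A) (c : A) : site0 (rightMul N c) = site0 N * lmul c := by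
  ext f x
  rw [Module.End.mul_apply, site0_apply, site0_apply]
  simp [rightMul, lmul_apply, mul_assoc]

lemma site0_one : site0 (1 : Matrix ι ι A) = 1 := by
  ext f x
  rw [site0_apply]
  simp [Matrix.one_apply]

lemma first_eq_embed (N : Matrix ι ι A) (m : ℕ) :
    first N m = embed (fun _ : Fin 1 => (0 : Fin (m + 1))) (first N 0) := by
  ext s t
  have h : Fin.tail s = Fin.tail t ↔
      ∀ c, c ∉ Set.range (fun _ : Fin 1 => (0 : Fin (m + 1))) → s c = t c := by
    constructor
    · intro h c hc
      obtain ⟨d, rfl⟩ : ∃ d, c = Fin.succ d := by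
        refine ⟨c.pred ?_, (Fin.succ_pred _ _).symm⟩
        rintro rfl; exact hc ⟨0, rfl⟩
      exact congrFun h d
    · intro h
      funext d
      refine h _ ?_
      rintro ⟨c, hc⟩
      exact Fin.succ_ne_zero d hc.symm
  simp only [embed, first, if_pos (Subsingleton.elim (Fin.tail (n := 0) _) (Fin.tail _))]
  by_cases h' : Fin.tail s = Fin.tail t
  · rw [if_pos h', if_pos (h.mp h')]; rfl
  · rw [if_neg h', if_neg (mt h.mpr h')]

/-- The inclusion of the sites `0, …, n - 1`. -/
lemma place_first (N : Matrix ι ι A) (m : ℕ) :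
    place (Fin.val : Fin (m + 1) → ℕ) (first N m) = site0 N := by
  rw [first_eq_embed, place_embed Fin.val_injective (Function.injective_of_subsingleton _)]
  rfl

lemma place_scal_at2 (X : Op ι 2 ℂ) {m : ℕ} (i : Fin m) :
    place (Fin.val : Fin (m + 1) → ℕ) (scal A (at2 X i)) = op2 A X i.val (i.val + 1) := by
  rw [place_at2 Fin.val_injective]; rfl

lemma isSkewInverse_skewInverse {X : Op ι 2 ℂ} (h : IsSkewInvertible X) :
    IsSkewInverse X (skewInverse X) := Classical.epsilon_spec h

lemma RMatrix.mul_inv_mat (R : RMatrix ι) : R.mat * R.mat⁻¹ = 1 :=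
  Matrix.mul_nonsing_inv _ ((Matrix.isUnit_iff_isUnit_det _).mp R.isUnit)

lemma RMatrix.inv_mul_mat (R : RMatrix ι) : R.mat⁻¹ * R.mat = 1 :=
  Matrix.nonsing_inv_mul _ ((Matrix.isUnit_iff_isUnit_det _).mp R.isUnit)

/-- The R-matrix in the sites `i`, `i + 1` of the chain. -/
def RMatrix.chainUnit (R : RMatrix ι) (A : Type) [Ring A] [Algebra ℂ A] (i : ℕ) :
    (ChainOp ι A)ˣ where
  val := op2 A R.mat i (i + 1)
  inv := op2 A R.mat⁻¹ i (i + 1)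
  val_inv := by rw [← op2_mul (by omega), R.mul_inv_mat, op2_one (by omega)]
  inv_val := by rw [← op2_mul (by omega), R.inv_mul_mat, op2_one (by omega)]

lemma op2_relation {X Y Z X' Y' Z' : Op ι 2 ℂ} {a b c a' b' c' : Fin 2}
    (h : at2 X a * at2 Y b * at2 Z c = at2 X' a' * at2 Y' b' * at2 Z' c') (i : ℕ) :
    op2 A X (i + a.val) (i + a.val + 1) * op2 A Y (i + b.val) (i + b.val + 1) *
      op2 A Z (i + c.val) (i + c.val + 1) =
    op2 A X' (i + a'.val) (i + a'.val + 1) * op2 A Y' (i + b'.val) (i + b'.val + 1) *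
      op2 A Z' (i + c'.val) (i + c'.val + 1) := by
  have hσ : Function.Injective (fun k : Fin 3 => i + k.val) := fun a b h => by
    ext; simpa using h
  have := congrArg (fun T => place (fun k : Fin 3 => i + k.val) (scal A T)) h
  simp only [scal_mul, place_mul hσ, place_at2 hσ] at this
  exact this

lemma place_copy (F : RMatrix ι) (N : Matrix ι ι A) (m : ℕ) (i : Fin m) :
    place (Fin.val : Fin (m + 1) → ℕ) (copy F N m i.succ) =
      QChain.cj (F.chainUnit A i.val) (place Fin.val (copy F N m i.castSucc)) := by
  have : copy F N m i.succ = scal A (at2 F.mat i) * copy F N m i.castSucc *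
      scal A (at2 F.mat⁻¹ i) := rfl
  rw [this, place_mul Fin.val_injective, place_mul Fin.val_injective, place_scal_at2,
    place_scal_at2]
  rfl

lemma place_copy_zero (F : RMatrix ι) (N : Matrix ι ι A) (m : ℕ) :
    place (Fin.val : Fin (m + 1) → ℕ) (copy F N m 0) = site0 N := place_first N m

/-- The relation `R_1 N_{\bar 1} N_{\bar 2} = N_{\bar 1} N_{\bar 2} R_1`. -/
def IsQuantumMatrix (R F : RMatrix ι) (N : Matrix ι ι A) : Prop :=
  scal A (at2 R.mat (0 : Fin 1)) * (copy F N 1 0 * copy F N 1 1) =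
    copy F N 1 0 * copy F N 1 1 * scal A (at2 R.mat (0 : Fin 1))

/-- The chain of sites for a quantum matrix `N`. -/
def chainOf (R F : RMatrix ι) (hR : IsSkewInvertible R.mat) (hRF : IsCompatiblePair R.mat F.mat)
    (N : Matrix ι ι A) (hN : IsQuantumMatrix R F N) : QChain (ChainOp ι A) where
  off := off ι A
  E := wtr A (matD R.mat)
  E_mul_left := wtr_mul_left
  E_mul_right := wtr_mul_right
  E_mem := wtr_mem
  E_mem_of := wtr_mem_of
  R := R.chainUnit A
  F := F.chainUnit A
  R_off h1 h2 := op2_mem_off h1 h2 _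
  Ri_off h1 h2 := op2_mem_off h1 h2 _
  F_off h1 h2 := op2_mem_off h1 h2 _
  Fi_off h1 h2 := op2_mem_off h1 h2 _
  R_comm h1 h2 := op2_comm_of h1 h2 _
  F_comm h1 h2 := op2_comm_of h1 h2 _
  R_braid i := Units.ext (op2_relation R.yangBaxter i)
  F_braid i := Units.ext (op2_relation F.yangBaxter i)
  compat₁ i := Units.ext (op2_relation hRF.1 i)
  compat₂ i := Units.ext (op2_relation hRF.2 i)
  E_R i := trS_mul_skew (k := i + 2) (isSkewInverse_skewInverse hR) (by omega) (by omega) (by omega)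
  E_cyc i T := op2_cyc_D' (isSkewInverse_skewInverse hR) R.mul_inv_mat R.inv_mul_mat R.yangBaxter
    (by omega) T
  E_conjR i _ hT := wtr_conj (isSkewInverse_skewInverse hR) R.mul_inv_mat R.inv_mul_mat
    R.yangBaxter.symm (by omega) hT
  E_conjF i _ hT := wtr_conj (isSkewInverse_skewInverse hR) F.mul_inv_mat F.inv_mul_mat
    hRF.2 (by omega) hT
  M₀ := site0 N
  M₀_off j := place_mem_off (Function.injective_of_subsingleton _) _ (by
    rintro ⟨c, hc⟩; exact absurd hc (Nat.succ_ne_zero j).symm)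
  RMM := by
    have h := congrArg (place (Fin.val : Fin 2 → ℕ)) hN
    have e1 := place_copy_zero F N 1
    have e2 := place_copy F N 1 0
    rw [Fin.castSucc_zero, e1] at e2
    simp only [place_mul Fin.val_injective, e1, place_scal_at2] at h
    change op2 A R.mat 0 1 * (site0 N * place Fin.val (copy F N 1 (Fin.succ 0))) =
      site0 N * place Fin.val (copy F N 1 (Fin.succ 0)) * op2 A R.mat 0 1 at h
    rw [e2] at h
    exact h

section Values

variable {R F : RMatrix ι} {hR : IsSkewInvertible R.mat} {hRF : IsCompatiblePair R.mat F.mat}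
  {N : Matrix ι ι A} {hN : IsQuantumMatrix R F N}

lemma bar_chainOf (m : ℕ) (i : Fin (m + 1)) :
    place (Fin.val : Fin (m + 1) → ℕ) (copy F N m i) = (chainOf R F hR hRF N hN).M i.val := by
  induction i using Fin.induction with
  | zero => exact place_copy_zero F N m
  | succ i ih => rw [place_copy, ih]; rfl

lemma place_prod_copy (m : ℕ) :
    place (Fin.val : Fin (m + 1) → ℕ) (List.ofFn (copy F N m)).prod =
      (chainOf R F hR hRF N hN).Mseq 0 (m + 1) := by
  have e : ∀ n : ℕ, (List.ofFn fun i : Fin n => (chainOf R F hR hRF N hN).M i.val).prod =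
      (chainOf R F hR hRF N hN).Mseq 0 n := by
    intro n
    induction n with
    | zero => simp
    | succ n ih =>
      rw [List.ofFn_succ_last, List.prod_append, QChain.Mseq_succ, ← ih]
      simp
  rw [← placeHom_apply _ Fin.val_injective, map_list_prod, List.map_ofFn, ← e]
  congr 2
  funext i
  exact bar_chainOf m i

lemma place_rho {m : ℕ} (α : BraidAlg m) (d : ℕ) :
    place (fun i : Fin (m + 1) => d + i.val) (scal A (R.rho α)) =
      (chainOf R F hR hRF N hN).rep d α := by
  have hσ : Function.Injective (fun i : Fin (m + 1) => d + i.val) := fun a b h => by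
    ext; simpa using h
  have h1 : ∀ b : Braid m, R.rho (MonoidAlgebra.of ℂ (Braid m) b) = (R.rhoGroup m b : Op ι (m + 1) ℂ) := by
    intro b; simp [RMatrix.rho]
  have h2 : ∀ i : Fin m, R.rhoGroup m (sig i) = R.unitAt i := fun i =>
    PresentedGroup.toGroup.of _
  refine QChain.rep_induction (P := fun α => place (fun i : Fin (m + 1) => d + i.val)
    (scal A (R.rho α)) = (chainOf R F hR hRF N hN).rep d α) α ?_ ?_ ?_ ?_ ?_
  · intro z
    rw [AlgHom.commutes, AlgHom.commutes, ← scalHom_apply, AlgHom.commutes,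
      ← placeHom_apply _ hσ, AlgHom.commutes]
  · intro i
    rw [QChain.rep_sigA, sigA, h1, h2]
    exact place_at2 hσ R.mat i
  · intro i
    rw [QChain.rep_of, h1, map_inv, map_inv, h2, QChain.repGroup_sig]
    exact place_at2 hσ R.mat⁻¹ i
  · intro x y hx hy
    rw [map_add, map_add, ← hx, ← hy, ← place_add, ← scalHom_apply, map_add]; rfl
  · intro x y hx hy
    rw [map_mul, map_mul, ← hx, ← hy, ← place_mul hσ, ← scal_mul]

/-- The weighted trace over the last tensor factor. -/
def wptr (D : Matrix ι ι ℂ) {n : ℕ} (X : Op ι (n + 1) A) : Op ι n A := fun s t =>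
  ∑ c, ∑ b, D c b • X (Fin.snoc (α := fun _ => ι) s b) (Fin.snoc (α := fun _ => ι) t c)

lemma op1_apply (D : Matrix ι ι ℂ) (j : ℕ) (f : (ℕ → ι) → A) (x : ℕ → ι) :
    op1 A D j f x = ∑ b, D (x j) b • f (Function.update x j b) := by
  simp only [op1, LinearMap.sum_apply, Finset.sum_apply, LinearMap.smul_apply, Pi.smul_apply,
    eu_apply]
  rw [Finset.sum_eq_single (x j)]
  · simp
  · intro a _ ha; simp [ha.symm]
  · simp

lemma wtr_place (D : Matrix ι ι ℂ) {n : ℕ} {σ : Fin (n + 1) → ℕ} (hσ : Function.Injective σ)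
    (X : Op ι (n + 1) A) :
    wtr A D (σ (Fin.last n)) (place σ X) = place (σ ∘ Fin.castSucc) (wptr D X) := by
  have e : op1 A D (σ (Fin.last n)) * place σ X = place σ (Matrix.of fun s t =>
      ∑ b, D (s (Fin.last n)) b • X (Function.update s (Fin.last n) b) t) := by
    ext f x
    have h1 : ∀ b, Function.update x (σ (Fin.last n)) b ∘ σ =
        Function.update (x ∘ σ) (Fin.last n) b := fun b =>
      Function.update_comp_eq_of_injective x hσ _ _
    have h2 : ∀ b t, Function.extend σ t (Function.update x (σ (Fin.last n)) b) =
        Function.extend σ t x := by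
      intro b t
      funext k
      by_cases hk : ∃ c, σ c = k
      · obtain ⟨c, rfl⟩ := hk; rw [hσ.extend_apply, hσ.extend_apply]
      · rw [Function.extend_apply' _ _ _ hk, Function.extend_apply' _ _ _ hk,
          Function.update_of_ne]
        rintro rfl; exact hk ⟨_, rfl⟩
    rw [Module.End.mul_apply, op1_apply]
    simp only [place_apply, h1, h2, Finset.smul_sum, Finset.sum_mul, Matrix.of_apply]
    rw [Finset.sum_comm]
    simp
  rw [wtr_def, e, trS_place hσ]
  congr 1
  ext s t
  simp [ptrLast, wptr, Fin.update_snoc_last]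

lemma trAll_succ {n : ℕ} (X : Op ι (n + 1) A) : trAll R X = trAll R (wptr (matD R.mat) X) := by
  simp only [trAll, wptr]
  rw [sum_snoc]
  refine Finset.sum_congr rfl fun s _ => ?_
  rw [Finset.sum_comm' (t' := Finset.univ) (s' := fun _ => Finset.univ) (by simp)]
  rw [sum_snoc, Finset.sum_congr rfl]
  intro t _
  rw [Finset.sum_comm, Finset.smul_sum]
  refine Finset.sum_congr rfl fun b _ => ?_
  rw [Finset.smul_sum]
  refine Finset.sum_congr rfl fun c _ => ?_
  rw [Fin.prod_univ_castSucc]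
  simp [mul_smul]

lemma ET_place_all {n : ℕ} (X : Op ι n A) :
    (chainOf R F hR hRF N hN).ET 0 n (place (Fin.val : Fin n → ℕ) X) = lmul (trAll R X) := by
  induction n with
  | zero =>
    ext f x
    simp only [QChain.ET_zero, place_apply, lmul_apply, trAll]
    have h : ∀ t : Fin 0 → ι, Function.extend (Fin.val : Fin 0 → ℕ) t x = x := fun t => by
      funext k; rw [Function.extend_apply']; rintro ⟨c, _⟩; exact c.elim0
    simp [h, Subsingleton.elim _ (default : Fin 0 → ι)]
  | succ n ih =>
    have e : (Fin.val : Fin (n + 1) → ℕ) ∘ Fin.castSucc = Fin.val := rfl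
    have := wtr_place (matD R.mat) (σ := (Fin.val : Fin (n + 1) → ℕ)) Fin.val_injective X
    rw [e, Fin.val_last] at this
    rw [trAll_succ, ← ih, QChain.ET_succ, ← this, zero_add]
    rfl

lemma trTail_succ {m : ℕ} (X : Op ι (m + 1 + 1) A) :
    trTail R X = trTail R (wptr (matD R.mat) X) := by
  ext a b
  simp only [trTail, wptr]
  rw [sum_snoc]
  refine Finset.sum_congr rfl fun s _ => ?_
  rw [Finset.sum_comm' (t' := Finset.univ) (s' := fun _ => Finset.univ) (by simp)]
  rw [sum_snoc, Finset.sum_congr rfl]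
  intro t _
  rw [Finset.sum_comm, Finset.smul_sum]
  refine Finset.sum_congr rfl fun b _ => ?_
  rw [Finset.smul_sum]
  refine Finset.sum_congr rfl fun c _ => ?_
  rw [Fin.prod_univ_castSucc]
  simp [mul_smul, Fin.cons_snoc_eq_snoc_cons]

lemma ET_place_tail {m : ℕ} (X : Op ι (m + 1) A) :
    (chainOf R F hR hRF N hN).ET 1 m (place (Fin.val : Fin (m + 1) → ℕ) X) =
      site0 (trTail R X) := by
  induction m with
  | zero =>
    rw [QChain.ET_zero, site0_def]
    have : (Fin.val : Fin 1 → ℕ) = fun _ => 0 := by funext c; simp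
    rw [this]
    congr 1
    ext s t
    have h : ∀ (s : Fin 1 → ι) (u : Fin 0 → ι), Fin.cons (α := fun _ => ι) (s 0) u = s := by
      intro s u; funext c; exact Fin.cases rfl (fun d => d.elim0) c
    simp [first, trTail, Subsingleton.elim (Fin.tail s) (Fin.tail t), h]
  | succ m ih =>
    have e : (Fin.val : Fin (m + 1 + 1) → ℕ) ∘ Fin.castSucc = Fin.val := rfl
    have := wtr_place (matD R.mat) (σ := (Fin.val : Fin (m + 1 + 1) → ℕ)) Fin.val_injective X
    rw [e, Fin.val_last] at this
    rw [trTail_succ, ← ih, QChain.ET_succ, ← this, add_comm 1 m]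
    rfl

lemma place_copiesRho {m : ℕ} (α : BraidAlg m) :
    place (Fin.val : Fin (m + 1) → ℕ) (copiesRho R F N α) =
      (chainOf R F hR hRF N hN).Mseq 0 (m + 1) * (chainOf R F hR hRF N hN).rep 0 α := by
  have e : (Fin.val : Fin (m + 1) → ℕ) = fun i => 0 + i.val := by funext i; simp
  rw [copiesRho, place_mul Fin.val_injective, place_prod_copy (hR := hR) (hRF := hRF) (hN := hN),
    ← place_rho]
  rw [← e]

lemma site0_matPow {m : ℕ} (α : BraidAlg m) :
    site0 (matPow R F N α) = (chainOf R F hR hRF N hN).mp m ((chainOf R F hR hRF N hN).rep 0 α) := by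
  rw [matPow, ← ET_place_tail (hR := hR) (hRF := hRF) (hN := hN),
    place_copiesRho (hR := hR) (hRF := hRF) (hN := hN)]
  rfl

lemma lmul_ch {m : ℕ} (α : BraidAlg m) :
    lmul (ch R F N α) = (chainOf R F hR hRF N hN).chi m ((chainOf R F hR hRF N hN).rep 0 α) := by
  rw [ch, ← ET_place_all (hR := hR) (hRF := hRF) (hN := hN),
    place_copiesRho (hR := hR) (hRF := hRF) (hN := hN)]
  rfl

end Values

/-! ## Naturality in the algebra -/

section Map

variable {B : Type} [Ring B] [Algebra ℂ B] (φ : A →ₐ[ℂ] B) (R F : RMatrix ι) (N : Matrix ι ι A)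

lemma scal_map {n : ℕ} (X : Op ι n ℂ) : (scal A X).map φ = scal B X := by
  ext s t; simp [scal]

lemma copy_map (m : ℕ) (i : Fin (m + 1)) : (copy F N m i).map φ = copy F (N.map φ) m i := by
  induction i using Fin.induction with
  | zero =>
    ext s t
    change φ (first N m s t) = first (N.map φ) m s t
    simp only [first]
    split_ifs <;> simp
  | succ i ih =>
    have h : ∀ (C : Type) [Ring C] [Algebra ℂ C] (N : Matrix ι ι C), copy F N m i.succ =
        scal C (at2 F.mat i) * copy F N m i.castSucc * scal C (at2 F.mat⁻¹ i) := fun _ _ _ _ => rfl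
    rw [h, h, ← ih, ← scal_map φ, ← scal_map φ, ← Matrix.map_mul, ← Matrix.map_mul]

lemma copiesRho_map {m : ℕ} (α : BraidAlg m) :
    (copiesRho R F N α).map φ = copiesRho R F (N.map φ) α := by
  rw [copiesRho, Matrix.map_mul, scal_map, copiesRho]
  congr 1
  have := map_list_prod φ.mapMatrix (List.ofFn (copy F N m))
  rw [List.map_ofFn] at this
  refine this.trans ?_
  congr 2
  funext i
  exact copy_map φ F N m i

lemma ch_map {m : ℕ} (α : BraidAlg m) : φ (ch R F N α) = ch R F (N.map φ) α := by
  rw [ch, ch, ← copiesRho_map, trAll, trAll, map_sum]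
  simp [map_sum]

lemma contraction_map (q μ : ℂ) :
    φ (contraction R F N q μ) = contraction R F (N.map φ) q μ := by
  rw [contraction, map_smul, ch_map, contraction]

end Map

section QM

variable (q μ : ℂ) (R F : RMatrix ι)

lemma isQuantumMatrix_genM : IsQuantumMatrix R F (genM q μ R F) := by
  have h : ∀ s t, toQM q μ R F _ = toQM q μ R F _ := fun s t =>
    RingQuot.mkAlgHom_rel ℂ (QMRel.rmm (q := q) (μ := μ) (R := R) (F := F) s t)
  have h2 : ((scal (FreeGen ι) (at2 R.mat (0 : Fin 1)) *
        (copy F (freeM ι) 1 0 * copy F (freeM ι) 1 1))).map (toQM q μ R F) =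
      (copy F (freeM ι) 1 0 * copy F (freeM ι) 1 1 *
        scal (FreeGen ι) (at2 R.mat (0 : Fin 1))).map (toQM q μ R F) := by
    ext s t; exact h s t
  simp only [Matrix.map_mul, scal_map, copy_map] at h2
  exact h2

lemma gInv_mul_contraction : gInv q μ R F * contraction R F (genM q μ R F) q μ = 1 := by
  have h : toQM q μ R F _ = toQM q μ R F _ := RingQuot.mkAlgHom_rel ℂ (QMRel.inv_mul (q := q)
    (μ := μ) (R := R) (F := F))
  rw [map_mul, map_one, contraction_map] at h
  exact h

lemma contraction_mul_gInv : contraction R F (genM q μ R F) q μ * gInv q μ R F = 1 := by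
  have h : toQM q μ R F _ = toQM q μ R F _ := RingQuot.mkAlgHom_rel ℂ (QMRel.mul_inv (q := q)
    (μ := μ) (R := R) (F := F))
  rw [map_mul, map_one, contraction_map] at h
  exact h

end QM

end Bridge

end
noncomputable section
section Star

variable {ι : Type} [Fintype ι] [DecidableEq ι] {q μ : ℂ} {R F : RMatrix ι}

/-- The chain of the extended quantum matrix algebra. -/
def qmChain (q μ : ℂ) {R F : RMatrix ι} (hR : IsSkewInvertible R.mat)
    (hRF : IsCompatiblePair R.mat F.mat) : QChain (ChainOp ι (QMAlg q μ R F)) :=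
  chainOf R F hR hRF (genM q μ R F) (isQuantumMatrix_genM q μ R F)

variable (hR : IsSkewInvertible R.mat) (hRF : IsCompatiblePair R.mat F.mat)

local notation "Ch" => qmChain q μ hR hRF

/-! ## Commutativity of the characteristic subalgebra -/

include hR hRF in
lemma ch_comm [Nonempty ι] {m p : ℕ} (α : BraidAlg m) (β : BraidAlg p) :
    ch R F (genM q μ R F) α * ch R F (genM q μ R F) β =
      ch R F (genM q μ R F) β * ch R F (genM q μ R F) α := by
  apply lmul_injective (ι := ι)
  rw [map_mul, map_mul, lmul_ch (hR := hR) (hRF := hRF) (hN := isQuantumMatrix_genM q μ R F),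
    lmul_ch (hR := hR) (hRF := hRF) (hN := isQuantumMatrix_genM q μ R F)]
  exact QChain.chi_comm _ α β

include hR hRF in
lemma charAlg_comm [Nonempty ι] (x y : charAlg q μ R F) : x * y = y * x := by
  have hg : ∀ {m : ℕ} (α : BraidAlg m), gInv q μ R F * ch R F (genM q μ R F) α =
      ch R F (genM q μ R F) α * gInv q μ R F := by
    intro m α
    set z := ch R F (genM q μ R F) α with hz
    have h1 : contraction R F (genM q μ R F) q μ * z = z * contraction R F (genM q μ R F) q μ := by
      rw [contraction, smul_mul_assoc, mul_smul_comm, hz, ch_comm hR hRF]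
    calc gInv q μ R F * z = gInv q μ R F * (z * contraction R F (genM q μ R F) q μ) *
          gInv q μ R F := by
          rw [mul_assoc, mul_assoc, contraction_mul_gInv, mul_one]
      _ = (gInv q μ R F * contraction R F (genM q μ R F) q μ) * z * gInv q μ R F := by
          rw [← h1]; simp only [mul_assoc]
      _ = _ := by rw [gInv_mul_contraction, one_mul]
  have gens : ∀ a ∈ ({x | ∃ (m : ℕ) (α : BraidAlg m), x = ch R F (genM q μ R F) α} ∪
      {gInv q μ R F} : Set (QMAlg q μ R F)), ∀ b ∈ ({x | ∃ (m : ℕ) (α : BraidAlg m),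
      x = ch R F (genM q μ R F) α} ∪ {gInv q μ R F} : Set (QMAlg q μ R F)), a * b = b * a := by
    rintro _ (⟨m, α, rfl⟩ | rfl) _ (⟨p, β, rfl⟩ | rfl)
    · exact ch_comm hR hRF α β
    · exact (hg α).symm
    · exact hg β
    · rfl
  exact (Algebra.isMulCommutative_adjoin ℂ gens).is_comm.comm x y

/-! ## Linear maps on the space of matrices -/

lemma PSpace.ext_site {N N' : PSpace q μ R F} (h : site0 N.val = site0 N'.val) : N = N' :=
  Subtype.ext (site0_injective h)

lemma PSpace.induction {P : PSpace q μ R F → Prop} (N : PSpace q μ R F)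
    (hid : ∀ c, P (idP q μ R F c)) (hpow : ∀ (m : ℕ) (α : BraidAlg m) c, P (powP q μ R F α c))
    (h0 : P 0) (hadd : ∀ N N', P N → P N' → P (N + N')) (hsmul : ∀ (z : ℂ) N, P N → P (z • N)) :
    P N := by
  obtain ⟨X, hX⟩ := N
  refine Submodule.span_induction (p := fun X hX => P (⟨X, hX⟩ : PSpace q μ R F)) ?_ h0 ?_ ?_ hX
  · rintro X (⟨c, rfl⟩ | ⟨m, α, c, rfl⟩)
    · exact hid c
    · exact hpow m α c
  · intro X Y hX hY h1 h2; exact hadd ⟨X, hX⟩ ⟨Y, hY⟩ h1 h2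
  · intro z X hX h; exact hsmul z ⟨X, hX⟩ h

lemma PSpace.hom_ext {V : Type} [AddCommGroup V] [Module ℂ V] {T T' : PSpace q μ R F →ₗ[ℂ] V}
    (hid : ∀ c, T (idP q μ R F c) = T' (idP q μ R F c))
    (hpow : ∀ (m : ℕ) (α : BraidAlg m) c, T (powP q μ R F α c) = T' (powP q μ R F α c)) :
    T = T' := by
  ext N
  refine PSpace.induction (P := fun N => T N = T' N) N hid hpow (by simp) ?_ ?_
  · intro N N' h h'; rw [map_add, map_add, h, h']
  · intro z N h; rw [map_smul, map_smul, h]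

lemma site0_idP (c : charAlg q μ R F) :
    site0 (idP q μ R F c).val = lmul (c : QMAlg q μ R F) := by
  change site0 (rightMul 1 (c : QMAlg q μ R F)) = _
  rw [site0_rightMul, site0_one, one_mul]

lemma site0_powP {m : ℕ} (α : BraidAlg m) (c : charAlg q μ R F) :
    site0 (powP q μ R F α c).val = (Ch).mp m ((Ch).rep 0 α) * lmul (c : QMAlg q μ R F) := by
  change site0 (rightMul _ (c : QMAlg q μ R F)) = _
  rw [site0_rightMul, site0_matPow (hR := hR) (hRF := hRF) (hN := isQuantumMatrix_genM q μ R F)]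
  rfl

lemma site0_actP (N : PSpace q μ R F) (c : charAlg q μ R F) :
    site0 (actP q μ R F N c).val = site0 N.val * lmul (c : QMAlg q μ R F) :=
  site0_rightMul _ _

lemma lmul_off (c : QMAlg q μ R F) (j : ℕ) : lmul c ∈ (Ch).off j := lmul_mem_off c j

/-- The right action of an element of the characteristic subalgebra as a linear map. -/
def actHom (c : charAlg q μ R F) : PSpace q μ R F →ₗ[ℂ] PSpace q μ R F where
  toFun N := actP q μ R F N c
  map_add' N N' := PSpace.ext_site (by
    change _ = site0 (_ + _)
    rw [map_add, site0_actP, site0_actP, site0_actP, ← add_mul, ← map_add]; rfl)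
  map_smul' z N := PSpace.ext_site (by
    change _ = site0 (z • _)
    rw [map_smul, site0_actP, site0_actP, ← smul_mul_assoc, ← map_smul]; rfl)

/-- `T` is the map `N ↦ N ⋆ N'`. -/
def IsStarWith (N' : PSpace q μ R F) (T : PSpace q μ R F →ₗ[ℂ] PSpace q μ R F) : Prop :=
  (∀ c, T (idP q μ R F c) = actP q μ R F N' c) ∧
  ∀ (m : ℕ) (α : BraidAlg m) c, site0 (T (powP q μ R F α c)).val =
    (Ch).starR m ((Ch).rep 0 α) (site0 N'.val) * lmul (c : QMAlg q μ R F)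

lemma IsStarWith.unique {N' : PSpace q μ R F} {T T' : PSpace q μ R F →ₗ[ℂ] PSpace q μ R F}
    (h : IsStarWith hR hRF N' T) (h' : IsStarWith hR hRF N' T') : T = T' :=
  PSpace.hom_ext (fun c => by rw [h.1, h'.1])
    (fun m α c => PSpace.ext_site (by rw [h.2, h'.2]))

lemma IsStarWith.add {N N' : PSpace q μ R F} {T T' : PSpace q μ R F →ₗ[ℂ] PSpace q μ R F}
    (h : IsStarWith hR hRF N T) (h' : IsStarWith hR hRF N' T') :
    IsStarWith hR hRF (N + N') (T + T') := by
  refine ⟨fun c => ?_, fun m α c => ?_⟩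
  · rw [LinearMap.add_apply, h.1, h'.1]; exact (map_add (actHom c) N N').symm
  · rw [LinearMap.add_apply]
    change site0 (_ + _) = (Ch).starR m ((Ch).rep 0 α) (site0 (N.val + N'.val)) * _
    rw [map_add, h.2, h'.2, map_add, QChain.starR_add, add_mul]

lemma IsStarWith.smul {N : PSpace q μ R F} {T : PSpace q μ R F →ₗ[ℂ] PSpace q μ R F}
    (h : IsStarWith hR hRF N T) (z : ℂ) : IsStarWith hR hRF (z • N) (z • T) := by
  refine ⟨fun c => ?_, fun m α c => ?_⟩
  · rw [LinearMap.smul_apply, h.1]; exact (map_smul (actHom c) z N).symm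
  · rw [LinearMap.smul_apply]
    change site0 (z • _) = (Ch).starR m ((Ch).rep 0 α) (site0 (z • N.val)) * _
    rw [map_smul, h.2, map_smul, QChain.starR_smul, smul_mul_assoc]

include hR hRF in
lemma lmul_comm [Nonempty ι] (c d : charAlg q μ R F) : (lmul (c : QMAlg q μ R F) :
    ChainOp ι (QMAlg q μ R F)) * lmul (d : QMAlg q μ R F) =
      lmul (d : QMAlg q μ R F) * lmul (c : QMAlg q μ R F) := by
  rw [← map_mul, ← map_mul]
  have := congrArg Subtype.val (charAlg_comm hR hRF c d)
  exact congrArg _ this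

lemma isStarWith_id [Nonempty ι] (d : charAlg q μ R F) :
    IsStarWith hR hRF (idP q μ R F d) (actHom d) := by
  refine ⟨fun c => PSpace.ext_site ?_, fun m α c => ?_⟩
  · change site0 (actP q μ R F _ d).val = _
    rw [site0_actP, site0_actP, site0_idP, site0_idP, lmul_comm hR hRF]
  · change site0 (actP q μ R F _ d).val = _
    rw [site0_actP, site0_powP hR hRF, site0_idP, ← one_mul (lmul (d : QMAlg q μ R F)),
      QChain.starR_mul _ (lmul_off hR hRF _), QChain.starR_one, mul_assoc, mul_assoc, one_mul,
      lmul_comm hR hRF]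
    exact QChain.W_off _ (by omega) (QChain.rep_mem_W _ 0 α)

lemma exists_isStarWith_pow [Nonempty ι] {p : ℕ} (β : BraidAlg p) (d : charAlg q μ R F) :
    ∃ T, IsStarWith hR hRF (powP q μ R F β d) T := by
  let S : Matrix ι ι (QMAlg q μ R F) →ₗ[ℂ] Matrix ι ι (QMAlg q μ R F) :=
    { toFun := fun X => unsite0 ((Ch).starL p ((Ch).rep 1 β) (site0 X) *
        lmul (d : QMAlg q μ R F))
      map_add' := fun X Y => by rw [map_add, QChain.starL_add, add_mul, map_add]
      map_smul' := fun z X => by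
        rw [map_smul, QChain.starL_smul, smul_mul_assoc, map_smul, RingHom.id_apply] }
  have hid : ∀ c : charAlg q μ R F, S (idP q μ R F c).val = (powP q μ R F β (c * d)).val := by
    intro c
    change unsite0 _ = _
    rw [← unsite0_site0 (powP q μ R F β (c * d)).val, site0_powP hR hRF, site0_idP,
      ← one_mul (lmul (c : QMAlg q μ R F)), QChain.starL_mul _ _ (lmul_off hR hRF _),
      QChain.starL_one, mul_assoc, ← map_mul]
    rfl
  have hpow : ∀ (m : ℕ) (α : BraidAlg m) (c : charAlg q μ R F), S (powP q μ R F α c).val =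
      (powP q μ R F (starExp α β) (c * d)).val := by
    intro m α c
    change unsite0 _ = _
    rw [← unsite0_site0 (powP q μ R F (starExp α β) (c * d)).val, site0_powP hR hRF,
      site0_powP hR hRF, QChain.starL_mul _ _ (lmul_off hR hRF _), QChain.starL_mp, mul_assoc,
      ← map_mul]
    rfl
  have hS : ∀ N : PSpace q μ R F, S N.val ∈ matSpace q μ R F := by
    intro N
    refine PSpace.induction (P := fun N => S N.val ∈ matSpace q μ R F) N ?_ ?_ ?_ ?_ ?_
    · intro c; rw [hid]; exact Subtype.property _
    · intro m α c; rw [hpow]; exact Subtype.property _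
    · change S 0 ∈ _
      rw [map_zero]; exact zero_mem _
    · intro N N' h h'
      change S (_ + _) ∈ _
      rw [map_add]; exact add_mem h h'
    · intro z N h
      change S (z • _) ∈ _
      rw [map_smul]; exact Submodule.smul_mem _ _ h
  refine ⟨{ toFun := fun N => ⟨S N.val, hS N⟩
            map_add' := fun N N' => Subtype.ext (map_add S N.val N'.val)
            map_smul' := fun z N => Subtype.ext (map_smul S z N.val) }, fun c => ?_, fun m α c => ?_⟩
  · refine (Subtype.ext (hid c) : _ = powP q μ R F β (c * d)).trans (PSpace.ext_site ?_)
    rw [site0_powP hR hRF, site0_actP, site0_powP hR hRF, charAlg_comm hR hRF, mul_assoc,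
      ← map_mul]
    rfl
  · change site0 (S _) = _
    rw [hpow, site0_powP hR hRF, site0_powP hR hRF, QChain.starR_mul _ (lmul_off hR hRF _),
      QChain.starR_mp, charAlg_comm hR hRF, mul_assoc, ← map_mul]
    rfl

lemma exists_isStarWith [Nonempty ι] (N' : PSpace q μ R F) :
    ∃ T, IsStarWith hR hRF N' T := by
  refine PSpace.induction (P := fun N' => ∃ T, IsStarWith hR hRF N' T) N' ?_ ?_ ?_ ?_ ?_
  · intro d; exact ⟨_, isStarWith_id hR hRF d⟩
  · intro m β d; exact exists_isStarWith_pow hR hRF β d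
  · obtain ⟨T, hT⟩ := exists_isStarWith_pow hR hRF (1 : BraidAlg 0) (0 : charAlg q μ R F)
    have := hT.smul hR hRF 0
    rw [zero_smul, zero_smul] at this
    exact ⟨0, this⟩
  · rintro N N' ⟨T, h⟩ ⟨T', h'⟩; exact ⟨_, h.add hR hRF h'⟩
  · rintro z N ⟨T, h⟩; exact ⟨_, h.smul hR hRF z⟩

/-- The `⋆`-product. -/
def starHom [Nonempty ι] : PSpace q μ R F →ₗ[ℂ] PSpace q μ R F →ₗ[ℂ] PSpace q μ R F :=
  LinearMap.flip
    { toFun := fun N' => (exists_isStarWith hR hRF N').choose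
      map_add' := fun N N' => IsStarWith.unique hR hRF (exists_isStarWith hR hRF _).choose_spec
        ((exists_isStarWith hR hRF N).choose_spec.add hR hRF
          (exists_isStarWith hR hRF N').choose_spec)
      map_smul' := fun z N => IsStarWith.unique hR hRF (exists_isStarWith hR hRF _).choose_spec
        ((exists_isStarWith hR hRF N).choose_spec.smul hR hRF z) }

lemma starHom_spec [Nonempty ι] (N' : PSpace q μ R F) :
    IsStarWith hR hRF N' ((starHom hR hRF).flip N') :=
  (exists_isStarWith hR hRF N').choose_spec

lemma isStarProduct_starHom [Nonempty ι] : IsStarProduct q μ R F (starHom hR hRF) where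
  pow_pow m p α β c d := PSpace.ext_site (by
    refine ((starHom_spec hR hRF (powP q μ R F β d)).2 m α c).trans ?_
    rw [site0_powP hR hRF, site0_powP hR hRF, QChain.starR_mul _ (lmul_off hR hRF _),
      QChain.starR_mp, charAlg_comm hR hRF, mul_assoc, ← map_mul]
    rfl)
  id_pow p β c d := ((starHom_spec hR hRF (powP q μ R F β d)).1 c).trans (PSpace.ext_site (by
    rw [site0_powP hR hRF, site0_actP, site0_powP hR hRF, charAlg_comm hR hRF, mul_assoc,
      ← map_mul]
    rfl))
  pow_id m α c d := PSpace.ext_site (by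
    refine ((starHom_spec hR hRF (idP q μ R F d)).2 m α c).trans ?_
    rw [← (isStarWith_id hR hRF d).2]
    change site0 (actP q μ R F _ d).val = _
    rw [site0_actP, site0_powP hR hRF, site0_powP hR hRF, mul_assoc, ← map_mul]
    rfl)
  id_id c d := ((starHom_spec hR hRF (idP q μ R F d)).1 c).trans (PSpace.ext_site (by
    rw [site0_idP, site0_actP, site0_idP, charAlg_comm hR hRF, ← map_mul]
    rfl))

lemma IsStarProduct.unique {s s' : PSpace q μ R F →ₗ[ℂ] PSpace q μ R F →ₗ[ℂ] PSpace q μ R F}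
    (h : IsStarProduct q μ R F s) (h' : IsStarProduct q μ R F s') : s = s' :=
  PSpace.hom_ext
    (fun c => PSpace.hom_ext (fun d => by rw [h.id_id, h'.id_id])
      (fun p β d => by rw [h.id_pow, h'.id_pow]))
    (fun m α c => PSpace.hom_ext (fun d => by rw [h.pow_id, h'.pow_id])
      (fun p β d => by rw [h.pow_pow, h'.pow_pow]))

include hR hRF in
lemma powP_starExp_assoc {m p r : ℕ} (α : BraidAlg m) (β : BraidAlg p) (γ : BraidAlg r)
    (c : charAlg q μ R F) : powP q μ R F (starExp (starExp α β) γ) c =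
      powP q μ R F (starExp α (starExp β γ)) c :=
  PSpace.ext_site (by
    rw [site0_powP hR hRF, site0_powP hR hRF, QChain.mp_starExp_assoc])

section

variable {s : PSpace q μ R F →ₗ[ℂ] PSpace q μ R F →ₗ[ℂ] PSpace q μ R F}
  (hs : IsStarProduct q μ R F s)

include hs hR hRF in
lemma IsStarProduct.assoc (x y z : PSpace q μ R F) : s (s x y) z = s x (s y z) := by
  refine PSpace.induction (P := fun x => s (s x y) z = s x (s y z)) x (fun c => ?_)
    (fun m α c => ?_) (by simp) (fun N N' h h' => by simp [h, h']) (fun z N h => by simp [h])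
  all_goals
    refine PSpace.induction (P := fun y => s (s _ y) z = s _ (s y z)) y (fun d => ?_)
      (fun p β d => ?_) (by simp) (fun N N' h h' => by simp [h, h']) (fun z N h => by simp [h])
  all_goals
    refine PSpace.induction (P := fun z => s (s _ _) z = s _ (s _ z)) z (fun e => ?_)
      (fun r γ e => ?_) (by simp) (fun N N' h h' => by simp [h, h']) (fun z N h => by simp [h])
  all_goals
    simp only [hs.id_id, hs.id_pow, hs.pow_id, hs.pow_pow, mul_assoc]
  exact powP_starExp_assoc hR hRF _ _ _ _

include hs in
lemma IsStarProduct.one_left (x : PSpace q μ R F) : s (idP q μ R F 1) x = x := by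
  refine PSpace.induction (P := fun x => s (idP q μ R F 1) x = x) x (fun c => ?_)
    (fun m α c => ?_) (by simp) (fun N N' h h' => by simp [h, h']) (fun z N h => by simp [h])
  · rw [hs.id_id, one_mul]
  · rw [hs.id_pow, one_mul]

lemma actP_idP (c d : charAlg q μ R F) :
    actP q μ R F (idP q μ R F c) d = idP q μ R F (c * d) := PSpace.ext_site (by
  rw [site0_actP, site0_idP, site0_idP, ← map_mul]; rfl)

lemma actP_powP {m : ℕ} (α : BraidAlg m) (c d : charAlg q μ R F) :
    actP q μ R F (powP q μ R F α c) d = powP q μ R F α (c * d) := Subtype.ext (by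
  change rightMul (rightMul _ _) _ = rightMul _ _
  funext a b
  simp [rightMul, mul_assoc])

lemma actP_add (x y : PSpace q μ R F) (d : charAlg q μ R F) :
    actP q μ R F (x + y) d = actP q μ R F x d + actP q μ R F y d := map_add (actHom d) x y

lemma actP_smul (z : ℂ) (x : PSpace q μ R F) (d : charAlg q μ R F) :
    actP q μ R F (z • x) d = z • actP q μ R F x d := map_smul (actHom d) z x

lemma actP_zero (d : charAlg q μ R F) : actP q μ R F 0 d = 0 := map_zero (actHom d)

include hs in
lemma IsStarProduct.id_right (x : PSpace q μ R F) (c : charAlg q μ R F) :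
    s x (idP q μ R F c) = actP q μ R F x c := by
  refine PSpace.induction (P := fun x => s x (idP q μ R F c) = actP q μ R F x c) x (fun c => ?_)
    (fun m α c => ?_) (by simp [actP_zero]) (fun N N' h h' => by simp [h, h', actP_add])
    (fun z N h => by simp [h, actP_smul])
  · rw [hs.id_id, actP_idP]
  · rw [hs.pow_id, actP_powP]

include hs in
lemma IsStarProduct.one_right (x : PSpace q μ R F) : s x (idP q μ R F 1) = x := by
  rw [hs.id_right]
  exact PSpace.ext_site (by
    rw [site0_actP, OneMemClass.coe_one, map_one, mul_one])

include hs hR hRF in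
lemma IsStarProduct.id_left [Nonempty ι] (x : PSpace q μ R F) (c : charAlg q μ R F) :
    s (idP q μ R F c) x = actP q μ R F x c := by
  refine PSpace.induction (P := fun x => s (idP q μ R F c) x = actP q μ R F x c) x (fun d => ?_)
    (fun m α d => ?_) (by simp [actP_zero]) (fun N N' h h' => by simp [h, h', actP_add])
    (fun z N h => by simp [h, actP_smul])
  · rw [hs.id_id, actP_idP, charAlg_comm hR hRF]
  · rw [hs.id_pow, actP_powP, charAlg_comm hR hRF]

include hs hR hRF in
lemma IsStarProduct.act_right (x y : PSpace q μ R F) (c : charAlg q μ R F) :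
    s x (actP q μ R F y c) = actP q μ R F (s x y) c := by
  rw [← hs.id_right, ← hs.id_right, hs.assoc hR hRF]

include hs hR hRF in
lemma IsStarProduct.act_left [Nonempty ι] (x y : PSpace q μ R F) (c : charAlg q μ R F) :
    s (actP q μ R F x c) y = actP q μ R F (s x y) c := by
  rw [← hs.id_right, hs.assoc hR hRF, hs.id_left hR hRF, hs.act_right hR hRF]

end

end Star

end
noncomputable section
section Completion

variable {ι : Type} [Fintype ι] [DecidableEq ι] {q μ : ℂ} {R F : RMatrix ι}
  (hR : IsSkewInvertible R.mat) (hRF : IsCompatiblePair R.mat F.mat)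
  {E : Type} [CommRing E] [Algebra ℂ E] (π : charAlg q μ R F →ₐ[ℂ] E)
  {s : PSpace q μ R F →ₗ[ℂ] PSpace q μ R F →ₗ[ℂ] PSpace q μ R F}
  (hs : IsStarProduct q μ R F s)

/-! ## The completed `⋆`-product -/

lemma tens_act (N : PSpace q μ R F) (c : charAlg q μ R F) (e : E) :
    tens π (actP q μ R F N c) e = tens π N (π c * e) := by
  rw [tens, tens, ← sub_eq_zero, ← map_sub, Submodule.mkQ_apply, Submodule.Quotient.mk_eq_zero]
  exact Submodule.subset_span ⟨N, c, e, rfl⟩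

/-- `tens` as a bilinear map. -/
def tensHom : PSpace q μ R F →ₗ[ℂ] E →ₗ[ℂ] Completed π :=
  (TensorProduct.mk ℂ (PSpace q μ R F) E).compr₂ (balanced π).mkQ

lemma tensHom_apply (N : PSpace q μ R F) (e : E) : tensHom π N e = tens π N e := rfl

lemma Completed.induction {P : Completed π → Prop} (x : Completed π)
    (ht : ∀ N e, P (tens π N e)) (hadd : ∀ x y, P x → P y → P (x + y)) : P x := by
  obtain ⟨y, rfl⟩ := (balanced π).mkQ_surjective x
  induction y using TensorProduct.induction_on with
  | zero =>
    have := ht 0 0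
    rwa [tens, TensorProduct.zero_tmul] at this
  | tmul N e => exact ht N e
  | add y z hy hz => rw [map_add]; exact hadd _ _ hy hz

lemma Completed.hom_ext {V : Type} [AddCommGroup V] [Module ℂ V] {T T' : Completed π →ₗ[ℂ] V}
    (h : ∀ N e, T (tens π N e) = T' (tens π N e)) : T = T' := by
  exact LinearMap.ext fun x => Completed.induction π (P := fun x => T x = T' x) x h
    (fun x y hx hy => by rw [map_add, map_add, hx, hy])

/-- Lift of a balanced bilinear map to the completion. -/
def Completed.lift {V : Type} [AddCommGroup V] [Module ℂ V]
    (f : PSpace q μ R F →ₗ[ℂ] E →ₗ[ℂ] V)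
    (hf : ∀ N c e, f (actP q μ R F N c) e = f N (π c * e)) : Completed π →ₗ[ℂ] V :=
  (balanced π).liftQ (TensorProduct.lift f) (by
    rw [balanced, Submodule.span_le]
    rintro _ ⟨N, c, e, rfl⟩
    simp [hf])

lemma Completed.lift_tens {V : Type} [AddCommGroup V] [Module ℂ V]
    (f : PSpace q μ R F →ₗ[ℂ] E →ₗ[ℂ] V)
    (hf : ∀ N c e, f (actP q μ R F N c) e = f N (π c * e)) (N : PSpace q μ R F) (e : E) :
    Completed.lift π f hf (tens π N e) = f N e := by
  simp [Completed.lift, tens]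

include hs hR hRF in
lemma exists_isCompletedStar [Nonempty ι] : ∃ t, IsCompletedStar π s t := by
  have h1 : ∀ (N : PSpace q μ R F) (e : E), ∃ T : Completed π →ₗ[ℂ] Completed π,
      ∀ N' e', T (tens π N' e') = tens π (s N N') (e * e') := by
    intro N e
    refine ⟨Completed.lift π ((tensHom π).compl₁₂ (s N) (LinearMap.mulLeft ℂ e)) ?_, ?_⟩
    · intro N' c e'
      simp only [LinearMap.compl₁₂_apply, LinearMap.mulLeft_apply, tensHom_apply]
      rw [hs.act_right hR hRF, tens_act, mul_left_comm]
    · intro N' e'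
      rw [Completed.lift_tens]; rfl
  choose T hT using h1
  let f : PSpace q μ R F →ₗ[ℂ] E →ₗ[ℂ] Completed π →ₗ[ℂ] Completed π :=
    LinearMap.mk₂ ℂ T
      (fun N N' e => Completed.hom_ext π fun N'' e'' => by
        simp only [LinearMap.add_apply, hT]
        simp only [← tensHom_apply, map_add, LinearMap.add_apply])
      (fun z N e => Completed.hom_ext π fun N'' e'' => by
        simp only [LinearMap.smul_apply, hT]
        simp only [← tensHom_apply, map_smul, LinearMap.smul_apply])
      (fun N e e' => Completed.hom_ext π fun N'' e'' => by
        simp only [LinearMap.add_apply, hT]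
        simp only [← tensHom_apply, map_add, add_mul])
      (fun z N e => Completed.hom_ext π fun N'' e'' => by
        simp only [LinearMap.smul_apply, hT]
        simp only [← tensHom_apply, map_smul, smul_mul_assoc])
  refine ⟨Completed.lift π f ?_, ?_⟩
  · intro N c e
    refine Completed.hom_ext π fun N'' e'' => ?_
    change T _ _ _ = T _ _ _
    rw [hT, hT, hs.act_left hR hRF, tens_act, mul_assoc]
  · intro N N' e e'
    rw [Completed.lift_tens]
    exact hT N e N' e'

lemma IsCompletedStar.unique {t t' : Completed π →ₗ[ℂ] Completed π →ₗ[ℂ] Completed π}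
    (h : IsCompletedStar π s t) (h' : IsCompletedStar π s t') : t = t' :=
  Completed.hom_ext π fun N e => Completed.hom_ext π fun N' e' => by rw [h, h']

section

variable {π} {t : Completed π →ₗ[ℂ] Completed π →ₗ[ℂ] Completed π}
  (ht : IsCompletedStar π s t)

include ht hs hR hRF in
lemma IsCompletedStar.assoc (x y z : Completed π) : t (t x y) z = t x (t y z) := by
  refine Completed.induction π (P := fun x => t (t x y) z = t x (t y z)) x (fun N e => ?_)
    (fun x y hx hy => by simp [hx, hy])
  refine Completed.induction π (P := fun y => t (t _ y) z = t _ (t y z)) y (fun N' e' => ?_)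
    (fun x y hx hy => by simp [hx, hy])
  refine Completed.induction π (P := fun z => t (t _ _) z = t _ (t _ z)) z (fun N'' e'' => ?_)
    (fun x y hx hy => by simp [hx, hy])
  rw [ht, ht, ht, ht, hs.assoc hR hRF, mul_assoc]

include ht hs in
lemma IsCompletedStar.one_left (x : Completed π) : t (tens π (idP q μ R F 1) 1) x = x := by
  refine Completed.induction π (P := fun x => t _ x = x) x (fun N e => ?_)
    (fun x y hx hy => by simp [hx, hy])
  rw [ht, hs.one_left, one_mul]

include ht hs in
lemma IsCompletedStar.one_right (x : Completed π) : t x (tens π (idP q μ R F 1) 1) = x := by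
  refine Completed.induction π (P := fun x => t x _ = x) x (fun N e => ?_)
    (fun x y hx hy => by simp [hx, hy])
  rw [ht, hs.one_right, mul_one]

end

end Completion

end
noncomputable section
/-! ## The Birman-Murakami-Wenzl relations on two neighbouring pairs of sites -/

/-- Two neighbouring pairs of BMW generators. -/
structure BMWPair {O : Type} [Ring O] [Algebra ℂ O] (R S : Oˣ) (K L : O) (c μ : ℂ) : Prop where
  mu_ne : μ ≠ 0
  braid : R * S * R = S * R * S
  Rinv : (↑R⁻¹ : O) = R - c • 1 + c • K
  Sinv : (↑S⁻¹ : O) = S - c • 1 + c • L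
  RK : (R : O) * K = μ • K
  KR : K * R = μ • K
  SL : (S : O) * L = μ • L
  LS : L * S = μ • L
  RSK' : (R : O) * S * K = L * (R * S)
  RiSiK' : (↑R⁻¹ : O) * ↑S⁻¹ * K = L * (↑R⁻¹ * ↑S⁻¹)
  LK : L * K = R * S * K
  LK' : L * K = ↑R⁻¹ * ↑S⁻¹ * K
  KLK : K * L * K = K

namespace BMWPair

variable {O : Type} [Ring O] [Algebra ℂ O] {R S : Oˣ} {K L : O} {c μ : ℂ}
  (h : BMWPair R S K L c μ)

include h

lemma RiK : (↑R⁻¹ : O) * K = μ⁻¹ • K := by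
  have : K = μ • (↑R⁻¹ * K) := by
    rw [← mul_smul_comm, ← h.RK, Units.inv_mul_cancel_left]
  conv_rhs => rw [this]
  rw [smul_smul, inv_mul_cancel₀ h.mu_ne, one_smul]

lemma SiL : (↑S⁻¹ : O) * L = μ⁻¹ • L := by
  have : L = μ • (↑S⁻¹ * L) := by
    rw [← mul_smul_comm, ← h.SL, Units.inv_mul_cancel_left]
  conv_rhs => rw [this]
  rw [smul_smul, inv_mul_cancel₀ h.mu_ne, one_smul]

lemma KSK : K * S * K = μ⁻¹ • K := by
  have : μ • (K * S * K) = K := by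
    rw [← smul_mul_assoc, ← smul_mul_assoc, ← h.KR, mul_assoc K, mul_assoc K, ← h.LK, ← mul_assoc,
      h.KLK]
  conv_rhs => rw [← this]
  rw [smul_smul, inv_mul_cancel₀ h.mu_ne, one_smul]

lemma LRS : L * R * S = L * K := by rw [mul_assoc, ← h.RSK', h.LK]

lemma LRiSi : L * ↑R⁻¹ * ↑S⁻¹ = L * K := by rw [mul_assoc, ← h.RiSiK', h.LK']

lemma LKSi : L * K * ↑S⁻¹ = L * R := by rw [← h.LRS, Units.mul_inv_cancel_right]

lemma LKS : L * K * S = L * ↑R⁻¹ := by rw [← h.LRiSi, Units.inv_mul_cancel_right]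

lemma RLK : (R : O) * (L * K) = ↑S⁻¹ * K := by
  rw [h.LK', mul_assoc, Units.mul_inv_cancel_left]

lemma RiLK : (↑R⁻¹ : O) * (L * K) = S * K := by
  rw [h.LK, mul_assoc, Units.inv_mul_cancel_left]

lemma LKL : L * K * L = L := by
  have e1 : L * R * L = μ⁻¹ • (L * K * L) := by
    rw [← h.LKSi, mul_assoc, h.SiL, mul_smul_comm]
  have e2 : L = R * S * K * (↑S⁻¹ * ↑R⁻¹) := by
    rw [h.RSK', mul_assoc, mul_assoc, Units.mul_inv_cancel_left, Units.mul_inv, mul_one]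
  have br : (R : O) * S * R = S * R * S := congrArg Units.val h.braid
  have e3 : L * K * L = μ • (L * R * L * K * (↑S⁻¹ * ↑R⁻¹)) := by
    calc L * K * L = L * R * S * (R * S * K * (↑S⁻¹ * ↑R⁻¹)) := by rw [h.LRS, ← e2]
      _ = L * R * (S * R * S) * K * (↑S⁻¹ * ↑R⁻¹) := by simp only [mul_assoc]
      _ = L * R * (R * S) * (R * K) * (↑S⁻¹ * ↑R⁻¹) := by rw [← br]; simp only [mul_assoc]
      _ = μ • (L * R * (R * S * K) * (↑S⁻¹ * ↑R⁻¹)) := by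
          rw [h.RK]; simp only [mul_assoc, mul_smul_comm, smul_mul_assoc]
      _ = _ := by rw [← h.LK]; simp only [mul_assoc]
  rw [e3, e1]
  have e4 : L * K * L * K = L * K := by rw [mul_assoc, mul_assoc, ← mul_assoc K, h.KLK]
  rw [smul_mul_assoc, smul_mul_assoc, smul_smul, mul_inv_cancel₀ h.mu_ne, one_smul, e4, ← mul_assoc,
    h.LKSi, Units.mul_inv_cancel_right]

lemma LRL : L * R * L = μ⁻¹ • L := by
  rw [← h.LKSi, mul_assoc, h.SiL, mul_smul_comm, h.LKL]

lemma KL : K * L = ↑S⁻¹ * ↑R⁻¹ * L := by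
  have : (R : O) * S * K * L = L := by rw [← h.LK, h.LKL]
  conv_rhs => rw [← this]
  rw [mul_assoc, mul_assoc, mul_assoc, Units.inv_mul_cancel_left, Units.inv_mul_cancel_left]

lemma KL' : K * L = S * R * L := by
  have : (↑R⁻¹ : O) * ↑S⁻¹ * K * L = L := by rw [← h.LK', h.LKL]
  conv_rhs => rw [← this]
  rw [mul_assoc, mul_assoc, mul_assoc, Units.mul_inv_cancel_left, Units.mul_inv_cancel_left]

lemma SKL : (S : O) * (K * L) = ↑R⁻¹ * L := by rw [h.KL, mul_assoc, Units.mul_inv_cancel_left]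

lemma KSR : K * S * R = K * L := by
  have br : (S : O) * R * S = R * S * R := (congrArg Units.val h.braid).symm
  have e2 : L = R * S * K * (↑S⁻¹ * ↑R⁻¹) := by
    rw [h.RSK', mul_assoc, mul_assoc, Units.mul_inv_cancel_left, Units.mul_inv, mul_one]
  have e3 : L * (↑R⁻¹ * ↑S⁻¹) = ↑R⁻¹ * ↑S⁻¹ * K := h.RiSiK'.symm
  have e4 : K = S * R * L * (↑R⁻¹ * ↑S⁻¹) := by
    rw [mul_assoc, e3, mul_assoc, mul_assoc, Units.mul_inv_cancel_left, Units.mul_inv_cancel_left]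
  have e5 : K * S * R = S * R * L := by
    conv_lhs => rw [e4]
    simp only [mul_assoc, Units.inv_mul, mul_one]
  rw [e5, h.KL']

lemma KSiRi : K * ↑S⁻¹ * ↑R⁻¹ = K * L := by
  have e4 : K = ↑S⁻¹ * ↑R⁻¹ * (L * (R * S)) := by
    rw [← h.RSK', mul_assoc, mul_assoc, Units.inv_mul_cancel_left, Units.inv_mul_cancel_left]
  conv_lhs => rw [e4]
  rw [h.KL, ← mul_assoc L, ← mul_assoc, Units.mul_inv_cancel_right, ← mul_assoc,
    Units.mul_inv_cancel_right]

lemma KLRi : K * L * ↑R⁻¹ = K * S := by rw [← h.KSR, Units.mul_inv_cancel_right]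

lemma KLR : K * L * R = K * ↑S⁻¹ := by rw [← h.KSiRi, Units.inv_mul_cancel_right]

lemma SKS : (S : O) * K * S = ↑R⁻¹ * L * ↑R⁻¹ := by
  rw [← h.RiLK, mul_assoc, h.LKS, mul_assoc]

lemma R_sq : (R : O) * R = 1 + c • (R : O) - (c * μ) • K := by
  have : (R : O) * ↑R⁻¹ = 1 := Units.mul_inv R
  rw [h.Rinv, mul_add, mul_sub, mul_smul_comm, mul_smul_comm, h.RK, mul_one, smul_smul] at this
  linear_combination (norm := module) this

lemma S_sq : (S : O) * S = 1 + c • (S : O) - (c * μ) • L := by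
  have : (S : O) * ↑S⁻¹ = 1 := Units.mul_inv S
  rw [h.Sinv, mul_add, mul_sub, mul_smul_comm, mul_smul_comm, h.SL, mul_one, smul_smul] at this
  linear_combination (norm := module) this

lemma RLR : (R : O) * L * R = S * K * S + c • (R * L + L * R - S * K - K * S) - (c * c) • L +
    (c * c) • K := by
  have hR : (R : O) = ↑R⁻¹ + c • 1 - c • K := by rw [h.Rinv]; module
  have e1 : (↑R⁻¹ : O) * L * ↑R⁻¹ = S * K * S := h.SKS.symm
  have e2 := h.RiLK
  have e3 := h.KLRi
  have e4 := h.KLK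
  have e5 : (↑R⁻¹ : O) * L = R * L - c • L + c • (K * L) := by
    rw [h.Rinv, add_mul, sub_mul, smul_mul_assoc, smul_mul_assoc, one_mul]
  have e6 : L * (↑R⁻¹ : O) = L * R - c • L + c • (L * K) := by
    rw [h.Rinv, mul_add, mul_sub, mul_smul_comm, mul_smul_comm, mul_one]
  calc (R : O) * L * R = (↑R⁻¹ + c • 1 - c • K) * L * (↑R⁻¹ + c • 1 - c • K) := by rw [← hR]
    _ = ↑R⁻¹ * L * ↑R⁻¹ + c • (↑R⁻¹ * L) + c • (L * ↑R⁻¹) + (c * c) • L - c • (↑R⁻¹ * (L * K)) -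
        c • (K * L * ↑R⁻¹) - (c * c) • (L * K) - (c * c) • (K * L) + (c * c) • (K * L * K) := by
        simp only [add_mul, sub_mul, mul_add, mul_sub, smul_mul_assoc, mul_smul_comm, one_mul,
          mul_one, smul_smul, mul_assoc, smul_add, smul_sub]
        abel
    _ = _ := by rw [e1, e5, e6, e2, e3, e4]; module

/-- The Yang-Baxter equation for baxterized elements, in terms of the coefficients. -/
lemma yangBaxter {η a a' b b' d d' : ℂ} (hK : K * K = η • K) (hL : L * L = η • L)
    (h0 : b = a + d + c * a * d) (h1 : b * a' + b' * a' * d = b' * (a + c * a * d))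
    (h2 : b * d' + b' * d' * a = b' * (d + c * a * d))
    (h3 : a' + d' - c * μ * a * d + (a * d' + a' * d) * μ + a' * d' * η + b * a' * d' * μ⁻¹ +
      b' * (a' * d' + c * c * a * d - c * a * d' - c * a' * d) - b' = 0) :
    (1 + a • (R : O) + a' • K) * (1 + b • (S : O) + b' • L) * (1 + d • (R : O) + d' • K) =
      (1 + d • (S : O) + d' • L) * (1 + b • (R : O) + b' • K) * (1 + a • (S : O) + a' • L) := by
  have r1 := h.RK
  have r2 := h.KR
  have r3 := h.SL
  have r4 := h.LS
  have br : (R : O) * S * R = S * R * S := congrArg Units.val h.braid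
  have s1 : (R : O) * L * K = S * K - c • K + c • (L * K) := by
    rw [mul_assoc, h.RLK, h.Sinv, add_mul, sub_mul, smul_mul_assoc, smul_mul_assoc, one_mul]
  have s2 : K * L * R = K * S - c • K + c • (K * L) := by
    rw [h.KLR, h.Sinv, mul_add, mul_sub, mul_smul_comm, mul_smul_comm, mul_one]
  have s3 : (S : O) * K * L = R * L - c • L + c • (K * L) := by
    rw [mul_assoc, h.SKL, h.Rinv, add_mul, sub_mul, smul_mul_assoc, smul_mul_assoc, one_mul]
  have s4 : L * K * S = L * R - c • L + c • (L * K) := by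
    rw [h.LKS, h.Rinv, mul_add, mul_sub, mul_smul_comm, mul_smul_comm, mul_one]
  have lhs : (1 + a • (R : O) + a' • K) * (1 + b • (S : O) + b' • L) * (1 + d • (R : O) + d' • K) =
      1 + (a + d) • (R : O) + (a' + d') • K + (a * d) • ((R : O) * R) + (a * d') • ((R : O) * K) +
      (a' * d) • (K * R) + (a' * d') • (K * K) + b • (S : O) + (a * b) • ((R : O) * S) +
      (b * d) • ((S : O) * R) + (a' * b) • (K * S) + (b * d') • (S * K) +
      (a * b * d) • ((R : O) * S * R) + (a * b * d') • ((R : O) * S * K) +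
      (a' * b * d) • (K * S * R) + (a' * b * d') • (K * S * K) + b' • L + (a * b') • (R * L) +
      (b' * d) • (L * R) + (a' * b') • (K * L) + (b' * d') • (L * K) +
      (a * b' * d) • (R * L * R) + (a * b' * d') • (R * L * K) + (a' * b' * d) • (K * L * R) +
      (a' * b' * d') • (K * L * K) := by
    simp only [add_mul, mul_add, smul_mul_assoc, mul_smul_comm, one_mul, mul_one, add_smul]
    module
  have rhs : (1 + d • (S : O) + d' • L) * (1 + b • (R : O) + b' • K) * (1 + a • (S : O) + a' • L) =
      1 + (a + d) • (S : O) + (a' + d') • L + (a * d) • ((S : O) * S) + (d * a') • ((S : O) * L) +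
      (d' * a) • (L * S) + (a' * d') • (L * L) + b • (R : O) + (b * d) • ((S : O) * R) +
      (a * b) • ((R : O) * S) + (d' * b) • (L * R) + (b * a') • (R * L) +
      (a * b * d) • ((S : O) * R * S) + (d * b * a') • ((S : O) * R * L) +
      (d' * b * a) • (L * R * S) + (a' * b * d') • (L * R * L) + b' • K + (d * b') • (S * K) +
      (b' * a) • (K * S) + (d' * b') • (L * K) + (b' * a') • (K * L) +
      (a * b' * d) • (S * K * S) + (d * b' * a') • (S * K * L) + (d' * b' * a) • (L * K * S) +
      (a' * b' * d') • (L * K * L) := by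
    simp only [add_mul, mul_add, smul_mul_assoc, mul_smul_comm, one_mul, mul_one, add_smul]
    module
  rw [lhs, rhs, r1, r2, r3, r4, hK, hL, h.R_sq, h.S_sq, br, ← h.LK, h.KSR, h.KSK, ← h.KL', h.LRS,
    h.LRL, h.RLR, s1, s2, s3, s4, h.KLK, h.LKL]
  linear_combination (norm := module) h0 • (S - R : O) + h1 • (K * S - R * L : O) +
    h2 • (S * K - L * R : O) + h3 • (K - L : O)

end BMWPair

end
noncomputable section
/-! ## Chains of BMW type -/

/-- `K_i = μ⁻¹ (q - q⁻¹)⁻¹ (q - R_i) (q⁻¹ + R_i)`. -/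
def QChain.kapOp {O : Type} [Ring O] [Algebra ℂ O] (C : QChain O) (q μ : ℂ) (i : ℕ) : O :=
  (μ * (q - q⁻¹))⁻¹ • ((q • 1 - (C.R i : O)) * (q⁻¹ • 1 + (C.R i : O)))

/-- A chain of sites with an R-matrix of BMW type. -/
structure BMWChain (O : Type) [Ring O] [Algebra ℂ O] extends QChain O where
  /-- the first BMW parameter -/
  q : ℂ
  /-- the second BMW parameter -/
  μ : ℂ
  q_ne : q ≠ 0
  c_ne' : q - q⁻¹ ≠ 0
  mu_ne : μ ≠ 0
  eta_ne' : eta q μ ≠ 0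
  cubic : ∀ i, ((R i : O) - q • 1) * ((R i : O) + q⁻¹ • 1) * ((R i : O) - μ • 1) = 0
  KK : ∀ i, toQChain.kapOp q μ (i + 1) * toQChain.kapOp q μ i =
    R i * R (i + 1) * toQChain.kapOp q μ i
  KK' : ∀ i, toQChain.kapOp q μ (i + 1) * toQChain.kapOp q μ i =
    ↑(R i)⁻¹ * ↑(R (i + 1))⁻¹ * toQChain.kapOp q μ i
  KKK : ∀ i, toQChain.kapOp q μ i * toQChain.kapOp q μ (i + 1) * toQChain.kapOp q μ i =
    toQChain.kapOp q μ i
  faithful : ∀ {i X}, X ∈ off i → X ∈ off (i + 1) → X * toQChain.kapOp q μ i = 0 → X = 0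

namespace BMWChain

open QChain (cj cj_def cj_mul cj_eq_of_comm comm_iff_cj cj_units inv_comm braid_inv)

variable {O : Type} [Ring O] [Algebra ℂ O] (C : BMWChain O)

/-- The operators `K_i`. -/
def K (i : ℕ) : O := C.kapOp C.q C.μ i

/-- `q - q⁻¹`. -/
def c : ℂ := C.q - C.q⁻¹

/-- The loop parameter. -/
def η : ℂ := eta C.q C.μ

lemma c_ne : C.c ≠ 0 := C.c_ne'

lemma η_ne : C.η ≠ 0 := C.eta_ne'

lemma c_mul_η : C.c * C.η * C.μ = 1 + C.c * C.μ - C.μ ^ 2 := by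
  have h1 := C.q_ne
  have h2 := C.c_ne'
  have h3 := C.mu_ne
  have e : C.q * C.q⁻¹ = 1 := mul_inv_cancel₀ h1
  rw [η, c, eta]
  generalize C.q⁻¹ = p at *
  field_simp
  linear_combination e

lemma K_eq (i : ℕ) : C.K i = (C.μ * C.c)⁻¹ • (1 + C.c • (C.R i : O) - (C.R i : O) * C.R i) := by
  have e : (C.q * C.q⁻¹) • (1 : O) = 1 := by rw [mul_inv_cancel₀ C.q_ne, one_smul]
  rw [K, QChain.kapOp, ← c]
  congr 1
  simp only [sub_mul, mul_add, smul_mul_assoc, mul_smul_comm, one_mul, mul_one]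
  rw [c]
  linear_combination (norm := module) e

lemma R_mul_R (i : ℕ) : (C.R i : O) * C.R i = 1 + C.c • (C.R i : O) - (C.c * C.μ) • C.K i := by
  rw [K_eq, smul_smul, mul_comm C.c, mul_inv_cancel₀ (mul_ne_zero C.mu_ne C.c_ne)]
  module

lemma R_mul_K (i : ℕ) : (C.R i : O) * C.K i = C.μ • C.K i := by
  have h := C.cubic i
  have h1 : (C.K i) * ((C.R i : O) - C.μ • 1) = 0 := by
    have e : C.K i = -(C.μ * C.c)⁻¹ • (((C.R i : O) - C.q • 1) * ((C.R i : O) + C.q⁻¹ • 1)) := by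
      rw [K, QChain.kapOp, ← c, neg_smul, ← smul_neg, ← neg_mul, neg_sub, add_comm (C.R i : O)]
    rw [e, smul_mul_assoc, h, smul_zero]
  rw [mul_sub, mul_smul_comm, mul_one, sub_eq_zero] at h1
  rw [← h1, K_eq, smul_mul_assoc, mul_smul_comm]
  congr 1
  simp only [mul_sub, mul_add, sub_mul, add_mul, smul_mul_assoc, mul_smul_comm, mul_one, one_mul,
    mul_assoc]

lemma Rinv (i : ℕ) : (↑(C.R i)⁻¹ : O) = C.R i - C.c • 1 + C.c • C.K i := by
  have : (C.R i : O) * (C.R i - C.c • 1 + C.c • C.K i) = 1 := by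
    rw [mul_add, mul_sub, mul_smul_comm, mul_smul_comm, R_mul_R, R_mul_K, mul_one]
    module
  rw [Units.inv_eq_of_mul_eq_one_right this]

lemma K_mem {S : Subalgebra ℂ O} {i : ℕ} (h : (C.R i : O) ∈ S) : C.K i ∈ S := by
  rw [K_eq]
  exact S.smul_mem (sub_mem (add_mem (one_mem _) (S.smul_mem h _)) (mul_mem h h)) _

lemma K_mem_W {a n i : ℕ} (h1 : a ≤ i) (h2 : i + 1 < a + n) : C.K i ∈ C.W a n :=
  C.K_mem (C.R_mem_W h1 h2)

lemma K_off {i j : ℕ} (h1 : j ≠ i) (h2 : j ≠ i + 1) : C.K i ∈ C.off j := C.K_mem (C.R_off h1 h2)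

lemma K_comm' {i : ℕ} {X : O} (h : (C.R i : O) * X = X * C.R i) : C.K i * X = X * C.K i := by
  rw [K_eq, smul_mul_assoc, mul_smul_comm]
  congr 1
  simp only [mul_sub, mul_add, sub_mul, add_mul, smul_mul_assoc, mul_smul_comm, mul_one, one_mul,
    mul_assoc, h]
  rw [← mul_assoc, h, mul_assoc]

lemma K_comm {i : ℕ} {X : O} (h : X ∈ C.off i) (h' : X ∈ C.off (i + 1)) :
    C.K i * X = X * C.K i := C.K_comm' (C.R_comm h h')

lemma map_K {B : Type} [Ring B] [Algebra ℂ B] (C' : BMWChain B) (f : O →ₐ[ℂ] B) {i j : ℕ}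
    (hq : C.q = C'.q) (hμ : C.μ = C'.μ) (h : f (C.R i) = C'.R j) : f (C.K i) = C'.K j := by
  rw [K_eq, K_eq, map_smul, map_sub, map_add, map_one, map_smul, map_mul, h, c, c, hq, hμ]

lemma cj_K (u : Oˣ) {i j : ℕ} (h : u * C.R i = C.R j * u) : cj u (C.K i) = C.K j :=
  C.map_K C (cj u) rfl rfl (cj_units _ _ _ h)

lemma unit_mul_K (u : Oˣ) {i j : ℕ} (h : u * C.R i = C.R j * u) : (u : O) * C.K i = C.K j * u := by
  rw [← C.cj_K u h, cj_def, Units.inv_mul_cancel_right]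

lemma K_mul_K (i : ℕ) : C.K i * C.K i = C.η • C.K i := by
  have h : C.K i * C.K i =
      (C.μ * C.c)⁻¹ • (1 + C.c • (C.R i : O) - (C.R i : O) * C.R i) * C.K i := by rw [← K_eq]
  rw [h, smul_mul_assoc, sub_mul, add_mul, smul_mul_assoc, mul_assoc, R_mul_K, mul_smul_comm,
    R_mul_K, one_mul, smul_smul, smul_smul]
  have e : C.η = (C.μ * C.c)⁻¹ * (1 + C.c * C.μ - C.μ * C.μ) := by
    rw [eq_inv_mul_iff_mul_eq₀ (mul_ne_zero C.mu_ne C.c_ne)]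
    linear_combination C.c_mul_η
  rw [e]
  module

lemma pair (i : ℕ) : BMWPair (C.R i) (C.R (i + 1)) (C.K i) (C.K (i + 1)) C.c C.μ where
  mu_ne := C.mu_ne
  braid := C.R_braid i
  Rinv := C.Rinv i
  Sinv := C.Rinv (i + 1)
  RK := C.R_mul_K i
  KR := by rw [C.K_comm' rfl, R_mul_K]
  SL := C.R_mul_K _
  LS := by rw [← C.R_mul_K, C.K_comm' rfl]
  RSK' := by
    have := C.unit_mul_K (C.R i * C.R (i + 1)) (i := i) (j := i + 1)
      ((C.R_braid i).trans (mul_assoc _ _ _))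
    simpa using this
  RiSiK' := by
    have := C.unit_mul_K ((C.R i)⁻¹ * (C.R (i + 1))⁻¹) (i := i) (j := i + 1)
      ((braid_inv (C.R_braid i)).trans (mul_assoc _ _ _))
    simpa using this
  LK := C.KK i
  LK' := C.KK' i
  KLK := C.KKK i

/-! ### Traces of the BMW generators -/

/-- A family of shifted operators with `tr X_{i+1} K_i = z K_i` has trace `z`. -/
lemma trace_eq_of_mul_K {X : ℕ → O} {z : ℂ} {i : ℕ} (h2 : X i ∈ C.off (i + 2))
    (hX : ((C.R i * C.R (i + 1) : Oˣ) : O) * X i = X (i + 1) * (C.R i * C.R (i + 1) : Oˣ))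
    (hz : C.E (i + 2) (X (i + 1)) * C.K i = z • C.K i) : C.E (i + 1) (X i) = z • 1 := by
  have P := C.pair i
  set Z := C.E (i + 1) (X i) with hZ
  have e1 : X (i + 1) = C.R i * (C.R (i + 1) * X i * ↑(C.R (i + 1))⁻¹) * ↑(C.R i)⁻¹ := by
    have : cj (C.R i * C.R (i + 1)) (X i) = X (i + 1) := by
      rw [cj_def, hX, Units.mul_inv_cancel_right]
    rw [← this, cj_mul, cj_def, cj_def]
  have e2 : C.E (i + 2) (X (i + 1)) = C.R i * Z * ↑(C.R i)⁻¹ := by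
    rw [e1, C.E_mul_right (C.Ri_off (by omega) (by omega)),
      C.E_mul_left (C.R_off (by omega) (by omega)), C.E_conjR (i + 1) h2]
  have e3 : Z * C.K i = z • C.K i := by
    rw [e2, mul_assoc, P.RiK, mul_smul_comm, mul_assoc] at hz
    have := congrArg (fun x => (C.μ • (↑(C.R i)⁻¹ : O)) * x) hz
    simp only [smul_mul_assoc, mul_smul_comm, smul_smul, mul_inv_cancel₀ C.mu_ne, one_smul,
      Units.inv_mul_cancel_left, P.RiK] at this
    rwa [inv_mul_cancel₀ C.mu_ne, one_smul] at this
  have o1 : Z ∈ C.off (i + 1) := C.E_mem _ _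
  have o2 : Z ∈ C.off (i + 2) := C.E_mem_of _ h2
  have e4 : (Z - z • 1) * C.K (i + 1) = 0 := by
    have : Z * C.K (i + 1) = z • C.K (i + 1) := by
      have h := P.LKL
      calc Z * C.K (i + 1) = Z * (C.K (i + 1) * C.K i * C.K (i + 1)) := by rw [h]
        _ = C.K (i + 1) * (Z * C.K i) * C.K (i + 1) := by
          rw [← mul_assoc (C.K (i + 1)) Z, C.K_comm o1 o2]; simp only [mul_assoc]
        _ = z • C.K (i + 1) := by rw [e3, mul_smul_comm, smul_mul_assoc, h]
    rw [sub_mul, this, smul_mul_assoc, one_mul, sub_self]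
  exact sub_eq_zero.mp (C.faithful (sub_mem o1 ((C.off _).smul_mem (one_mem _) _))
    (sub_mem o2 ((C.off _).smul_mem (one_mem _) _)) e4)

lemma E_K (i : ℕ) : C.E (i + 1) (C.K i) = C.μ • 1 := by
  refine C.trace_eq_of_mul_K (C.K_off (by omega) (by omega))
    (C.unit_mul_K _ ((C.R_braid i).trans (mul_assoc _ _ _))) ?_
  rw [← C.E_mul_right (C.K_off (i := i) (j := i + 2) (by omega) (by omega)), (C.pair i).LK,
    mul_assoc, C.E_mul_left (C.R_off (by omega) (by omega)),
    C.E_mul_right (C.K_off (i := i) (j := i + 2) (by omega) (by omega)), C.E_R, one_mul, R_mul_K]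

lemma E_Rinv (i : ℕ) : C.E (i + 1) (↑(C.R i)⁻¹ : O) = C.μ ^ 2 • 1 := by
  have h : C.R i * C.R (i + 1) * (C.R i)⁻¹ = (C.R (i + 1))⁻¹ * (C.R i * C.R (i + 1)) := by
    rw [mul_inv_eq_iff_eq_mul, mul_assoc, eq_inv_mul_iff_mul_eq, ← mul_assoc, ← C.R_braid]
  refine C.trace_eq_of_mul_K (X := fun i => (↑(C.R i)⁻¹ : O)) (C.Ri_off (by omega) (by omega))
    ?_ ?_
  · have := congrArg Units.val h
    simpa using this
  · have e : (↑(C.R (i + 1))⁻¹ : O) * C.K i = C.R i * (C.K (i + 1) * C.K i) :=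
      (C.pair i).RLK.symm
    rw [← C.E_mul_right (C.K_off (i := i) (j := i + 2) (by omega) (by omega)), e,
      C.E_mul_left (C.R_off (by omega) (by omega)),
      C.E_mul_right (C.K_off (i := i) (j := i + 2) (by omega) (by omega)), C.E_K, smul_mul_assoc,
      one_mul, mul_smul_comm, R_mul_K, smul_smul, pow_two]

lemma E_one (j : ℕ) : C.E j 1 = (C.η * C.μ) • 1 := by
  have h1 : ∀ i, C.E (i + 1) 1 = (C.η * C.μ) • 1 := by
    intro i
    have h := C.E_Rinv i
    rw [C.Rinv, map_add, map_sub, map_smul, map_smul, C.E_R, C.E_K] at h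
    have h2 : C.c • (C.E (i + 1) 1 - (C.η * C.μ) • (1 : O)) = 0 := by
      have e : (C.c * C.η * C.μ) • (1 : O) = (1 + C.c * C.μ - C.μ ^ 2) • (1 : O) := by
        rw [C.c_mul_η]
      linear_combination (norm := module) -e - h
    rcases smul_eq_zero.mp h2 with h3 | h3
    · exact absurd h3 C.c_ne
    · exact sub_eq_zero.mp h3
  rcases j with _ | j
  · rw [← C.E_conjR 0 (one_mem _), mul_one, Units.mul_inv]
    exact h1 0
  · exact h1 j

/-! ### Caps -/

lemma E_cj {u : Oˣ} {j : ℕ} (h1 : (u : O) ∈ C.off j) (h2 : (↑u⁻¹ : O) ∈ C.off j) (T : O) :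
    C.E j (cj u T) = cj u (C.E j T) := by
  rw [cj_def, C.E_mul_right h2, C.E_mul_left h1, cj_def]

lemma E_E_conj {X : O} {d : ℕ} (h2 : X ∈ C.off (d + 2)) (h3 : X ∈ C.off (d + 3)) :
    C.E (d + 2) (C.E (d + 3)
      (cj (C.R (d + 1) * C.R d * (C.R (d + 2) * C.R (d + 1))) X)) = C.E d (C.E (d + 1) X) := by
  have h : ∀ {i T}, T ∈ C.off (i + 1) → C.E (i + 1) (cj (C.R i) T) = C.E i T :=
    fun hT => C.E_conjR _ hT
  have m : ∀ {i j T}, j ≠ i → j ≠ i + 1 → T ∈ C.off j → cj (C.R i) T ∈ C.off j :=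
    fun h1 h2 hT => mul_mem (mul_mem (C.R_off h1 h2) hT) (C.Ri_off h1 h2)
  rw [cj_mul, cj_mul, cj_mul,
    C.E_cj (j := d + 3) (C.R_off (by omega) (by omega)) (C.Ri_off (by omega) (by omega)),
    C.E_cj (j := d + 3) (C.R_off (by omega) (by omega)) (C.Ri_off (by omega) (by omega)),
    h (i := d + 2) (m (by omega) (by omega) h3), h (i := d + 1) h2,
    h (i := d + 1) (m (by omega) (by omega) (C.E_mem_of _ h2)), h (C.E_mem _ _)]

/-- Sandwiching between two caps is a partial trace. -/
lemma K_mul_mul_K {T : O} {d : ℕ} (h2 : T ∈ C.off (d + 2)) (h3 : T ∈ C.off (d + 3)) :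
    (C.η * C.μ ^ 2) • (C.K d * T * C.K d) = C.K d * C.E d (C.E (d + 1) (C.K d * T * C.K d)) := by
  have P := C.pair d
  have Q := C.pair (d + 1)
  set S : Oˣ := C.R (d + 1) * C.R d * (C.R (d + 2) * C.R (d + 1)) with hS
  have a1 : (C.R d * C.R (d + 1)) * C.R d = C.R (d + 1) * (C.R d * C.R (d + 1)) :=
    (C.R_braid d).trans (mul_assoc _ _ _)
  have a2 : (C.R (d + 1) * C.R d) * C.R (d + 1) = C.R d * (C.R (d + 1) * C.R d) :=
    (C.R_braid d).symm.trans (mul_assoc _ _ _)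
  have a3 : (C.R (d + 1) * C.R (d + 2)) * C.R (d + 1) = C.R (d + 2) * (C.R (d + 1) * C.R (d + 2)) :=
    (C.R_braid (d + 1)).trans (mul_assoc _ _ _)
  have a4 : (C.R (d + 2) * C.R (d + 1)) * C.R (d + 2) = C.R (d + 1) * (C.R (d + 2) * C.R (d + 1)) :=
    (C.R_braid (d + 1)).symm.trans (mul_assoc _ _ _)
  have hS' : S = (C.R (d + 1) * C.R (d + 2)) * (C.R d * C.R (d + 1)) := by
    rw [hS, mul_assoc, mul_assoc, ← mul_assoc (C.R d), C.Ru_comm (show d + 1 < d + 2 by omega)]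
    simp only [mul_assoc]
  have s0 : S * C.R d = C.R (d + 2) * S := by
    rw [hS', mul_assoc, a1, ← mul_assoc, a3]; simp only [mul_assoc]
  have s2 : S * C.R (d + 2) = C.R d * S := by
    rw [hS, mul_assoc, a4, ← mul_assoc, a2]; simp only [mul_assoc]
  have k0 := C.unit_mul_K S s0
  have k2 := C.unit_mul_K S s2
  have kk : C.K d * C.K (d + 2) = C.K (d + 2) * C.K d :=
    C.K_comm (C.K_off (by omega) (by omega)) (C.K_off (by omega) (by omega))
  have fix : (S : O) * (C.K d * C.K (d + 2)) = C.K d * C.K (d + 2) := by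
    have e1 : (C.R (d + 2) : O) * C.R (d + 1) * C.K (d + 2) = C.K (d + 1) * C.K (d + 2) := Q.KL'.symm
    have e2 : (C.R (d + 1) : O) * (C.R d * (C.K (d + 1) * C.K d)) = C.K d := by
      rw [P.LK', mul_assoc, Units.mul_inv_cancel_left, Units.mul_inv_cancel_left]
    calc (S : O) * (C.K d * C.K (d + 2))
        = C.R (d + 1) * (C.R d * ((C.R (d + 2) * C.R (d + 1) * C.K (d + 2)) * C.K d)) := by
          rw [kk, hS]; simp only [Units.val_mul, mul_assoc]
      _ = C.R (d + 1) * (C.R d * (C.K (d + 1) * C.K d)) * C.K (d + 2) := by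
          rw [e1, mul_assoc (C.K (d + 1)), ← kk]; simp only [mul_assoc]
      _ = _ := by rw [e2]
  have fix' : (↑S⁻¹ : O) * (C.K d * C.K (d + 2)) = C.K d * C.K (d + 2) := by
    conv_lhs => rw [← fix]
    rw [Units.inv_mul_cancel_left]
  have k0' : C.K d * (↑S⁻¹ : O) = ↑S⁻¹ * C.K (d + 2) := by
    rw [Units.eq_inv_mul_iff_mul_eq, ← mul_assoc, k0, Units.mul_inv_cancel_right]
  have tk : T * C.K (d + 2) = C.K (d + 2) * T := (C.K_comm h2 h3).symm
  have t'k : cj S T * C.K d = C.K d * cj S T := by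
    rw [← C.cj_K S s2, ← map_mul, ← map_mul, tk]
  have main : C.K d * T * C.K d * C.K (d + 2) = C.K d * cj S (C.K d * T * C.K d) := by
    calc C.K d * T * C.K d * C.K (d + 2) = C.K d * T * (↑S⁻¹ * (C.K d * C.K (d + 2))) := by
          rw [fix', mul_assoc]
      _ = C.K d * (↑S⁻¹ * (cj S T * C.K d)) * C.K (d + 2) := by
          rw [cj_def]; simp only [mul_assoc, Units.inv_mul_cancel_left]
      _ = ↑S⁻¹ * (C.K (d + 2) * C.K d) * cj S T * C.K (d + 2) := by
          rw [t'k, ← mul_assoc, k0']; simp only [mul_assoc]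
      _ = C.K d * (C.K (d + 2) * cj S T * C.K (d + 2)) := by
          rw [← kk, fix']; simp only [mul_assoc]
      _ = _ := by rw [map_mul, map_mul, C.cj_K S s0]
  have o2 : C.K d * T * C.K d ∈ C.off (d + 2) :=
    mul_mem (mul_mem (C.K_off (by omega) (by omega)) h2) (C.K_off (by omega) (by omega))
  have o3 : C.K d * T * C.K d ∈ C.off (d + 3) :=
    mul_mem (mul_mem (C.K_off (by omega) (by omega)) h3) (C.K_off (by omega) (by omega))
  have := congrArg (fun x => C.E (d + 2) (C.E (d + 3) x)) main
  rw [C.E_mul_left (j := d + 3) o3, C.E_K (d + 2), C.E_mul_left o2, map_smul, C.E_one,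
    C.E_mul_left (C.K_off (by omega) (by omega)), C.E_mul_left (C.K_off (by omega) (by omega)),
    C.E_E_conj o2 o3, mul_smul_comm, mul_smul_comm, mul_one, smul_smul] at this
  rw [← this]
  congr 1
  ring

/-- The 2-contraction. -/
def g : O := C.η⁻¹ • C.chi 1 (C.K 0)

lemma K_zero_off {j : ℕ} (h : 1 < j) : C.K 0 ∈ C.off j := C.K_off (by omega) (by omega)

lemma g_off (j : ℕ) : C.g ∈ C.off j :=
  (C.off j).smul_mem (C.chi_off (fun _ h => C.K_zero_off h) j) _

lemma M_M_comm_K (d : ℕ) : C.K d * (C.M d * C.M (d + 1)) = C.M d * C.M (d + 1) * C.K d :=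
  C.K_comm' (C.RMM_all d)

lemma M_M_K (d : ℕ) : C.M d * C.M (d + 1) * C.K d = (C.μ ^ 2)⁻¹ • (C.g * C.K d) := by
  induction d with
  | zero =>
    have hm := C.mu_ne
    have he := C.η_ne
    have h := C.K_mul_mul_K (T := C.M 0 * C.M 1) (d := 0)
      (mul_mem (C.M_off (by omega)) (C.M_off (by omega)))
      (mul_mem (C.M_off (by omega)) (C.M_off (by omega)))
    have e : C.K 0 * (C.M 0 * C.M 1) * C.K 0 = C.η • (C.M 0 * C.M 1 * C.K 0) := by
      rw [C.M_M_comm_K 0, mul_assoc, K_mul_K, mul_smul_comm]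
    have eg : C.E 0 (C.E 1 (C.M 0 * C.M 1 * C.K 0)) = C.η • C.g := by
      rw [g, smul_smul, mul_inv_cancel₀ he, one_smul, QChain.chi]
      simp [QChain.ET_succ, QChain.Mseq_succ]
    have gk : C.K 0 * C.g = C.g * C.K 0 := C.K_comm (C.g_off _) (C.g_off _)
    rw [e, map_smul, map_smul, eg, mul_smul_comm, mul_smul_comm, gk, smul_smul, smul_smul] at h
    rw [← sub_eq_zero]
    have h' : (C.η * C.η * C.μ ^ 2) • (C.M 0 * C.M (0 + 1) * C.K 0 -
        (C.μ ^ 2)⁻¹ • (C.g * C.K 0)) = 0 := by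
      have e2 : (C.η * C.η * C.μ ^ 2) • (C.μ ^ 2)⁻¹ • (C.g * C.K 0) =
          (C.η * C.η) • (C.g * C.K 0) := by
        rw [smul_smul, mul_assoc, mul_inv_cancel₀ (pow_ne_zero 2 hm), mul_one]
      rw [smul_sub, e2, ← h, sub_eq_zero]
      congr 1; ring
    exact (smul_eq_zero.mp h').resolve_left
      (mul_ne_zero (mul_ne_zero he he) (pow_ne_zero 2 hm))
  | succ d ih =>
    have e : cj (C.F d * C.F (d + 1)) (C.M d * C.M (d + 1)) = C.M (d + 1) * C.M (d + 1 + 1) := by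
      rw [map_mul, cj_mul, cj_mul, C.cj_F_M, cj_eq_of_comm (C.M_comm_F (Or.inl (by omega))),
        C.cj_F_M, cj_eq_of_comm (C.M_comm_F (Or.inr (by omega)))]
    have hk : cj (C.F d * C.F (d + 1)) (C.K d) = C.K (d + 1) :=
      C.cj_K _ (by rw [← C.compat₂, mul_assoc])
    have hg : cj (C.F d * C.F (d + 1)) C.g = C.g := by
      rw [cj_mul, cj_eq_of_comm (C.F_comm (C.g_off _) (C.g_off _)),
        cj_eq_of_comm (C.F_comm (C.g_off _) (C.g_off _))]
    rw [← e, ← hk, ← map_mul, ih, map_smul, map_mul, hg]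

/-- A cap on the last two strands of a matrix power contributes a factor `η g`. -/
lemma mp_mul_K {m : ℕ} {w : O} (hw : w ∈ C.W 0 (m + 1)) :
    C.mp (m + 2) (w * C.K (m + 1)) = C.η • (C.mp m w * C.g) := by
  have h1 : C.Mseq 0 (m + 2 + 1) = C.Mseq 0 (m + 1) * (C.M (m + 1) * C.M (m + 2)) := by
    rw [C.Mseq_succ, C.Mseq_succ 0 (m + 1), mul_assoc]; simp only [zero_add]
  have h2 : w * (C.M (m + 1) * C.M (m + 2)) = C.M (m + 1) * C.M (m + 2) * w := by
    refine C.W_comm hw fun i _ h => ?_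
    rw [← mul_assoc, C.M_comm_R (Or.inr (by omega)), mul_assoc, C.M_comm_R (Or.inr (by omega)),
      mul_assoc]
  have o1 : ∀ j, m < j → C.Mseq 0 (m + 1) * w ∈ C.off j := fun j hj =>
    mul_mem (C.Mseq_off (by omega)) (C.W_off (by omega) hw)
  have gk : C.g * C.K (m + 1) = C.K (m + 1) * C.g := (C.K_comm (C.g_off _) (C.g_off _)).symm
  rw [QChain.mp, QChain.mp, h1, mul_assoc, ← mul_assoc (C.M (m + 1) * _), ← h2, mul_assoc w,
    M_M_K, gk, mul_smul_comm, mul_smul_comm, map_smul, ← mul_assoc, ← mul_assoc,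
    C.ET_mul_right fun j _ _ => C.g_off j, C.ET_add 1 m 2, add_comm 1 m, C.ET_succ, C.ET_succ,
    C.ET_zero, C.E_mul_left (o1 _ (by omega)), add_zero, C.E_K (m + 1), mul_smul_comm, mul_one,
    map_smul, ← mul_one (C.Mseq 0 (m + 1) * w), C.E_mul_left (o1 _ (by omega)), C.E_one,
    mul_smul_comm, map_smul, map_smul, smul_mul_assoc, smul_mul_assoc, mul_one, smul_smul,
    smul_smul]
  congr 1
  have := C.mu_ne
  field_simp

lemma mp_one_K : C.mp 1 (C.K 0) = C.μ⁻¹ • C.g := by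
  have gk : C.g * C.K 0 = C.K 0 * C.g := (C.K_comm (C.g_off _) (C.g_off _)).symm
  have h : C.Mseq 0 (1 + 1) = C.M 0 * C.M (0 + 1) := by simp [QChain.Mseq_succ]
  rw [QChain.mp, h, M_M_K, C.ET_succ, C.ET_zero, gk, map_smul, C.E_mul_right (C.g_off _), C.E_K 0,
    smul_mul_assoc, one_mul, smul_smul]
  congr 1
  have := C.mu_ne
  field_simp

end BMWChain

end
noncomputable section
/-! ## Antisymmetrizers -/

namespace BMWChain

open QChain (cj cj_def cj_mul cj_eq_of_comm comm_iff_cj cj_units inv_comm braid_inv)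

variable {O : Type} [Ring O] [Algebra ℂ O] (C : BMWChain O)

/-- The coefficient of `R_i` in the baxterized element with spectral parameter `q^{-2 m}`. -/
def cR (m : ℕ) : ℂ := (C.q⁻¹ ^ (2 * m) - 1) / C.c

/-- The coefficient of `K_i` in the baxterized element with spectral parameter `q^{-2 m}`. -/
def cK (m : ℕ) : ℂ := (C.q⁻¹ ^ (2 * m) - 1) / (C.q * C.μ⁻¹ * C.q⁻¹ ^ (2 * m) + 1)

/-- The baxterized element with spectral parameter `q^{-2 m}`. -/
def bax (i m : ℕ) : O := 1 + C.cR m • (C.R i : O) + C.cK m • C.K i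

/-- The antisymmetrizer on the strands `d, …, d + m`. -/
def as (d m : ℕ) : O := C.rep d (antisym C.q C.μ m)

/-- The normalization of the antisymmetrizers. -/
def nrm (m : ℕ) : ℂ := C.q ^ m / qnum C.q (m + 1)

/-- The quantum numbers and the denominators of the baxterized elements do not vanish up to `N`. -/
structure Regular (N : ℕ) : Prop where
  qnum_ne : ∀ i, 2 ≤ i → i ≤ N → qnum C.q i ≠ 0
  den_ne : ∀ i, 1 ≤ i → i ≤ N → C.q * C.μ⁻¹ * C.q⁻¹ ^ (2 * i) + 1 ≠ 0

lemma rep_kap (d : ℕ) {m : ℕ} (i : Fin m) : C.rep d (kap C.q C.μ i) = C.K (d + i.val) := by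
  rw [kap, map_smul, map_mul, map_sub, map_add, map_smul, map_smul, map_one, QChain.rep_sigA]
  rfl

lemma rep_baxMinus (d : ℕ) {m : ℕ} (i : Fin m) (k : ℕ) :
    C.rep d (baxMinus C.q C.μ i (C.q⁻¹ ^ (2 * k))) = C.bax (d + i.val) k := by
  rw [baxMinus, map_add, map_add, map_smul, map_smul, rep_kap, QChain.rep_sigA, map_one]
  rfl

lemma as_zero (d : ℕ) : C.as d 0 = 1 := by rw [as, antisym, map_one]

lemma as_succ (d m : ℕ) :
    C.as d (m + 1) = C.nrm (m + 1) • (C.as d m * C.bax (d + m) (m + 1) * C.as d m) := by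
  rw [as, antisym, map_smul, map_mul, map_mul, QChain.rep_shift, rep_baxMinus]
  rfl

lemma as_mem_W (d m : ℕ) : C.as d m ∈ C.W d (m + 1) := C.rep_mem_W d _

lemma bax_comm {i : ℕ} {X : O} (h : (C.R i : O) * X = X * C.R i) (m : ℕ) :
    C.bax i m * X = X * C.bax i m := by
  rw [bax, add_mul, add_mul, mul_add, mul_add, smul_mul_assoc, smul_mul_assoc, mul_smul_comm,
    mul_smul_comm, C.K_comm' h, h, one_mul, mul_one]

lemma as_comm {d m : ℕ} {i : ℕ} (h : i + 1 < d ∨ d + m < i) :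
    (C.R i : O) * C.as d m = C.as d m * C.R i :=
  C.R_comm (C.W_off (by omega) (C.as_mem_W d m)) (C.W_off (by omega) (C.as_mem_W d m))

lemma K_mul_of_R {i : ℕ} {Y : O} (h : (C.R i : O) * Y = -C.q⁻¹ • Y) : C.K i * Y = 0 := by
  have hq := C.q_ne
  have e : 1 + C.c * (-C.q⁻¹) - (-C.q⁻¹) * (-C.q⁻¹) = 0 := by rw [c]; field_simp; ring
  rw [K_eq, smul_mul_assoc, sub_mul, add_mul, smul_mul_assoc, mul_assoc, h, mul_smul_comm, h,
    one_mul, smul_smul, smul_smul]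
  have : Y + (C.c * -C.q⁻¹) • Y - (-C.q⁻¹ * -C.q⁻¹) • Y = (0 : ℂ) • Y := by
    rw [← e]; module
  rw [this, zero_smul, smul_zero]

lemma mul_K_of_R {i : ℕ} {Y : O} (h : Y * (C.R i : O) = -C.q⁻¹ • Y) : Y * C.K i = 0 := by
  have hq := C.q_ne
  have e : 1 + C.c * (-C.q⁻¹) - (-C.q⁻¹) * (-C.q⁻¹) = 0 := by rw [c]; field_simp; ring
  rw [K_eq, mul_smul_comm, mul_sub, mul_add, mul_smul_comm, ← mul_assoc, h, smul_mul_assoc, h,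
    mul_one, smul_smul, smul_smul]
  have : Y + (C.c * -C.q⁻¹) • Y - (-C.q⁻¹ * -C.q⁻¹) • Y = (0 : ℂ) • Y := by
    rw [← e]; module
  rw [this, zero_smul, smul_zero]

lemma bax_mul_of_R {i : ℕ} {Y : O} (h : (C.R i : O) * Y = -C.q⁻¹ • Y) (m : ℕ) :
    C.bax i m * Y = (1 - C.q⁻¹ * C.cR m) • Y := by
  rw [bax, add_mul, add_mul, smul_mul_assoc, smul_mul_assoc, h, C.K_mul_of_R h, one_mul]
  module

lemma mul_bax_of_R {i : ℕ} {Y : O} (h : Y * (C.R i : O) = -C.q⁻¹ • Y) (m : ℕ) :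
    Y * C.bax i m = (1 - C.q⁻¹ * C.cR m) • Y := by
  rw [bax, mul_add, mul_add, mul_smul_comm, mul_smul_comm, h, C.mul_K_of_R h, mul_one]
  module

lemma cR_one : C.cR 1 = -C.q⁻¹ := by
  have h := C.c_ne
  have hq := C.q_ne
  rw [cR, div_eq_iff h, c]
  linear_combination inv_mul_cancel₀ hq

lemma nrm_mul (m : ℕ) (h : qnum C.q (m + 1) ≠ 0) :
    C.nrm m * (1 - C.q⁻¹ * C.cR m) = 1 := by
  have hq := C.q_ne
  have hc := C.c_ne
  have e : 1 - C.q⁻¹ * C.cR m = qnum C.q (m + 1) * (C.q ^ m)⁻¹ := by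
    have e1 : C.c * C.q = C.q ^ 2 - 1 := by
      rw [c, sub_mul, inv_mul_cancel₀ hq]; ring
    have e2 : C.q ^ 2 - 1 ≠ 0 := e1 ▸ mul_ne_zero hc hq
    have e3 : C.c = (C.q ^ 2 - 1) / C.q := by rw [eq_div_iff hq, e1]
    rw [cR, qnum, ← c, e3]
    simp only [inv_pow]
    field_simp
    ring
  rw [e, nrm]
  field_simp

variable {N : ℕ} (hN : C.Regular N)

include hN

lemma cK_one (h1 : 1 ≤ N) : C.cK 1 * (C.μ + C.q⁻¹) = -C.q⁻¹ * C.c * C.μ := by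
  have hq := C.q_ne
  have hm := C.mu_ne
  have h := hN.den_ne 1 le_rfl h1
  rw [cK, div_mul_eq_mul_div, div_eq_iff h, c]
  simp only [inv_pow]
  field_simp
  ring

lemma R_mul_bax_one (h1 : 1 ≤ N) (i : ℕ) : (C.R i : O) * C.bax i 1 = -C.q⁻¹ • C.bax i 1 := by
  have h := C.cK_one hN h1
  have hq : C.q⁻¹ * C.c = 1 - C.q⁻¹ * C.q⁻¹ := by
    rw [c, mul_sub, inv_mul_cancel₀ C.q_ne]
  rw [bax, mul_add, mul_add, mul_smul_comm, mul_smul_comm, mul_one, R_mul_R, R_mul_K, cR_one]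
  linear_combination (norm := skip) h • C.K i - hq • (C.R i : O)
  module

lemma bax_one_mul_R (h1 : 1 ≤ N) (i : ℕ) : C.bax i 1 * (C.R i : O) = -C.q⁻¹ • C.bax i 1 := by
  rw [← C.R_mul_bax_one hN h1, C.bax_comm rfl]

lemma bax_yangBaxter (i : ℕ) {m n : ℕ} (hm : 1 ≤ m) (hn : 1 ≤ n) (h : m + n ≤ N) :
    C.bax i m * C.bax (i + 1) (m + n) * C.bax i n =
      C.bax (i + 1) n * C.bax i (m + n) * C.bax (i + 1) m := by
  have hc := C.c_ne'
  have hq := C.q_ne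
  have hμ := C.mu_ne
  have den : ∀ {k}, 1 ≤ k → k ≤ N → C.q * C.q⁻¹ ^ (2 * k) + C.μ ≠ 0 := by
    intro k h1 h2 h3
    apply hN.den_ne k h1 h2
    field_simp
    linear_combination h3
  have fK : ∀ k, C.cK k = C.μ * (C.q⁻¹ ^ (2 * k) - 1) / (C.q * C.q⁻¹ ^ (2 * k) + C.μ) := by
    intro k
    rw [cK]
    field_simp
  have dm := den hm (by omega)
  have dn := den hn (by omega)
  have dmn := den (show 1 ≤ m + n by omega) h
  have e1 : C.c * C.q = C.q ^ 2 - 1 := by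
    rw [c, sub_mul, inv_mul_cancel₀ hq]; ring
  have e2 : C.q ^ 2 - 1 ≠ 0 := e1 ▸ mul_ne_zero hc hq
  have e3 : C.c = (C.q ^ 2 - 1) / C.q := by rw [eq_div_iff hq, e1]
  have e4 : C.η = (C.q - C.μ) * (1 + C.q * C.μ) / (C.μ * (C.q ^ 2 - 1)) := by
    rw [η, eta, ← c, e3]
    field_simp
  refine (C.pair i).yangBaxter (η := C.η) (C.K_mul_K i) (C.K_mul_K (i + 1)) ?_ ?_ ?_ ?_
  all_goals
    simp only [cR, fK, e4, e3, mul_add 2, pow_add] at *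
    generalize C.q⁻¹ ^ (2 * m) = x at *
    generalize C.q⁻¹ ^ (2 * n) = y at *
    generalize C.q = q at *
    generalize C.μ = μ at *
    have dm' : x * q + μ ≠ 0 := by rwa [mul_comm]
    have dmn' : x * y * q + μ ≠ 0 := by rwa [mul_comm]
    have dmn'' : x * q * y + μ ≠ 0 := by rwa [mul_right_comm]
    have dn' : y * q + μ ≠ 0 := by rwa [mul_comm]
    have dm1 : μ + x * q ≠ 0 := by rwa [add_comm]
    have dn1 : μ + q * y ≠ 0 := by rwa [add_comm]
    have dmn1 : μ + x * q * y ≠ 0 := by rwa [add_comm]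
    field_simp
    ring

/-- One step of the fusion procedure: if `e` is built from `e'` and from `b_s(m)`, where `e'` commutes
with `R_r`, then `e b_r(m+1) e` is an eigenvector of `R_r`. -/
lemma fusion_step {r s m : ℕ} {e e' : O} {z : ℂ} (hrs : s = r + 1 ∨ r = s + 1) (hm : 1 ≤ m)
    (hmN : m + 1 ≤ N) (he : e = z • (e' * C.bax s m * e')) (h1 : e' * e = e) (h2 : e * e' = e)
    (hr : (C.R r : O) * e' = e' * C.R r) (h3 : (C.R s : O) * e = -C.q⁻¹ • e)
    (h4 : e * (C.R s : O) = -C.q⁻¹ • e) :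
    (C.R r : O) * (e * C.bax r (m + 1) * e) = -C.q⁻¹ • (e * C.bax r (m + 1) * e) ∧
      e * C.bax r (m + 1) * e * C.R r = -C.q⁻¹ • (e * C.bax r (m + 1) * e) := by
  have hs : (1 + C.q⁻¹ * C.q⁻¹) ≠ 0 := by
    have hq := C.q_ne
    have h := hN.qnum_ne 2 le_rfl (by omega)
    intro h0
    apply h
    rw [qnum, div_eq_zero_iff]
    left
    field_simp at h0
    field_simp
    linear_combination (C.q ^ 2 - 1) * h0
  have ybl : C.bax s 1 * C.bax r (m + 1) * C.bax s m =
      C.bax r m * C.bax s (m + 1) * C.bax r 1 := by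
    rcases hrs with rfl | rfl
    · exact (C.bax_yangBaxter hN r hm le_rfl hmN).symm
    · rw [add_comm m 1]
      exact C.bax_yangBaxter hN s le_rfl hm (by omega)
  have ybr : C.bax s m * C.bax r (m + 1) * C.bax s 1 =
      C.bax r 1 * C.bax s (m + 1) * C.bax r m := by
    rcases hrs with rfl | rfl
    · rw [add_comm m 1]
      exact (C.bax_yangBaxter hN r le_rfl hm (by omega)).symm
    · exact C.bax_yangBaxter hN s hm le_rfl hmN
  have el : ∀ T, T * e = z • (T * (e' * C.bax s m * e')) := fun T =>
    (congrArg (T * ·) he).trans (mul_smul_comm _ _ _)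
  have er : ∀ T, e * T = z • (e' * C.bax s m * e' * T) := fun T =>
    (congrArg (· * T) he).trans (smul_mul_assoc _ _ _)
  have ce : ∀ k, C.bax r k * e' = e' * C.bax r k := C.bax_comm hr
  have e5 : C.bax s 1 * e = (1 + C.q⁻¹ * C.q⁻¹) • e := by
    rw [C.bax_mul_of_R h3, cR_one]; congr 1; ring
  have e6 : e * C.bax s 1 = (1 + C.q⁻¹ * C.q⁻¹) • e := by
    rw [C.mul_bax_of_R h4, cR_one]; congr 1; ring
  have e7 : (1 + C.q⁻¹ * C.q⁻¹) • (e * C.bax r (m + 1) * e) =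
      z • (e * C.bax r m * C.bax s (m + 1) * e' * C.bax r 1) := by
    calc (1 + C.q⁻¹ * C.q⁻¹) • (e * C.bax r (m + 1) * e)
        = e * C.bax s 1 * C.bax r (m + 1) * e := by rw [e6, smul_mul_assoc, smul_mul_assoc]
      _ = z • (e * C.bax s 1 * (C.bax r (m + 1) * e') * C.bax s m * e') := by
          rw [el]; simp only [mul_assoc]
      _ = z • (e * C.bax s 1 * e' * C.bax r (m + 1) * C.bax s m * e') := by
          rw [ce]; simp only [mul_assoc]
      _ = z • (e * (C.bax s 1 * C.bax r (m + 1) * C.bax s m) * e') := by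
          rw [e6, smul_mul_assoc, h2, ← e6]; simp only [mul_assoc]
      _ = _ := by rw [ybl]; simp only [mul_assoc]; rw [ce]
  have e8 : (1 + C.q⁻¹ * C.q⁻¹) • (e * C.bax r (m + 1) * e) =
      z • (C.bax r 1 * (e' * C.bax s (m + 1) * C.bax r m * e)) := by
    calc (1 + C.q⁻¹ * C.q⁻¹) • (e * C.bax r (m + 1) * e)
        = e * C.bax r (m + 1) * (C.bax s 1 * e) := by rw [e5, mul_smul_comm]
      _ = z • (e' * C.bax s m * (e' * C.bax r (m + 1)) * (C.bax s 1 * e)) := by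
          rw [mul_assoc, er]; simp only [mul_assoc]
      _ = z • (e' * C.bax s m * C.bax r (m + 1) * (e' * (C.bax s 1 * e))) := by
          rw [← ce]; simp only [mul_assoc]
      _ = z • (e' * (C.bax s m * C.bax r (m + 1) * C.bax s 1) * e) := by
          rw [e5, mul_smul_comm, h1, ← e5]; simp only [mul_assoc]
      _ = _ := by rw [ybr]; simp only [← mul_assoc]; rw [ce]
  have h1N : 1 ≤ N := by omega
  constructor
  · apply smul_right_injective O hs
    simp only
    rw [← mul_smul_comm, e8, mul_smul_comm, ← mul_assoc, C.R_mul_bax_one hN h1N, smul_mul_assoc,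
      smul_comm z, ← e8, smul_comm]
  · apply smul_right_injective O hs
    simp only
    rw [← smul_mul_assoc, e7, smul_mul_assoc, mul_assoc _ (C.bax r 1), C.bax_one_mul_R hN h1N,
      mul_smul_comm, smul_comm z, ← e7, smul_comm]

/-- Elements on which all `R_i`, `d ≤ i < d + m`, act from the left by `-q⁻¹` are fixed by the
antisymmetrizer. -/
lemma as_mul_of_R {d m : ℕ} (hm : m + 1 ≤ N) {Y : O}
    (h : ∀ i, d ≤ i → i < d + m → (C.R i : O) * Y = -C.q⁻¹ • Y) : C.as d m * Y = Y := by
  induction m with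
  | zero => rw [as_zero, one_mul]
  | succ m ih =>
    have e := ih (by omega) fun i h1 h2 => h i h1 (by omega)
    rw [as_succ, smul_mul_assoc, mul_assoc, e, mul_assoc, C.bax_mul_of_R (h _ (by omega) (by omega)),
      mul_smul_comm, e, smul_smul, C.nrm_mul _ (hN.qnum_ne _ (by omega) (by omega)), one_smul]

lemma mul_as_of_R {d m : ℕ} (hm : m + 1 ≤ N) {Y : O}
    (h : ∀ i, d ≤ i → i < d + m → Y * (C.R i : O) = -C.q⁻¹ • Y) : Y * C.as d m = Y := by
  induction m with
  | zero => rw [as_zero, mul_one]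
  | succ m ih =>
    have e := ih (by omega) fun i h1 h2 => h i h1 (by omega)
    rw [as_succ, mul_smul_comm, ← mul_assoc, ← mul_assoc, e,
      C.mul_bax_of_R (h _ (by omega) (by omega)),
      smul_mul_assoc, e, smul_smul, C.nrm_mul _ (hN.qnum_ne _ (by omega) (by omega)), one_smul]

lemma R_as_and {m : ℕ} (hm : m + 1 ≤ N) : ∀ d i, d ≤ i → i < d + m →
    (C.R i : O) * C.as d m = -C.q⁻¹ • C.as d m ∧ C.as d m * (C.R i : O) = -C.q⁻¹ • C.as d m := by
  induction m with
  | zero => intro d i h1 h2; omega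
  | succ m ih =>
    intro d i h1 h2
    have ih' := ih (by omega)
    by_cases hi : i < d + m
    · have h := ih' d i h1 hi
      rw [as_succ, mul_smul_comm, mul_assoc, ← mul_assoc, h.1, smul_mul_assoc, smul_mul_assoc,
        mul_assoc, mul_assoc, h.2, mul_smul_comm, mul_smul_comm, smul_comm]
      exact ⟨rfl, rfl⟩
    · obtain rfl : i = d + m := by omega
      suffices h : (C.R (d + m) : O) * (C.as d m * C.bax (d + m) (m + 1) * C.as d m) =
          -C.q⁻¹ • (C.as d m * C.bax (d + m) (m + 1) * C.as d m) ∧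
          C.as d m * C.bax (d + m) (m + 1) * C.as d m * C.R (d + m) =
          -C.q⁻¹ • (C.as d m * C.bax (d + m) (m + 1) * C.as d m) by
        rw [as_succ, mul_smul_comm, h.1, smul_mul_assoc, h.2, smul_comm]
        exact ⟨rfl, rfl⟩
      rcases m with _ | m
      · simp only [as_zero, mul_one, one_mul, add_zero, zero_add]
        exact ⟨C.R_mul_bax_one hN (by omega) d, C.bax_one_mul_R hN (by omega) d⟩
      · refine C.fusion_step hN (s := d + m) (e' := C.as d m) (Or.inr rfl) (by omega) (by omega)
          (C.as_succ d m) ?_ ?_ (C.as_comm (by omega)) (ih' d _ (by omega) (by omega)).1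
          (ih' d _ (by omega) (by omega)).2
        · exact C.as_mul_of_R hN (by omega) fun i h1 h2 => (ih' d i h1 (by omega)).1
        · exact C.mul_as_of_R hN (by omega) fun i h1 h2 => (ih' d i h1 (by omega)).2

lemma R_mul_as {m d i : ℕ} (hm : m + 1 ≤ N) (h1 : d ≤ i) (h2 : i < d + m) :
    (C.R i : O) * C.as d m = -C.q⁻¹ • C.as d m := (C.R_as_and hN hm d i h1 h2).1

lemma as_mul_R {m d i : ℕ} (hm : m + 1 ≤ N) (h1 : d ≤ i) (h2 : i < d + m) :
    C.as d m * (C.R i : O) = -C.q⁻¹ • C.as d m := (C.R_as_and hN hm d i h1 h2).2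

/-- Smaller antisymmetrizers are absorbed. -/
lemma as_mul_as {m d m' d' : ℕ} (hm : m + 1 ≤ N) (h1 : d ≤ d') (h2 : d' + m' ≤ d + m) :
    C.as d' m' * C.as d m = C.as d m :=
  C.as_mul_of_R hN (by omega) fun _ _ _ => C.R_mul_as hN hm (by omega) (by omega)

lemma as_mul_as' {m d m' d' : ℕ} (hm : m + 1 ≤ N) (h1 : d ≤ d') (h2 : d' + m' ≤ d + m) :
    C.as d m * C.as d' m' = C.as d m :=
  C.mul_as_of_R hN (by omega) fun _ _ _ => C.as_mul_R hN hm (by omega) (by omega)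

/-- The recursion that enlarges antisymmetrizers by a strand on the left. -/
lemma as_succ' {m : ℕ} (hm : m + 2 ≤ N) (d : ℕ) : C.as d (m + 1) =
    C.nrm (m + 1) • (C.as (d + 1) m * C.bax d (m + 1) * C.as (d + 1) m) := by
  induction m generalizing d with
  | zero => rw [as_succ, as_zero, as_zero, add_zero]
  | succ m ih =>
    set Z := C.as (d + 1) (m + 1) * C.bax d (m + 2) * C.as (d + 1) (m + 1) with hZ
    have e1 : C.as d (m + 2) * (C.nrm (m + 2) • Z) = C.as d (m + 2) := by
      rw [hZ, mul_smul_comm, ← mul_assoc, ← mul_assoc, C.as_mul_as' hN (by omega) (by omega)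
        (by omega), C.mul_bax_of_R (C.as_mul_R hN (by omega) le_rfl (by omega)), smul_mul_assoc,
        C.as_mul_as' hN (by omega) (by omega) (by omega), smul_smul,
        C.nrm_mul _ (hN.qnum_ne _ (by omega) (by omega)), one_smul]
    have e2 : C.as d (m + 2) * Z = Z := by
      apply C.as_mul_of_R hN (by omega)
      intro i h1 h2
      by_cases hi : d < i
      · rw [hZ, ← mul_assoc, ← mul_assoc, C.R_mul_as hN (by omega) (by omega) (by omega),
          smul_mul_assoc, smul_mul_assoc]
      · obtain rfl : i = d := by omega
        exact (C.fusion_step hN (s := i + 1) (e' := C.as (i + 2) m) (Or.inl rfl) (by omega)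
          (by omega) (ih (by omega) (i + 1)) (C.as_mul_as hN (by omega) (by omega) (by omega))
          (C.as_mul_as' hN (by omega) (by omega) (by omega)) (C.as_comm (by omega))
          (C.R_mul_as hN (by omega) (by omega) (by omega))
          (C.as_mul_R hN (by omega) (by omega) (by omega))).1
    rw [← e1, mul_smul_comm, e2]

end BMWChain

end
noncomputable section
/-! ## Recursions for the matrix powers of the antisymmetrizers -/

namespace BMWChain

open QChain (cj cj_def cj_mul cj_eq_of_comm comm_iff_cj cj_units inv_comm braid_inv rep_induction)

variable {O : Type} [Ring O] [Algebra ℂ O] (C : BMWChain O)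

/-- `K_n ⋯ K_1`. -/
def KD : ℕ → O
  | 0 => 1
  | n + 1 => C.K (n + 1) * KD n

/-- `K_s ⋯ K_{s+n-1}`. -/
def KU (s : ℕ) : ℕ → O
  | 0 => 1
  | n + 1 => KU s n * C.K (s + n)

lemma KD_succ (n : ℕ) : C.KD (n + 1) = C.K (n + 1) * C.KD n := rfl

lemma KU_succ (s n : ℕ) : C.KU s (n + 1) = C.KU s n * C.K (s + n) := rfl

lemma KU_mem_W {a s n p : ℕ} (h1 : a ≤ s) (h : s + n < a + p) : C.KU s n ∈ C.W a p := by
  induction n with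
  | zero => exact one_mem _
  | succ n ih => exact mul_mem (ih (by omega)) (C.K_mem_W (by omega) (by omega))

lemma KD_comm {n i : ℕ} (h : n + 1 < i) : (C.R i : O) * C.KD n = C.KD n * C.R i := by
  induction n with
  | zero => simp [KD]
  | succ n ih =>
    rw [KD_succ, mul_assoc, ← ih (by omega), ← mul_assoc, ← mul_assoc,
      C.R_comm (C.K_off (by omega) (by omega)) (C.K_off (by omega) (by omega))]

lemma KKK_R (i : ℕ) : C.K (i + 2) * C.K (i + 1) * C.K i * C.R (i + 2) =
    C.R i * (C.K (i + 2) * C.K (i + 1) * C.K i) := by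
  have P := C.pair i
  have Q := C.pair (i + 1)
  have h1 : C.K i * (C.R (i + 2) : O) = C.R (i + 2) * C.K i :=
    C.K_comm (C.R_off (by omega) (by omega)) (C.R_off (by omega) (by omega))
  have h2 : (C.R i : O) * C.K (i + 2) = C.K (i + 2) * C.R i :=
    C.R_comm (C.K_off (by omega) (by omega)) (C.K_off (by omega) (by omega))
  rw [mul_assoc, h1, ← mul_assoc, Q.LKS, mul_assoc, ← P.RLK, ← mul_assoc, ← h2]
  simp only [mul_assoc]

/-- Intertwiners of the generators intertwine the representations. -/
lemma mul_rep_of {T : O} {d e m : ℕ} (h : ∀ i, i < m → T * C.R (d + i) = C.R (e + i) * T)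
    (α : BraidAlg m) : T * C.rep d α = C.rep e α * T := by
  refine rep_induction (P := fun α => T * C.rep d α = C.rep e α * T) α ?_ ?_ ?_ ?_ ?_
  · intro z; rw [AlgHom.commutes, AlgHom.commutes, Algebra.commutes]
  · intro i; rw [QChain.rep_sigA, QChain.rep_sigA]; exact h i i.isLt
  · intro i
    rw [QChain.rep_of, QChain.rep_of, map_inv, map_inv, QChain.repGroup_sig, QChain.repGroup_sig,
      Units.eq_inv_mul_iff_mul_eq, ← mul_assoc, ← h i i.isLt, Units.mul_inv_cancel_right]
  · intro x y hx hy; rw [map_add, map_add, mul_add, add_mul, hx, hy]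
  · intro x y hx hy; rw [map_mul, map_mul, ← mul_assoc, hx, mul_assoc, hy, mul_assoc]

lemma KD_mul_R {i n : ℕ} (h1 : 1 ≤ i) (h2 : i + 2 ≤ n) :
    C.KD n * C.R (i + 2) = C.R i * C.KD n := by
  obtain ⟨e, rfl⟩ : ∃ e, n = i + 2 + e := ⟨n - i - 2, by omega⟩
  clear h2
  induction e with
  | zero =>
    obtain ⟨i, rfl⟩ : ∃ j, i = j + 1 := ⟨i - 1, by omega⟩
    have h := C.KKK_R (i + 1)
    have e : C.KD (i + 1 + 2) = C.K (i + 1 + 2) * C.K (i + 1 + 1) * C.K (i + 1) * C.KD i := by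
      rw [KD_succ, KD_succ, KD_succ]; simp only [mul_assoc]
    rw [add_zero, e, mul_assoc, ← C.KD_comm (by omega), ← mul_assoc, h]
    simp only [mul_assoc]
  | succ e ih =>
    rw [← add_assoc, KD_succ, mul_assoc, ih, ← mul_assoc,
      C.K_comm (C.R_off (by omega) (by omega)) (C.R_off (by omega) (by omega)), mul_assoc]

lemma KD_mul_as (m : ℕ) : C.KD (m + 2) * C.as 3 m = C.as 1 m * C.KD (m + 2) := by
  refine C.mul_rep_of (fun i hi => ?_) _
  rw [show 3 + i = (1 + i) + 2 by omega]
  exact C.KD_mul_R (by omega) (by omega)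

lemma KU_mul_KD {s n : ℕ} (h1 : 1 ≤ s) : C.KU s n * C.KD (s + n) = C.KD s := by
  induction n with
  | zero => rw [KU, one_mul, add_zero]
  | succ n ih =>
    obtain ⟨r, hr⟩ : ∃ r, s + n = r + 1 := ⟨s + n - 1, by omega⟩
    rw [KU_succ, ← add_assoc, KD_succ, mul_assoc]
    rw [hr] at ih ⊢
    have e := C.KKK (r + 1)
    calc C.KU s n * (C.K (r + 1) * (C.K (r + 1 + 1) * C.KD (r + 1)))
        = C.KU s n * (C.K (r + 1) * C.K (r + 1 + 1) * C.K (r + 1) * C.KD r) := by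
          rw [KD_succ]; simp only [mul_assoc]
      _ = C.KU s n * C.KD (r + 1) := congrArg (fun x => C.KU s n * (x * C.KD r)) e
      _ = _ := ih

lemma KU_comm {s n : ℕ} {X : O} (h : ∀ j, s ≤ j → X ∈ C.off j) : C.KU s n * X = X * C.KU s n := by
  induction n with
  | zero => simp [KU]
  | succ n ih =>
    rw [KU_succ, mul_assoc, C.K_comm (h _ (by omega)) (h _ (by omega)), ← mul_assoc, ih, mul_assoc]

lemma KD_mul_KU (n : ℕ) : C.KD (n + 2) * C.KU 2 n = C.K (n + 2) * C.K (n + 1) := by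
  induction n with
  | zero => simp [KD, KU]
  | succ n ih =>
    have e := (C.pair (n + 1)).LKL
    calc C.KD (n + 2 + 1) * C.KU 2 (n + 1)
        = C.K (n + 2 + 1) * (C.KD (n + 2) * C.KU 2 n) * C.K (n + 2) := by
          rw [KD_succ, KU_succ, add_comm 2 n]; simp only [mul_assoc]
      _ = C.K (n + 2 + 1) * (C.K (n + 2) * C.K (n + 1) * C.K (n + 2)) := by
          rw [ih]; simp only [mul_assoc]
      _ = _ := by rw [show C.K (n + 2) * C.K (n + 1) * C.K (n + 2) = C.K (n + 2) from e]

lemma KU_succ' (s n : ℕ) : C.KU s (n + 1) = C.K s * C.KU (s + 1) n := by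
  induction n with
  | zero => simp [KU]
  | succ n ih =>
    rw [KU_succ, ih, KU_succ, mul_assoc]
    congr 3; omega

/-! ### The recursions -/

/-- The matrix `M^{a^{(m+1)}}`. -/
def mA (m : ℕ) : O := C.mp m (C.as 0 m)

/-- The matrix `M^{a^{(m+1)↑1} κ_1}`. -/
def mB (m : ℕ) : O := C.mp (m + 1) (C.as 1 m * C.K 0)

/-- The character `a_{m+1}`. -/
def ac (m : ℕ) : O := C.chi m (C.as 0 m)

/-- The `⋆`-product with `M` from the left. -/
def xs (X : O) : O := C.starR 0 1 X

lemma xs_add (X Y : O) : C.xs (X + Y) = C.xs X + C.xs Y := C.starR_add _ _ _ _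

lemma xs_smul (z : ℂ) (X : O) : C.xs (z • X) = z • C.xs X := C.starR_smul _ _ _ _

lemma xs_mul {X c : O} (hc : ∀ j, c ∈ C.off j) : C.xs (X * c) = C.xs X * c := C.starR_mul hc

lemma xs_one : C.xs 1 = C.M₀ := by
  rw [xs, C.starR_one (one_mem _), C.mp_zero, mul_one]

lemma xs_mp {m : ℕ} (β : BraidAlg m) :
    C.xs (C.mp m (C.rep 0 β)) = C.mp (m + 1) (C.rep 1 β * C.R 0) := by
  have h := C.starR_mp (1 : BraidAlg 0) β
  rw [map_one, C.rep_starExp, map_one, one_mul] at h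
  rw [xs, h, zero_add]
  rfl

lemma chi_rep_off {m : ℕ} (α : BraidAlg m) (j : ℕ) : C.chi m (C.rep 0 α) ∈ C.off j :=
  C.chi_off (C.W_zero_off (C.rep_mem_W 0 α)) j

lemma ac_off (m j : ℕ) : C.ac m ∈ C.off j := C.chi_rep_off _ j

lemma mp_rep_one {m : ℕ} (β : BraidAlg m) :
    C.mp (m + 1) (C.rep 1 β) = C.M₀ * C.chi m (C.rep 0 β) := by
  have h := C.mp_mul_chi (1 : BraidAlg 0) β
  rw [map_one, one_mul, C.mp_zero, mul_one, zero_add, zero_add] at h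
  exact h

lemma xs_mA (m : ℕ) : C.xs (C.mA m) = C.mp (m + 1) (C.as 1 m * C.R 0) := C.xs_mp _

lemma mp_as_one (m : ℕ) : C.mp (m + 1) (C.as 1 m) = C.M₀ * C.ac m := C.mp_rep_one _

lemma mB_zero : C.mB 0 = C.μ⁻¹ • C.g := by rw [mB, as_zero, one_mul, zero_add, mp_one_K]

lemma mp_two : C.mp 2 (C.K 1 * C.R 0) = C.μ⁻¹ • (C.M₀ * C.g) := by
  have h1 : C.K 1 * C.R 0 * C.K 1 = C.μ⁻¹ • C.K 1 := (C.pair 0).LRL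
  have h2 : C.K 1 * C.K 1 * C.R 0 = C.η • (C.K 1 * C.R 0) := by rw [K_mul_K, smul_mul_assoc]
  have h3 : C.mp 2 (1 * C.K 1) = C.η • (C.mp 0 1 * C.g) := C.mp_mul_K (one_mem _)
  have h4 : C.mp 2 (C.K 1 * C.R 0 * C.K 1) = C.mp 2 (C.K 1 * (C.K 1 * C.R 0)) :=
    C.mp_cyc (C.K_mem_W le_rfl (by omega)) _
  rw [h1, ← mul_assoc, h2, C.mp_smul, C.mp_smul, ← one_mul (C.K 1), h3, C.mp_zero, mul_one,
    smul_comm] at h4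
  exact (smul_right_injective O C.η_ne (by simpa using h4)).symm

lemma xs_mB_zero : C.xs (C.mB 0) = C.μ⁻¹ • (C.M₀ * C.g) := by
  have h := C.xs_mp (kap C.q C.μ (0 : Fin 1))
  rw [rep_kap, rep_kap] at h
  rw [mB, as_zero, one_mul, ← mp_two]
  exact h

lemma rep_as_K (m : ℕ) : ∃ β : BraidAlg (m + 1), ∀ d, C.rep d β = C.as (d + 1) m * C.K d :=
  ⟨algShift 1 (by omega) (antisym C.q C.μ m) * kap C.q C.μ 0, fun d => by
    rw [map_mul, QChain.rep_shift, rep_kap]; rfl⟩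

lemma xs_mB (m : ℕ) : C.xs (C.mB m) = C.mp (m + 2) (C.as 2 m * C.K 1 * C.R 0) := by
  obtain ⟨β, hβ⟩ := C.rep_as_K m
  rw [mB, ← hβ, xs_mp, hβ]

lemma mp_as_mul_KK {m : ℕ} {X : O} (hX : X ∈ C.W 0 2) :
    C.mp (m + 3) (C.as 1 m * X * (C.K (m + 2) * C.K (m + 1))) =
      C.mp (m + 1) (C.as 1 m * X) * C.g := by
  set w := C.as 1 m * X with hw
  have hwm : w ∈ C.W 0 (m + 1 + 1) := mul_mem (C.W_mono (by omega) (by omega) (C.as_mem_W 1 m))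
    (C.W_mono (by omega) (by omega) hX)
  have kw : C.K (m + 2) * w = w * C.K (m + 2) :=
    C.K_comm (C.W_off (by omega) hwm) (C.W_off (by omega) hwm)
  have e : C.K (m + 2) * C.K (m + 1) * C.K (m + 2) = C.K (m + 2) := (C.pair (m + 1)).LKL
  have h1 := C.mp_cyc (m := m + 3) (C.K_mem_W (a := 1) (n := m + 3) (i := m + 2) (by omega)
    (by omega)) (w * (C.K (m + 2) * C.K (m + 1)))
  rw [mul_assoc, e, ← mul_assoc, ← mul_assoc, kw, mul_assoc w, K_mul_K, mul_smul_comm,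
    smul_mul_assoc, C.mp_smul, show C.mp (m + 3) (w * C.K (m + 2)) = _ from C.mp_mul_K hwm,
    mul_assoc w] at h1
  exact (smul_right_injective O C.η_ne h1).symm

lemma mp_as_KK_R (m : ℕ) :
    C.mp (m + 3) (C.as 1 m * (C.K (m + 2) * C.K (m + 1)) * C.R 0) = C.xs (C.mA m) * C.g := by
  set w := C.as 1 m with hw
  have hwm : w ∈ C.W 0 (m + 1 + 1) := C.W_mono (by omega) (by omega) (C.as_mem_W 1 m)
  have hwR : w * C.R 0 ∈ C.W 0 (m + 1 + 1) := mul_mem hwm (C.R_mem_W (by omega) (by omega))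
  have kw : C.K (m + 2) * w = w * C.K (m + 2) :=
    C.K_comm (C.W_off (by omega) hwm) (C.W_off (by omega) hwm)
  have kr : C.K (m + 2) * C.R 0 = C.R 0 * C.K (m + 2) :=
    C.K_comm (C.R_off (by omega) (by omega)) (C.R_off (by omega) (by omega))
  have e : C.K (m + 2) * C.K (m + 1) * C.K (m + 2) = C.K (m + 2) := (C.pair (m + 1)).LKL
  have h1 := C.mp_cyc (m := m + 3) (C.K_mem_W (a := 1) (n := m + 3) (i := m + 2) (by omega)
    (by omega)) (w * (C.K (m + 2) * C.K (m + 1)) * C.R 0)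
  rw [mul_assoc, ← kr, ← mul_assoc, mul_assoc w, e, mul_assoc, kr, ← mul_assoc, ← mul_assoc,
    ← mul_assoc, ← mul_assoc, kw, mul_assoc w (C.K (m + 2)) (C.K (m + 2)), K_mul_K, mul_smul_comm,
    smul_mul_assoc, smul_mul_assoc, C.mp_smul, show C.mp (m + 3) (w * C.R 0 * C.K (m + 2)) = _ from C.mp_mul_K hwR,
    mul_assoc w] at h1
  rw [xs_mA]
  exact (smul_right_injective O C.η_ne h1).symm

lemma mp_as_KR (m : ℕ) :
    C.mp (m + 3) (C.as 3 m * (C.K 1 * C.R 0)) = C.μ⁻¹ • (C.M₀ * C.ac m * C.g) := by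
  have h := C.mp_mul_chi (kap C.q C.μ (1 : Fin 2) * sigA (0 : Fin 2)) (antisym C.q C.μ m)
  rw [map_mul, rep_kap, QChain.rep_sigA] at h
  have gc : C.g * C.ac m = C.ac m * C.g := by
    have := C.chi_comm (kap C.q C.μ (0 : Fin 1)) (antisym C.q C.μ m)
    rw [rep_kap] at this
    rw [g, smul_mul_assoc, mul_smul_comm]
    exact congrArg _ this
  have e : C.as 3 m * (C.K 1 * C.R 0) = C.K 1 * C.R 0 * C.as 3 m :=
    C.W_comm_of_off (C.as_mem_W 3 m) fun j h _ =>
      mul_mem (C.K_off (by omega) (by omega)) (C.R_off (by omega) (by omega))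
  rw [e, show m + 3 = 2 + m + 1 by omega]
  refine h.trans ?_
  rw [show C.mp 2 (C.K (0 + ((1 : Fin 2) : ℕ)) * C.R (0 + ((0 : Fin 2) : ℕ))) = _ from C.mp_two, smul_mul_assoc, mul_assoc, mul_assoc]
  exact congrArg (fun x => C.μ⁻¹ • (C.M₀ * x)) gc

lemma mp_as_mul_mul_KD {m : ℕ} {U : O} (hU : U ∈ C.W 1 (m + 3)) :
    C.mp (m + 3) (C.as 3 m * (U * C.KD (m + 2)) * C.R 0) =
      C.mp (m + 3) (C.as 1 m * (C.KD (m + 2) * C.R 0 * U)) := by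
  have e : C.R 0 * C.as 3 m = C.as 3 m * C.R 0 := C.as_comm (by omega)
  calc C.mp (m + 3) (C.as 3 m * (U * C.KD (m + 2)) * C.R 0)
      = C.mp (m + 3) (C.as 3 m * U * (C.KD (m + 2) * C.R 0)) := by simp only [mul_assoc]
    _ = C.mp (m + 3) (C.KD (m + 2) * C.R 0 * (C.as 3 m * U)) :=
        (C.mp_cyc (mul_mem (C.W_mono (by omega) (by omega) (C.as_mem_W 3 m)) hU) _).symm
    _ = C.mp (m + 3) (C.KD (m + 2) * (C.R 0 * C.as 3 m) * U) := by simp only [mul_assoc]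
    _ = C.mp (m + 3) (C.KD (m + 2) * C.as 3 m * (C.R 0 * U)) := by rw [e]; simp only [mul_assoc]
    _ = _ := by rw [KD_mul_as]; simp only [mul_assoc]

lemma mp_as_KKR (m : ℕ) :
    C.mp (m + 3) (C.as 3 m * (C.K 2 * C.K 1) * C.R 0) = C.xs (C.mA m) * C.g := by
  have h1 : C.K 2 * C.K 1 = C.KU 2 m * C.KD (m + 2) := by
    rw [add_comm m 2, C.KU_mul_KD (by omega)]; simp [KD]
  have h2 : C.R 0 * C.KU 2 m = C.KU 2 m * C.R 0 :=
    (C.KU_comm fun j hj => C.R_off (by omega) (by omega)).symm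
  rw [h1, C.mp_as_mul_mul_KD (C.KU_mem_W (by omega) (by omega)), mul_assoc (C.KD _), h2,
    ← mul_assoc (C.KD _), KD_mul_KU, ← mul_assoc, mp_as_KK_R]

lemma mp_as_RKR (m : ℕ) :
    C.mp (m + 3) (C.as 3 m * (C.R 2 * C.K 1) * C.R 0) =
      (C.mB m + (C.c * C.μ⁻¹) • (C.M₀ * C.ac m) - C.c • C.xs (C.mA m)) * C.g := by
  have h1 : C.R 2 * C.K 1 = C.R 2 * C.KU 1 (m + 1) * C.KD (m + 2) := by
    rw [mul_assoc, show m + 2 = 1 + (m + 1) by omega, C.KU_mul_KD le_rfl]; simp [KD]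
  have P := C.pair 0
  have h2 : (C.R 0 : O) * C.R 2 = C.R 2 * C.R 0 :=
    C.R_comm (C.R_off (by omega) (by omega)) (C.R_off (by omega) (by omega))
  have h3 : C.K 2 * C.K 1 * C.R 2 = C.K 2 * ↑(C.R 1)⁻¹ := (C.pair 1).LKS
  have h4 : (↑(C.R 1)⁻¹ : O) * C.R 0 * C.K 1 =
      (C.K 0 + (C.c * C.μ⁻¹) • 1 - C.c • (C.R 0 : O)) * C.K 1 := by
    have e1 : C.K 1 * C.R 0 * C.K 1 = C.μ⁻¹ • C.K 1 := P.LRL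
    have e2 : C.K 0 * C.K 1 = C.R 1 * C.R 0 * C.K 1 := P.KL'
    rw [C.Rinv 1, add_mul, add_mul, sub_mul, sub_mul, smul_mul_assoc, smul_mul_assoc,
      smul_mul_assoc, smul_mul_assoc, e1, ← e2, sub_mul, add_mul, smul_mul_assoc, smul_mul_assoc,
      one_mul, one_mul]
    module
  have key : ∀ n, C.KD (n + 2) * C.R 2 * C.R 0 * C.K 1 =
      (C.K 0 + (C.c * C.μ⁻¹) • 1 - C.c • (C.R 0 : O)) * C.KD (n + 2) := by
    intro n
    have hc : ∀ j, 2 ≤ j → C.K j * (C.K 0 + (C.c * C.μ⁻¹) • 1 - C.c • (C.R 0 : O)) =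
        (C.K 0 + (C.c * C.μ⁻¹) • 1 - C.c • (C.R 0 : O)) * C.K j := fun j hj => by
      have : ∀ i, 1 < i → C.K 0 + (C.c * C.μ⁻¹) • 1 - C.c • (C.R 0 : O) ∈ C.off i := fun i hi =>
        sub_mem (add_mem (C.K_zero_off hi) ((C.off i).smul_mem (one_mem _) _))
          ((C.off i).smul_mem (C.R_off (by omega) (by omega)) _)
      exact C.K_comm (this _ (by omega)) (this _ (by omega))
    induction n with
    | zero =>
      have : C.KD (0 + 2) = C.K 2 * C.K 1 := by simp [KD]
      rw [this, h3, mul_assoc, mul_assoc, ← mul_assoc _ (C.R 0 : O), h4, ← mul_assoc,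
        hc 2 le_rfl, mul_assoc]
    | succ n ih =>
      have : C.KD (n + 1 + 2) = C.K (n + 3) * C.KD (n + 2) := rfl
      rw [this, mul_assoc, mul_assoc, mul_assoc, ← mul_assoc (C.KD _), ← mul_assoc (C.KD _ * _), ih,
        ← mul_assoc, hc _ (by omega), mul_assoc]
  have hX : C.K 0 + (C.c * C.μ⁻¹) • 1 - C.c • (C.R 0 : O) ∈ C.W 0 2 :=
    sub_mem (add_mem (C.K_mem_W le_rfl (by omega)) ((C.W 0 2).smul_mem (one_mem _) _))
      ((C.W 0 2).smul_mem (C.R_mem_W le_rfl (by omega)) _)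
  have e5 : C.KD (m + 2) * C.R 0 * (C.R 2 * C.KU 1 (m + 1)) =
      (C.K 0 + (C.c * C.μ⁻¹) • 1 - C.c • (C.R 0 : O)) * (C.K (m + 2) * C.K (m + 1)) := by
    rw [KU_succ', mul_assoc, ← mul_assoc (C.R 0 : O), h2, ← KD_mul_KU, ← mul_assoc, ← mul_assoc,
      ← mul_assoc, key, mul_assoc]
  rw [h1, C.mp_as_mul_mul_KD (mul_mem (C.R_mem_W (by omega) (by omega))
    (C.KU_mem_W (by omega) (by omega))), e5, ← mul_assoc, C.mp_as_mul_KK hX, mul_sub, mul_add,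
    mul_smul_comm, mul_smul_comm, mul_one, sub_eq_add_neg, ← neg_smul, C.mp_add, C.mp_add, C.mp_smul,
    C.mp_smul, xs_mA, mp_as_one, mB, neg_smul, ← sub_eq_add_neg]

variable {N : ℕ} (hN : C.Regular N)

include hN

lemma mp_as_bax_as {m : ℕ} (hm : m + 1 ≤ N) :
    C.mp (m + 1) (C.as 1 m * C.bax 0 (m + 1) * C.as 1 m) =
      C.M₀ * C.ac m + C.cR (m + 1) • C.xs (C.mA m) + C.cK (m + 1) • C.mB m := by
  rw [C.mp_cyc (C.as_mem_W 1 m), ← mul_assoc, C.as_mul_as hN hm le_rfl le_rfl, bax, mul_add, mul_add,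
    mul_one, mul_smul_comm, mul_smul_comm, C.mp_add, C.mp_add, C.mp_smul, C.mp_smul, xs_mA, mp_as_one,
    mB]

lemma mA_succ {m : ℕ} (hm : m + 2 ≤ N) :
    C.mA (m + 1) = C.nrm (m + 1) • (C.M₀ * C.ac m + C.cR (m + 1) • C.xs (C.mA m) +
      C.cK (m + 1) • C.mB m) := by
  rw [mA, C.as_succ' hN hm, C.mp_smul, C.mp_as_bax_as hN (by omega)]

lemma mp_as_bax_as_KR {m : ℕ} (hm : m + 1 ≤ N) :
    C.mp (m + 3) (C.as 3 m * C.bax 2 (m + 1) * C.as 3 m * (C.K 1 * C.R 0)) =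
      (C.μ⁻¹ • (C.M₀ * C.ac m) + C.cR (m + 1) • (C.mB m + (C.c * C.μ⁻¹) • (C.M₀ * C.ac m) -
        C.c • C.xs (C.mA m)) + C.cK (m + 1) • C.xs (C.mA m)) * C.g := by
  set X := C.K 1 * C.R 0 with hX
  have e1 : C.as 3 m * X = X * C.as 3 m := C.W_comm_of_off (C.as_mem_W 3 m) fun j h _ =>
    mul_mem (C.K_off (by omega) (by omega)) (C.R_off (by omega) (by omega))
  have e2 : C.as 3 m * C.bax 2 (m + 1) * C.as 3 m * X =
      C.as 3 m * C.bax 2 (m + 1) * X * C.as 3 m := by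
    rw [mul_assoc, e1, ← mul_assoc]
  rw [e2, C.mp_cyc (C.W_mono (by omega) (by omega) (C.as_mem_W 3 m)), ← mul_assoc (C.as 3 m),
    ← mul_assoc (C.as 3 m), C.as_mul_as hN hm le_rfl le_rfl, bax, mul_add, mul_add, mul_one, add_mul, add_mul,
    mul_smul_comm, mul_smul_comm, smul_mul_assoc, smul_mul_assoc, C.mp_add, C.mp_add, C.mp_smul,
    C.mp_smul, mp_as_KR, hX, ← mul_assoc, mul_assoc (C.as 3 m), ← mul_assoc, mul_assoc (C.as 3 m),
    mp_as_RKR, ← mul_assoc (C.as 3 m * C.K 2), mul_assoc (C.as 3 m), mp_as_KKR]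
  simp only [add_mul, smul_mul_assoc]

lemma xs_mB_succ {m : ℕ} (hm : m + 2 ≤ N) :
    C.xs (C.mB (m + 1)) = C.nrm (m + 1) • ((C.μ⁻¹ • (C.M₀ * C.ac m) + C.cR (m + 1) •
      (C.mB m + (C.c * C.μ⁻¹) • (C.M₀ * C.ac m) - C.c • C.xs (C.mA m)) +
        C.cK (m + 1) • C.xs (C.mA m)) * C.g) := by
  rw [xs_mB, C.as_succ' hN hm, ← C.mp_as_bax_as_KR hN (by omega), ← C.mp_smul, mul_assoc,
    smul_mul_assoc]

/-- The vanishing of the next antisymmetrizer. -/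
def Vanish (C : BMWChain O) (N : ℕ) : Prop :=
  ∀ m, m + 1 = N → ∀ d, C.as (d + 1) m * C.bax d N * C.as (d + 1) m = 0

omit hN in
lemma mA_last {m : ℕ} (hN : C.Regular (m + 1)) (hv : C.Vanish (m + 1)) :
    C.M₀ * C.ac m + C.cR (m + 1) • C.xs (C.mA m) + C.cK (m + 1) • C.mB m = 0 := by
  rw [← C.mp_as_bax_as hN le_rfl, hv m rfl]
  simp [QChain.mp]

omit hN in
lemma mB_last {m : ℕ} (hN : C.Regular (m + 1)) (hv : C.Vanish (m + 1)) :
    (C.μ⁻¹ • (C.M₀ * C.ac m) + C.cR (m + 1) • (C.mB m + (C.c * C.μ⁻¹) • (C.M₀ * C.ac m) -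
        C.c • C.xs (C.mA m)) + C.cK (m + 1) • C.xs (C.mA m)) * C.g = 0 := by
  rw [← C.mp_as_bax_as_KR hN le_rfl, hv m rfl]
  simp [QChain.mp]

end BMWChain

end
noncomputable section
/-! ## Generators of the algebra of characters -/

namespace BMWChain

open QChain (cj cj_def cj_mul cj_eq_of_comm comm_iff_cj cj_units inv_comm braid_inv rep_induction)

variable {O : Type} [Ring O] [Algebra ℂ O] (C : BMWChain O)

/-- The generators `1`, `R_k`, `K_k`. -/
def IsGen (k : ℕ) (t : O) : Prop := t = 1 ∨ t = C.R k ∨ t = C.K k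

/-- The span of the products `u t v` with words `u`, `v` in the first `k + 1` strands and
`t = 1, R_k, K_k`. -/
def Sp (k : ℕ) : Submodule ℂ O :=
  Submodule.span ℂ {x | ∃ u ∈ C.W 0 (k + 1), ∃ t, C.IsGen k t ∧ ∃ v ∈ C.W 0 (k + 1), x = u * t * v}

lemma mem_Sp {k : ℕ} {u t v : O} (hu : u ∈ C.W 0 (k + 1)) (ht : C.IsGen k t)
    (hv : v ∈ C.W 0 (k + 1)) : u * t * v ∈ C.Sp k :=
  Submodule.subset_span ⟨u, hu, t, ht, v, hv, rfl⟩

lemma mul_mem_Sp {k : ℕ} {u v x : O} (hu : u ∈ C.W 0 (k + 1)) (hx : x ∈ C.Sp k)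
    (hv : v ∈ C.W 0 (k + 1)) : u * x * v ∈ C.Sp k := by
  refine Submodule.span_induction (p := fun x _ => u * x * v ∈ C.Sp k) ?_ ?_ ?_ ?_ hx
  · rintro x ⟨u', hu', t, ht, v', hv', rfl⟩
    have := C.mem_Sp (mul_mem hu hu') ht (mul_mem hv' hv)
    simpa only [mul_assoc] using this
  · simp
  · intro x y _ _ hx hy; rw [mul_add, add_mul]; exact add_mem hx hy
  · intro z x _ hx; rw [mul_smul_comm, smul_mul_assoc]; exact (C.Sp k).smul_mem _ hx

lemma gen_mul_gen {k : ℕ} {s t : O} (hs : C.IsGen k s) (ht : C.IsGen k t) : s * t ∈ C.Sp k := by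
  have o : (1 : O) ∈ C.W 0 (k + 1) := one_mem _
  have g1 : ∀ {t}, C.IsGen k t → t ∈ C.Sp k := fun h => by simpa using C.mem_Sp o h o
  have h1 := g1 (Or.inl rfl)
  have hR := g1 (Or.inr (Or.inl rfl))
  have hK := g1 (Or.inr (Or.inr rfl))
  rcases hs with rfl | rfl | rfl
  · rw [one_mul]; exact g1 ht
  · rcases ht with rfl | rfl | rfl
    · rwa [mul_one]
    · rw [R_mul_R]
      exact sub_mem (add_mem h1 ((C.Sp k).smul_mem _ hR)) ((C.Sp k).smul_mem _ hK)
    · rw [R_mul_K]; exact (C.Sp k).smul_mem _ hK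
  · rcases ht with rfl | rfl | rfl
    · rwa [mul_one]
    · rw [(C.pair k).KR]; exact (C.Sp k).smul_mem _ hK
    · rw [K_mul_K]; exact (C.Sp k).smul_mem _ hK

lemma gen_mul_gen_mul_gen {k : ℕ} {s t' t : O} (hs : C.IsGen (k + 1) s) (ht' : C.IsGen k t')
    (ht : C.IsGen (k + 1) t) : s * t' * t ∈ C.Sp (k + 1) := by
  have P := C.pair k
  have o : (1 : O) ∈ C.W 0 (k + 1 + 1) := one_mem _
  have wR : (C.R k : O) ∈ C.W 0 (k + 1 + 1) := C.R_mem_W (by omega) (by omega)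
  have wRi : (↑(C.R k)⁻¹ : O) ∈ C.W 0 (k + 1 + 1) := C.Ri_mem_W (by omega) (by omega)
  have wK : C.K k ∈ C.W 0 (k + 1 + 1) := C.K_mem_W (by omega) (by omega)
  have wt : t' ∈ C.W 0 (k + 1 + 1) := by
    rcases ht' with rfl | rfl | rfl
    exacts [o, wR, wK]
  have gS : C.IsGen (k + 1) (C.R (k + 1)) := Or.inr (Or.inl rfl)
  have gL : C.IsGen (k + 1) (C.K (k + 1)) := Or.inr (Or.inr rfl)
  have g1 : C.IsGen (k + 1) 1 := Or.inl rfl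
  rcases hs with rfl | hs
  · simpa using C.mem_Sp wt ht o
  rcases ht with rfl | ht
  · simpa using C.mem_Sp o (Or.inr hs) wt
  rcases ht' with rfl | rfl | rfl
  · rw [mul_one]; exact C.gen_mul_gen (Or.inr hs) (Or.inr ht)
  · rcases hs with rfl | rfl <;> rcases ht with rfl | rfl
    · have br : (C.R (k + 1) : O) * C.R k * C.R (k + 1) = C.R k * C.R (k + 1) * C.R k :=
        (congrArg Units.val P.braid).symm
      rw [br]; exact C.mem_Sp wR gS wR
    · rw [← P.KL']; simpa using C.mem_Sp wK gL o
    · rw [P.LRS]; simpa using C.mem_Sp o gL wK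
    · rw [P.LRL]; exact (C.Sp _).smul_mem _ (by simpa using C.mem_Sp o gL o)
  · rcases hs with rfl | rfl <;> rcases ht with rfl | rfl
    · rw [P.SKS]; exact C.mem_Sp wRi gL wRi
    · rw [mul_assoc, P.SKL]; simpa using C.mem_Sp wRi gL o
    · rw [P.LKS]; simpa using C.mem_Sp o gL wRi
    · rw [P.LKL]; simpa using C.mem_Sp o gL o

lemma gen_comm {k : ℕ} {s w : O} (hs : C.IsGen (k + 1) s) (hw : w ∈ C.W 0 (k + 1)) :
    s * w = w * s := by
  have h1 : w ∈ C.off (k + 1) := C.W_off (by omega) hw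
  have h2 : w ∈ C.off (k + 2) := C.W_off (by omega) hw
  rcases hs with rfl | rfl | rfl
  · rw [one_mul, mul_one]
  · exact C.R_comm h1 h2
  · exact C.K_comm h1 h2

lemma W_zero_one {w : O} (hw : w ∈ C.W 0 1) : ∃ z : ℂ, w = algebraMap ℂ O z := by
  have : C.W 0 1 ≤ ⊥ := C.W_le fun i h1 h2 => by omega
  obtain ⟨z, hz⟩ := Algebra.mem_bot.mp (this hw)
  exact ⟨z, hz.symm⟩

lemma le_Sp_of {k : ℕ} (h : ∀ u ∈ C.W 0 (k + 1), ∀ s t, C.IsGen k s → C.IsGen k t →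
    s * u * t ∈ C.Sp k) {w : O} (hw : w ∈ C.W 0 (k + 2)) : w ∈ C.Sp k := by
  have o : (1 : O) ∈ C.W 0 (k + 1) := one_mem _
  have h1 : ∀ s, C.IsGen k s → ∀ x ∈ C.Sp k, s * x ∈ C.Sp k := by
    intro s hs x hx
    refine Submodule.span_induction (p := fun x _ => s * x ∈ C.Sp k) ?_ ?_ ?_ ?_ hx
    · rintro x ⟨u, hu, t, ht, v, hv, rfl⟩
      have := C.mul_mem_Sp o (h u hu s t hs ht) hv
      simpa only [mul_assoc, one_mul] using this
    · simp
    · intro x y _ _ hx hy; rw [mul_add]; exact add_mem hx hy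
    · intro z x _ hx; rw [mul_smul_comm]; exact (C.Sp k).smul_mem _ hx
  have h2 : ∀ x ∈ C.Sp k, w * x ∈ C.Sp k := by
    refine Algebra.adjoin_induction (p := fun w _ => ∀ x ∈ C.Sp k, w * x ∈ C.Sp k)
      ?_ ?_ ?_ ?_ hw
    · rintro y ⟨i, -, hi, hy⟩ x hx
      by_cases hik : i < k
      · have : y ∈ C.W 0 (k + 1) := by
          rcases hy with rfl | rfl
          · exact C.R_mem_W (by omega) (by omega)
          · exact C.Ri_mem_W (by omega) (by omega)
        simpa using C.mul_mem_Sp this hx o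
      · obtain rfl : i = k := by omega
        have hR := h1 _ (Or.inr (Or.inl rfl)) x hx
        have hK := h1 _ (Or.inr (Or.inr rfl)) x hx
        rcases hy with rfl | rfl
        · exact hR
        · rw [C.Rinv, add_mul, sub_mul, smul_mul_assoc, smul_mul_assoc, one_mul]
          exact add_mem (sub_mem hR ((C.Sp i).smul_mem _ hx)) ((C.Sp i).smul_mem _ hK)
    · intro z x hx
      rw [← Algebra.smul_def]; exact (C.Sp k).smul_mem _ hx
    · intro x y _ _ hx hy z hz; rw [add_mul]; exact add_mem (hx z hz) (hy z hz)
    · intro x y _ _ hx hy z hz; rw [mul_assoc]; exact hx _ (hy z hz)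
  have h3 : (1 : O) ∈ C.Sp k := by simpa using C.mem_Sp o (Or.inl rfl) o
  simpa using h2 1 h3

/-- Words in `k + 2` strands contain the last generator at most once. -/
lemma W_le_Sp {k : ℕ} {w : O} (hw : w ∈ C.W 0 (k + 2)) : w ∈ C.Sp k := by
  induction k generalizing w with
  | zero =>
    refine C.le_Sp_of (fun u hu s t hs ht => ?_) hw
    obtain ⟨z, rfl⟩ := C.W_zero_one hu
    rw [← Algebra.commutes, mul_assoc, ← Algebra.smul_def]
    exact (C.Sp 0).smul_mem _ (C.gen_mul_gen hs ht)
  | succ k ih =>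
    refine C.le_Sp_of (fun u hu s t hs ht => ?_) hw
    refine Submodule.span_induction (p := fun u _ => s * u * t ∈ C.Sp (k + 1)) ?_ ?_ ?_ ?_ (ih hu)
    · rintro x ⟨u1, hu1, t', ht', u2, hu2, rfl⟩
      have e : s * (u1 * t' * u2) * t = u1 * (s * t' * t) * u2 := by
        rw [mul_assoc u1, ← mul_assoc s, C.gen_comm hs hu1, mul_assoc u1, mul_assoc u1, mul_assoc u1]
        congr 1
        rw [mul_assoc, mul_assoc t', ← C.gen_comm ht hu2]
        simp only [mul_assoc]
      rw [e]
      exact C.mul_mem_Sp (C.W_mono le_rfl (by omega) hu1) (C.gen_mul_gen_mul_gen hs ht' ht)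
        (C.W_mono le_rfl (by omega) hu2)
    · simp
    · intro x y _ _ hx hy; rw [mul_add, add_mul]; exact add_mem hx hy
    · intro z x _ hx; rw [mul_smul_comm, smul_mul_assoc]; exact (C.Sp _).smul_mem _ hx

/-- Induction over the products `u t v`. -/
lemma W_induction {k : ℕ} {P : O → Prop} (h0 : P 0) (ha : ∀ x y, P x → P y → P (x + y))
    (hs : ∀ (z : ℂ) x, P x → P (z • x))
    (h : ∀ u ∈ C.W 0 (k + 1), ∀ v ∈ C.W 0 (k + 1), P (u * v) ∧ P (u * C.R k * v) ∧ P (u * C.K k * v))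
    {w : O} (hw : w ∈ C.W 0 (k + 2)) : P w := by
  refine Submodule.span_induction (p := fun x _ => P x) ?_ h0 (fun x y _ _ => ha x y)
    (fun z x _ => hs z x) (C.W_le_Sp hw)
  rintro x ⟨u, hu, t, rfl | rfl | rfl, v, hv, rfl⟩
  · rw [mul_one]; exact (h u hu v hv).1
  · exact (h u hu v hv).2.1
  · exact (h u hu v hv).2.2

lemma exists_K_mul_mul_K {k : ℕ} {w : O} (hw : w ∈ C.W 0 (k + 2)) :
    ∃ v ∈ C.W 0 (k + 1), C.K (k + 1) * w * C.K (k + 1) = v * C.K (k + 1) := by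
  refine C.W_induction (P := fun w => ∃ v ∈ C.W 0 (k + 1), C.K (k + 1) * w * C.K (k + 1) =
    v * C.K (k + 1)) ⟨0, zero_mem _, by simp⟩ ?_ ?_ ?_ hw
  · rintro x y ⟨v, hv, h⟩ ⟨v', hv', h'⟩
    exact ⟨v + v', add_mem hv hv', by rw [mul_add, add_mul, h, h', add_mul]⟩
  · rintro z x ⟨v, hv, h⟩
    exact ⟨z • v, (C.W _ _).smul_mem hv _, by rw [mul_smul_comm, smul_mul_assoc, h, smul_mul_assoc]⟩
  · intro u hu v hv
    have P := C.pair k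
    have cu := C.gen_comm (Or.inr (Or.inr rfl)) hu
    have cv := C.gen_comm (Or.inr (Or.inr rfl)) hv
    have key : ∀ t, ∀ z : ℂ, C.K (k + 1) * t * C.K (k + 1) = z • C.K (k + 1) →
        C.K (k + 1) * (u * t * v) * C.K (k + 1) = (z • (u * v)) * C.K (k + 1) := by
      intro t z h
      calc C.K (k + 1) * (u * t * v) * C.K (k + 1)
          = (C.K (k + 1) * u) * t * (v * C.K (k + 1)) := by simp only [mul_assoc]
        _ = u * (C.K (k + 1) * t * C.K (k + 1)) * v := by rw [cu, ← cv]; simp only [mul_assoc]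
        _ = _ := by rw [h, mul_smul_comm, smul_mul_assoc, smul_mul_assoc, mul_assoc, cv, mul_assoc]
    have hm : ∀ z : ℂ, z • (u * v) ∈ C.W 0 (k + 1) := fun z => (C.W _ _).smul_mem (mul_mem hu hv) _
    refine ⟨⟨_, hm C.η, ?_⟩, ⟨_, hm C.μ⁻¹, key _ _ P.LRL⟩, ⟨_, hm 1, key _ _ ?_⟩⟩
    · have := key 1 C.η (by rw [mul_one, K_mul_K])
      rwa [mul_one] at this
    · rw [one_smul, P.LKL]

/-- `R_{j+p-1} ⋯ R_j`. -/
def RD (j : ℕ) : ℕ → O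
  | 0 => 1
  | p + 1 => C.R (j + p) * RD j p

lemma RD_succ (j p : ℕ) : C.RD j (p + 1) = C.R (j + p) * C.RD j p := rfl

lemma RD_succ' (j p : ℕ) : C.RD j (p + 1) = C.RD (j + 1) p * C.R j := by
  induction p with
  | zero => simp [RD]
  | succ p ih => rw [RD_succ, ih, RD_succ, ← mul_assoc]; congr 4; omega

lemma exists_RD (p : ℕ) : ∃ α : BraidAlg p, ∀ d, C.rep d α = C.RD d p := by
  induction p with
  | zero => exact ⟨1, fun d => map_one _⟩
  | succ p ih =>
    obtain ⟨α, hα⟩ := ih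
    refine ⟨sigA (Fin.last p) * algShift 0 (by omega) α, fun d => ?_⟩
    rw [map_mul, QChain.rep_shift, QChain.rep_sigA, add_zero, hα]; rfl

lemma RD_mem_W {a j p n : ℕ} (h1 : a ≤ j) (h2 : j + p < a + n) : C.RD j p ∈ C.W a n := by
  induction p with
  | zero => exact one_mem _
  | succ p ih => exact mul_mem (C.R_mem_W (by omega) (by omega)) (ih (by omega))

lemma RD_mul_K (j p : ℕ) : ∃ u ∈ C.W 0 (j + p + 1), ∃ v ∈ C.W 0 (j + p + 1),
    C.RD (j + 1) p * C.K j = u * C.K (j + p) * v := by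
  induction p generalizing j with
  | zero => exact ⟨1, one_mem _, 1, one_mem _, by simp [RD]⟩
  | succ p ih =>
    obtain ⟨u, hu, v, hv, h⟩ := ih (j + 1)
    have P := C.pair j
    have e : (↑(C.R j)⁻¹ : O) * C.RD (j + 1 + 1) p = C.RD (j + 1 + 1) p * ↑(C.R j)⁻¹ :=
      inv_comm (C.R_comm (C.W_off (a := j + 2) (n := p + 1) (by omega) (C.RD_mem_W (by omega) (by omega)))
        (C.W_off (a := j + 2) (n := p + 1) (by omega) (C.RD_mem_W (by omega) (by omega))))
    rw [show j + (p + 1) = j + 1 + p by omega]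
    refine ⟨↑(C.R j)⁻¹ * u, mul_mem (C.Ri_mem_W (by omega) (by omega)) hu, v * C.K j,
      mul_mem hv (C.K_mem_W (by omega) (by omega)), ?_⟩
    calc C.RD (j + 1) (p + 1) * C.K j = C.RD (j + 1 + 1) p * (C.R (j + 1) * C.K j) := by
          rw [RD_succ', mul_assoc]
      _ = ↑(C.R j)⁻¹ * (C.RD (j + 1 + 1) p * C.K (j + 1)) * C.K j := by
          rw [← P.RiLK, ← mul_assoc, ← e]; simp only [mul_assoc]
      _ = _ := by rw [h]; simp only [mul_assoc]

lemma chi_mul_K {m : ℕ} {w : O} (hw : w ∈ C.W 0 (m + 1)) :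
    C.chi (m + 2) (w * C.K (m + 1)) = C.η • (C.chi m w * C.g) := by
  rw [C.chi_eq, C.mp_mul_K hw, map_smul, C.E_mul_right (C.g_off 0), C.chi_eq]

lemma chi_one_K : C.chi 1 (C.K 0) = C.η • C.g := by
  rw [g, smul_smul, mul_inv_cancel₀ C.η_ne, one_smul]

section

variable {S : Subalgebra ℂ O}

lemma chi_K_mul_mem (hg : C.g ∈ S) {m : ℕ}
    (ih : ∀ k, k < m + 1 → ∀ w ∈ C.W 0 (k + 1), C.chi k w ∈ S) {w : O} (hw : w ∈ C.W 0 (m + 1)) :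
    C.chi (m + 1) (C.K m * w) ∈ S := by
  rcases m with _ | m
  · obtain ⟨z, rfl⟩ := C.W_zero_one hw
    rw [← Algebra.commutes, ← Algebra.smul_def, C.chi_smul]
    exact S.smul_mem (C.chi_one_K ▸ S.smul_mem hg _) _
  · obtain ⟨v, hv, h⟩ := C.exists_K_mul_mul_K hw
    have e : C.η • C.chi (m + 2) (C.K (m + 1) * w) = C.η • (C.chi m v * C.g) := by
      rw [← C.chi_mul_K hv, ← h, C.chi_cyc (C.K_mem_W (by omega) (by omega)), ← mul_assoc, K_mul_K,
        smul_mul_assoc, C.chi_smul]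
    rw [smul_right_injective O C.η_ne e]
    exact mul_mem (ih m (by omega) v hv) hg

lemma chi_RD_mul_mem (hg : C.g ∈ S) (hp : ∀ p, C.chi p (C.RD 0 p) ∈ S) {n : ℕ}
    (ih : ∀ k, k < n → ∀ w ∈ C.W 0 (k + 1), C.chi k w ∈ S) (j : ℕ) : ∀ p, j + p = n →
    ∀ w ∈ C.W 0 (j + 1), C.chi (j + p) (C.RD j p * w) ∈ S := by
  induction j with
  | zero =>
    intro p _ w hw
    obtain ⟨z, rfl⟩ := C.W_zero_one hw
    rw [← Algebra.commutes, ← Algebra.smul_def, C.chi_smul, zero_add]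
    exact S.smul_mem (hp p) _
  | succ j ihj =>
    intro p hn w hw
    refine C.W_induction (P := fun w => C.chi (j + 1 + p) (C.RD (j + 1) p * w) ∈ S) ?_ ?_ ?_ ?_ hw
    · simp [QChain.chi]
    · intro x y hx hy; rw [mul_add, C.chi_add]; exact add_mem hx hy
    · intro z x hx; rw [mul_smul_comm, C.chi_smul]; exact S.smul_mem hx _
    · intro u hu v hv
      have hvu := mul_mem hv hu
      have rd : ∀ x ∈ C.W 0 (j + 1), C.RD (j + 1) p * x = x * C.RD (j + 1) p := fun x hx =>
        C.W_comm_of_off (a := j + 1) (n := p + 1) (C.RD_mem_W (by omega) (by omega))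
          fun i h1 h2 => C.W_off (by omega) hx
      have cyc : ∀ t, C.chi (j + 1 + p) (C.RD (j + 1) p * (u * t * v)) =
          C.chi (j + 1 + p) (C.RD (j + 1) p * t * (v * u)) := by
        intro t
        rw [mul_assoc u, ← mul_assoc, rd u hu, mul_assoc u,
          ← C.chi_cyc (C.W_mono le_rfl (by omega) hu)]
        simp only [mul_assoc]
      refine ⟨?_, ?_, ?_⟩
      · have e := cyc 1
        rw [mul_one, mul_one, rd _ hvu] at e
        obtain ⟨α, hα⟩ := C.exists_rep hvu
        obtain ⟨β, hβ⟩ := C.exists_RD p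
        rw [e, ← hα, ← hβ, show j + 1 + p = j + p + 1 by omega, C.chi_mul_chi, hα, hβ]
        exact mul_mem (ih j (by omega) _ hvu) (hp p)
      · rw [cyc, ← C.RD_succ', show j + 1 + p = j + (p + 1) by omega]
        exact ihj (p + 1) (by omega) _ hvu
      · obtain ⟨u', hu', v', hv', h⟩ := C.RD_mul_K j p
        rw [cyc, h, show j + 1 + p = j + p + 1 by omega, mul_assoc, mul_assoc,
          ← C.chi_cyc (C.W_mono le_rfl (by omega) hu'), mul_assoc]
        exact C.chi_K_mul_mem hg (fun k hk => ih k (by omega))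
          (mul_mem (mul_mem hv' (C.W_mono le_rfl (by omega) hvu)) hu')

/-- All characters belong to the algebra generated by `g` and the power sums. -/
lemma chi_mem (hg : C.g ∈ S) (hp : ∀ p, C.chi p (C.RD 0 p) ∈ S) (m : ℕ) :
    ∀ w ∈ C.W 0 (m + 1), C.chi m w ∈ S := by
  induction m using Nat.strong_induction_on with
  | _ m ih =>
    intro w hw
    have := C.chi_RD_mul_mem hg hp ih m 0 rfl w hw
    simpa [RD] using this

end

/-! ### Power sums -/

lemma mp_RD_succ (p : ℕ) : C.mp (p + 1) (C.RD 0 (p + 1)) = C.xs (C.mp p (C.RD 0 p)) := by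
  obtain ⟨β, hβ⟩ := C.exists_RD p
  rw [← hβ, xs_mp, hβ, RD_succ', zero_add]

lemma cR_ne {m : ℕ} (h : qnum C.q m ≠ 0) : C.cR m ≠ 0 := by
  have hq := C.q_ne
  intro h0
  apply h
  rw [cR, div_eq_zero_iff] at h0
  have h1 := h0.resolve_right C.c_ne
  have e : C.q ^ m - C.q⁻¹ ^ m = -(C.q ^ m) * (C.q⁻¹ ^ (2 * m) - 1) := by
    have : C.q ^ m * C.q⁻¹ ^ (2 * m) = C.q⁻¹ ^ m := by
      rw [two_mul, pow_add, ← mul_assoc, ← mul_pow, mul_inv_cancel₀ hq, one_pow, one_mul]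
    linear_combination this
  rw [qnum, e, h1, mul_zero, zero_div]

lemma nrm_ne {m : ℕ} (h : qnum C.q (m + 1) ≠ 0) : C.nrm m ≠ 0 :=
  div_ne_zero (pow_ne_zero _ C.q_ne) h

lemma qnum_one : qnum C.q 1 = 1 := by
  rw [qnum, pow_one, pow_one]; exact div_self C.c_ne

variable {N : ℕ} (hN : C.Regular N)

include hN

lemma Regular.qnum_ne' {m : ℕ} (h1 : 1 ≤ m) (h2 : m ≤ N) : qnum C.q m ≠ 0 := by
  rcases Nat.lt_or_ge 1 m with h | h
  · exact hN.qnum_ne m h h2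
  · obtain rfl : m = 1 := by omega
    rw [qnum_one]; exact one_ne_zero

lemma chi_as_K (m : ℕ) : C.chi (m + 2) (C.as 2 m * C.K 0) = C.η • (C.g * C.ac m) := by
  have h := C.chi_mul_chi (kap C.q C.μ (0 : Fin 1)) (antisym C.q C.μ m)
  rw [rep_kap] at h
  have e : C.as 2 m * C.K 0 = C.K 0 * C.as 2 m := C.W_comm_of_off (C.as_mem_W 2 m) fun j h _ =>
    C.K_off (by omega) (by omega)
  rw [e, show m + 2 = 1 + m + 1 by omega, ← smul_mul_assoc, ← chi_one_K]
  exact h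

lemma E_mB_mem {S : Subalgebra ℂ O} (hg : C.g ∈ S) (ha : ∀ m, m + 1 ≤ N → C.ac m ∈ S) {m : ℕ}
    (hm : m + 1 ≤ N) : C.E 0 (C.mB m) ∈ S := by
  rcases m with _ | m
  · have h := C.chi_one_K
    rw [C.chi_eq] at h
    rw [mB, as_zero, one_mul, h]
    exact S.smul_mem hg _
  · have ce : C.as 2 m * C.K 0 = C.K 0 * C.as 2 m := C.W_comm_of_off (C.as_mem_W 2 m)
      fun j h _ => C.K_off (by omega) (by omega)
    have wK : C.K 0 ∈ C.W 0 (m + 2 + 1) := C.K_mem_W le_rfl (by omega)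
    have wa : C.as 2 m ∈ C.W 0 (m + 2 + 1) := C.W_mono (by omega) (by omega) (C.as_mem_W 2 m)
    have hb : C.K 0 * C.bax 1 (m + 1) * C.K 0 =
        (C.η + C.cR (m + 1) * C.μ⁻¹ + C.cK (m + 1)) • C.K 0 := by
      have e1 := (C.pair 0).KSK
      have e2 := (C.pair 0).KLK
      rw [zero_add] at e1 e2
      rw [bax, mul_add, mul_add, mul_one, add_mul, add_mul, mul_smul_comm, mul_smul_comm,
        smul_mul_assoc, smul_mul_assoc, e1, e2, K_mul_K]
      module
    set b := C.bax 1 (m + 1) with hbd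
    have e1 : C.chi (m + 2) (C.as 2 m * b * C.as 2 m * C.K 0) =
        C.chi (m + 2) (C.as 2 m * b * C.K 0) := by
      rw [mul_assoc, ce, ← mul_assoc, C.chi_cyc wa, ← mul_assoc, ← mul_assoc,
        C.as_mul_as hN (by omega) le_rfl le_rfl]
    have e2 : C.η • C.chi (m + 2) (C.as 2 m * b * C.K 0) =
        (C.η + C.cR (m + 1) * C.μ⁻¹ + C.cK (m + 1)) • C.chi (m + 2) (C.as 2 m * C.K 0) := by
      rw [← C.chi_smul, ← C.chi_smul, ← mul_smul_comm, ← mul_smul_comm, ← hb, ← K_mul_K, ← mul_assoc,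
        C.chi_cyc wK, ← mul_assoc, ← mul_assoc, ← ce]
      simp only [mul_assoc]
    have e3 : C.chi (m + 2) (C.as 2 m * b * C.K 0) ∈ S := by
      have : C.chi (m + 2) (C.as 2 m * b * C.K 0) =
          C.η⁻¹ • C.η • C.chi (m + 2) (C.as 2 m * b * C.K 0) := by
        rw [smul_smul, inv_mul_cancel₀ C.η_ne, one_smul]
      rw [this, e2, C.chi_as_K hN]
      exact S.smul_mem (S.smul_mem (S.smul_mem (mul_mem hg (ha _ (by omega))) _) _) _
    rw [mB, ← C.chi_eq, C.as_succ' hN hm, smul_mul_assoc, C.chi_smul, e1]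
    exact S.smul_mem e3 _

/-- Multiples of `1` and of the matrix powers `M^{a^{(m+1)}}`, `M^{a^{(m+1)↑1} κ_1}`. -/
def powSpan (C : BMWChain O) (N : ℕ) (S : Subalgebra ℂ O) : Submodule ℂ O :=
  Submodule.span ℂ {X | ∃ s ∈ S, ∃ m, m + 1 ≤ N ∧ (X = C.mA m * s ∨ X = C.mB m * s)}

omit hN in
lemma mul_mem_powSpan {S : Subalgebra ℂ O} {X s : O} (hX : X ∈ C.powSpan N S) (hs : s ∈ S) :
    X * s ∈ C.powSpan N S := by
  refine Submodule.span_induction (p := fun X _ => X * s ∈ C.powSpan N S) ?_ ?_ ?_ ?_ hX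
  · rintro X ⟨t, ht, m, hm, rfl | rfl⟩ <;> rw [mul_assoc] <;>
    exact Submodule.subset_span ⟨_, mul_mem ht hs, m, hm, by simp⟩
  · simp
  · intro x y _ _ hx hy; rw [add_mul]; exact add_mem hx hy
  · intro z x _ hx; rw [smul_mul_assoc]; exact Submodule.smul_mem _ _ hx

lemma xs_mem_powSpan {S : Subalgebra ℂ O} (hg : C.g ∈ S) (ha : ∀ m, m + 1 ≤ N → C.ac m ∈ S)
    (hv : C.Vanish N) (hSo : ∀ s ∈ S, ∀ j, s ∈ C.off j) {X : O} (hX : X ∈ C.powSpan N S) :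
    C.xs X ∈ C.powSpan N S := by
  have hA : ∀ {m}, m + 1 ≤ N → ∀ {s}, s ∈ S → C.mA m * s ∈ C.powSpan N S := fun {m} hm {s} hs =>
    Submodule.subset_span ⟨s, hs, m, hm, Or.inl rfl⟩
  have hB : ∀ {m}, m + 1 ≤ N → C.mB m ∈ C.powSpan N S := fun {m} hm =>
    Submodule.subset_span ⟨1, one_mem _, m, hm, Or.inr (mul_one _).symm⟩
  have hM : ∀ {s}, s ∈ S → ∀ {m}, m + 1 ≤ N → C.M₀ * s ∈ C.powSpan N S := fun {s} hs m hm => by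
    have : C.mA 0 = C.M₀ := by rw [mA, as_zero, C.mp_zero, mul_one]
    rw [← this]; exact hA (by omega) hs
  have xA : ∀ {m}, m + 1 ≤ N → C.xs (C.mA m) ∈ C.powSpan N S := by
    intro m hm
    have hc := C.cR_ne (hN.qnum_ne' C (m := m + 1) (by omega) hm)
    have key : C.M₀ * C.ac m + C.cR (m + 1) • C.xs (C.mA m) + C.cK (m + 1) • C.mB m ∈
        C.powSpan N S := by
      rcases Nat.lt_or_ge (m + 1) N with h | h
      · have hn := C.nrm_ne (hN.qnum_ne (m + 1 + 1) (by omega) h)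
        have e := C.mA_succ hN (m := m) h
        have e2 := congrArg ((C.nrm (m + 1))⁻¹ • ·) e
        simp only [smul_smul (C.nrm (m + 1))⁻¹, inv_mul_cancel₀ hn, one_smul] at e2
        rw [← e2]
        exact Submodule.smul_mem _ _ (by simpa using hA h (one_mem S))
      · obtain rfl : N = m + 1 := by omega
        rw [C.mA_last hN hv]
        exact zero_mem _
    have : C.xs (C.mA m) = (C.cR (m + 1))⁻¹ • (C.M₀ * C.ac m + C.cR (m + 1) • C.xs (C.mA m) +
        C.cK (m + 1) • C.mB m - C.M₀ * C.ac m - C.cK (m + 1) • C.mB m) := by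
      rw [show C.M₀ * C.ac m + C.cR (m + 1) • C.xs (C.mA m) +
        C.cK (m + 1) • C.mB m - C.M₀ * C.ac m - C.cK (m + 1) • C.mB m =
        C.cR (m + 1) • C.xs (C.mA m) by abel, smul_smul, inv_mul_cancel₀ hc, one_smul]
    rw [this]
    exact Submodule.smul_mem _ _ (sub_mem (sub_mem key (hM (ha m hm) hm))
      (Submodule.smul_mem _ _ (hB hm)))
  have xB : ∀ {m}, m + 1 ≤ N → C.xs (C.mB m) ∈ C.powSpan N S := by
    intro m hm
    rcases m with _ | m
    · rw [xs_mB_zero]; exact Submodule.smul_mem _ _ (hM hg hm)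
    · rw [C.xs_mB_succ hN hm]
      have hma := hM (ha m (by omega)) hm
      have hx := xA (m := m) (by omega)
      exact Submodule.smul_mem _ _ (C.mul_mem_powSpan (add_mem (add_mem
        (Submodule.smul_mem _ _ hma) (Submodule.smul_mem _ _ (sub_mem (add_mem (hB (by omega))
          (Submodule.smul_mem _ _ hma)) (Submodule.smul_mem _ _ hx))))
        (Submodule.smul_mem _ _ hx)) hg)
  refine Submodule.span_induction (p := fun X _ => C.xs X ∈ C.powSpan N S) ?_ ?_ ?_ ?_ hX
  · rintro X ⟨s, hs, m, hm, rfl | rfl⟩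
    · rw [C.xs_mul (hSo s hs)]; exact C.mul_mem_powSpan (xA hm) hs
    · rw [C.xs_mul (hSo s hs)]; exact C.mul_mem_powSpan (xB hm) hs
  · have : C.xs 0 = 0 := by simpa using C.xs_smul 0 0
    rw [this]; exact zero_mem _
  · intro x y _ _ hx hy; rw [xs_add]; exact add_mem hx hy
  · intro z x _ hx; rw [xs_smul]; exact Submodule.smul_mem _ _ hx

lemma E_mem_of_powSpan {S : Subalgebra ℂ O} (hg : C.g ∈ S) (ha : ∀ m, m + 1 ≤ N → C.ac m ∈ S)
    (hSo : ∀ s ∈ S, ∀ j, s ∈ C.off j) {X : O} (hX : X ∈ C.powSpan N S) : C.E 0 X ∈ S := by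
  refine Submodule.span_induction (p := fun X _ => C.E 0 X ∈ S) ?_ ?_ ?_ ?_ hX
  · rintro X ⟨s, hs, m, hm, rfl | rfl⟩
    · rw [C.E_mul_right (hSo s hs 0), mA, ← C.chi_eq]; exact mul_mem (ha m hm) hs
    · rw [C.E_mul_right (hSo s hs 0)]; exact mul_mem (C.E_mB_mem hN hg ha hm) hs
  · simp
  · intro x y _ _ hx hy; rw [map_add]; exact add_mem hx hy
  · intro z x _ hx; rw [map_smul]; exact S.smul_mem hx _

/-- All characters are polynomials in `g` and `a_1, …, a_N`, if the next antisymmetrizer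
vanishes. -/
theorem chi_mem_adjoin (hN1 : 1 ≤ N) (hv : C.Vanish N) {m : ℕ} {w : O} (hw : w ∈ C.W 0 (m + 1)) :
    C.chi m w ∈ Algebra.adjoin ℂ ({C.g} ∪ {x | ∃ m, m + 1 ≤ N ∧ x = C.ac m}) := by
  set S := Algebra.adjoin ℂ ({C.g} ∪ {x | ∃ m, m + 1 ≤ N ∧ x = C.ac m}) with hS
  have hg : C.g ∈ S := Algebra.subset_adjoin (Or.inl rfl)
  have ha : ∀ m, m + 1 ≤ N → C.ac m ∈ S := fun m hm => Algebra.subset_adjoin (Or.inr ⟨m, hm, rfl⟩)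
  have hSo : ∀ s ∈ S, ∀ j, s ∈ C.off j := by
    intro s hs j
    have : S ≤ C.off j := Algebra.adjoin_le (by
      rintro x (rfl | ⟨m, -, rfl⟩)
      · exact C.g_off j
      · exact C.ac_off m j)
    exact this hs
  have hM : ∀ p, C.mp p (C.RD 0 p) ∈ C.powSpan N S := by
    intro p
    induction p with
    | zero =>
      exact Submodule.subset_span ⟨1, one_mem _, 0, hN1, Or.inl (by rw [mul_one, mA, as_zero]; rfl)⟩
    | succ p ih => rw [mp_RD_succ]; exact C.xs_mem_powSpan hN hg ha hv hSo ih
  exact C.chi_mem hg (fun p => by rw [C.chi_eq]; exact C.E_mem_of_powSpan hN hg ha hSo (hM p)) m w hw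

end BMWChain

end
noncomputable section
/-! ## The square of the last antisymmetric character -/

namespace BMWChain

open QChain (cj cj_def cj_mul cj_eq_of_comm comm_iff_cj cj_units inv_comm braid_inv rep_induction)

variable {O : Type} [Ring O] [Algebra ℂ O] (C : BMWChain O)

/-- Nested arcs: the sites `d + i` and `d + 2 j - 1 - i` are paired. -/
def nest (d : ℕ) : ℕ → O
  | 0 => 1
  | j + 1 => C.Dw (d + 1) (2 * j) * C.K d * nest (d + 2) j

lemma nest_succ (d j : ℕ) :
    C.nest d (j + 1) = C.Dw (d + 1) (2 * j) * C.K d * C.nest (d + 2) j := rfl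

lemma K_comm_Mseq {d e n : ℕ} (h : d + 1 < e) : C.K d * C.Mseq e n = C.Mseq e n * C.K d :=
  C.K_comm' (C.Mseq_comm_R (Or.inl h))

lemma Mseq_mul_nest (d j : ℕ) :
    C.Mseq d (2 * j) * C.nest d j = ((C.μ ^ 2)⁻¹ • C.g) ^ j * C.nest d j := by
  induction j generalizing d with
  | zero => simp [nest]
  | succ j ih =>
    have hD := C.Dw_mem_WU (a := d) (n := 2 * (j + 1)) (j := d + 1) (p := 2 * j) (by omega)
      (by omega)
    have e1 := C.Mseq_comm_W hD.1
    have e2 : C.Mseq d (2 * (j + 1)) = C.M d * C.M (d + 1) * C.Mseq (d + 2) (2 * j) := by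
      rw [show 2 * (j + 1) = 2 + 2 * j by ring, C.Mseq_add]; simp [QChain.Mseq_succ]
    have ho : ∀ n i, ((C.μ ^ 2)⁻¹ • C.g) ^ n ∈ C.off i := fun n i =>
      pow_mem ((C.off i).smul_mem (C.g_off i) _) n
    have hw := C.W_comm_of_off hD.1 fun i _ _ => ho (j + 1) i
    have hk : C.K d * ((C.μ ^ 2)⁻¹ • C.g) ^ j = ((C.μ ^ 2)⁻¹ • C.g) ^ j * C.K d :=
      C.K_comm (ho _ _) (ho _ _)
    calc C.Mseq d (2 * (j + 1)) * C.nest d (j + 1)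
        = C.Mseq d (2 * (j + 1)) * C.Dw (d + 1) (2 * j) * (C.K d * C.nest (d + 2) j) := by
          rw [nest_succ]; simp only [mul_assoc]
      _ = C.Dw (d + 1) (2 * j) * (C.M d * C.M (d + 1) * (C.K d * C.Mseq (d + 2) (2 * j)) *
            C.nest (d + 2) j) := by
          rw [← e1, e2, C.K_comm_Mseq (by omega)]; simp only [mul_assoc]
      _ = C.Dw (d + 1) (2 * j) * ((C.M d * C.M (d + 1) * C.K d) *
            (C.Mseq (d + 2) (2 * j) * C.nest (d + 2) j)) := by simp only [mul_assoc]
      _ = C.Dw (d + 1) (2 * j) * (((C.μ ^ 2)⁻¹ • C.g) * (C.K d * ((C.μ ^ 2)⁻¹ • C.g) ^ j) *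
            C.nest (d + 2) j) := by rw [M_M_K, ih, ← smul_mul_assoc]; simp only [mul_assoc]
      _ = C.Dw (d + 1) (2 * j) * ((C.μ ^ 2)⁻¹ • C.g) ^ (j + 1) * (C.K d * C.nest (d + 2) j) := by
          rw [hk, pow_succ' ((C.μ ^ 2)⁻¹ • C.g) j]; simp only [mul_assoc]
      _ = _ := by rw [hw, nest_succ]; simp only [mul_assoc]

lemma nest_succ_succ (d j : ℕ) : C.nest d (j + 2) =
    ((C.Dw (d + 2) (2 * j) * C.Dw (d + 3) (2 * j) : Oˣ) : O) *
      (C.K (d + 1) * C.K (d + 2) * C.K d * C.nest (d + 4) j) := by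
  have hD := C.Dw_mem_WU (a := d + 3) (n := 2 * j + 1) (j := d + 3) (p := 2 * j) le_rfl (by omega)
  have e1 : (C.Dw (d + 3) (2 * j) : O) * C.K d = C.K d * C.Dw (d + 3) (2 * j) :=
    C.W_comm_of_off hD.1 fun i h _ => C.K_off (by omega) (by omega)
  have e2 : C.Dw (d + 1) (2 * (j + 1)) * C.Dw (d + 3) (2 * j) =
      C.Dw (d + 2) (2 * j) * C.Dw (d + 1) (2 * (j + 1)) := by
    have : ∀ p, p ≤ 2 * j → C.Dw (d + 1) (2 * (j + 1)) * C.Dw (d + 3) p =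
        C.Dw (d + 2) p * C.Dw (d + 1) (2 * (j + 1)) := by
      intro p
      induction p with
      | zero => simp [QChain.Dw]
      | succ p ih =>
        intro hp
        have h := C.Dw_shift (j := d + 1) (i := p + 1) (p := 2 * (j + 1)) (by omega)
        rw [show d + 1 + 1 + (p + 1) = d + 3 + p by omega,
          show d + 1 + (p + 1) = d + 2 + p by omega] at h
        have h' : C.Dw (d + 1) (2 * (j + 1)) * (C.R (d + 3 + p))⁻¹ =
            (C.R (d + 2 + p))⁻¹ * C.Dw (d + 1) (2 * (j + 1)) := by
          rw [mul_inv_eq_iff_eq_mul, mul_assoc, h, inv_mul_cancel_left]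
        rw [C.Dw_succ, C.Dw_succ, ← mul_assoc, h', mul_assoc, ih (by omega), mul_assoc]
    exact this _ le_rfl
  have e3 : C.Dw (d + 1) (2 * (j + 1)) =
      C.Dw (d + 3) (2 * j) * ((C.R (d + 2))⁻¹ * (C.R (d + 1))⁻¹) := by
    rw [show 2 * (j + 1) = 2 * j + 1 + 1 by ring, C.Dw_succ', C.Dw_succ', mul_assoc]
  have e4 : (↑(C.R (d + 2))⁻¹ : O) * ↑(C.R (d + 1))⁻¹ * C.K (d + 2) = C.K (d + 1) * C.K (d + 2) :=
    (C.pair (d + 1)).KL.symm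
  have e5 : C.K d * C.K (d + 2) = C.K (d + 2) * C.K d :=
    C.K_comm (C.K_off (by omega) (by omega)) (C.K_off (by omega) (by omega))
  calc C.nest d (j + 2) = ((C.Dw (d + 1) (2 * (j + 1)) : Oˣ) : O) * (C.K d *
        C.Dw (d + 3) (2 * j)) * (C.K (d + 2) * C.nest (d + 4) j) := by
        rw [nest_succ, nest_succ]; simp only [mul_assoc]
    _ = ((C.Dw (d + 1) (2 * (j + 1)) * C.Dw (d + 3) (2 * j) : Oˣ) : O) *
          (C.K d * C.K (d + 2) * C.nest (d + 4) j) := by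
        rw [← e1, Units.val_mul]; simp only [mul_assoc]
    _ = ((C.Dw (d + 2) (2 * j) * C.Dw (d + 3) (2 * j) : Oˣ) : O) *
          (↑(C.R (d + 2))⁻¹ * ↑(C.R (d + 1))⁻¹ * C.K (d + 2) * C.K d * C.nest (d + 4) j) := by
        rw [e2, e3, e5]; simp only [Units.val_mul, mul_assoc]
    _ = _ := by rw [e4]

/-- Nested arcs reflect the R-matrices. -/
lemma R_mul_nest {i j : ℕ} (d : ℕ) (h : i < j) :
    (C.R (d + j - 1 + i) : O) * C.nest d j = C.R (d + j - 1 - i) * C.nest d j := by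
  induction j generalizing d i with
  | zero => omega
  | succ j ih =>
    by_cases hi : i < j
    · have key : ∀ s, s + 1 < 2 * j → (C.R (d + 1 + s) : O) * C.nest d (j + 1) =
          C.Dw (d + 1) (2 * j) * (C.K d * (C.R (d + 2 + s) * C.nest (d + 2) j)) := by
        intro s hs
        have h1 := congrArg Units.val (C.Dw_shift (j := d + 1) hs)
        have h2 : C.K d * (C.R (d + 2 + s) : O) = C.R (d + 2 + s) * C.K d :=
          C.K_comm (C.R_off (by omega) (by omega)) (C.R_off (by omega) (by omega))
        simp only [Units.val_mul] at h1
        rw [nest_succ, ← mul_assoc, ← mul_assoc, ← h1, mul_assoc (C.Dw _ _ : O), ← mul_assoc (C.K d),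
          h2]
        simp only [mul_assoc]
      have h1 := key (j + i - 1) (by omega)
      have h2 := key (j - i - 1) (by omega)
      have h3 := ih (d + 2) hi
      rw [show d + 1 + (j + i - 1) = d + (j + 1) - 1 + i by omega,
        show d + 2 + (j + i - 1) = d + 2 + j - 1 + i by omega] at h1
      rw [show d + 1 + (j - i - 1) = d + (j + 1) - 1 - i by omega,
        show d + 2 + (j - i - 1) = d + 2 + j - 1 - i by omega] at h2
      rw [h1, h2, h3]
    · obtain rfl : i = j := by omega
      rcases i with _ | i
      · rfl
      · rw [show d + (i + 1 + 1) - 1 + (i + 1) = d + 2 + 2 * i by omega,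
          show d + (i + 1 + 1) - 1 - (i + 1) = d by omega, nest_succ_succ]
        have h1 := congrArg Units.val (C.Dw_pair (d + 2) (2 * i))
        have h2 : (C.R d : O) * (C.Dw (d + 2) (2 * i) * C.Dw (d + 3) (2 * i) : Oˣ) =
            (C.Dw (d + 2) (2 * i) * C.Dw (d + 3) (2 * i) : Oˣ) * C.R d := by
          rw [← Units.val_mul, ← Units.val_mul, ← mul_assoc,
            ← C.Dw_comm (i := d) (j := d + 2) (p := 2 * i) (Or.inl (by omega)), mul_assoc,
            ← C.Dw_comm (i := d) (j := d + 3) (p := 2 * i) (Or.inl (by omega)), mul_assoc]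
        have h3 : (C.R (d + 2) : O) * (C.K (d + 1) * C.K (d + 2)) = ↑(C.R (d + 1))⁻¹ * C.K (d + 2) :=
          (C.pair (d + 1)).SKL
        have h4 : (C.R d : O) * (C.K (d + 1) * C.K d) = ↑(C.R (d + 1))⁻¹ * C.K d := (C.pair d).RLK
        have e5 : C.K (d + 2) * C.K d = C.K d * C.K (d + 2) :=
          C.K_comm (C.K_off (by omega) (by omega)) (C.K_off (by omega) (by omega))
        have h5 : (C.R (d + 2) : O) * (C.K (d + 1) * C.K (d + 2) * C.K d) =
            C.R d * (C.K (d + 1) * C.K (d + 2) * C.K d) := by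
          rw [← mul_assoc, h3, mul_assoc (C.K (d + 1)), e5, ← mul_assoc (C.K (d + 1)), ← mul_assoc,
            h4, mul_assoc, mul_assoc, e5]
        rw [Units.val_mul] at h1
        rw [← mul_assoc, ← Units.val_mul (C.R (d + 2 + 2 * i)), ← h1, ← mul_assoc (C.R d : O), h2,
          mul_assoc _ (C.R (d + 2) : O), mul_assoc _ (C.R d : O), ← mul_assoc (C.R (d + 2) : O), h5,
          mul_assoc (C.R d : O)]

/-! ### Faithfulness of nested arcs -/

lemma eq_zero_of_mul_K {y : O} {i : ℕ} (h1 : y ∈ C.off (i + 1)) (h2 : y ∈ C.off (i + 2))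
    (h : y * C.K i = 0) : y = 0 := by
  apply C.faithful h1 h2
  have e : C.K (i + 1) * C.K i * C.K (i + 1) = C.K (i + 1) := (C.pair i).LKL
  have e2 : C.K (i + 1) * y = y * C.K (i + 1) := C.K_comm h1 h2
  change y * C.K (i + 1) = 0
  rw [← e, ← mul_assoc, ← mul_assoc, ← e2, mul_assoc (C.K (i + 1)), h, mul_zero, zero_mul]

lemma eq_zero_of_mul_Dw_K {d j : ℕ} {x : O} (hx : ∀ i, d + j < i → x ∈ C.off i)
    (h : x * (C.Dw (d + 1) j * C.K d) = 0) : x = 0 := by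
  induction j generalizing d x with
  | zero =>
    exact C.eq_zero_of_mul_K (hx (d + 1) (by omega)) (hx (d + 2) (by omega))
      (by simpa [QChain.Dw] using h)
  | succ j ih =>
    have e1 : (C.R d : O) * (C.K (d + 1) * C.K d) = ↑(C.R (d + 1))⁻¹ * C.K d := (C.pair d).RLK
    have e2 : (C.R d : O) * C.Dw (d + 2) j = C.Dw (d + 2) j * C.R d := by
      rw [← Units.val_mul, ← C.Dw_comm (i := d) (j := d + 2) (p := j) (Or.inl (by omega)), Units.val_mul]
    have e3 : C.K (d + 1) * C.K d * C.K (d + 1) = C.K (d + 1) := (C.pair d).LKL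
    have e4 : (C.Dw (d + 1) (j + 1) : O) * C.K d * C.K (d + 1) =
        C.R d * (C.Dw (d + 2) j * C.K (d + 1)) := by
      calc (C.Dw (d + 1) (j + 1) : O) * C.K d * C.K (d + 1)
          = C.Dw (d + 2) j * (↑(C.R (d + 1))⁻¹ * C.K d) * C.K (d + 1) := by
            rw [C.Dw_succ', Units.val_mul]; simp only [mul_assoc]
        _ = (C.Dw (d + 2) j * C.R d) * (C.K (d + 1) * C.K d * C.K (d + 1)) := by
            rw [← e1]; simp only [mul_assoc]
        _ = _ := by rw [e3, ← e2]; simp only [mul_assoc]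
    have e5 : x * C.R d = 0 := by
      refine ih (d := d + 1) (fun i hi => mul_mem (hx i (by omega)) (C.R_off (by omega) (by omega))) ?_
      rw [mul_assoc, ← e4, ← mul_assoc, h, zero_mul]
    rw [← Units.mul_inv_cancel_right x (C.R d), e5, zero_mul]

lemma eq_zero_of_mul_nest {d j : ℕ} {x : O} (hx : ∀ i, d + j ≤ i → x ∈ C.off i)
    (h : x * C.nest d j = 0) : x = 0 := by
  induction j generalizing d x with
  | zero => simpa [nest] using h
  | succ j ih =>
    have e1 : C.Dw (d + 1) (2 * j) = C.Dw (d + 1 + j) j * C.Dw (d + 1) j := by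
      have : ∀ p, C.Dw (d + 1) (j + p) = C.Dw (d + 1 + j) p * C.Dw (d + 1) j := by
        intro p
        induction p with
        | zero => simp [QChain.Dw]
        | succ p ih => rw [← add_assoc, C.Dw_succ, ih, C.Dw_succ, mul_assoc, add_assoc _ j p]
      rw [two_mul, this]
    have hD := C.Dw_mem_WU (a := d + 1 + j) (n := j + 1) (j := d + 1 + j) (p := j) le_rfl (by omega)
    have e2 : (C.Dw (d + 1 + j) j : O) * x = x * C.Dw (d + 1 + j) j :=
      C.W_comm_of_off hD.1 fun i h1 _ => hx i (by omega)
    have hD2 := C.Dw_mem_WU (a := d) (n := j + 2) (j := d + 1) (p := j) (by omega) (by omega)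
    apply C.eq_zero_of_mul_Dw_K (d := d) (j := j) fun i hi => hx i (by omega)
    refine ih (d := d + 2) (fun i hi => mul_mem (hx i (by omega)) (mul_mem
      (C.W_off (by omega) hD2.1) (C.K_off (by omega) (by omega)))) ?_
    have h' := congrArg (fun y => (↑(C.Dw (d + 1 + j) j)⁻¹ : O) * y) h
    simp only [mul_zero] at h'
    rw [← h', nest_succ, e1, Units.val_mul]
    simp only [← mul_assoc]
    rw [mul_assoc (↑(C.Dw (d + 1 + j) j)⁻¹ : O) x, ← e2, Units.inv_mul_cancel_left]

/-! ### Traces of the antisymmetrizers -/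

/-- The trace of the antisymmetrizer on `m + 1` strands. -/
def asTrace : ℕ → ℂ
  | 0 => C.η * C.μ
  | m + 1 => C.nrm (m + 1) * (C.η * C.μ + C.cR (m + 1) + C.cK (m + 1) * C.μ) * asTrace m

lemma E_bax (i m : ℕ) :
    C.E (i + 1) (C.bax i m) = (C.η * C.μ + C.cR m + C.cK m * C.μ) • 1 := by
  rw [bax, map_add, map_add, map_smul, map_smul, C.E_R, C.E_K, C.E_one]
  module

section

variable {N : ℕ} (hN : C.Regular N)

include hN

lemma ET_as {m : ℕ} (hm : m + 1 ≤ N) : C.ET 0 (m + 1) (C.as 0 m) = C.asTrace m • 1 := by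
  induction m with
  | zero =>
    rw [as_zero, C.ET_succ, C.ET_zero, C.E_one, asTrace]
  | succ m ih =>
    have ho : C.as 0 m ∈ C.off (0 + m + 1) := C.W_off (by omega) (C.as_mem_W 0 m)
    rw [C.ET_succ, as_succ, map_smul, show 0 + (m + 1) = 0 + m + 1 by omega, C.E_mul_right ho,
      C.E_mul_left ho, E_bax, mul_smul_comm, mul_one, smul_mul_assoc,
      C.as_mul_as hN (by omega) le_rfl le_rfl, smul_smul, map_smul, ih (by omega), smul_smul,
      asTrace]

omit hN in
lemma asTrace_factor {k m : ℕ} (hμ : C.μ * C.q ^ k = C.q) (hk : m + 1 ≤ k)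
    (hd : C.q * C.μ⁻¹ * C.q⁻¹ ^ (2 * (m + 1)) + 1 ≠ 0) :
    C.nrm (m + 1) * (C.η * C.μ + C.cR (m + 1) + C.cK (m + 1) * C.μ) =
      C.q * C.μ * (qnum C.q (k - 1 - m) / qnum C.q (m + 2)) *
        ((C.q * C.μ⁻¹ * C.q⁻¹ ^ (2 * (m + 2)) + 1) /
          (C.q * C.μ⁻¹ * C.q⁻¹ ^ (2 * (m + 1)) + 1)) := by
  obtain ⟨j, rfl⟩ : ∃ j, k = m + 1 + j := ⟨k - (m + 1), by omega⟩
  rw [show m + 1 + j - 1 - m = j by omega]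
  have hq := C.q_ne
  have hm := C.mu_ne
  have hc := C.c_ne
  have hη : C.η * C.μ = (C.q - C.μ) * (C.q⁻¹ + C.μ) / C.c := by
    rw [η, eta, ← c]; field_simp
  have hx : ∀ y : ℂ, y / qnum C.q (m + 2) = y * (qnum C.q (m + 2))⁻¹ := fun y => div_eq_mul_inv _ _
  rw [nrm, hη, cR, cK, hx, hx]
  generalize (qnum C.q (m + 2))⁻¹ = z
  have hA : C.q ^ (m + 1) ≠ 0 := pow_ne_zero _ hq
  have hB : C.q ^ j ≠ 0 := pow_ne_zero _ hq
  have e1 : C.q⁻¹ ^ (2 * (m + 1)) = ((C.q ^ (m + 1)) ^ 2)⁻¹ := by rw [inv_pow]; ring_nf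
  have e2 : C.q⁻¹ ^ (2 * (m + 2)) = ((C.q ^ (m + 1)) ^ 2 * C.q ^ 2)⁻¹ := by rw [inv_pow]; ring_nf
  have e3 : C.μ = C.q / (C.q ^ (m + 1) * C.q ^ j) := by
    rw [eq_div_iff (mul_ne_zero hA hB), ← pow_add, hμ]
  have e4 : qnum C.q j = (C.q ^ j - (C.q ^ j)⁻¹) / C.c := by rw [qnum, inv_pow, c]
  rw [e1, e3] at hd
  rw [e1, e2, e3, e4]
  have hcq : C.c = (C.q ^ 2 - 1) / C.q := by rw [c]; field_simp
  rw [hcq] at hc ⊢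
  generalize C.q ^ (m + 1) = A at *
  generalize C.q ^ j = B at *
  have hc2 : C.q ^ 2 - 1 ≠ 0 := fun h => hc (by rw [h, zero_div])
  have hd2 : B + A ≠ 0 := fun h => hd (by
    have : A = -B := by linear_combination h
    subst this
    field_simp
    ring)
  have hd3 : C.q * (C.q / (A * B))⁻¹ * (A ^ 2)⁻¹ + 1 = (B + A) / A := by field_simp
  rw [hd3]
  field_simp
  ring

lemma asTrace_eq {m : ℕ} (hμ : C.μ * C.q ^ N = C.q) (hm : m + 1 ≤ N) :
    C.asTrace m = C.η * C.μ * (C.q * C.μ) ^ m *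
      (∏ i ∈ Finset.range m, qnum C.q (N - 1 - i) / qnum C.q (i + 2)) *
        ((C.q * C.μ⁻¹ * C.q⁻¹ ^ (2 * (m + 1)) + 1) / (C.q * C.μ⁻¹ * C.q⁻¹ ^ 2 + 1)) := by
  have h1 := hN.den_ne 1 le_rfl (by omega)
  induction m with
  | zero =>
    rw [asTrace]
    simp only [zero_add, mul_one, pow_zero, Finset.range_zero, Finset.prod_empty] at h1 ⊢
    rw [div_self h1, mul_one]
  | succ m ih =>
    have h := hN.den_ne (m + 1) (by omega) (by omega)
    rw [asTrace, ih (by omega), C.asTrace_factor hμ (by omega) h, Finset.prod_range_succ]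
    rw [mul_one] at h1
    generalize C.q * C.μ⁻¹ * C.q⁻¹ ^ (2 * (m + 1)) + 1 = x at *
    field_simp
    ring

lemma asTrace_last {m : ℕ} (hμ : C.μ * C.q ^ N = C.q) (hm : m + 1 = N) :
    C.asTrace m = C.μ ^ N := by
  subst hm
  have h1 := hN.den_ne 1 le_rfl (by omega)
  rw [C.asTrace_eq hN hμ le_rfl, Finset.prod_div_distrib]
  have hp : ∀ n, n ≤ m + 1 → ∏ i ∈ Finset.range n, qnum C.q (i + 1) ≠ 0 := fun n hn =>
    Finset.prod_ne_zero_iff.mpr fun i hi =>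
      hN.qnum_ne' C (by omega) (by have := Finset.mem_range.mp hi; omega)
  have e1 : ∏ i ∈ Finset.range m, qnum C.q (m + 1 - 1 - i) =
      ∏ i ∈ Finset.range m, qnum C.q (i + 1) := by
    rw [← Finset.prod_range_reflect]
    refine Finset.prod_congr rfl fun i hi => ?_
    have := Finset.mem_range.mp hi
    congr 1; omega
  have e2 : ∏ i ∈ Finset.range m, qnum C.q (i + 2) =
      (∏ i ∈ Finset.range m, qnum C.q (i + 1)) * qnum C.q (m + 1) := by
    rw [← Finset.prod_range_succ, Finset.prod_range_succ', zero_add, C.qnum_one, mul_one]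
  have h2 := hN.qnum_ne' C (m := m + 1) (by omega) le_rfl
  rw [e1, e2, div_mul_eq_div_div, div_self (hp m (by omega))]
  have hq := C.q_ne
  have hm := C.mu_ne
  have hc := C.c_ne
  have hη : C.η * C.μ = (C.q - C.μ) * (C.q⁻¹ + C.μ) / C.c := by
    rw [η, eta, ← c]; field_simp
  have hA : C.q ^ m ≠ 0 := pow_ne_zero _ hq
  have e3 : C.μ = (C.q ^ m)⁻¹ := by
    rw [← mul_eq_one_iff_eq_inv₀ hA]
    apply mul_right_cancel₀ hq
    rw [one_mul, mul_assoc, ← pow_succ, hμ]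
  have e4 : qnum C.q (m + 1) = (C.q * C.q ^ m - (C.q * C.q ^ m)⁻¹) / C.c := by
    rw [qnum, inv_pow, c, pow_succ']
  have e5 : C.q⁻¹ ^ (2 * (m + 1)) = ((C.q * C.q ^ m) ^ 2)⁻¹ := by rw [inv_pow]; ring_nf
  rw [hη, e5, mul_pow, pow_succ C.μ m]
  rw [e4] at h2 ⊢
  rw [mul_one, e3] at h1
  generalize C.μ ^ m = u
  rw [e3]
  generalize C.q ^ m = A at *
  have h3 : C.q * A - (C.q * A)⁻¹ ≠ 0 := fun h => h2 (by rw [h, zero_div])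
  have h4 : (C.q * A) ^ 2 - 1 ≠ 0 := fun h => h3 (by
    field_simp
    linear_combination h)
  have h5 : A + C.q ≠ 0 := fun h => h1 (by
    have : A = -C.q := by linear_combination h
    subst this
    field_simp
    ring)
  have e6 : C.q * A⁻¹⁻¹ * C.q⁻¹ ^ 2 + 1 = (A + C.q) / C.q := by field_simp
  have e7 : C.q * A - (C.q * A)⁻¹ = ((C.q * A) ^ 2 - 1) / (C.q * A) := by field_simp
  rw [mul_pow] at h4
  rw [e6, e7, mul_pow]
  field_simp
  ring

/-- The last antisymmetric character is a square root of a power of `g`. -/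
lemma ac_sq {m : ℕ} (hμ : C.μ * C.q ^ N = C.q) (hm : m + 1 = N) {z : O} (hz : ∀ i, z ∈ C.off i)
    (h : C.Mseq 0 N * C.as 0 m = C.as 0 m * z) : C.ac m ^ 2 = C.g ^ N := by
  have hδ := C.ET_as hN hm.le
  rw [C.asTrace_last hN hμ hm] at hδ
  have hF : ∀ n, cj (C.Fw n) z = z := fun n => C.cj_Fw_eq fun i _ =>
    cj_eq_of_comm (C.F_comm (hz i) (hz (i + 1)))
  have hW : ∀ {a n w}, w ∈ C.W a n → w * z = z * w := fun hw => C.W_comm_of_off hw fun i _ _ => hz i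
  have hs : ∀ d, C.Mseq d N * C.as d m = C.as d m * z := by
    intro d
    induction d with
    | zero => exact h
    | succ d ih =>
      have e := congrArg (cj (C.Fw (d + N))) ih
      rwa [map_mul, map_mul, hF, C.cj_Fw_Mseq le_rfl, as, C.cj_Fw_rep (by omega)] at e
  have hac : C.ac m = C.μ ^ N • z := by
    rw [ac, QChain.chi, hm, h, C.ET_mul_right fun j _ _ => hz j]
    rw [hm] at hδ
    rw [hδ, smul_mul_assoc, one_mul]
  have hn1 : C.as N m * (C.as 0 m * C.nest 0 N) = C.as 0 m * C.nest 0 N := by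
    refine C.as_mul_of_R hN hm.le fun i h1 h2 => ?_
    obtain ⟨i, rfl⟩ := Nat.exists_eq_add_of_le h1
    have e := C.R_mul_nest (i := i + 1) (j := N) 0 (by omega)
    rw [show 0 + N - 1 + (i + 1) = N + i by omega] at e
    rw [← mul_assoc, C.as_comm (by omega), mul_assoc, e, ← mul_assoc,
      C.as_mul_R hN hm.le (by omega) (by omega), smul_mul_assoc]
  have hcomm : C.as N m * C.as 0 m = C.as 0 m * C.as N m :=
    C.W_comm_of_off (C.as_mem_W N m) fun j _ _ => C.W_off (by omega) (C.as_mem_W 0 m)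
  have hx : (z * z - ((C.μ ^ 2)⁻¹ • C.g) ^ N) * C.as 0 m * C.nest 0 N = 0 := by
    have hg : C.as 0 m * ((C.μ ^ 2)⁻¹ • C.g) ^ N = ((C.μ ^ 2)⁻¹ • C.g) ^ N * C.as 0 m :=
      C.W_comm_of_off (C.as_mem_W 0 m) fun j _ _ =>
        pow_mem ((C.off j).smul_mem (C.g_off j) _) N
    have e1 : C.Mseq 0 (2 * N) * (C.as 0 m * C.nest 0 N) =
        ((C.μ ^ 2)⁻¹ • C.g) ^ N * (C.as 0 m * C.nest 0 N) := by
      rw [← mul_assoc, ← C.Mseq_comm_W (C.W_mono (by omega) (by omega) (C.as_mem_W 0 m)), mul_assoc,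
        Mseq_mul_nest, ← mul_assoc, hg, mul_assoc]
    have e2 : C.Mseq 0 (2 * N) * (C.as 0 m * C.nest 0 N) = z * z * (C.as 0 m * C.nest 0 N) := by
      calc C.Mseq 0 (2 * N) * (C.as 0 m * C.nest 0 N)
          = C.Mseq 0 N * (C.Mseq N N * C.as N m) * (C.as 0 m * C.nest 0 N) := by
            rw [two_mul, C.Mseq_add, zero_add, mul_assoc, mul_assoc, mul_assoc, hn1]
        _ = C.Mseq 0 N * z * (C.as N m * (C.as 0 m * C.nest 0 N)) := by
            rw [hs, hW (C.as_mem_W N m)]; simp only [mul_assoc]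
        _ = C.Mseq 0 N * C.as 0 m * (z * C.nest 0 N) := by
            rw [hn1, mul_assoc _ z, ← mul_assoc z, ← hW (C.as_mem_W 0 m)]; simp only [mul_assoc]
        _ = z * (C.as 0 m * z) * C.nest 0 N := by
            rw [h, hW (C.as_mem_W 0 m)]; simp only [mul_assoc]
            rw [← mul_assoc _ z, hW (C.as_mem_W 0 m)]; simp only [mul_assoc]
        _ = _ := by rw [hW (C.as_mem_W 0 m)]; simp only [mul_assoc]
    rw [mul_assoc, sub_mul, ← e1, e2, sub_self]
  have hy : (z * z - ((C.μ ^ 2)⁻¹ • C.g) ^ N) * C.as 0 m = 0 := by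
    refine C.eq_zero_of_mul_nest (fun i hi => mul_mem (sub_mem (mul_mem (hz i) (hz i)) (pow_mem
      ((C.off i).smul_mem (C.g_off i) _) N)) (C.W_off (by omega) (C.as_mem_W 0 m))) hx
  have ht := congrArg (C.ET 0 N) hy
  rw [C.ET_mul_left fun j _ _ => sub_mem (mul_mem (hz j) (hz j)) (pow_mem
      ((C.off j).smul_mem (C.g_off j) _) N), map_zero] at ht
  rw [hm] at hδ
  have hm0 := C.mu_ne
  rw [hδ, mul_smul_comm, mul_one, smul_eq_zero_iff_right (pow_ne_zero _ hm0), sub_eq_zero] at ht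
  rw [hac, sq, smul_mul_smul_comm, ht, smul_pow, smul_smul]
  rw [inv_pow, ← pow_add, ← pow_mul, two_mul, mul_inv_cancel₀ (pow_ne_zero _ hm0), one_smul]

end

end BMWChain

end
noncomputable section
/-! ## The BMW chain of the extended quantum matrix algebra -/

section Chain

variable {ι : Type} [Fintype ι] [DecidableEq ι] {A : Type} [Ring A] [Algebra ℂ A]

/-- `op2` as an algebra homomorphism. -/
def op2Hom (A : Type) [Ring A] [Algebra ℂ A] {i j : ℕ} (h : i ≠ j) : Op ι 2 ℂ →ₐ[ℂ] ChainOp ι A :=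
  (placeHom ![i, j] (pair_injective h)).comp (scalHom A 2)

lemma op2Hom_apply {i j : ℕ} (h : i ≠ j) (X : Op ι 2 ℂ) : op2Hom A h X = op2 A X i j :=
  place_pair h X

lemma sum_single_mul_mul_single {n : Type} [Fintype n] [DecidableEq n] (K : Matrix n n ℂ) (s t : n) :
    ∑ u, Matrix.single u s (1 : ℂ) * K * Matrix.single t u 1 = K s t • (1 : Matrix n n ℂ) := by
  ext a b
  rw [Matrix.sum_apply, Finset.sum_eq_single a]
  · by_cases h : a = b
    · subst h
      simp [Matrix.mul_apply, Matrix.single_apply]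
    · simp [h]
  · intro u _ hu
    simp [Matrix.mul_assoc, hu.symm]
  · simp

lemma eq_zero_of_mul_op2 {K : Op ι 2 ℂ} (hK : K ≠ 0) {i j : ℕ} (h : i ≠ j) {X : ChainOp ι A}
    (h1 : X ∈ off ι A i) (h2 : X ∈ off ι A j) (hX : X * op2 A K i j = 0) : X = 0 := by
  obtain ⟨s, t, hst⟩ : ∃ s t, K s t ≠ 0 := by
    by_contra! h0
    exact hK (by ext s t; exact h0 s t)
  have hc : ∀ Z : Op ι 2 ℂ, X * op2 A Z i j = op2 A Z i j * X := fun Z =>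
    mul_comm_of_onSites (op2_mem Z i j) (by rintro k (rfl | rfl) <;> assumption)
  have key : X * op2Hom A h (K s t • 1) = 0 := by
    rw [← sum_single_mul_mul_single, map_sum, Finset.mul_sum]
    refine Finset.sum_eq_zero fun u _ => ?_
    simp only [map_mul, op2Hom_apply]
    rw [← mul_assoc, ← mul_assoc, hc, mul_assoc _ X, hX, mul_zero, zero_mul]
  rw [map_smul, map_one, mul_smul_comm, mul_one] at key
  exact (smul_eq_zero.mp key).resolve_left hst

end Chain

section Instance

variable {ι : Type} [Fintype ι] [DecidableEq ι] {q μ : ℂ} {R F : RMatrix ι}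

lemma IsBMWType.c_ne (h : IsBMWType q μ R) : q - q⁻¹ ≠ 0 := by
  obtain ⟨h0, h1, h2⟩ := h.q_ne
  intro hc
  have : (q - 1) * (q + 1) = 0 := by field_simp at hc; linear_combination hc
  rcases mul_eq_zero.mp this with h | h
  · exact h1 (by linear_combination h)
  · exact h2 (by linear_combination h)

lemma IsBMWType.matK_ne (h : IsBMWType q μ R) : matK q μ R.mat ≠ 0 := by
  intro hK
  rw [matK, smul_eq_zero] at hK
  have hK := hK.resolve_left (mul_ne_zero (inv_ne_zero h.mu_ne.1) (inv_ne_zero h.c_ne))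
  have hp : ((Polynomial.X - Polynomial.C q) * (Polynomial.X + Polynomial.C q⁻¹)).Monic :=
    (Polynomial.monic_X_sub_C q).mul (Polynomial.monic_X_add_C q⁻¹)
  have h0 : Polynomial.aeval R.mat
      ((Polynomial.X - Polynomial.C q) * (Polynomial.X + Polynomial.C q⁻¹)) = 0 := by
    rw [map_mul, map_sub, map_add, Polynomial.aeval_X, Polynomial.aeval_C, Polynomial.aeval_C,
      Algebra.algebraMap_eq_smul_one, Algebra.algebraMap_eq_smul_one, ← neg_eq_zero, ← neg_mul,
      neg_sub, add_comm R.mat]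
    exact hK
  have hd := Polynomial.natDegree_le_natDegree (minpoly.min ℂ R.mat hp h0)
  rw [h.minpoly_eq, Polynomial.Monic.natDegree_mul hp (Polynomial.monic_X_sub_C μ)] at hd
  simp at hd

lemma IsBMWType.nonempty (h : IsBMWType q μ R) : Nonempty ι := by
  by_contra hn
  rw [not_nonempty_iff] at hn
  exact h.matK_ne (Subsingleton.elim _ _)

lemma IsBMWType.cubic (h : IsBMWType q μ R) :
    (R.mat - q • 1) * (R.mat + q⁻¹ • 1) * (R.mat - μ • 1) = 0 := by
  have e := minpoly.aeval ℂ R.mat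
  rw [h.minpoly_eq] at e
  simpa [Algebra.algebraMap_eq_smul_one] using e

variable (h : IsBMWType q μ R) (hR : IsSkewInvertible R.mat) (hRF : IsCompatiblePair R.mat F.mat)

lemma kapOp_qmChain (i : ℕ) :
    (qmChain q μ hR hRF).kapOp q μ i = op2 (QMAlg q μ R F) (matK q μ R.mat) i (i + 1) := by
  rw [← op2Hom_apply (Nat.succ_ne_self i).symm, matK, map_smul, map_mul, map_sub, map_add, map_smul, map_smul,
    map_one, op2Hom_apply, QChain.kapOp, mul_inv]
  rfl

/-- The chain of the extended quantum matrix algebra, for an R-matrix of BMW type. -/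
def bmwChain : BMWChain (ChainOp ι (QMAlg q μ R F)) where
  toQChain := qmChain q μ hR hRF
  q := q
  μ := μ
  q_ne := h.q_ne.1
  c_ne' := h.c_ne
  mu_ne := h.mu_ne.1
  eta_ne' := by
    refine div_ne_zero (mul_ne_zero (sub_ne_zero.mpr h.mu_ne.2.1.symm) fun h0 => h.mu_ne.2.2 ?_)
      (mul_ne_zero h.mu_ne.1 h.c_ne)
    linear_combination h0
  cubic i := by
    have e := congrArg (op2Hom (QMAlg q μ R F) (Nat.succ_ne_self i).symm) h.cubic
    simp only [map_mul, map_sub, map_add, map_smul, map_one, map_zero, op2Hom_apply] at e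
    exact e
  KK i := by
    rw [kapOp_qmChain, kapOp_qmChain]
    have h1 : at2 (ι := ι) 1 (0 : Fin 2) = 1 := embed_one _
    have e1 : at2 1 (0 : Fin 2) * at2 (matK q μ R.mat) (1 : Fin 2) *
        at2 (matK q μ R.mat) (0 : Fin 2) = at2 R.mat (0 : Fin 2) * at2 R.mat (1 : Fin 2) *
        at2 (matK q μ R.mat) (0 : Fin 2) := by rw [h1, one_mul]; exact h.K_two_K_one
    have e := op2_relation (A := QMAlg q μ R F) e1 i
    rw [op2_one (by omega), one_mul] at e
    exact e
  KK' i := by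
    rw [kapOp_qmChain, kapOp_qmChain]
    have h1 : at2 (ι := ι) 1 (0 : Fin 2) = 1 := embed_one _
    have e1 : at2 1 (0 : Fin 2) * at2 (matK q μ R.mat) (1 : Fin 2) *
        at2 (matK q μ R.mat) (0 : Fin 2) = at2 R.mat⁻¹ (0 : Fin 2) * at2 R.mat⁻¹ (1 : Fin 2) *
        at2 (matK q μ R.mat) (0 : Fin 2) := by rw [h1, one_mul]; exact h.K_two_K_one_inv
    have e := op2_relation (A := QMAlg q μ R F) e1 i
    rw [op2_one (by omega), one_mul] at e
    exact e
  KKK i := by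
    rw [kapOp_qmChain, kapOp_qmChain]
    have h1 : at2 (ι := ι) 1 (0 : Fin 2) = 1 := embed_one _
    have e1 : at2 (matK q μ R.mat) (0 : Fin 2) * at2 (matK q μ R.mat) (1 : Fin 2) *
        at2 (matK q μ R.mat) (0 : Fin 2) = at2 1 (0 : Fin 2) * at2 1 (0 : Fin 2) *
        at2 (matK q μ R.mat) (0 : Fin 2) := by rw [h1, one_mul, one_mul]; exact h.K_K_K
    have e := op2_relation (A := QMAlg q μ R F) e1 i
    rw [op2_one (by omega), one_mul, one_mul] at e
    exact e
  faithful h1 h2 h3 := by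
    rw [kapOp_qmChain] at h3
    exact eq_zero_of_mul_op2 h.matK_ne (by omega) h1 h2 h3

local notation "Ch" => bmwChain h hR hRF

lemma lmul_chC {m : ℕ} (α : BraidAlg m) :
    lmul (chC q μ R F α : QMAlg q μ R F) = (Ch).chi m ((Ch).rep 0 α) :=
  lmul_ch (hR := hR) (hRF := hRF) (hN := isQuantumMatrix_genM q μ R F) α

lemma lmul_aC (m : ℕ) : lmul (aC q μ R F (m + 1) : QMAlg q μ R F) = (Ch).ac m :=
  lmul_chC h hR hRF _

lemma lmul_gC : lmul (gC q μ R F : QMAlg q μ R F) = (Ch).g := by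
  have e := lmul_chC h hR hRF (kap q μ (0 : Fin 1))
  have e2 : (Ch).rep 0 (kap q μ (0 : Fin 1)) = (Ch).K 0 := (Ch).rep_kap 0 (0 : Fin 1)
  rw [e2] at e
  change lmul ((eta q μ)⁻¹ • (chC q μ R F (kap q μ (0 : Fin 1)) : QMAlg q μ R F)) = _
  rw [map_smul, e]
  rfl

lemma gInvC_mul_gC : gInvC q μ R F * gC q μ R F = 1 :=
  Subtype.ext (gInv_mul_contraction q μ R F)

end Instance

/-! ### Chains of orthogonal type -/

section Orthogonal

variable {ι : Type} [Fintype ι] [DecidableEq ι] {q : ℂ} {k : ℕ} {R F : RMatrix ι}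

lemma muO_mul (hq : q ≠ 0) (k : ℕ) : muO q k * q ^ k = q := by
  rw [muO, ← zpow_natCast q k, ← zpow_add₀ hq]; simp

variable (h : IsOrthogonalType q k R) (hRF : IsCompatiblePair R.mat F.mat)

local notation "Ch" => bmwChain h.bmw h.skew hRF

lemma regular_bmwChain : (Ch).Regular k where
  qnum_ne := h.qnum_ne
  den_ne i h1 h2 := by
    have hq : q ≠ 0 := h.bmw.q_ne.1
    have hm : muO q k ≠ 0 := h.bmw.mu_ne.1
    intro h0
    apply h.mu_ne i h1 h2
    change q * (muO q k)⁻¹ * q⁻¹ ^ (2 * i) + 1 = 0 at h0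
    have e : q ^ (1 - 2 * (i : ℤ)) = q * q⁻¹ ^ (2 * i) := by
      rw [zpow_sub₀ hq, zpow_one, div_eq_mul_inv, inv_pow]
      norm_cast
    rw [e]
    field_simp at h0 ⊢
    linear_combination h0

lemma vanish_bmwChain : (Ch).Vanish k := by
  intro m hm d
  have e := congrArg (fun X => place (fun i : Fin (m + 1 + 1) => d + i.val)
    (scal (QMAlg q (muO q k) R F) X)) (h.vanish m hm)
  simp only [place_rho (hR := h.skew) (hRF := hRF) (hN := isQuantumMatrix_genM q (muO q k) R F)] at e
  have e0 : place (fun i : Fin (m + 1 + 1) => d + i.val)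
      (scal (QMAlg q (muO q k) R F) (0 : Op ι (m + 1 + 1) ℂ)) = 0 := by
    ext f x; simp [place_apply, scal]
  rw [e0] at e
  have e1 : (Ch).rep d (algShift 1 (by omega : 1 + m ≤ m + 1) (antisym q (muO q k) m) *
      baxMinus q (muO q k) (0 : Fin (m + 1)) (q⁻¹ ^ (2 * k)) *
      algShift 1 (by omega : 1 + m ≤ m + 1) (antisym q (muO q k) m)) = 0 := e
  rw [map_mul, map_mul, QChain.rep_shift] at e1
  have e2 := (Ch).rep_baxMinus d (0 : Fin (m + 1)) k
  rw [← e1]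
  congr 2
  exact e2.symm

lemma exists_rank_one {n : Type} [Fintype n] [DecidableEq n] {X : Matrix n n ℂ} (hX : X.rank = 1) :
    ∃ u v : n → ℂ, ∀ s t, X s t = u s * v t := by
  obtain ⟨u, hu⟩ := finrank_le_one_iff.mp (le_of_eq hX)
  have : ∀ t, ∃ c : ℂ, ∀ s, X s t = u.val s * c := by
    intro t
    obtain ⟨c, hc⟩ := hu ⟨X.mulVecLin (Pi.single t 1), ⟨_, rfl⟩⟩
    refine ⟨c, fun s => ?_⟩
    have e := congrFun (congrArg Subtype.val hc) s
    simp at e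
    rw [← e, mul_comm]
  choose v hv using this
  exact ⟨u.val, v, fun s t => hv t s⟩

lemma exists_Mseq_mul_as {m : ℕ} (hm : m + 1 = k) : ∃ z : ChainOp ι (QMAlg q (muO q k) R F),
    (∀ i, z ∈ (Ch).off i) ∧ (Ch).Mseq 0 k * (Ch).as 0 m = (Ch).as 0 m * z := by
  obtain ⟨u, v, huv⟩ := exists_rank_one (h.rank_one m hm)
  set X := R.rho (antisym q (muO q k) m) with hX
  set Y := (List.ofFn (copy F (genM q (muO q k) R F) m)).prod with hY
  have eX : place Fin.val (scal (QMAlg q (muO q k) R F) X) = (Ch).as 0 m := by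
    have e := place_rho (hR := h.skew) (hRF := hRF) (hN := isQuantumMatrix_genM q (muO q k) R F)
      (antisym q (muO q k) m) 0
    simp only [zero_add] at e
    exact e
  have eY : place Fin.val Y = (Ch).Mseq 0 (m + 1) :=
    place_prod_copy (hR := h.skew) (hRF := hRF) (hN := isQuantumMatrix_genM q (muO q k) R F) m
  have hN := regular_bmwChain h hRF
  refine ⟨lmul (∑ a, ∑ b, (v a * u b) • Y a b), fun i => lmul_mem_off _ i, ?_⟩
  have e1 : (Ch).Mseq 0 k * (Ch).as 0 m =
      place Fin.val (scal _ X * Y * scal _ X) := by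
    rw [place_mul Fin.val_injective, place_mul Fin.val_injective, eX, eY,
      (Ch).Mseq_comm_W ((Ch).as_mem_W 0 m), mul_assoc, (Ch).as_mul_as hN hm.le le_rfl le_rfl, hm]
  rw [e1, ← eX]
  ext f x
  simp only [place_apply, Module.End.mul_apply, lmul_apply, ← mul_assoc]
  refine Finset.sum_congr rfl fun t _ => ?_
  congr 1
  simp only [Matrix.mul_apply, scal, Matrix.map_apply, huv, map_mul, Finset.sum_mul, Finset.mul_sum]
  rw [Finset.sum_comm]
  refine Finset.sum_congr rfl fun a _ => Finset.sum_congr rfl fun b _ => ?_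
  simp only [Algebra.algebraMap_eq_smul_one, smul_mul_assoc, mul_smul_comm, one_mul, mul_one,
    smul_smul]
  congr 1
  ring

include h hRF in
/-- The square of the last antisymmetric character is a power of the contraction. -/
lemma aC_sq : aC q (muO q k) R F k ^ 2 = gC q (muO q k) R F ^ k := by
  have := h.bmw.nonempty
  obtain ⟨m, rfl⟩ : ∃ m, k = m + 1 := ⟨k - 1, by have := h.two_le; omega⟩
  obtain ⟨z, hz, e⟩ := exists_Mseq_mul_as h hRF rfl
  apply Subtype.ext
  apply lmul_injective (ι := ι)
  have e2 := BMWChain.ac_sq _ (regular_bmwChain h hRF) (muO_mul h.bmw.q_ne.1 _) rfl hz e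
  rw [← lmul_aC, ← lmul_gC, ← map_pow, ← map_pow] at e2
  exact e2

include h hRF in
/-- The characteristic subalgebra is generated by the antisymmetric characters and `g`, `g⁻¹`. -/
lemma adjoin_charSym :
    Algebra.adjoin ℂ (Set.range (CharSym.val q (muO q k) R F (k := k))) = ⊤ := by
  have := h.bmw.nonempty
  set S := Algebra.adjoin ℂ (Set.range (CharSym.val q (muO q k) R F (k := k))) with hS
  have hch : ∀ {m : ℕ} (α : BraidAlg m), chC q (muO q k) R F α ∈ S := by
    intro m α
    have e := (Ch).chi_mem_adjoin (regular_bmwChain h hRF) (by have := h.two_le; omega)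
      (vanish_bmwChain h hRF) ((Ch).rep_mem_W 0 α)
    rw [← lmul_chC] at e
    have le : Algebra.adjoin ℂ ({(Ch).g} ∪ {x | ∃ m, m + 1 ≤ k ∧ x = (Ch).ac m}) ≤
        S.map ((lmul (ι := ι)).comp (charAlg q (muO q k) R F).val) := by
      apply Algebra.adjoin_le
      rintro x (rfl | ⟨m, hm, rfl⟩)
      · exact ⟨gC q (muO q k) R F, Algebra.subset_adjoin ⟨CharSym.g, rfl⟩, lmul_gC _ _ _⟩
      · exact ⟨aC q (muO q k) R F (m + 1), Algebra.subset_adjoin ⟨CharSym.a ⟨m, hm⟩, rfl⟩,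
          lmul_aC _ _ _ _⟩
    obtain ⟨y, hy, e2⟩ := le e
    have : y = chC q (muO q k) R F α := Subtype.ext (lmul_injective (ι := ι) e2)
    rwa [← this]
  have hall : ∀ x ∈ charAlg q (muO q k) R F, ∃ y ∈ S, (y : QMAlg q (muO q k) R F) = x := by
    intro x hx
    have le : charAlg q (muO q k) R F ≤ S.map (charAlg q (muO q k) R F).val := by
      apply Algebra.adjoin_le
      rintro x (⟨m, α, rfl⟩ | rfl)
      · exact ⟨_, hch α, rfl⟩
      · exact ⟨gInvC q (muO q k) R F, Algebra.subset_adjoin ⟨CharSym.gi, rfl⟩, rfl⟩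
    obtain ⟨y, hy, e⟩ := le hx
    exact ⟨y, hy, e⟩
  rw [eq_top_iff]
  rintro x -
  obtain ⟨y, hy, e⟩ := hall x x.2
  rwa [← Subtype.ext e]

end Orthogonal

end
noncomputable section
/-! ## Spectral variables -/

lemma prod_range_two_mul {B : Type} [CommRing B] {f : ℕ → B} {g : B} {i : ℕ}
    (h : ∀ j, j < i → f j * f (2 * i - 1 - j) = g) : ∏ j ∈ Finset.range (2 * i), f j = g ^ i := by
  rw [two_mul, Finset.prod_range_add, ← Finset.prod_range_reflect (fun j => f (i + j)),
    ← Finset.prod_mul_distrib]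
  conv_rhs => rw [← Finset.card_range i, ← Finset.prod_const]
  refine Finset.prod_congr rfl fun j hj => ?_
  have hj := Finset.mem_range.mp hj
  rw [← h j hj]
  congr 2
  omega

/-- Elementary symmetric functions of variables that are interchanged by an involution up to
inversion. -/
lemma pow_mul_sum_powersetCard {B : Type} [CommRing B] {N : ℕ} {f : Fin N → B} {τ : Fin N → Fin N}
    (hτ : Function.Involutive τ) {g : B} (hg : ∀ j, f j * f (τ j) = g) {n : ℕ} (hn : n ≤ N) :
    g ^ (N - n) * ∑ t ∈ Finset.univ.powersetCard n, ∏ j ∈ t, f j =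
      (∏ j, f j) * ∑ t ∈ Finset.univ.powersetCard (N - n), ∏ j ∈ t, f j := by
  rw [Finset.mul_sum, Finset.mul_sum]
  refine Finset.sum_bij' (fun t _ => tᶜ.map hτ.toPerm.toEmbedding)
    (fun t _ => tᶜ.map hτ.toPerm.toEmbedding) ?_ ?_ ?_ ?_ ?_
  · intro t ht
    rw [Finset.mem_powersetCard_univ] at ht ⊢
    rw [Finset.card_map, Finset.card_compl, Fintype.card_fin, ht]
  · intro t ht
    rw [Finset.mem_powersetCard_univ] at ht ⊢
    rw [Finset.card_map, Finset.card_compl, Fintype.card_fin, ht]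
    omega
  · intro t _
    ext x
    simp [Finset.mem_map_equiv, hτ x]
  · intro t _
    ext x
    simp [Finset.mem_map_equiv, hτ x]
  · intro t ht
    rw [Finset.mem_powersetCard_univ] at ht
    have hc : tᶜ.card = N - n := by rw [Finset.card_compl, Fintype.card_fin, ht]
    rw [Finset.prod_map, ← hc, ← Finset.prod_const, ← Finset.prod_mul_prod_compl t f, mul_assoc,
      ← Finset.prod_mul_distrib, mul_comm]
    congr 1
    exact Finset.prod_congr rfl fun j _ => (hg j).symm

lemma exists_algHom_of_surjective {A B D : Type} [Ring A] [Ring B] [Ring D] [Algebra ℂ A]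
    [Algebra ℂ B] [Algebra ℂ D] (f : A →ₐ[ℂ] B) (hf : Function.Surjective f) (g : A →ₐ[ℂ] D)
    (h : ∀ x, f x = 0 → g x = 0) : ∃ π : B →ₐ[ℂ] D, ∀ x, π (f x) = g x := by
  have key : ∀ x y, f x = f y → g x = g y := fun x y e => by
    rw [← sub_eq_zero, ← map_sub]
    exact h _ (by rw [map_sub, e, sub_self])
  choose s hs using hf
  refine ⟨{ toFun := fun b => g (s b), map_one' := ?_, map_mul' := fun x y => ?_,
            map_zero' := ?_, map_add' := fun x y => ?_, commutes' := fun z => ?_ },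
    fun x => key _ _ (hs _)⟩
  · rw [← map_one g]; exact key _ _ (by rw [hs, map_one])
  · rw [← map_mul g]; exact key _ _ (by rw [hs, map_mul, hs, hs])
  · exact h _ (hs 0)
  · rw [← map_add g]; exact key _ _ (by rw [hs, map_add, hs, hs])
  · rw [← g.commutes]; exact key _ _ (by rw [hs, f.commutes])

section Spectral

variable (i : ℕ)

/-- The involution of the spectral variables that fixes `ν_0`. -/
def specInv (j : Fin (2 * i + 1)) : Fin (2 * i + 1) :=
  if h : j.val = 0 then j else ⟨2 * i + 1 - j.val, by omega⟩

lemma specInv_specInv (j : Fin (2 * i + 1)) : specInv i (specInv i j) = j := by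
  ext; unfold specInv; split_ifs <;> simp_all <;> omega

lemma specInv_involutive : Function.Involutive (specInv i) := specInv_specInv i

lemma nu_mul_nu {x y : Fin (2 * i + 1)} {j : ℕ} (h1 : 1 ≤ j) (h2 : j ≤ i) (hx : x.val = i + j)
    (hy : y.val = i + 1 - j) : nu i x * nu i y = nu i 0 ^ 2 := by
  have e : Ideal.Quotient.mk (spectralIdeal i) (MvPolynomial.X x * MvPolynomial.X y) =
      Ideal.Quotient.mk (spectralIdeal i) (MvPolynomial.X 0 ^ 2) :=
    Ideal.Quotient.eq.mpr (Ideal.subset_span ⟨j, x, y, h1, h2, hx, hy, rfl⟩)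
  simp only [nu, ← map_mul, ← map_pow, e]

lemma nu_mul_specInv (j : Fin (2 * i + 1)) : nu i j * nu i (specInv i j) = nu i 0 ^ 2 := by
  by_cases h0 : j.val = 0
  · obtain rfl : j = 0 := Fin.ext h0
    rw [specInv, dif_pos h0, sq]
  · rw [specInv, dif_neg h0]
    have := j.2
    rcases Nat.lt_or_ge i j.val with h | h
    · exact nu_mul_nu i (j := j.val - i) (by omega) (by omega) (by omega) (by simp only; omega)
    · rw [mul_comm]
      exact nu_mul_nu i (j := i + 1 - j.val) (by omega) (by omega) (by simp only; omega) (by omega)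

lemma isUnit_nu_zero : IsUnit (nu i 0) := IsLocalization.Away.algebraMap_isUnit _

lemma elemSym_eq (n : ℕ) : elemSym i n =
    ∑ t ∈ (Finset.univ : Finset (Fin (2 * i + 1))).powersetCard n, ∏ j ∈ t, nu i j := by
  rw [elemSym, Finset.esymm_map_val]

lemma elemSym_zero : elemSym i 0 = 1 := by simp [elemSym_eq]

lemma elemSym_last : elemSym i (2 * i + 1) = ∏ j, nu i j := by
  have : (Finset.univ : Finset (Fin (2 * i + 1))).powersetCard (2 * i + 1) = {Finset.univ} := by
    have := Finset.powersetCard_self (Finset.univ : Finset (Fin (2 * i + 1)))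
    rwa [Finset.card_univ, Fintype.card_fin] at this
  rw [elemSym_eq, this, Finset.sum_singleton]

/-- The reciprocal relations for elementary symmetric functions of spectral variables. -/
lemma elemSym_reciprocal {n : ℕ} (hn : n ≤ 2 * i + 1) :
    (nu i 0 ^ 2) ^ (2 * i + 1 - n) * elemSym i n =
      elemSym i (2 * i + 1) * elemSym i (2 * i + 1 - n) := by
  rw [elemSym_last, elemSym_eq, elemSym_eq]
  exact pow_mul_sum_powersetCard (specInv_involutive i) (nu_mul_specInv i) hn

/-- The product of the spectral variables. -/
lemma elemSym_last_eq : elemSym i (2 * i + 1) = nu i 0 * (nu i 0 ^ 2) ^ i := by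
  rw [elemSym_last, Fin.prod_univ_succ]
  congr 1
  let f : ℕ → SpecAlg i := fun j => if h : j < 2 * i then nu i ⟨j + 1, by omega⟩ else 0
  have e : ∏ j : Fin (2 * i), nu i j.succ = ∏ j ∈ Finset.range (2 * i), f j := by
    rw [← Fin.prod_univ_eq_prod_range]
    refine Finset.prod_congr rfl fun j _ => ?_
    simp only [f, dif_pos j.2]
    rfl
  rw [e]
  refine prod_range_two_mul fun j hj => ?_
  simp only [f]
  rw [dif_pos (by omega), dif_pos (by omega), mul_comm]
  exact nu_mul_nu i (j := i - j) (by omega) (by omega) (by simp only; omega) (by simp only; omega)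

/-- The elementary symmetric function `e_n(ν_1, …, ν_{2i})`. -/
def elemSymTail (n : ℕ) : SpecAlg i :=
  ∑ t ∈ (Finset.univ : Finset (Fin (2 * i))).powersetCard n, ∏ j ∈ t, nu i j.succ

lemma elemSymTail_zero : elemSymTail i 0 = 1 := by simp [elemSymTail]

lemma elemSym_succ (n : ℕ) :
    elemSym i (n + 1) = elemSymTail i (n + 1) + nu i 0 * elemSymTail i n := by
  have e : (Finset.univ : Finset (Fin (2 * i + 1))).val.map (nu i) =
      nu i 0 ::ₘ (Finset.univ : Finset (Fin (2 * i))).val.map fun j => nu i j.succ := by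
    rw [Fin.univ_succ, Finset.cons_val, Multiset.map_cons, Finset.map_val, Multiset.map_map]
    rfl
  rw [elemSym, e, Multiset.esymm, Multiset.powersetCard_cons, Multiset.map_add, Multiset.sum_add,
    Multiset.map_map]
  simp only [Function.comp_def, Multiset.prod_cons]
  rw [Multiset.sum_map_mul_left, elemSymTail, elemSymTail, ← Finset.esymm_map_val,
    ← Finset.esymm_map_val]
  rfl

lemma elemSymTail_reciprocal {n : ℕ} (hn : n ≤ i) :
    elemSymTail i (2 * i - n) = elemSymTail i n * (nu i 0 ^ 2) ^ (i - n) := by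
  have hg : ∀ j : Fin (2 * i), nu i j.succ * nu i j.rev.succ = nu i 0 ^ 2 := fun j => by
    rw [← nu_mul_specInv i j.succ]
    congr 2
    ext
    rw [specInv, dif_neg (by simp)]
    simp only [Fin.val_succ, Fin.val_rev]
    omega
  have e := pow_mul_sum_powersetCard Fin.rev_involutive hg (n := n) (by omega)
  have e3 : ∏ j : Fin (2 * i), nu i j.succ = (nu i 0 ^ 2) ^ i := by
    have := elemSym_last_eq i
    rw [elemSym_last, Fin.prod_univ_succ] at this
    exact (isUnit_nu_zero i).mul_left_cancel this
  have e4 : (nu i 0 ^ 2) ^ (2 * i - n) = (nu i 0 ^ 2) ^ i * (nu i 0 ^ 2) ^ (i - n) := by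
    rw [← pow_add]; congr 1; omega
  rw [e3, e4, mul_assoc] at e
  have := (((isUnit_nu_zero i).pow 2).pow i).mul_left_cancel e
  exact this.symm.trans (mul_comm _ _)

lemma sum_elemSym_mul_pow (n : ℕ) :
    ∑ j ∈ Finset.range (n + 1), elemSym i (n - j) * (-nu i 0) ^ j = elemSymTail i n := by
  induction n with
  | zero => simp [elemSym_zero, elemSymTail_zero]
  | succ n ih =>
    rw [Finset.sum_range_succ', Nat.sub_zero, pow_zero, mul_one, elemSym_succ, ← ih, Finset.mul_sum]
    have : ∀ j, elemSym i (n + 1 - (j + 1)) * (-nu i 0) ^ (j + 1) =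
        -(nu i 0 * (elemSym i (n - j) * (-nu i 0) ^ j)) := fun j => by
      rw [Nat.add_sub_add_right, pow_succ]; ring
    simp only [this, Finset.sum_neg_distrib]
    ring

end Spectral

/-! ## The homomorphism to the spectral algebra -/

section Hom

variable {ι : Type} [Fintype ι] [DecidableEq ι] {q : ℂ} {l : ℕ} {R F : RMatrix ι}

/-- The values of the generators of the characteristic subalgebra in spectral variables. -/
def CharSym.spec (i : ℕ) : CharSym (2 * i + 1) → SpecAlg i
  | .a j => elemSym i (j.val + 1)
  | .g => nu i 0 ^ 2
  | .gi => (Ring.inverse (nu i 0)) ^ 2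

lemma aeval_symA (i n : ℕ) (hn : n ≤ 2 * i + 1) :
    MvPolynomial.aeval (CharSym.spec i) (symA (2 * i + 1) n) = elemSym i n := by
  rw [symA]
  split_ifs with h
  · rw [MvPolynomial.aeval_X, CharSym.spec]
    congr 1
    simp only
    omega
  · obtain rfl : n = 0 := by omega
    rw [map_one, elemSym_zero]

lemma reciprocalIdeal_le (i : ℕ) : reciprocalIdeal (2 * i + 1) ≤
    RingHom.ker (MvPolynomial.aeval (R := ℂ) (CharSym.spec i)) := by
  rw [reciprocalIdeal, Ideal.span_le]
  rintro f (⟨n, hn, rfl⟩ | rfl)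
  · rw [SetLike.mem_coe, RingHom.mem_ker, map_sub, map_mul, map_mul, map_pow, aeval_symA i n hn,
      aeval_symA i _ le_rfl, aeval_symA i _ (by omega), MvPolynomial.aeval_X, sub_eq_zero]
    exact elemSym_reciprocal i hn
  · rw [SetLike.mem_coe, RingHom.mem_ker, map_sub, map_mul, map_one, MvPolynomial.aeval_X,
      MvPolynomial.aeval_X, sub_eq_zero]
    change nu i 0 ^ 2 * (Ring.inverse (nu i 0)) ^ 2 = 1
    rw [← mul_pow, Ring.mul_inverse_cancel _ (isUnit_nu_zero i), one_pow]

lemma IsSpectralHom.map_gInvC_mul {π : charAlg q (muO q (2 * l - 1)) R F →ₐ[ℂ] SpecAlg (l - 1)} :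
    π (gInvC q _ R F) * π (gC q _ R F) = 1 := by
  rw [← map_mul, gInvC_mul_gC, map_one]

variable (hR : IsOrthogonalType q (2 * l - 1) R) (hRF : IsCompatiblePair R.mat F.mat)

include hR hRF

lemma IsSpectralHom.map_gC {π : charAlg q (muO q (2 * l - 1)) R F →ₐ[ℂ] SpecAlg (l - 1)}
    (hl : 2 ≤ l) (h : IsSpectralHom q (muO q (2 * l - 1)) R F l π) :
    π (gC q (muO q (2 * l - 1)) R F) = nu (l - 1) 0 ^ 2 := by
  have h1 := h.1
  have h2 := congrArg π (aC_sq hR hRF)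
  have h3 := IsSpectralHom.map_gInvC_mul (π := π)
  rw [map_pow, map_pow] at h2
  rw [gHalf, map_mul, map_pow] at h1
  rw [← h1, mul_pow, h2]
  set x := π (gC q (muO q (2 * l - 1)) R F)
  set y := π (gInvC q (muO q (2 * l - 1)) R F)
  rw [show 2 * l - 1 = (l - 1) * 2 + 1 by omega, ← pow_mul, pow_succ, ← mul_assoc, ← mul_pow, h3,
    one_pow, one_mul]

lemma IsSpectralHom.unique {π π' : charAlg q (muO q (2 * l - 1)) R F →ₐ[ℂ] SpecAlg (l - 1)}
    (hl : 2 ≤ l) (h : IsSpectralHom q (muO q (2 * l - 1)) R F l π)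
    (h' : IsSpectralHom q (muO q (2 * l - 1)) R F l π') : π = π' := by
  have hg : π (gC q (muO q (2 * l - 1)) R F) = π' (gC q (muO q (2 * l - 1)) R F) := by
    rw [h.map_gC hR hRF hl, h'.map_gC hR hRF hl]
  refine AlgHom.ext_of_adjoin_eq_top (adjoin_charSym hR hRF) ?_
  rintro _ ⟨x | _ | _, rfl⟩
  · have hx := x.2
    exact (h.2 (x.val + 1) (by omega) (by omega)).trans (h'.2 (x.val + 1) (by omega) (by omega)).symm
  · exact hg
  · have h3 := IsSpectralHom.map_gInvC_mul (π := π)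
    have h4 := IsSpectralHom.map_gInvC_mul (π := π')
    change π (gInvC q (muO q (2 * l - 1)) R F) = π' (gInvC q (muO q (2 * l - 1)) R F)
    rw [← hg, mul_comm] at h4
    exact left_inv_eq_right_inv h3 h4

lemma exists_isSpectralHom (hl : 2 ≤ l)
    (hind : OnlyReciprocalRelations q (muO q (2 * l - 1)) R F (2 * l - 1)) :
    ∃ π, IsSpectralHom q (muO q (2 * l - 1)) R F l π := by
  obtain ⟨i, rfl⟩ : ∃ i, l = i + 1 := ⟨l - 1, by omega⟩
  have hk : 2 * (i + 1) - 1 = 2 * i + 1 := by omega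
  have had := adjoin_charSym hR hRF
  simp only [IsSpectralHom]
  generalize muO q (2 * (i + 1) - 1) = μ at *
  rw [hk] at hind had ⊢
  change ∃ π : charAlg q μ R F →ₐ[ℂ] SpecAlg i, π (gHalf q μ R F (i + 1)) = nu i 0 ∧
    ∀ n, 1 ≤ n → n ≤ 2 * i + 1 → π (aC q μ R F n) = elemSym i n
  let f : FreeAlgebra ℂ (CharSym (2 * i + 1)) →ₐ[ℂ] charAlg q μ R F :=
    FreeAlgebra.lift ℂ (CharSym.val q μ R F)
  let φ : FreeAlgebra ℂ (CharSym (2 * i + 1)) →ₐ[ℂ] SpecAlg i :=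
    (MvPolynomial.aeval (CharSym.spec i)).comp (FreeAlgebra.lift ℂ MvPolynomial.X)
  have hf : Function.Surjective f := by
    rw [← AlgHom.range_eq_top, ← Algebra.adjoin_range_eq_range_freeAlgebra_lift, had]
  obtain ⟨π, hπf⟩ := exists_algHom_of_surjective f hf φ fun x hx => reciprocalIdeal_le i (hind x hx)
  have hπ : ∀ x, π (CharSym.val q μ R F x) = CharSym.spec i x := by
    intro x
    simpa [f, φ] using hπf (FreeAlgebra.ι ℂ x)
  have ha : ∀ n, 1 ≤ n → n ≤ 2 * i + 1 → π (aC q μ R F n) = elemSym i n := by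
    intro n h1 h2
    obtain ⟨m, rfl⟩ : ∃ m, n = m + 1 := ⟨n - 1, by omega⟩
    exact hπ (.a ⟨m, h2⟩)
  refine ⟨π, ?_, ha⟩
  have e : π (gInvC q μ R F) = Ring.inverse (nu i 0) ^ 2 := hπ .gi
  rw [gHalf, hk, Nat.add_sub_cancel, map_mul, map_pow, e, ha _ (by omega) le_rfl, elemSym_last_eq,
    mul_left_comm, ← mul_pow, ← mul_pow, Ring.inverse_mul_cancel _ (isUnit_nu_zero i), one_pow,
    one_pow, mul_one]

end Hom

end
noncomputable section
/-! ## Algebra behind the factorized Cayley-Hamilton identity -/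

section Factorization

open Polynomial

/-- The coefficients of the solution of the recursion for matrix powers of antisymmetrizers. -/
structure BMWCoeff (q L L' t u u' κ κ' : ℂ) : Prop where
  sum : κ + q⁻¹ * u = 1
  sum' : κ' + q⁻¹ * u' = 1
  t_κ : (q - q⁻¹) * t * κ * L = u
  t_u : (q - q⁻¹) * t * u = q * (u - u')
  diff : q * L' * κ' - u' = q⁻¹ * L'
  cross : L * (κ - κ') = -(u * u')
  u_u : u * (1 + q * u') = q ^ 2 * u'
  one_sub_t : (q - q⁻¹) * (1 - t) = u'
  L_eq : q ^ 2 * L' = L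

/-- `(q - q⁻¹) L / (1 + L)` -/
def coeffU (q L : ℂ) : ℂ := (q - q⁻¹) * L / (1 + L)

/-- `(1 + q⁻² L) / (1 + L)` -/
def coeffK (q L : ℂ) : ℂ := (1 + q⁻¹ ^ 2 * L) / (1 + L)

lemma bmwCoeff {q L L' : ℂ} (hq : q ≠ 0) (hL : q ^ 2 * L' = L) (h : 1 + L ≠ 0) (h' : 1 + L' ≠ 0) :
    BMWCoeff q L L' (1 + L')⁻¹ (coeffU q L) (coeffU q L') (coeffK q L) (coeffK q L') := by
  subst hL
  constructor <;> simp only [coeffU, coeffK] <;> field_simp <;> ring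

section

variable {P : Type} [CommRing P] (ψ : ℂ →+* P) {q L L' t u u' κ κ' : ℂ}
  (e : BMWCoeff q L L' t u u' κ κ') (hq : q ≠ 0) {X G W S Y : P}
  (hY : ψ (q ^ 2) * G * Y = X ^ 2 * W + (ψ (q ^ 2) * G - X ^ 2) * S)

include e hq hY

lemma BMWCoeff.rec_fst (T : P) : T * X - X * (X * (X * (ψ κ * W + ψ (q⁻¹ * u) * S))) -
    ψ ((q - q⁻¹) * t) * (G * X * (ψ (q * L * κ) * Y - ψ u * S)) =
      X * (ψ κ' * (T - X ^ 2 * W) + ψ (q⁻¹ * u') * (-(ψ (q ^ 2) * G * S) + (T - X ^ 2 * W))) := by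
  have c1 := congrArg ψ e.sum
  have c1' := congrArg ψ e.sum'
  have c2 := congrArg ψ e.t_κ
  have c3 := congrArg ψ e.t_u
  have c9 := congrArg ψ (mul_inv_cancel₀ hq)
  simp only [map_mul, map_sub, map_add, map_one, map_pow] at *
  linear_combination -X * (T - X ^ 2 * W) * c1' - X * G * ψ q * Y * c2 + X * G * S * c3 +
    X * G * S * ψ u' * ψ q * c9 - X ^ 3 * W * c1 - X * ψ q⁻¹ * ψ u * hY +
    X * ψ q * ψ u * G * (Y - S) * c9

lemma BMWCoeff.rec_snd (T : P) : G * (ψ (q⁻¹ * L') * T * X - G * X * (ψ (q * L * κ) * Y - ψ u * S) +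
      ψ ((q - q⁻¹) * (1 - t)) * (X * (X * (X * (ψ κ * W + ψ (q⁻¹ * u) * S))))) =
    G * X * (ψ (q * L' * κ') * (-(ψ (q ^ 2) * G * Y) + T) -
      ψ u' * (-(ψ (q ^ 2) * G * S) + (T - X ^ 2 * W))) := by
  have c1 := congrArg ψ e.sum
  have c4 := congrArg ψ e.diff
  have c5 := congrArg ψ e.cross
  have c6 := congrArg ψ e.u_u
  have c7 := congrArg ψ e.one_sub_t
  have c8 := congrArg ψ e.L_eq
  have c9 := congrArg ψ (mul_inv_cancel₀ hq)
  simp only [map_mul, map_sub, map_add, map_one, map_pow, map_neg] at *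
  linear_combination G * X * (-T * c4 + X ^ 2 * (ψ κ * W + ψ q⁻¹ * ψ u * S) * c7 +
    ψ q * ψ κ' * G * Y * c8 - G * ψ q * Y * c5 + G * S * c6 + ψ u' * X ^ 2 * W * c1 +
    ψ u * ψ u' * ψ q⁻¹ * hY - ψ u * ψ u' * G * ψ q * (Y - S) * c9)

end

variable {E : Type} [CommRing E] [Algebra ℂ E] (q : ℂ) (γ : E) (a : ℕ → E)

/-- Complex constants as polynomials. -/
def cst : ℂ →+* E[X] := (C : E →+* E[X]).comp (algebraMap ℂ E)

/-- `∑_{j ≤ m} (-X)^{m-j} q^j a_j` -/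
def polyZ : ℕ → E[X]
  | 0 => 1
  | m + 1 => -(X * polyZ m) + cst (q ^ (m + 1)) * C (a (m + 1))

/-- `∑_{j ≤ m} (-q² γ)^{m-j} q^j a_j X^j` -/
def polyY : ℕ → E[X]
  | 0 => 1
  | m + 1 => -(cst (q ^ 2) * C γ * polyY m) + cst (q ^ (m + 1)) * C (a (m + 1)) * X ^ (m + 1)

/-- `∑_{j ≤ m} (-q² γ)^{m-j} X^j Z_j` -/
def polyS : ℕ → E[X]
  | 0 => 1
  | m + 1 => -(cst (q ^ 2) * C γ * polyS m) + X ^ (m + 1) * polyZ q a (m + 1)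

lemma polyY_eq (m : ℕ) : cst (q ^ 2) * C γ * polyY q γ a m =
    X ^ 2 * (X ^ m * polyZ q a m) + (cst (q ^ 2) * C γ - X ^ 2) * polyS q γ a m := by
  induction m with
  | zero => simp [polyY, polyZ, polyS]
  | succ m ih =>
    rw [polyY, polyS, polyZ]
    linear_combination -(cst (q ^ 2) * C γ) * ih

variable {Q : Type} [Ring Q] [Algebra E Q] {x : Q} {A B : ℕ → Q} {L : ℕ → ℂ} {k : ℕ}

lemma pow_mul_rec (hq : q ≠ 0) (hL : ∀ m, q ^ 2 * L (m + 1) = L m) (hL1 : ∀ m, m ≤ k → 1 + L m ≠ 0)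
    (hA0 : A 0 = x) (hB0 : B 0 = (algebraMap ℂ E (q⁻¹ * L 0) * γ) • 1)
    (hA : ∀ m, m < k → A (m + 1) = (algebraMap ℂ E (q ^ (m + 1)) * a (m + 1)) • x - x * A m -
      algebraMap ℂ E ((q - q⁻¹) * (1 + L (m + 1))⁻¹) • B m)
    (hB : ∀ m, m < k → x * B (m + 1) = γ •
      ((algebraMap ℂ E (q⁻¹ * L (m + 1) * q ^ (m + 1)) * a (m + 1)) • x - B m +
        algebraMap ℂ E ((q - q⁻¹) * (1 - (1 + L (m + 1))⁻¹)) • (x * A m))) {m : ℕ} (hm : m ≤ k) :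
    x ^ m * A m = aeval x (X * (cst (coeffK q (L m)) * (X ^ m * polyZ q a m) +
      cst (q⁻¹ * coeffU q (L m)) * polyS q γ a m)) ∧
    x ^ m * (x * B m) = aeval x (C γ * X * (cst (q * L m * coeffK q (L m)) * polyY q γ a m -
      cst (coeffU q (L m)) * polyS q γ a m)) := by
  induction m with
  | zero =>
    have e := bmwCoeff hq (hL 0) (hL1 0 hm) (L' := L 1)
    have h0 := hL1 0 hm
    constructor
    · rw [hA0, pow_zero, one_mul]
      have e1 : coeffK q (L 0) + q⁻¹ * coeffU q (L 0) = 1 := by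
        rw [coeffK, coeffU]; field_simp; ring
      have e2 := congrArg (cst (E := E)) e1
      simp only [map_add, map_one] at e2
      have e3 : X * (cst (coeffK q (L 0)) * (X ^ 0 * polyZ q a 0) +
          cst (q⁻¹ * coeffU q (L 0)) * polyS q γ a 0) = X := by
        rw [polyZ, polyS]; linear_combination X * e2
      rw [e3, aeval_X]
    · rw [hB0, pow_zero, one_mul, mul_smul_comm, mul_one]
      have e1 : q * L 0 * coeffK q (L 0) - coeffU q (L 0) = q⁻¹ * L 0 := by
        rw [coeffK, coeffU]; field_simp; ring
      have e2 := congrArg (cst (E := E)) e1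
      simp only [map_sub] at e2
      have e3 : C γ * X * (cst (q * L 0 * coeffK q (L 0)) * polyY q γ a 0 -
          cst (coeffU q (L 0)) * polyS q γ a 0) = C (algebraMap ℂ E (q⁻¹ * L 0) * γ) * X := by
        rw [polyY, polyS, C_mul]
        change _ = cst (q⁻¹ * L 0) * C γ * X
        linear_combination C γ * X * e2
      rw [e3, map_mul (aeval x), aeval_C, aeval_X, Algebra.smul_def]
  | succ m ih =>
    obtain ⟨ihA, ihB⟩ := ih (by omega)
    have e := bmwCoeff hq (hL m) (hL1 m (by omega)) (hL1 (m + 1) hm)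
    have hY := polyY_eq q γ a m
    have hs : ∀ (e : E) (p : E[X]), e • aeval x p = aeval x (C e * p) := fun e p => by
      rw [map_mul, aeval_C, Algebra.smul_def]
    have hx : ∀ p : E[X], x * aeval x p = aeval x (X * p) := fun p => by rw [map_mul, aeval_X]
    have h1 : ∀ z : Q, x ^ (m + 1) * (x * z) = x * (x * (x ^ m * z)) := fun z => by
      simp only [← mul_assoc, ← pow_succ, ← pow_succ']
    have h2 : ∀ z : Q, x ^ (m + 1) * z = x ^ m * (x * z) := fun z => by rw [pow_succ, mul_assoc]
    have h3 : x ^ (m + 1) * x = x ^ (m + 2) := (pow_succ x (m + 1)).symm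
    constructor
    · have e1 : x ^ (m + 1) * A (m + 1) = (algebraMap ℂ E (q ^ (m + 1)) * a (m + 1)) • x ^ (m + 2) -
          x * (x * (x ^ m * A m)) -
          algebraMap ℂ E ((q - q⁻¹) * (1 + L (m + 1))⁻¹) • (x ^ m * (x * B m)) := by
        rw [hA m (by omega), mul_sub, mul_sub, mul_smul_comm, mul_smul_comm, h1, h2 (B m), h3]
      have e2 : x ^ (m + 2) = aeval x (X ^ (m + 2) : E[X]) := by rw [map_pow, aeval_X]
      rw [e1, ihA, ihB, e2, hx, hx, hs, hs, ← map_sub, ← map_sub]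
      congr 1
      rw [polyS, polyZ, C_mul]
      have key := e.rec_fst cst hq hY (cst (q ^ (m + 1)) * C (a (m + 1)) * X ^ (m + 1))
      change cst (q ^ (m + 1)) * C (a (m + 1)) * X ^ (m + 2) - _ - cst _ * _ = _
      linear_combination key
    · have e1 : x ^ (m + 1) * (x * B (m + 1)) = γ • ((algebraMap ℂ E (q⁻¹ * L (m + 1) * q ^ (m + 1)) *
          a (m + 1)) • x ^ (m + 2) - x ^ m * (x * B m) +
          algebraMap ℂ E ((q - q⁻¹) * (1 - (1 + L (m + 1))⁻¹)) • (x * (x * (x ^ m * A m)))) := by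
        rw [hB m (by omega), mul_smul_comm, mul_add, mul_sub, mul_smul_comm, mul_smul_comm, h1,
          h2 (B m), h3]
      have e2 : x ^ (m + 2) = aeval x (X ^ (m + 2) : E[X]) := by rw [map_pow, aeval_X]
      rw [e1, ihA, ihB, e2, hx, hx, hs, hs, ← map_sub, ← map_add, hs]
      congr 1
      rw [polyY, polyS, polyZ, C_mul]
      have key := e.rec_snd cst hq hY (cst (q ^ (m + 1)) * C (a (m + 1)) * X ^ (m + 1))
      change C γ * (cst _ * C (a (m + 1)) * X ^ (m + 2) - _ + cst _ * _) = _
      rw [map_mul cst (q⁻¹ * L (m + 1))]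
      linear_combination key

/-- The last step of the factorization: a linear factor is removed. -/
lemma linear_factor {P : Type} [CommRing P] (ψ : ℂ →+* P) {q L u κ : ℂ} {k r : ℕ} (hk : k = 2 * r + 1)
    (hq : q ≠ 0) (hu : u ≠ 0) (hκ : κ ≠ 0) (hL : L * q ^ k = 1) (i1 : q * κ + u = q)
    (i2 : q ^ 3 * κ - u * q ^ (k + 2) = q) {X n χ H S Z Y : P} (hn : IsUnit n)
    (h1 : ψ κ * (X ^ k * Z) + ψ (q⁻¹ * u) * S = 0) (h2 : ψ (q * L * κ) * Y - ψ u * S = 0)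
    (hZ : Z = -((X - ψ q * n) * χ)) (hY : Y = ψ (q ^ k) * n ^ k * ((X - ψ q * n) * χ))
    (hS : S = -(χ * H)) (hH : (X + ψ q * n) * H = X ^ (k + 2) + (ψ q * n) ^ (k + 2)) :
    (X - n) * χ = 0 := by
  have unit : ∀ {z : ℂ}, z ≠ 0 → IsUnit (ψ z) := fun h => (isUnit_iff_ne_zero.mpr h).map ψ
  have c1 := congrArg ψ i1
  have c2 := congrArg ψ i2
  have c3 := congrArg ψ hL
  have c4 := congrArg ψ (mul_inv_cancel₀ hq)
  simp only [map_mul, map_add, map_sub, map_pow, map_one] at c1 c2 c3 c4 h1 h2 hY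
  set w := (X - ψ q * n) * χ with hw
  have s1 : (X ^ k - n ^ k) * w = 0 := by
    refine (unit hκ).mul_right_eq_zero.mp ?_
    rw [hZ] at h1
    rw [hY] at h2
    linear_combination -h1 - ψ q⁻¹ * h2 + ψ κ * n ^ k * w * c3 +
      ψ L * ψ κ * ψ q ^ k * n ^ k * w * c4
  have h2' : ψ q * ψ κ * n ^ k * w + ψ u * (χ * H) = 0 := by
    rw [hY, hS] at h2
    linear_combination h2 - ψ q * ψ κ * n ^ k * w * c3
  have s2 : (X ^ 2 - n ^ 2) * w = 0 := by
    refine (unit hq).mul_right_eq_zero.mp ((hn.pow k).mul_right_eq_zero.mp ?_)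
    linear_combination (X + ψ q * n) * (X - ψ q * n) * h2' - ψ u * w * hH - ψ u * X ^ 2 * s1 -
      n ^ k * X ^ 2 * w * c1 + n ^ (k + 2) * w * c2 + ψ u * hH * (w - (X - ψ q * n) * χ)
  have s3 : X * w = n * w := by
    have hp : ∀ j, X ^ (2 * j) * w = n ^ (2 * j) * w := by
      intro j
      induction j with
      | zero => simp
      | succ j ih =>
        rw [mul_add, pow_add, pow_add]
        linear_combination X ^ 2 * ih + n ^ (2 * j) * s2
    rw [← sub_eq_zero]
    refine (hn.pow (2 * r)).mul_right_eq_zero.mp ?_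
    rw [hk, pow_succ, pow_succ] at s1
    linear_combination s1 - X * hp r
  have s4 : X * ((X - n) * χ) = ψ q * n * ((X - n) * χ) := by
    linear_combination s3 + (n - X) * hw
  have hp : ∀ j, X ^ j * ((X - n) * χ) = (ψ q * n) ^ j * ((X - n) * χ) := by
    intro j
    induction j with
    | zero => simp
    | succ j ih =>
      rw [pow_succ, pow_succ]
      linear_combination X * ih + (ψ q * n) ^ j * s4
  have s5 : ψ u * (H * ((X - n) * χ)) = 0 := by
    linear_combination (X - n) * h2' - ψ q * ψ κ * n ^ k * s3
  refine ((unit hq).mul hn |>.pow (k + 2)).mul_right_eq_zero.mp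
    ((unit hu).mul_right_eq_zero.mp ((unit (two_ne_zero)).mul_right_eq_zero.mp ?_))
  rw [map_ofNat]
  linear_combination (X + ψ q * n) * s5 - ψ u * ((X - n) * χ) * hH - ψ u * hp (k + 2)

lemma polyZ_eq (h0 : a 0 = 1) (m : ℕ) : polyZ q a m =
    ∑ j ∈ Finset.range (m + 1), (-X) ^ (m - j) * (cst (q ^ j) * C (a j)) := by
  induction m with
  | zero => simp [polyZ, h0]
  | succ m ih =>
    rw [polyZ, ih, Finset.sum_range_succ _ (m + 1), Nat.sub_self, pow_zero, one_mul, ← neg_mul,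
      Finset.mul_sum]
    congr 1
    refine Finset.sum_congr rfl fun j hj => ?_
    rw [Nat.succ_sub (Nat.lt_succ_iff.mp (Finset.mem_range.mp hj)), pow_succ', mul_assoc]

lemma polyY_eq_sum (h0 : a 0 = 1) (m : ℕ) : polyY q γ a m =
    ∑ j ∈ Finset.range (m + 1), (-(cst (q ^ 2) * C γ)) ^ (m - j) *
      (cst (q ^ j) * C (a j) * X ^ j) := by
  induction m with
  | zero => simp [polyY, h0]
  | succ m ih =>
    rw [polyY, ih, Finset.sum_range_succ _ (m + 1), Nat.sub_self, pow_zero, one_mul, ← neg_mul,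
      Finset.mul_sum]
    congr 1
    refine Finset.sum_congr rfl fun j hj => ?_
    rw [Nat.succ_sub (Nat.lt_succ_iff.mp (Finset.mem_range.mp hj)), pow_succ' (-(cst (q ^ 2) * C γ)), mul_assoc (-(cst (q ^ 2) * C γ))]

/-- The characteristic polynomial with roots `q ν_j`. -/
def charPoly (N : ℕ) : E[X] :=
  ∑ j ∈ Finset.range (N + 1), (-1) ^ j * (cst (q ^ j) * C (a j)) * X ^ (N - j)

lemma polyZ_last (h0 : a 0 = 1) {r : ℕ} :
    polyZ q a (2 * r + 1) = -charPoly q a (2 * r + 1) := by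
  rw [polyZ_eq q a h0, charPoly, ← Finset.sum_neg_distrib]
  refine Finset.sum_congr rfl fun j hj => ?_
  have hj := Nat.lt_succ_iff.mp (Finset.mem_range.mp hj)
  obtain ⟨i, hi⟩ := Nat.exists_eq_add_of_le hj
  rw [hi, Nat.add_sub_cancel_left, neg_pow (X : E[X])]
  have : (-1 : E[X]) ^ i = -(-1) ^ j := by
    have e : (-1 : E[X]) ^ j * (-1) ^ i = -1 := by
      rw [← pow_add, ← hi]; exact Odd.neg_one_pow ⟨r, rfl⟩
    have e2 : (-1 : E[X]) ^ j * (-1) ^ j = 1 := by rw [← mul_pow]; simp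
    linear_combination (-1 : E[X]) ^ j * e - (-1) ^ i * e2
  rw [this]
  ring

lemma polyY_last (h0 : a 0 = 1) {N : ℕ} {n : E}
    (hrec : ∀ j, j ≤ N → γ ^ (N - j) * a j = n ^ N * a (N - j)) :
    polyY q γ a N = cst (q ^ N) * C n ^ N * charPoly q a N := by
  rw [polyY_eq_sum q γ a h0, charPoly, ← Finset.sum_range_reflect, Finset.mul_sum]
  refine Finset.sum_congr rfl fun j hj => ?_
  have hj := Nat.lt_succ_iff.mp (Finset.mem_range.mp hj)
  have e : N + 1 - 1 - j = N - j := by omega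
  have e2 : N - (N - j) = j := by omega
  have h := congrArg C (hrec (N - j) (by omega))
  have e3 : (cst (q ^ N) : E[X]) = cst (q ^ j) * cst (q ^ (N - j)) := by
    rw [← map_mul, ← pow_add, Nat.add_sub_cancel' hj]
  rw [e2, C_mul, C_mul, C_pow, C_pow] at h
  rw [e, e2, neg_pow, mul_pow, e3, ← map_pow cst, ← pow_mul, two_mul, pow_add, map_mul cst]
  linear_combination (-1) ^ j * cst (q ^ j) * cst (q ^ j) * cst (q ^ (N - j)) * X ^ (N - j) * h

lemma charPoly_eq_prod {N : ℕ} (f : Fin N → E)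
    (ha : ∀ j, j ≤ N → a j = ∑ t ∈ Finset.univ.powersetCard j, ∏ i ∈ t, f i) :
    charPoly q a N = ∏ i, (X - C (algebraMap ℂ E q * f i)) := by
  have h := Multiset.prod_X_sub_X_eq_sum_esymm
    ((Finset.univ : Finset (Fin N)).val.map fun i => algebraMap ℂ E q * f i)
  rw [Multiset.map_map, Multiset.card_map, Finset.card_val, Finset.card_univ, Fintype.card_fin] at h
  have e : ∏ i, (X - C (algebraMap ℂ E q * f i)) = _ := h
  rw [e, charPoly]
  refine Finset.sum_congr rfl fun j hj => ?_
  rw [Finset.esymm_map_val, ha j (Nat.lt_succ_iff.mp (Finset.mem_range.mp hj)), mul_assoc]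
  congr 2
  change C _ * C _ = C _
  rw [← C_mul, Finset.mul_sum]
  congr 1
  refine Finset.sum_congr rfl fun t ht => ?_
  rw [Finset.prod_mul_distrib, Finset.prod_const, (Finset.mem_powersetCard_univ.mp ht), map_pow]

/-- The factorized Cayley-Hamilton identity from the recursions for matrix powers. -/
theorem factorized_of_rec {n : E} {χ : E[X]} {r : ℕ} (hk : k = 2 * r + 1) (hq : q ≠ 0)
    (hL : ∀ m, q ^ 2 * L (m + 1) = L m) (hL1 : ∀ m, m ≤ k → 1 + L m ≠ 0) (hLk : L k * q ^ k = 1)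
    (hq2 : q ^ (k + 2) ≠ -1) (hc : q - q⁻¹ ≠ 0) (hn : IsUnit n) (hγ : γ = n ^ 2)
    (h0 : a 0 = 1) (hrec : ∀ j, j ≤ k → γ ^ (k - j) * a j = n ^ k * a (k - j))
    (hχ : charPoly q a k = (X - C (algebraMap ℂ E q * n)) * χ)
    (hA0 : A 0 = x) (hB0 : B 0 = (algebraMap ℂ E (q⁻¹ * L 0) * γ) • 1)
    (hA : ∀ m, m < k → A (m + 1) = (algebraMap ℂ E (q ^ (m + 1)) * a (m + 1)) • x - x * A m -
      algebraMap ℂ E ((q - q⁻¹) * (1 + L (m + 1))⁻¹) • B m)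
    (hB : ∀ m, m < k → x * B (m + 1) = γ •
      ((algebraMap ℂ E (q⁻¹ * L (m + 1) * q ^ (m + 1)) * a (m + 1)) • x - B m +
        algebraMap ℂ E ((q - q⁻¹) * (1 - (1 + L (m + 1))⁻¹)) • (x * A m)))
    (hAk : A k = 0) (hBk : B k = 0) : aeval x ((X - C n) * χ) = 0 := by
  have hLne : ∀ m, L m ≠ 0 := by
    have hk0 : L k ≠ 0 := fun h => by rw [h, zero_mul] at hLk; exact zero_ne_one hLk
    have e : ∀ m, L 0 = (q ^ 2) ^ m * L m := by
      intro m
      induction m with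
      | zero => simp
      | succ m ih => rw [ih, ← hL m, pow_succ (q ^ 2), mul_assoc]
    have hL0 : L 0 ≠ 0 := by
      rw [e k]; exact mul_ne_zero (pow_ne_zero _ (pow_ne_zero _ hq)) hk0
    exact fun m h => hL0 (by rw [e m, h, mul_zero])
  have hγu : IsUnit γ := hγ ▸ hn.pow 2
  obtain ⟨y, hy⟩ : ∃ y, x * y = 1 := by
    have h := hB 0 (by omega)
    rw [hB0, hA0] at h
    have hu : IsUnit (γ * (algebraMap ℂ E (q⁻¹ * L 0) * γ)) := hγu.mul
      (((isUnit_iff_ne_zero.mpr (mul_ne_zero (inv_ne_zero hq) (hLne 0))).map (algebraMap ℂ E)).mul hγu)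
    obtain ⟨v, hv⟩ := hu.exists_left_inv
    set s1 := algebraMap ℂ E (q⁻¹ * L (0 + 1) * q ^ (0 + 1)) * a (0 + 1)
    set s2 := algebraMap ℂ E ((q - q⁻¹) * (1 - (1 + L (0 + 1))⁻¹))
    set s0 := algebraMap ℂ E (q⁻¹ * L 0)
    refine ⟨v • ((γ * s1) • 1 + (γ * s2) • x - B (0 + 1)), ?_⟩
    have e : x * ((γ * s1) • 1 + (γ * s2) • x - B (0 + 1)) = (γ * (s0 * γ)) • 1 := by
      rw [mul_sub, h, mul_add, mul_smul_comm, mul_smul_comm, mul_one]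
      module
    rw [mul_smul_comm, e, smul_smul, hv, one_smul]
  have hcancel : ∀ p : E[X], aeval x (X * p) = 0 → aeval x p = 0 := fun p hp => by
    rw [← mul_one (aeval x p), ← hy, ← mul_assoc]
    have : aeval x p * x = aeval x (X * p) := by rw [mul_comm, map_mul, aeval_X]
    rw [this, hp, zero_mul]
  obtain ⟨h1, h2⟩ := pow_mul_rec q γ a hq hL hL1 hA0 hB0 hA hB le_rfl
  rw [hAk, mul_zero] at h1
  rw [hBk, mul_zero, mul_zero, mul_assoc, map_mul, aeval_C, ← Algebra.smul_def] at h2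
  have h1 := hcancel _ h1.symm
  have h2 := hcancel _ (hγu.smul_eq_zero.mp h2.symm)
  have hmonic : (X ^ 2 - C (algebraMap ℂ E q * n) ^ 2 : E[X]).Monic := by
    rw [← C_pow]; exact monic_X_pow_sub_C _ two_ne_zero
  obtain ⟨H, hH⟩ : X + C (algebraMap ℂ E q * n) ∣ X ^ (k + 2) + C (algebraMap ℂ E q * n) ^ (k + 2) :=
    Odd.add_dvd_pow_add_pow _ _ ⟨r + 1, by omega⟩
  have hZ : polyZ q a k = -((X - C (algebraMap ℂ E q * n)) * χ) := by
    rw [← hχ, hk]; exact polyZ_last q a h0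
  have hY : polyY q γ a k = cst (q ^ k) * C n ^ k * ((X - C (algebraMap ℂ E q * n)) * χ) := by
    rw [← hχ]; exact polyY_last q γ a h0 hrec
  have hS : polyS q γ a k = -(χ * H) := by
    apply hmonic.isRegular.left
    have e := polyY_eq q γ a k
    rw [hZ, hY, hγ] at e
    have e1 : (cst q : E[X]) = C (algebraMap ℂ E q) := rfl
    simp only [map_pow, e1, C_mul, hγ] at e hH ⊢
    linear_combination e - (X - C (algebraMap ℂ E q) * C n) * χ * hH
  let I := RingHom.ker (aeval x : E[X] →ₐ[E] Q)
  have hI : ∀ p : E[X], Ideal.Quotient.mk I p = 0 ↔ aeval x p = 0 := fun p =>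
    Ideal.Quotient.eq_zero_iff_mem.trans RingHom.mem_ker
  rw [← hI] at h1 h2 ⊢
  have h0k := hL1 k le_rfl
  have hcst : (C (algebraMap ℂ E q * n) : E[X]) = cst q * C n := C_mul
  rw [hcst] at hZ hY hH
  rw [map_mul, map_sub]
  refine linear_factor ((Ideal.Quotient.mk I).comp cst) (q := q) (L := L k) (u := coeffU q (L k))
    (κ := coeffK q (L k)) hk hq ?_ ?_ hLk ?_ ?_ (hn.map ((Ideal.Quotient.mk I).comp C)) (H := Ideal.Quotient.mk I H)
    (Z := Ideal.Quotient.mk I (polyZ q a k)) (Y := Ideal.Quotient.mk I (polyY q γ a k)) (S := Ideal.Quotient.mk I (polyS q γ a k)) ?_ ?_ ?_ ?_ ?_ ?_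
  · exact div_ne_zero (mul_ne_zero hc (hLne k)) h0k
  · refine div_ne_zero (fun h => hq2 ?_) h0k
    have : q ^ (k + 2) * (1 + q⁻¹ ^ 2 * L k) = 0 := by rw [h, mul_zero]
    rw [pow_add] at this ⊢
    field_simp at this
    linear_combination this - hLk
  · rw [coeffU, coeffK]; field_simp; ring
  · rw [coeffU, coeffK, pow_add]
    generalize q ^ k = z at *
    field_simp
    linear_combination (1 - q ^ 2) * hLk
  · rw [← h1]; simp only [map_mul, map_add, map_pow]; rfl
  · rw [← h2]; simp only [map_mul, map_sub]; rfl
  · rw [hZ]; simp only [map_mul, map_sub, map_neg]; rfl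
  · rw [hY]; simp only [map_mul, map_sub, map_pow]; rfl
  · rw [hS]; simp only [map_mul, map_neg]
  · have := congrArg (Ideal.Quotient.mk I) hH
    simp only [map_mul, map_add, map_pow] at this
    exact this.symm

end Factorization

end
noncomputable section
/-! ## The recursions for normalized matrix powers -/

namespace BMWChain

variable {O : Type} [Ring O] [Algebra ℂ O] (C : BMWChain O)

/-- The spectral parameters of the recursion. -/
def lam (m : ℕ) : ℂ := C.q * C.μ⁻¹ * C.q⁻¹ ^ (2 * m)

/-- `(m+1)_q M^{a^{(m+1)}}` for `m < N`, continued by zero. -/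
def sA (N m : ℕ) : O := if m < N then qnum C.q (m + 1) • C.mA m else 0

/-- `(m+1)_q M^{a^{(m+1)↑1} κ_1}` for `m < N`, continued by zero. -/
def sB (N m : ℕ) : O := if m < N then qnum C.q (m + 1) • C.mB m else 0

lemma pow_mul_cR (m : ℕ) : C.q ^ m * C.cR m = -qnum C.q m := by
  have hq := C.q_ne
  rw [cR, qnum, ← c, two_mul, pow_add, inv_pow]
  field_simp
  ring

lemma pow_mul_cK (m : ℕ) : C.q ^ m * C.cK m = -(C.c * (1 + C.lam m)⁻¹ * qnum C.q m) := by
  have hc := C.c_ne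
  have e : C.cK m = C.cR m * C.c * (1 + C.lam m)⁻¹ := by
    rw [cR, div_mul_cancel₀ _ hc, cK, lam, div_eq_mul_inv, add_comm]
  rw [e, ← mul_assoc, ← mul_assoc, pow_mul_cR]
  ring

lemma qnum_mul_nrm {m : ℕ} (h : qnum C.q (m + 1) ≠ 0) : qnum C.q (m + 1) * C.nrm m = C.q ^ m := by
  rw [nrm, mul_div_cancel₀ _ h]

lemma pow_sub (m : ℕ) : C.q ^ m - C.c * qnum C.q m = C.q⁻¹ ^ m := by
  rw [qnum, ← c, mul_div_cancel₀ _ C.c_ne]; ring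

variable {N : ℕ} (hN : C.Regular N) (hv : C.Vanish N)

include hN hv

lemma sA_succ {m : ℕ} (hm : m < N) : C.sA N (m + 1) = C.q ^ (m + 1) • (C.M₀ * C.ac m) -
    C.xs (C.sA N m) - (C.c * (1 + C.lam (m + 1))⁻¹) • C.sB N m := by
  have h1 := C.pow_mul_cR (m + 1)
  have h2 := C.pow_mul_cK (m + 1)
  have key : C.sA N (m + 1) = C.q ^ (m + 1) • (C.M₀ * C.ac m + C.cR (m + 1) • C.xs (C.mA m) +
      C.cK (m + 1) • C.mB m) := by
    rcases Nat.lt_or_ge (m + 1) N with h | h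
    · rw [sA, if_pos h, C.mA_succ hN h, smul_smul,
        C.qnum_mul_nrm (hN.qnum_ne (m + 2) (by omega) h)]
    · obtain rfl : N = m + 1 := by omega
      rw [C.mA_last hN hv, sA, if_neg (by omega), smul_zero]
  rw [key, sA, sB, if_pos hm, if_pos hm, C.xs_smul, smul_add, smul_add, smul_smul, smul_smul, h1, h2]
  module

lemma xs_sB_succ {m : ℕ} (hm : m < N) : C.xs (C.sB N (m + 1)) =
    ((C.μ⁻¹ * C.q⁻¹ ^ (m + 1)) • (C.M₀ * C.ac m) - C.sB N m +
      (C.c * (1 - (1 + C.lam (m + 1))⁻¹)) • C.xs (C.sA N m)) * C.g := by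
  have h1 := C.pow_mul_cR (m + 1)
  have h2 := C.pow_mul_cK (m + 1)
  have h3 := C.pow_sub (m + 1)
  have key : C.xs (C.sB N (m + 1)) = C.q ^ (m + 1) • ((C.μ⁻¹ • (C.M₀ * C.ac m) + C.cR (m + 1) •
      (C.mB m + (C.c * C.μ⁻¹) • (C.M₀ * C.ac m) - C.c • C.xs (C.mA m)) +
        C.cK (m + 1) • C.xs (C.mA m)) * C.g) := by
    rcases Nat.lt_or_ge (m + 1) N with h | h
    · rw [sB, if_pos h, C.xs_smul, C.xs_mB_succ hN h, smul_smul,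
        C.qnum_mul_nrm (hN.qnum_ne (m + 2) (by omega) h)]
    · obtain rfl : N = m + 1 := by omega
      have : C.xs 0 = 0 := by have := C.xs_smul 0 0; simpa using this
      rw [C.mB_last hN hv, sB, if_neg (by omega), smul_zero, this]
  rw [key, sA, sB, if_pos hm, if_pos hm, C.xs_smul, ← smul_mul_assoc]
  congr 1
  rw [smul_add, smul_add, smul_smul, smul_smul (C.q ^ (m + 1)), smul_smul (C.q ^ (m + 1)), h1, h2,
    ← h3]
  module

end BMWChain

section Recursion

variable {ι : Type} [Fintype ι] [DecidableEq ι] {q μ : ℂ} {R F : RMatrix ι}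
  (h : IsBMWType q μ R) (hR : IsSkewInvertible R.mat) (hRF : IsCompatiblePair R.mat F.mat)
  {s : PSpace q μ R F →ₗ[ℂ] PSpace q μ R F →ₗ[ℂ] PSpace q μ R F}
  (hs : IsStarProduct q μ R F s)

local notation "Ch" => bmwChain h hR hRF

/-- `(m+1)_q M^{a^{(m+1)}}` for `m < N`, continued by zero. -/
def powA (q μ : ℂ) (R F : RMatrix ι) (N m : ℕ) : PSpace q μ R F :=
  if m < N then qnum q (m + 1) • powP q μ R F (antisym q μ m) 1 else 0

/-- `(m+1)_q M^{a^{(m+1)↑1} κ_1}` for `m < N`, continued by zero. -/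
def powB (q μ : ℂ) (R F : RMatrix ι) (N m : ℕ) : PSpace q μ R F :=
  if m < N then qnum q (m + 1) • powP q μ R F
    (algShift 1 (by omega : 1 + m ≤ m + 1) (antisym q μ m) * kap q μ (0 : Fin (m + 1))) 1 else 0

lemma site0_smul (z : ℂ) (N : PSpace q μ R F) : site0 (z • N).val = z • site0 N.val :=
  map_smul site0 z N.val

lemma site0_sub (N N' : PSpace q μ R F) : site0 (N - N').val = site0 N.val - site0 N'.val :=
  map_sub site0 N.val N'.val

lemma site0_add (N N' : PSpace q μ R F) : site0 (N + N').val = site0 N.val + site0 N'.val :=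
  map_add site0 N.val N'.val

lemma site0_zero : site0 (0 : PSpace q μ R F).val = 0 := map_zero site0

lemma site0_powP_one {m : ℕ} (α : BraidAlg m) :
    site0 (powP q μ R F α 1).val = (Ch).mp m ((Ch).rep 0 α) := by
  rw [site0_powP hR hRF, OneMemClass.coe_one, map_one, mul_one]
  rfl

lemma site0_MP : site0 (MP q μ R F).val = (Ch).M₀ := by
  rw [MP, site0_powP_one h hR hRF, map_one]
  exact (Ch).mp_zero 1 |>.trans (mul_one _)

include hs in
lemma site0_star_MP (N : PSpace q μ R F) :
    site0 (s (MP q μ R F) N).val = (Ch).xs (site0 N.val) := by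
  have hl : ∀ c : charAlg q μ R F, ∀ j, lmul (c : QMAlg q μ R F) ∈ (Ch).off j := fun c j =>
    lmul_mem_off _ j
  refine PSpace.induction (P := fun N => site0 (s (MP q μ R F) N).val = (Ch).xs (site0 N.val)) N
    (fun c => ?_) (fun m α c => ?_) ?_ (fun N N' h1 h2 => ?_) (fun z N h1 => ?_)
  · rw [MP, hs.pow_id, one_mul, site0_powP hR hRF, site0_idP]
    have e := (Ch).xs_mul (X := 1) (hl c)
    rw [one_mul] at e
    rw [e, (Ch).xs_one, map_one]
    congr 1
  · rw [MP, hs.pow_pow, one_mul, site0_powP hR hRF, site0_powP hR hRF]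
    refine Eq.trans ?_ ((Ch).xs_mul (hl c)).symm
    congr 1
    have e := (Ch).starR_mp (1 : BraidAlg 0) α
    rw [map_one] at e
    exact e.symm
  · rw [map_zero, site0_zero]
    have := (Ch).xs_smul 0 0
    simpa using this.symm
  · rw [map_add, site0_add, h1, h2, site0_add, (Ch).xs_add]
  · rw [map_smul, site0_smul, h1, site0_smul, (Ch).xs_smul]

lemma site0_powA (N m : ℕ) : site0 (powA q μ R F N m).val = (Ch).sA N m := by
  rw [powA, BMWChain.sA]
  split_ifs with hm
  · rw [site0_smul, site0_powP_one h hR hRF]; rfl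
  · exact site0_zero

lemma site0_powB (N m : ℕ) : site0 (powB q μ R F N m).val = (Ch).sB N m := by
  rw [powB, BMWChain.sB]
  split_ifs with hm
  · rw [site0_smul, site0_powP_one h hR hRF, map_mul, QChain.rep_shift]
    have e := (Ch).rep_kap 0 (0 : Fin (m + 1))
    congr 2
    exact congrArg _ e
  · exact site0_zero

include h hR hRF in
lemma powA_zero {N : ℕ} (hN1 : 1 ≤ N) : powA q μ R F N 0 = MP q μ R F := by
  have e : qnum q 1 = 1 := (Ch).qnum_one
  rw [powA, if_pos (Nat.pos_of_ne_zero (by omega)), zero_add, e, one_smul, antisym, MP]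

include h hR hRF in
lemma powB_zero {N : ℕ} (hN1 : 1 ≤ N) : powB q μ R F N 0 = μ⁻¹ • idP q μ R F (gC q μ R F) := by
  apply PSpace.ext_site
  have e : qnum q 1 = 1 := (Ch).qnum_one
  rw [site0_powB h hR hRF, site0_smul, site0_idP, lmul_gC h hR hRF, BMWChain.sB, if_pos (Nat.pos_of_ne_zero (by omega)),
    (Ch).mB_zero]
  change qnum q 1 • _ = _
  rw [e, one_smul]
  rfl

variable {N : ℕ} (hN : (bmwChain h hR hRF).Regular N) (hv : (bmwChain h hR hRF).Vanish N)

include hs hN hv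

lemma powA_succ {m : ℕ} (hm : m < N) : powA q μ R F N (m + 1) =
    q ^ (m + 1) • actP q μ R F (MP q μ R F) (aC q μ R F (m + 1)) -
      s (MP q μ R F) (powA q μ R F N m) -
      ((q - q⁻¹) * (1 + (Ch).lam (m + 1))⁻¹) • powB q μ R F N m := by
  apply PSpace.ext_site
  rw [site0_powA h hR hRF, (Ch).sA_succ hN hv hm, site0_sub, site0_sub, site0_smul, site0_smul,
    site0_actP, site0_MP h hR hRF, lmul_aC h hR hRF, site0_star_MP h hR hRF hs,
    site0_powA h hR hRF, site0_powB h hR hRF]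
  rfl

lemma star_powB_succ {m : ℕ} (hm : m < N) : s (MP q μ R F) (powB q μ R F N (m + 1)) =
    actP q μ R F ((μ⁻¹ * q⁻¹ ^ (m + 1)) • actP q μ R F (MP q μ R F) (aC q μ R F (m + 1)) -
      powB q μ R F N m +
      ((q - q⁻¹) * (1 - (1 + (Ch).lam (m + 1))⁻¹)) • s (MP q μ R F) (powA q μ R F N m))
      (gC q μ R F) := by
  apply PSpace.ext_site
  rw [site0_star_MP h hR hRF hs, site0_powB h hR hRF, (Ch).xs_sB_succ hN hv hm, site0_actP,
    site0_add, site0_sub, site0_smul, site0_smul,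
    site0_actP, site0_MP h hR hRF, lmul_aC h hR hRF, lmul_gC h hR hRF, site0_star_MP h hR hRF hs,
    site0_powA h hR hRF, site0_powB h hR hRF]
  rfl

end Recursion

end
noncomputable section
/-! ## The completed algebra as an algebra over the spectral variables -/

open Polynomial in
lemma aeval_charPoly {E Q : Type} [CommRing E] [Algebra ℂ E] [Ring Q] [Algebra E Q] (q : ℂ) (a : ℕ → E)
    (N : ℕ) (x : Q) : aeval x (charPoly q a N) =
      ∑ j ∈ Finset.range (N + 1), algebraMap ℂ E ((-q) ^ j) • (a j • x ^ (N - j)) := by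
  rw [charPoly, map_sum]
  refine Finset.sum_congr rfl fun j _ => ?_
  rw [map_mul, map_pow (aeval x) X, aeval_X, Algebra.smul_def, Algebra.smul_def,
    ← mul_assoc (algebraMap E Q _), ← map_mul (algebraMap E Q)]
  congr 1
  have e : ((-1) ^ j * (cst (q ^ j) * C (a j)) : E[X]) = C (algebraMap ℂ E ((-q) ^ j) * a j) := by
    change (-1) ^ j * (C _ * C _) = _
    rw [neg_pow q, map_mul (algebraMap ℂ E), map_pow (algebraMap ℂ E) (-1), map_neg, map_one, C_mul,
      C_mul, C_pow, C_neg, C_1, mul_assoc]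
  rw [e, aeval_C]

section Realization

variable {ι : Type} [Fintype ι] [DecidableEq ι] {q μ : ℂ} {R F : RMatrix ι} {E : Type} [CommRing E]
  [Algebra ℂ E] {π : charAlg q μ R F →ₐ[ℂ] E}
  {s : PSpace q μ R F →ₗ[ℂ] PSpace q μ R F →ₗ[ℂ] PSpace q μ R F}
  {t : Completed π →ₗ[ℂ] Completed π →ₗ[ℂ] Completed π}

/-- A realization of the completed algebra as an algebra over `E`. -/
structure IsRealization (t : Completed π →ₗ[ℂ] Completed π →ₗ[ℂ] Completed π) {Q : Type} [Ring Q]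
    [Algebra E Q] (φ : Completed π →+ Q) : Prop where
  injective : Function.Injective φ
  map_star : ∀ x y, φ (t x y) = φ x * φ y
  map_tens : ∀ N e, φ (tens π N e) = e • φ (tens π N 1)
  map_one : φ (tens π (idP q μ R F 1) 1) = 1

lemma exists_isRealization (hs : IsStarProduct q μ R F s) (ht : IsCompletedStar π s t)
    (hR : IsSkewInvertible R.mat) (hRF : IsCompatiblePair R.mat F.mat) :
    ∃ (Q : Type) (_ : Ring Q) (_ : Algebra E Q) (φ : Completed π →+ Q), IsRealization t φ := by
  let rng : Ring (Completed π) :=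
    { (inferInstance : AddCommGroup (Completed π)) with
      mul := fun x y => t x y
      one := tens π (idP q μ R F 1) 1
      mul_assoc := IsCompletedStar.assoc hR hRF hs ht
      one_mul := IsCompletedStar.one_left hs ht
      mul_one := IsCompletedStar.one_right hs ht
      left_distrib := fun x y z => map_add (t x) y z
      right_distrib := fun x y z => by
        change t (x + y) z = t x z + t y z
        rw [map_add, LinearMap.add_apply]
      zero_mul := fun x => by
        change t 0 x = 0
        rw [map_zero, LinearMap.zero_apply]
      mul_zero := fun x => map_zero (t x) }
  have hl : ∀ e N e', t (tens π (idP q μ R F 1) e) (tens π N e') = tens π N (e * e') := fun e N e' => by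
    rw [ht, hs.one_left]
  have hr : ∀ e N e', t (tens π N e') (tens π (idP q μ R F 1) e) = tens π N (e' * e) := fun e N e' => by
    rw [ht, hs.one_right]
  let f : E →+* Completed π :=
    { toFun := fun e => tens π (idP q μ R F 1) e
      map_one' := rfl
      map_mul' := fun e e' => (hl e _ e').symm
      map_zero' := map_zero (tensHom π _)
      map_add' := map_add (tensHom π _) }
  let alg : Algebra E (Completed π) := f.toAlgebra' fun e x =>
    Completed.induction π (P := fun x => t (tens π (idP q μ R F 1) e) x = t x (tens π (idP q μ R F 1) e)) x
      (fun N e' => by rw [hl, hr, mul_comm]) (fun x y hx hy => by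
        rw [map_add, map_add, LinearMap.add_apply, hx, hy])
  refine ⟨Completed π, rng, alg, AddMonoidHom.id _, fun _ _ h => h, fun _ _ => rfl, fun N e => ?_, rfl⟩
  change _ = t (tens π (idP q μ R F 1) e) (tens π N 1)
  rw [hl, mul_one]
  rfl

lemma existsUnique_isCompletedStar [Nonempty ι] (hs : IsStarProduct q μ R F s)
    (hR : IsSkewInvertible R.mat) (hRF : IsCompatiblePair R.mat F.mat) :
    ∃! t, IsCompletedStar π s t :=
  have ⟨t, ht⟩ := exists_isCompletedStar hR hRF π hs
  ⟨t, ht, fun _ h => h.unique π ht⟩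

namespace IsRealization

variable {Q : Type} [Ring Q] [Algebra E Q] {φ : Completed π →+ Q} (h : IsRealization t φ)
  (ht : IsCompletedStar π s t)

include h

lemma map_smul (z : ℂ) (N : PSpace q μ R F) :
    φ (tens π (z • N) 1) = algebraMap ℂ E z • φ (tens π N 1) := by
  rw [← h.map_tens, ← tensHom_apply, ← tensHom_apply, LinearMap.map_smul, LinearMap.smul_apply,
    ← LinearMap.map_smul, Algebra.algebraMap_eq_smul_one]

lemma map_add (N N' : PSpace q μ R F) :
    φ (tens π (N + N') 1) = φ (tens π N 1) + φ (tens π N' 1) := by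
  simp only [← tensHom_apply, _root_.map_add, LinearMap.add_apply]

lemma map_sub (N N' : PSpace q μ R F) :
    φ (tens π (N - N') 1) = φ (tens π N 1) - φ (tens π N' 1) := by
  simp only [← tensHom_apply, _root_.map_sub, LinearMap.sub_apply]

lemma map_zero : φ (tens π (0 : PSpace q μ R F) 1) = 0 := by
  simp only [← tensHom_apply, _root_.map_zero, LinearMap.zero_apply]

lemma map_sum {κ : Type} (S : Finset κ) (f : κ → PSpace q μ R F) :
    φ (tens π (∑ i ∈ S, f i) 1) = ∑ i ∈ S, φ (tens π (f i) 1) := by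
  simp only [← tensHom_apply, _root_.map_sum, LinearMap.sum_apply]

lemma map_act (N : PSpace q μ R F) (c : charAlg q μ R F) :
    φ (tens π (actP q μ R F N c) 1) = π c • φ (tens π N 1) := by
  rw [tens_act, h.map_tens, mul_one]

lemma map_id (c : charAlg q μ R F) : φ (tens π (idP q μ R F c) 1) = π c • 1 := by
  have e : idP q μ R F c = actP q μ R F (idP q μ R F 1) c := by rw [actP_idP, one_mul]
  rw [e, h.map_act, h.map_one]

lemma map_linFactor (e : E) : φ (linFactor π e) = φ (tens π (MP q μ R F) 1) - algebraMap E Q e := by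
  rw [linFactor, _root_.map_sub, h.map_tens (idP q μ R F 1), h.map_one, Algebra.algebraMap_eq_smul_one]

lemma map_starProd (L : List (Completed π)) : φ (starProd π t L) = (L.map φ).prod := by
  induction L with
  | nil => exact h.map_one
  | cons x L ih =>
    rw [List.map_cons, List.prod_cons, ← ih, ← h.map_star]
    rfl

include ht

lemma map_mul (N N' : PSpace q μ R F) :
    φ (tens π (s N N') 1) = φ (tens π N 1) * φ (tens π N' 1) := by
  rw [← h.map_star, ht, one_mul]

lemma map_starPow (n : ℕ) : φ (tens π (starPow q μ R F s n) 1) = φ (tens π (MP q μ R F) 1) ^ n := by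
  induction n with
  | zero => rw [pow_zero]; exact h.map_one
  | succ n ih => rw [pow_succ', ← ih, ← h.map_mul ht]; rfl

variable (hb : IsBMWType q μ R) (hR : IsSkewInvertible R.mat) (hRF : IsCompatiblePair R.mat F.mat)
  (hs : IsStarProduct q μ R F s)

omit ht in
include hb hR hRF in
lemma map_powB_zero {N : ℕ} (hN1 : 1 ≤ N) : φ (tens π (powB q μ R F N 0) 1) =
    (algebraMap ℂ E μ⁻¹ * π (gC q μ R F)) • 1 := by
  rw [powB_zero hb hR hRF hN1, h.map_smul, h.map_id, smul_smul]

variable {N : ℕ} (hN : (bmwChain hb hR hRF).Regular N) (hv : (bmwChain hb hR hRF).Vanish N)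

include hs hN hv

lemma map_powA_succ {m : ℕ} (hm : m < N) : φ (tens π (powA q μ R F N (m + 1)) 1) =
    (algebraMap ℂ E (q ^ (m + 1)) * π (aC q μ R F (m + 1))) • φ (tens π (MP q μ R F) 1) -
      φ (tens π (MP q μ R F) 1) * φ (tens π (powA q μ R F N m) 1) -
      algebraMap ℂ E ((q - q⁻¹) * (1 + (bmwChain hb hR hRF).lam (m + 1))⁻¹) •
        φ (tens π (powB q μ R F N m) 1) := by
  rw [powA_succ hb hR hRF hs hN hv hm, h.map_sub, h.map_sub, h.map_smul, h.map_act, h.map_mul ht,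
    h.map_smul, smul_smul]

lemma map_powB_succ {m : ℕ} (hm : m < N) :
    φ (tens π (MP q μ R F) 1) * φ (tens π (powB q μ R F N (m + 1)) 1) = π (gC q μ R F) •
      ((algebraMap ℂ E (μ⁻¹ * q⁻¹ ^ (m + 1)) * π (aC q μ R F (m + 1))) • φ (tens π (MP q μ R F) 1) -
        φ (tens π (powB q μ R F N m) 1) +
        algebraMap ℂ E ((q - q⁻¹) * (1 - (1 + (bmwChain hb hR hRF).lam (m + 1))⁻¹)) •
          (φ (tens π (MP q μ R F) 1) * φ (tens π (powA q μ R F N m) 1))) := by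
  rw [← h.map_mul ht, star_powB_succ hb hR hRF hs hN hv hm, h.map_act, h.map_add, h.map_sub,
    h.map_smul, h.map_act, h.map_smul, h.map_mul ht, smul_smul]

end IsRealization

end Realization

section CayleyHamilton

variable {ι : Type} [Fintype ι] [DecidableEq ι] {q : ℂ} {l : ℕ} {R F : RMatrix ι}

variable {π : charAlg q (muO q (2 * l - 1)) R F →ₐ[ℂ] SpecAlg (l - 1)}
  {s : PSpace q (muO q (2 * l - 1)) R F →ₗ[ℂ] PSpace q (muO q (2 * l - 1)) R F →ₗ[ℂ] PSpace q (muO q (2 * l - 1)) R F}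
  {t : Completed π →ₗ[ℂ] Completed π →ₗ[ℂ] Completed π}
  {Q : Type} [Ring Q] [Algebra (SpecAlg (l - 1)) Q] {φ : Completed π →+ Q}
  (hR : IsOrthogonalType q (2 * l - 1) R) (hRF : IsCompatiblePair R.mat F.mat) (hl : 2 ≤ l)
  (hs : IsStarProduct q (muO q (2 * l - 1)) R F s) (hπ : IsSpectralHom q (muO q (2 * l - 1)) R F l π) (ht : IsCompletedStar π s t)
  (hφ : IsRealization t φ)

lemma charPoly_elemSymTail (q : ℂ) (i : ℕ) : charPoly q (elemSymTail i) (2 * i) =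
    ∏ j : Fin (2 * i), (Polynomial.X - Polynomial.C (algebraMap ℂ (SpecAlg i) q * nu i j.succ)) :=
  charPoly_eq_prod q _ _ fun _ _ => rfl

lemma charPoly_elemSym (q : ℂ) (i : ℕ) : charPoly q (elemSym i) (2 * i + 1) =
    (Polynomial.X - Polynomial.C (algebraMap ℂ (SpecAlg i) q * nu i 0)) *
      charPoly q (elemSymTail i) (2 * i) := by
  rw [charPoly_elemSymTail, charPoly_eq_prod q _ (nu i) fun j _ => elemSym_eq i j,
    Fin.prod_univ_succ]

include hR hRF hl hπ

lemma IsSpectralHom.map_aC {i : ℕ} (hi : i ≤ 2 * l - 1) : π (aC q (muO q (2 * l - 1)) R F i) = elemSym (l - 1) i := by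
  rcases Nat.eq_zero_or_pos i with rfl | h
  · rw [elemSym_zero]; exact map_one π
  · exact hπ.2 i h hi

lemma IsSpectralHom.map_epsC {i : ℕ} (hi : i ≤ 2 * (l - 1)) :
    π (epsC q (muO q (2 * l - 1)) R F l i) = elemSymTail (l - 1) i := by
  have key : ∀ n, n ≤ l - 1 → π (∑ j ∈ Finset.range (n + 1),
      aC q (muO q (2 * l - 1)) R F (n - j) * (-gHalf q (muO q (2 * l - 1)) R F l) ^ j) = elemSymTail (l - 1) n := fun n hn => by
    rw [map_sum, ← sum_elemSym_mul_pow]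
    refine Finset.sum_congr rfl fun j _ => ?_
    rw [map_mul, map_pow, map_neg, hπ.1, hπ.map_aC hR hRF hl (by omega)]
  rw [epsC]
  split_ifs with h
  · exact key i h
  · have e := elemSymTail_reciprocal (l - 1) (n := 2 * (l - 1) - i) (by omega)
    rw [map_mul, key _ (by omega), map_pow, hπ.map_gC hR hRF hl,
      show i - (l - 1) = l - 1 - (2 * (l - 1) - i) by omega, ← e]
    congr 1
    omega

include ht hφ

lemma map_starProd_linFactor : φ (t (linFactor π (nu (l - 1) 0))
    (starProd π t (List.ofFn fun i : Fin (2 * (l - 1)) => linFactor π (q • nu (l - 1) i.succ)))) =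
    Polynomial.aeval (φ (tens π (MP q (muO q (2 * l - 1)) R F) 1))
      ((Polynomial.X - Polynomial.C (nu (l - 1) 0)) *
        charPoly q (elemSymTail (l - 1)) (2 * (l - 1))) := by
  rw [hφ.map_star, hφ.map_starProd, hφ.map_linFactor, map_mul, map_sub, Polynomial.aeval_X,
    Polynomial.aeval_C]
  congr 1
  rw [charPoly_elemSymTail, ← List.prod_ofFn, map_list_prod, List.map_ofFn, List.map_ofFn]
  congr 2
  funext i
  simp only [Function.comp]
  rw [hφ.map_linFactor, map_sub, Polynomial.aeval_X, Polynomial.aeval_C, Algebra.smul_def]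

lemma map_cayleyHamilton : φ (tens π (cayleyHamilton q (muO q (2 * l - 1)) R F s l) 1) =
    Polynomial.aeval (φ (tens π (MP q (muO q (2 * l - 1)) R F) 1))
      ((Polynomial.X - Polynomial.C (nu (l - 1) 0)) *
        charPoly q (elemSymTail (l - 1)) (2 * (l - 1))) := by
  rw [cayleyHamilton, hφ.map_mul ht, hφ.map_sub, hφ.map_id, hφ.map_sum, hπ.1, map_mul, map_sub,
    Polynomial.aeval_X, Polynomial.aeval_C, aeval_charPoly, Algebra.algebraMap_eq_smul_one]
  congr 1
  refine Finset.sum_congr rfl fun i hi => ?_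
  rw [hφ.map_smul, hφ.map_act, hφ.map_starPow ht,
    hπ.map_epsC hR hRF hl (Nat.lt_succ_iff.mp (Finset.mem_range.mp hi))]

include hs

/-- The factorized Cayley-Hamilton identity. -/
lemma aeval_factorized (hq : q ^ (2 * l + 1) ≠ -1) :
    Polynomial.aeval (φ (tens π (MP q (muO q (2 * l - 1)) R F) 1))
      ((Polynomial.X - Polynomial.C (nu (l - 1) 0)) *
        charPoly q (elemSymTail (l - 1)) (2 * (l - 1))) = 0 := by
  have hq0 : q ≠ 0 := hR.bmw.q_ne.1
  have hμ0 : (muO q (2 * l - 1)) ≠ 0 := hR.bmw.mu_ne.1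
  have hμ : (muO q (2 * l - 1)) * q ^ (2 * l - 1) = q := muO_mul hq0 _
  have hk : 2 * l - 1 = 2 * (l - 1) + 1 := by omega
  have hreg := regular_bmwChain hR hRF
  have hvan := vanish_bmwChain hR hRF
  have hL : ∀ m, q⁻¹ * (bmwChain hR.bmw hR.skew hRF).lam m = (muO q (2 * l - 1))⁻¹ * q⁻¹ ^ (2 * m) := fun m => by
    change q⁻¹ * (q * (muO q (2 * l - 1))⁻¹ * q⁻¹ ^ (2 * m)) = _
    field_simp
  have hγ := hπ.map_gC hR hRF hl
  refine factorized_of_rec (k := 2 * l - 1) (q := q)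
    (L := (bmwChain hR.bmw hR.skew hRF).lam) (γ := nu (l - 1) 0 ^ 2)
    (a := fun j => π (aC q (muO q (2 * l - 1)) R F j)) (A := fun m => φ (tens π (powA q (muO q (2 * l - 1)) R F (2 * l - 1) m) 1))
    (B := fun m => φ (tens π (powB q (muO q (2 * l - 1)) R F (2 * l - 1) m) 1)) (r := l - 1) hk hq0 (fun m => ?_)
    (fun m hm => ?_) ?_ ?_ hR.bmw.c_ne (isUnit_nu_zero _) rfl (map_one π) (fun j hj => ?_) ?_ ?_ ?_
    (fun m hm => ?_) (fun m hm => ?_) ?_ ?_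
  · change q ^ 2 * (q * (muO q (2 * l - 1))⁻¹ * q⁻¹ ^ (2 * (m + 1))) = q * (muO q (2 * l - 1))⁻¹ * q⁻¹ ^ (2 * m)
    rw [mul_add, pow_add, inv_pow, inv_pow]
    field_simp
  · rw [add_comm]
    rcases Nat.eq_zero_or_pos m with rfl | h
    · intro e
      apply hreg.den_ne (2 * l - 1) (by omega) le_rfl
      change q * (muO q (2 * l - 1))⁻¹ * q⁻¹ ^ (2 * (2 * l - 1)) + 1 = 0
      change q * (muO q (2 * l - 1))⁻¹ * q⁻¹ ^ (2 * 0) + 1 = 0 at e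
      have e1 : q * (muO q (2 * l - 1))⁻¹ = q ^ (2 * l - 1) := by
        rw [mul_inv_eq_iff_eq_mul₀ hμ0, mul_comm]; exact hμ.symm
      rw [e1] at e ⊢
      rw [mul_zero, pow_zero, mul_one] at e
      rw [pow_mul', inv_pow, eq_neg_of_add_eq_zero_left e]
      norm_num
    · exact hreg.den_ne m h hm
  · change q * (muO q (2 * l - 1))⁻¹ * q⁻¹ ^ (2 * (2 * l - 1)) * q ^ (2 * l - 1) = 1
    have e1 : q * (muO q (2 * l - 1))⁻¹ = q ^ (2 * l - 1) := by
      rw [mul_inv_eq_iff_eq_mul₀ hμ0, mul_comm]; exact hμ.symm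
    rw [e1, pow_mul', inv_pow]
    field_simp
  · rwa [show 2 * l - 1 + 2 = 2 * l + 1 by omega]
  · have e := elemSym_reciprocal (l - 1) (n := j) (by omega)
    rw [elemSym_last_eq, show 2 * (l - 1) + 1 - j = 2 * l - 1 - j by omega] at e
    rw [hπ.map_aC hR hRF hl hj, hπ.map_aC hR hRF hl (by omega), e]
    congr 1
    rw [hk, pow_succ' _ (2 * (l - 1)), pow_mul]
  · rw [show charPoly q (fun j => π (aC q (muO q (2 * l - 1)) R F j)) (2 * l - 1) =
      charPoly q (elemSym (l - 1)) (2 * l - 1) from ?_, hk, charPoly_elemSym]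
    refine Finset.sum_congr rfl fun j hj => ?_
    simp only
    rw [hπ.map_aC hR hRF hl (Nat.lt_succ_iff.mp (Finset.mem_range.mp hj))]
  · rw [powA_zero hR.bmw hR.skew hRF (by omega)]
  · rw [hL, mul_zero, pow_zero, mul_one]
    exact (hφ.map_powB_zero hR.bmw hR.skew hRF (by omega)).trans (by rw [hγ])
  · exact hφ.map_powA_succ ht hR.bmw hR.skew hRF hs hreg hvan hm
  · have e : q⁻¹ * (bmwChain hR.bmw hR.skew hRF).lam (m + 1) * q ^ (m + 1) =
        (muO q (2 * l - 1))⁻¹ * q⁻¹ ^ (m + 1) := by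
      rw [hL, two_mul (m + 1), pow_add q⁻¹ (m + 1), mul_assoc, mul_assoc, ← mul_pow,
        inv_mul_cancel₀ hq0, one_pow, mul_one]
    rw [e, ← hγ]
    exact hφ.map_powB_succ ht hR.bmw hR.skew hRF hs hreg hvan hm
  · rw [powA, if_neg (lt_irrefl _), hφ.map_zero]
  · rw [powB, if_neg (lt_irrefl _), hφ.map_zero]

end CayleyHamilton

end

end QMA

open QMA in
theorem corollary5p9 {ι : Type} [Fintype ι] [DecidableEq ι] (l : ℕ) (hl : 2 ≤ l) (q : ℂ)
    (R F : RMatrix ι)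
    (hR : IsOrthogonalType q (2 * l - 1) R)
    (hF : IsStrictSkewInvertible F.mat)
    (hRF : IsCompatiblePair R.mat F.mat)
    (hq : q ^ (2 * l + 1) ≠ -1)
    (hind : OnlyReciprocalRelations q (muO q (2 * l - 1)) R F (2 * l - 1)) :
    (∃! s, IsStarProduct q (muO q (2 * l - 1)) R F s) ∧
    (∃! π, IsSpectralHom q (muO q (2 * l - 1)) R F l π) ∧
    ∀ s, IsStarProduct q (muO q (2 * l - 1)) R F s →
    ∀ π, IsSpectralHom q (muO q (2 * l - 1)) R F l π →
      (∃! t, IsCompletedStar π s t) ∧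
      ∀ t, IsCompletedStar π s t →
        (∀ x y z, t (t x y) z = t x (t y z)) ∧
        (∀ x, t (tens π (idP q (muO q (2 * l - 1)) R F 1) 1) x = x ∧
          t x (tens π (idP q (muO q (2 * l - 1)) R F 1) 1) = x) ∧
        t (linFactor π (nu (l - 1) 0))
            (starProd π t (List.ofFn fun i : Fin (2 * (l - 1)) =>
              linFactor π (q • nu (l - 1) i.succ))) =
          tens π (cayleyHamilton q (muO q (2 * l - 1)) R F s l) 1 ∧
        t (linFactor π (nu (l - 1) 0))
            (starProd π t (List.ofFn fun i : Fin (2 * (l - 1)) =>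
              linFactor π (q • nu (l - 1) i.succ))) = 0 := by
  have : Nonempty ι := hR.bmw.nonempty
  refine ⟨⟨_, isStarProduct_starHom hR.skew hRF, fun _ h => h.unique (isStarProduct_starHom hR.skew hRF)⟩,
    ?_, fun s hs π hπ => ⟨existsUnique_isCompletedStar hs hR.skew hRF, fun t ht => ?_⟩⟩
  · obtain ⟨π, hπ⟩ := exists_isSpectralHom hR hRF hl hind
    exact ⟨π, hπ, fun _ h => h.unique hR hRF hl hπ⟩
  · have H := exists_isRealization hs ht hR.skew hRF
    obtain ⟨Q, rQ, H⟩ := H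
    obtain ⟨aQ, H⟩ := H
    obtain ⟨φ, hφ⟩ := H
    have e := map_starProd_linFactor hR hRF hl hπ ht hφ
    have e1 := e.trans (map_cayleyHamilton hR hRF hl hπ ht hφ).symm
    have e2 := (e.trans (aeval_factorized hR hRF hl hs hπ ht hφ hq)).trans (map_zero φ).symm
    have e3 := hφ.injective e1
    have e4 := hφ.injective e2
    refine ⟨fun x y z => ?_, fun x => ⟨?_, ?_⟩, e3, e4⟩
    · exact IsCompletedStar.assoc hR.skew hRF hs ht x y z
    · exact IsCompletedStar.one_left hs ht x
    · exact IsCompletedStar.one_right hs ht x
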